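/- **Setting.** Greek indices run over $1,\dots,4$, Latin indices $i,j,h,k$ over $1,2,3$. Let $D=\{x\in\mathbb R^4: |x^i-\bar x^i|<d,\ |x^4|<\epsilon\}$ with $d,\epsilon>0$. Let $A^{\lambda\mu}=A^{\mu\lambda}$ be functions on $D$ with continuous bounded derivatives up to order four, the fourth derivatives being Lipschitz, and let $B^{s\mu}_r$ ($1\le r,s\le n$) be functions with continuous bounded derivatives up to order two, the second derivatives being Lipschitz. Assume $A^{44}>0$ and that $\sum A^{ij}\xi_i\xi_j$ is negative definite at every point of $D$. For continuous $f_r$ consider the system $$[E]\qquad \sum_{\lambda,\mu}A^{\lambda\mu}\frac{\partial^2u_r}{\partial x^\lambda\partial x^\mu}+\sum_{s,\mu}B^{s\mu}_r\frac{\partial u_s}{\partial x^\mu}+f_r=0,\qquad r=1,\dots,n .$$ A solution is a family $u_s\in C^1(D)$ whose first derivatives are differentiable in $D$ and which satisfies $[E]$ at every point of $D$. **Adapted coordinates.** Let $M_0\in D$ have coordinates $x_0$. A frame at $M_0$ is a real matrix $(a^{\alpha\beta})$ with $\sum A^{\lambda\mu}(x_0)\xi_\lambda\xi_\mu=(\sum_\alpha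 a^{4\alpha}\xi_\alpha)^2-\sum_i(\sum_\alpha a^{i\alpha}\xi_\alpha)^2$ for all $\xi$, $a^{i4}=0$ and $a^{44}>0$; let $(a^0_{\alpha\beta})$ be its inverse transpose. Put $y^\alpha=\sum_\beta a^0_{\alpha\beta}x^\beta$, $A^{*\alpha\beta}=\sum A^{\lambda\mu}a^0_{\alpha\lambda}a^0_{\beta\mu}$, $B^{*s\alpha}_r=\sum_\lambda B^{s\lambda}_ra^0_{\alpha\lambda}$. From here on all coefficients, $f$, $u$ and derivatives are taken in the coordinates $y$ and the stars are omitted; $[\varphi]$ denotes the value of $\varphi$ at a point of the conoid, and $\partial[\varphi]/\partial y^i=[\partial\varphi/\partial y^i]-p_i[\partial\varphi/\partial y^4]$. **Auxiliary functions.** Put $T^\alpha=A^{\alpha4}+\sum_jA^{\alpha j}p_j$, $F=A^{44}+2\sum A^{i4}p_i+\sum A^{ij}p_ip_j$, $R_i=-\frac12\big(\frac{\partial F}{\partial y^i}-p_i\frac{\partial F}{\partial y^4}\big)$, $\mathcal Q^r_t=\frac12\big([B^{r4}_t]+\sum_i[B^{ri}_t]p_i\big)$, $\mathcal Q=-\frac12\big(\sum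 p_j\frac{\partial[A^{ij}]}{\partial y^i}+\sum\frac{\partial[A^{i4}]}{\partial y^i}\big)$. The bicharacteristics from $M_0$ and the transport equations are $$\frac{dy^\alpha}{d\lambda_1}=T^\alpha,\quad \frac{dp_i}{d\lambda_1}=R_i,\quad \frac{d\omega^r_s}{d\lambda_1}=\sum_t\mathcal Q^r_t\omega^t_s+\mathcal Q\,\omega^r_s,\qquad y=y_0,\ p=p^0,\ \omega^r_s=\delta^r_s\ \text{ for }\lambda_1=0 .$$ Let $X$ denote the collection of $y^\alpha,p_i$ and of the functions $y^\alpha_j,z^i_j,y^\alpha_{jh},z^i_{jh},y^\alpha_{jhk},z^i_{jhk}$ governed by the equations obtained from those of $(y,p)$ by formal differentiation up to three times with respect to free parameters $p^0_j$ (initial values: $z^i_j=\delta^i_j$, all others $0$); let $\Omega$ denote the collection of $\omega^r_s$ and of the functions $\omega^r_{sj},\omega^r_{sjh}$ governed by the equations obtained from that of $\omega$ by formal differentiation up to twice (initial values $0$). Write these systems as $dX/d\lambda_1=E(X)$, $d\Omega/d\lambda_1=F(X,\Omega)$, with initial values $X_0,\Omega_0$. Take $p^0=(\sin\lambda_2\cos\lambda_3,\sin\lambda_2\sin\lambda_3,\cos\lambda_2)$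 and the parameter $x^4=a^{44}y^4$ instead of $\lambda_1$; the systems become $$X=X_0+\int_{x^4_0}^{x^4}\frac{a^0_{44}}{T^4}E(X)\,d\tau,\qquad \Omega=\Omega_0+\int_{x^4_0}^{x^4}\frac{a^0_{44}}{T^4}F(X,\Omega)\,d\tau. \tag{1}$$ **Integrands.** Let $K_{ij}=T^ip^0_j+\sum_hy^i_h(\delta_{hj}-p^0_hp^0_j)$, let $J$ be the Jacobian determinant $D(y^1,y^2,y^3)/D(\lambda_1,\lambda_2,\lambda_3)$, with elements $T^i$, $\sum_jy^i_j\,\partial p^0_j/\partial\lambda_2$, $\sum_jy^i_j\,\partial p^0_j/\partial\lambda_3$ (so $J=\sin\lambda_2\det K$), and let $\sigma=|\det K|^{-1/2}$, $\sigma^r_s=\sigma\omega^r_s$. For a function $\varphi$ of $(p^0,X,\Omega)$, $\partial\varphi/\partial y^i$ denotes its derivative along the conoid, i.e. $$\frac{\partial\varphi}{\partial y^i}=\sum_kp^0_k(K^{-1})_{ki}\frac{\partial\varphi}{\partial\lambda_1}+\sum_{h,k}(\delta_{hk}-p^0_hp^0_k)(K^{-1})_{ki}\frac{\partial\varphi}{\partial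 p^0_h},$$ where the derivatives of the entries of $(X,\Omega)$ with respect to $\lambda_1$ are the corresponding entries of $(E,F)$, and their derivatives with respect to $p^0_h$ are the corresponding entries of the next order. Put $$L^r_s=\sum_{i,j}\frac{\partial^2([A^{ij}]\sigma^r_s)}{\partial y^i\partial y^j}-\sum_{i,t}\frac{\partial([B^{ri}_t]\sigma^t_s)}{\partial y^i},$$ $$E^i_s=\sum_{j,r}\Big([A^{ij}]\sigma^r_s\frac{\partial[u_r]}{\partial y^j}-[u_r]\frac{\partial([A^{ij}]\sigma^r_s)}{\partial y^j}\Big)+2\sum_r\sigma^r_sT^i\Big[\frac{\partial u_r}{\partial y^4}\Big]+\sum_{r,t}[B^{ti}_r][u_t]\sigma^r_s,$$ $$H_s=\sum_r\big([u_r]L^r_s+\sigma^r_s[f_r]\big)\frac{a^0_{44}J}{T^4},\qquad I_s=\frac{J}{T^4}\sum_iE^i_sp_i .$$ **Theorem.** For every $0<d_0<d$ there is $0<\epsilon_0<\epsilon$, depending only on $A$, $B$, $D$, $d_0$, such that for every $M_0$ with $|x^i_0-\bar x^i|\le d_0$ and $0<|x^4_0|\le\epsilon_0$ a frame at $M_0$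 exists and, for every frame at $M_0$: 1. the system (1) has, for $x^4$ between $x^4_0$ and $0$, $0\le\lambda_2\le\pi$, $0\le\lambda_3\le2\pi$, a solution $(X,\Omega)$, continuous in $(x^4,\lambda_2,\lambda_3)$; for each fixed $(\lambda_2,\lambda_3)$ it is the only solution of (1) on that interval that is continuous in $x^4$. The conoid points $x=(\sum_\alpha a^{\alpha\beta}y^\alpha)_\beta$ so obtained lie in $D$ and have fourth coordinate equal to the parameter $x^4$; moreover $F=0$, $T^4>0$, and $\det K\ne0$ for $x^4\neq x^4_0$; 2. for all continuous $f_r$ and every solution $u$ of $[E]$ in $D$, the function $H_s$ is continuous and bounded for $x^4\ne x^4_0$, the function $I_s$ at $x^4=0$ is continuous in $(\lambda_2,\lambda_3)$, and the Kirchhoff formulae hold: $$4\pi\,u_s(M_0)=\operatorname{sgn}(x^4_0)\left(\int_0^{2\pi}\!\!\int_0^{\pi}I_s\big|_{x^4=0}\,d\lambda_2\,d\lambda_3-\int_{x^4_0}^0\int_0^{2\pi}\!\!\int_0^\pi H_s\,d\lambda_2\,d\lambda_3\,dx^4\right),\qquad s=1,\dots,n.$$ -/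

import Mathlib

open scoped BigOperators

namespace KirchhoffConoid

/-- Points of space-time. The index `3` is the temporal coordinate `x⁴`; the indices `0, 1, 2`
(that is, `i.castSucc` for `i : Fin 3`) are the spatial coordinates. -/
abbrev Pt := Fin 4 → ℝ

/-- A contact element on a characteristic surface: a point `x` together with `p = (p₁, p₂, p₃)`,
the normal being `(p₁, p₂, p₃, 1)`. -/
abbrev Ph := Pt × (Fin 3 → ℝ)

/-- `n × n` arrays of real numbers, with the sup norm. -/
abbrev Mat (n : ℕ) := Fin n → Fin n → ℝ

/-- Principal coefficients `A^{αβ}(x)` (written `A x α β`). -/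
abbrev CoefA := Pt → Fin 4 → Fin 4 → ℝ

/-- First order coefficients: `B r s μ x` is the coefficient of `∂u_s/∂x^μ` in the `r`-th
equation. -/
abbrev CoefB (n : ℕ) := Fin n → Fin n → Fin 4 → Pt → ℝ

/-- The box `|x^i - c^i| < d`, `|x⁴| < e`. -/
def box (c : Fin 3 → ℝ) (d e : ℝ) : Set Pt :=
  {x | (∀ i : Fin 3, |x i.castSucc - c i| < d) ∧ |x 3| < e}

/-- The partial derivative `∂g/∂x^α`. -/
noncomputable def pd (α : Fin 4) (g : Pt → ℝ) (x : Pt) : ℝ :=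
  fderiv ℝ g x (Pi.single α 1)

/-- `u` is a (classical) solution in `Ω` of the system
`∑ A^{λμ} ∂²u_r/∂x^λ∂x^μ + ∑ B^{s μ}_r ∂u_s/∂x^μ + f_r = 0`, with continuous first derivatives. -/
structure IsSolution {n : ℕ} (A : CoefA) (B : CoefB n) (f : Fin n → Pt → ℝ)
    (Ω : Set Pt) (u : Fin n → Pt → ℝ) : Prop where
  contDiffOn : ∀ s, ContDiffOn ℝ 1 (u s) Ω
  twice : ∀ s, ∀ x ∈ Ω, DifferentiableAt ℝ (fderiv ℝ (u s)) x
  eqn : ∀ r, ∀ x ∈ Ω,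
    (∑ l, ∑ m, A x l m * pd l (pd m (u r)) x) + (∑ s, ∑ m, B r s m x * pd m (u s) x) + f r x = 0

/-- The hypotheses on the coefficients in the open set `Ω`: symmetry of `A`, derivatives up to the
orders four (`A`) and two (`B`) that are continuous and bounded, Lipschitz conditions on the
derivatives of top order, and normal hyperbolicity with `x⁴` temporal. -/
structure GoodCoef {n : ℕ} (A : CoefA) (B : CoefB n) (Ω : Set Pt) : Prop where
  symm : ∀ x ∈ Ω, ∀ α β, A x α β = A x β α
  smoothA : ∀ α β, ContDiffOn ℝ 4 (fun x => A x α β) Ω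
  boundA : ∀ α β, ∀ k ≤ 4, ∃ C : ℝ, ∀ x ∈ Ω, ‖iteratedFDeriv ℝ k (fun x => A x α β) x‖ ≤ C
  lipA : ∀ α β, ∃ C : NNReal, LipschitzOnWith C (iteratedFDeriv ℝ 4 (fun x => A x α β)) Ω
  smoothB : ∀ r s μ, ContDiffOn ℝ 2 (B r s μ) Ω
  boundB : ∀ r s μ, ∀ k ≤ 2, ∃ C : ℝ, ∀ x ∈ Ω, ‖iteratedFDeriv ℝ k (B r s μ) x‖ ≤ C
  lipB : ∀ r s μ, ∃ C : NNReal, LipschitzOnWith C (iteratedFDeriv ℝ 2 (B r s μ)) Ω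
  temporal : ∀ x ∈ Ω, 0 < A x 3 3
  spatial : ∀ x ∈ Ω, ∀ ξ : Fin 3 → ℝ, ξ ≠ 0 →
    (∑ i : Fin 3, ∑ j : Fin 3, A x i.castSucc j.castSucc * ξ i * ξ j) < 0

section Bicharacteristics

/-- The covector `(p₁, p₂, p₃, 1)`. -/
def cov (p : Fin 3 → ℝ) : Fin 4 → ℝ := Fin.snoc p 1

/-- `T^α = A^{α4} + ∑_j A^{αj} p_j`. -/
noncomputable def T (A : CoefA) (v : Ph) : Pt := fun α => ∑ β, A v.1 α β * cov v.2 β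

/-- `F = A^{44} + 2 ∑ A^{i4} p_i + ∑ A^{ij} p_i p_j`, as a function of `x` for fixed `p`. -/
noncomputable def F (A : CoefA) (p : Fin 3 → ℝ) (x : Pt) : ℝ :=
  ∑ α, ∑ β, A x α β * cov p α * cov p β

/-- `∂[g]/∂x^i = [∂g/∂x^i] - p_i [∂g/∂x⁴]`: the derivative along the conoid, with the `x^i` as
parameters, of the restriction `[g]` of a function `g` of the four coordinates. -/
noncomputable def pdCon (i : Fin 3) (g : Pt → ℝ) (v : Ph) : ℝ :=
  pd i.castSucc g v.1 - v.2 i * pd 3 g v.1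

/-- `R_i = -½ (∂F/∂x^i - p_i ∂F/∂x⁴)`. -/
noncomputable def R (A : CoefA) (v : Ph) : Fin 3 → ℝ := fun i => -(1 / 2) * pdCon i (F A v.2) v

/-- The right-hand side of the bicharacteristic equations
`dx^α/dλ₁ = T^α`, `dp_i/dλ₁ = R_i`. -/
noncomputable def bichar (A : CoefA) (v : Ph) : Ph := (T A v, R A v)

/-- The matrix `𝒬^r_t + δ^r_t 𝒬` of the transport equations `dω^r_s/dλ₁ = ∑_t 𝒬^r_t ω^t_s + 𝒬 ω^r_s`,
where `𝒬^r_t = ½ (B_t^{r4} + ∑ B_t^{ri} p_i)` and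
`𝒬 = -½ (∑ p_j ∂[A^{ij}]/∂x^i + ∑ ∂[A^{i4}]/∂x^i)`. -/
noncomputable def transport {n : ℕ} (A : CoefA) (B : CoefB n) (v : Ph) : Mat n := fun r t =>
  1 / 2 * (∑ α, B t r α v.1 * cov v.2 α) +
    if r = t then
      -(1 / 2) * ∑ i : Fin 3, ∑ β, cov v.2 β * pdCon i (fun x => A x i.castSucc β) v
    else 0

end Bicharacteristics

section AuxiliaryFunctions

/-- The values of the auxiliary functions `X`. With `V = (x, p)`, an element consists of `V`,
of the `∂V/∂p⁰_j = (y_j, z_j)`, of the `∂²V/∂p⁰_j∂p⁰_h = (y_{jh}, z_{jh})` and of the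
`∂³V/∂p⁰_j∂p⁰_h∂p⁰_k = (y_{jhk}, z_{jhk})`. -/
abbrev XVal := Ph × (Fin 3 → Ph) × (Fin 3 → Fin 3 → Ph) × (Fin 3 → Fin 3 → Fin 3 → Ph)

/-- The values of the auxiliary functions `Ω`: an element consists of `ω = (ω^r_s)` (written
`ω r s`), of its derivatives `ω_j` and of its derivatives `ω_{jh}` with respect to the `p⁰_j`. -/
abbrev WVal (n : ℕ) := Mat n × (Fin 3 → Mat n) × (Fin 3 → Fin 3 → Mat n)

/-- Right-hand side `E(X)` of the equations `dX/dλ₁ = E(X)`: the bicharacteristic equations and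
the equations deduced from them by up to three differentiations with respect to the `p⁰_j`. -/
noncomputable def E (A : CoefA) (X : XVal) : XVal :=
  let v := X.1
  let v₁ := X.2.1
  let v₂ := X.2.2.1
  let v₃ := X.2.2.2
  let D₁ := fun a => fderiv ℝ (bichar A) v a
  let D₂ := fun a b => iteratedFDeriv ℝ 2 (bichar A) v ![a, b]
  let D₃ := fun a b c => iteratedFDeriv ℝ 3 (bichar A) v ![a, b, c]
  (bichar A v,
    fun j => D₁ (v₁ j),
    fun j h => D₂ (v₁ j) (v₁ h) + D₁ (v₂ j h),
    fun j h k => D₃ (v₁ j) (v₁ h) (v₁ k) + D₂ (v₂ j h) (v₁ k) + D₂ (v₂ j k) (v₁ h)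
      + D₂ (v₂ h k) (v₁ j) + D₁ (v₃ j h k))

/-- The matrix product `(P ω)^r_s = ∑_t P^r_t ω^t_s`. -/
def mmul {n : ℕ} (P w : Mat n) : Mat n := fun r s => ∑ t, P r t * w t s

/-- Right-hand side `F(X, Ω)` of the equations `dΩ/dλ₁ = F(X, Ω)`: the transport equations of the
`ω^r_s` and the equations deduced from them by up to two differentiations with respect to the
`p⁰_j`. -/
noncomputable def EW {n : ℕ} (A : CoefA) (B : CoefB n) (X : XVal) (W : WVal n) : WVal n :=
  let v := X.1
  let v₁ := X.2.1
  let v₂ := X.2.2.1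
  let w := W.1
  let w₁ := W.2.1
  let w₂ := W.2.2
  let P := transport A B v
  let P₁ := fun a => fderiv ℝ (transport A B) v a
  let P₂ := fun a b => iteratedFDeriv ℝ 2 (transport A B) v ![a, b]
  (mmul P w,
    fun j => mmul (P₁ (v₁ j)) w + mmul P (w₁ j),
    fun j h => mmul (P₂ (v₁ j) (v₁ h) + P₁ (v₂ j h)) w + mmul (P₁ (v₁ j)) (w₁ h)
      + mmul (P₁ (v₁ h)) (w₁ j) + mmul P (w₂ j h))

/-- `p⁰ = (sin λ₂ cos λ₃, sin λ₂ sin λ₃, cos λ₂)`. -/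
noncomputable def p0 (l₂ l₃ : ℝ) : Fin 3 → ℝ :=
  ![Real.sin l₂ * Real.cos l₃, Real.sin l₂ * Real.sin l₃, Real.cos l₂]

/-- Value `X₀` at the vertex `y₀` of the functions `X`. -/
def X0 (y₀ : Pt) (q : Fin 3 → ℝ) : XVal :=
  ((y₀, q), fun j => (0, Pi.single j 1), 0, 0)

/-- Value `Ω₀` at the vertex of the functions `Ω`: `ω^r_s = δ^r_s`, and zero for the derivatives. -/
def W0 (n : ℕ) : WVal n := (fun r s => if r = s then 1 else 0, 0, 0)

/-- `X` and `W`, functions of a temporal parameter `t`, satisfy along the bicharacteristic with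
initial direction `q` through the vertex `y₀` the integral equations
`X = X₀ + ∫ E(X) κ/T⁴ dt`, `Ω = Ω₀ + ∫ F(X, Ω) κ/T⁴ dt` on the segment from `t₀` to `t₁`.
Here `t = y⁴/κ`, so that `dλ₁ = κ dt/T⁴`. -/
structure IsAuxiliary {n : ℕ} (A : CoefA) (B : CoefB n) (κ : ℝ) (y₀ : Pt) (q : Fin 3 → ℝ)
    (t₀ t₁ : ℝ) (X : ℝ → XVal) (W : ℝ → WVal n) : Prop where
  contX : ContinuousOn X (Set.uIcc t₀ t₁)
  contW : ContinuousOn W (Set.uIcc t₀ t₁)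
  eqX : ∀ t ∈ Set.uIcc t₀ t₁,
    X t = X0 y₀ q + ∫ τ in t₀..t, (κ / T A (X τ).1 3) • E A (X τ)
  eqW : ∀ t ∈ Set.uIcc t₀ t₁,
    W t = W0 n + ∫ τ in t₀..t, (κ / T A (X τ).1 3) • EW A B (X τ) (W τ)

end AuxiliaryFunctions

section Integrands

/-- The quantities `(p⁰, X, Ω)` in terms of which the integrands are expressed. -/
abbrev Jet (n : ℕ) := (Fin 3 → ℝ) × XVal × WVal n

/-- The matrix `K_{ij} = T^i p⁰_j + ∑_h y^i_h (δ_{hj} - p⁰_h p⁰_j)`. With `μ_j = λ₁ p⁰_j` one has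
`det K = λ₁² D`, where `D` is the determinant of the `∂x^i/∂μ_j`. -/
noncomputable def K {n : ℕ} (A : CoefA) (S : Jet n) : Matrix (Fin 3) (Fin 3) ℝ :=
  Matrix.of fun i j => T A S.2.1.1 i.castSucc * S.1 j
    + ∑ h, (S.2.1.2.1 h).1 i.castSucc * ((if h = j then 1 else 0) - S.1 h * S.1 j)

/-- `∂p⁰/∂λ₂`. -/
noncomputable def p0d2 (l₂ l₃ : ℝ) : Fin 3 → ℝ :=
  ![Real.cos l₂ * Real.cos l₃, Real.cos l₂ * Real.sin l₃, -Real.sin l₂]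

/-- `∂p⁰/∂λ₃`. -/
noncomputable def p0d3 (l₂ l₃ : ℝ) : Fin 3 → ℝ :=
  ![-(Real.sin l₂ * Real.sin l₃), Real.sin l₂ * Real.cos l₃, 0]

/-- The Jacobian `J_{xλ} = D(x¹, x², x³)/D(λ₁, λ₂, λ₃)`, with the elements `∂x^i/∂λ₁ = T^i` and
`∂x^i/∂λ_u = ∑_j y^i_j ∂p⁰_j/∂λ_u` for `u = 2, 3`. It equals `λ₁² D sin λ₂`. -/
noncomputable def Jac {n : ℕ} (A : CoefA) (l₂ l₃ : ℝ) (S : Jet n) : ℝ :=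
  (Matrix.of ![fun i : Fin 3 => T A S.2.1.1 i.castSucc,
    fun i : Fin 3 => ∑ j, (S.2.1.2.1 j).1 i.castSucc * p0d2 l₂ l₃ j,
    fun i : Fin 3 => ∑ j, (S.2.1.2.1 j).1 i.castSucc * p0d3 l₂ l₃ j]).det

/-- `σ = |sin λ₂ / J_{xλ}|^{1/2} = |λ₁² D|^{-1/2}`, written in the form that makes sense for
`sin λ₂ = 0` too. -/
noncomputable def sigma {n : ℕ} (A : CoefA) (S : Jet n) : ℝ := (Real.sqrt |(K A S).det|)⁻¹

/-- `σ^r_s = σ ω^r_s`. -/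
noncomputable def sig {n : ℕ} (A : CoefA) (r s : Fin n) (S : Jet n) : ℝ :=
  sigma A S * S.2.2.1 r s

/-- The derivatives with respect to `x^i`, on the conoid, of `p⁰`, `X`, `Ω`, that is
`∂φ/∂x^i = (∂λ₁/∂x^i) ∂φ/∂λ₁ + ∑_h (∂p⁰_h/∂x^i) ∂φ/∂p⁰_h` with
`∂λ₁/∂x^i = ∑_k p⁰_k (K⁻¹)_{ki}`, `∂p⁰_h/∂x^i = ∑_k (δ_{hk} - p⁰_h p⁰_k) (K⁻¹)_{ki}`.
The entries that belong to the derivatives of top order of `X` and `Ω` are never used and are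
given the value `0`. -/
noncomputable def disp {n : ℕ} (A : CoefA) (B : CoefB n) (i : Fin 3) (S : Jet n) : Jet n :=
  let q := S.1
  let X := S.2.1
  let W := S.2.2
  let c : Fin 3 → ℝ := fun k => (K A S)⁻¹ k i
  let dl : ℝ := ∑ k, q k * c k
  let dq : Fin 3 → ℝ := fun h => c h - q h * dl
  let EX := E A X
  let EΩ := EW A B X W
  (dq,
    (dl • EX.1 + ∑ h, dq h • X.2.1 h,
      fun j => dl • EX.2.1 j + ∑ h, dq h • X.2.2.1 j h,
      fun j k => dl • EX.2.2.1 j k + ∑ h, dq h • X.2.2.2 j k h,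
      0),
    (dl • EΩ.1 + ∑ h, dq h • W.2.1 h,
      fun j => dl • EΩ.2.1 j + ∑ h, dq h • W.2.2 j h,
      0))

/-- The derivative `∂φ/∂x^i` on the conoid of a function `φ` of `(p⁰, X, Ω)`. -/
noncomputable def dx {n : ℕ} (A : CoefA) (B : CoefB n) (i : Fin 3) (φ : Jet n → ℝ) (S : Jet n) : ℝ :=
  fderiv ℝ φ S (disp A B i S)

/-- `L^r_s = ∑ ∂²([A^{ij}] σ^r_s)/∂x^i∂x^j - ∑ ∂([B_t^{ri}] σ^t_s)/∂x^i`. -/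
noncomputable def L {n : ℕ} (A : CoefA) (B : CoefB n) (r s : Fin n) (S : Jet n) : ℝ :=
  (∑ i, ∑ j, dx A B i (dx A B j fun S' => A S'.2.1.1.1 i.castSucc j.castSucc * sig A r s S') S)
    - ∑ i, ∑ t, dx A B i (fun S' => B t r i.castSucc S'.2.1.1.1 * sig A t s S') S

/-- `E^i_s = ∑ ([A^{ij}] σ^r_s ∂[u_r]/∂x^j - [u_r] ∂([A^{ij}] σ^r_s)/∂x^j)
  + 2 ∑ σ^r_s T^i [∂u_r/∂x⁴] + ∑ [B_r^{ti}] [u_t] σ^r_s`. -/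
noncomputable def flux {n : ℕ} (A : CoefA) (B : CoefB n) (u : Fin n → Pt → ℝ) (i : Fin 3)
    (s : Fin n) (S : Jet n) : ℝ :=
  (∑ j, ∑ r, (A S.2.1.1.1 i.castSucc j.castSucc * sig A r s S * pdCon j (u r) S.2.1.1
      - u r S.2.1.1.1 * dx A B j (fun S' => A S'.2.1.1.1 i.castSucc j.castSucc * sig A r s S') S))
    + 2 * ∑ r, sig A r s S * T A S.2.1.1 i.castSucc * pd 3 (u r) S.2.1.1.1
    + ∑ r, ∑ t, B r t i.castSucc S.2.1.1.1 * u t S.2.1.1.1 * sig A r s S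

/-- The quantity under the triple integral,
`H_s = ∑_r ([u_r] L^r_s + σ^r_s [f_r]) κ J_{xλ}/T⁴` (with `dλ₁ = κ dt/T⁴`). -/
noncomputable def H {n : ℕ} (A : CoefA) (B : CoefB n) (f u : Fin n → Pt → ℝ) (κ : ℝ) (s : Fin n)
    (l₂ l₃ : ℝ) (S : Jet n) : ℝ :=
  (∑ r, (u r S.2.1.1.1 * L A B r s S + sig A r s S * f r S.2.1.1.1))
    * (κ * Jac A l₂ l₃ S / T A S.2.1.1 3)

/-- The quantity under the double integral, `I_s = ∑_i E^i_s J_{xλ} p_i/T⁴`. -/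
noncomputable def I {n : ℕ} (A : CoefA) (B : CoefB n) (u : Fin n → Pt → ℝ) (s : Fin n)
    (l₂ l₃ : ℝ) (S : Jet n) : ℝ :=
  (∑ i, flux A B u i s S * S.2.1.1.2 i) * Jac A l₂ l₃ S / T A S.2.1.1 3

end Integrands

section Frames

/-- Coefficients `a = (a₀^{αβ})` reducing the quadratic form `A₀` to
`(∑ a^{4α} X_α)² - ∑_i (∑ a^{iα} X_α)²`, with `a^{i4} = 0` and `a^{44} > 0`. -/
structure IsFrame (A₀ : Fin 4 → Fin 4 → ℝ) (a : Matrix (Fin 4) (Fin 4) ℝ) : Prop where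
  reduces : ∀ ξ : Fin 4 → ℝ, (∑ l, ∑ m, A₀ l m * ξ l * ξ m) =
    (∑ α, a 3 α * ξ α) ^ 2 - ∑ i : Fin 3, (∑ α, a i.castSucc α * ξ α) ^ 2
  adapted : ∀ i : Fin 3, a i.castSucc 3 = 0
  pos : 0 < a 3 3

/-- The inverse frame `a⁰_{αβ}`: `∑_α a^{αβ} a⁰_{αγ} = δ_{βγ}`. -/
noncomputable def inv (a : Matrix (Fin 4) (Fin 4) ℝ) : Matrix (Fin 4) (Fin 4) ℝ := (a⁻¹).transpose

/-- The adapted coordinates `y^α = ∑_β a⁰_{αβ} x^β` of `x`. -/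
noncomputable def toY (a : Matrix (Fin 4) (Fin 4) ℝ) (x : Pt) : Pt := fun α => ∑ β, inv a α β * x β

/-- The original coordinates `x^β = ∑_α a^{αβ} y^α`. -/
def toX (a : Matrix (Fin 4) (Fin 4) ℝ) (y : Pt) : Pt := fun β => ∑ α, a α β * y α

/-- `A^{*αβ} = ∑ A^{λμ} a⁰_{αλ} a⁰_{βμ}` as functions of `y`. -/
noncomputable def AStar (a : Matrix (Fin 4) (Fin 4) ℝ) (A : CoefA) : CoefA := fun y α β =>
  ∑ l, ∑ m, A (toX a y) l m * inv a α l * inv a β m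

/-- `B^{*α} = ∑ B^λ a⁰_{αλ}` as functions of `y`. -/
noncomputable def BStar {n : ℕ} (a : Matrix (Fin 4) (Fin 4) ℝ) (B : CoefB n) : CoefB n :=
  fun r s α y => ∑ l, B r s l (toX a y) * inv a α l

/-- A family of functions of `x` (the `u_s`, the `f_s`) expressed in the coordinates `y`. -/
def fStar {n : ℕ} (a : Matrix (Fin 4) (Fin 4) ℝ) (f : Fin n → Pt → ℝ) : Fin n → Pt → ℝ :=
  fun s y => f s (toX a y)

end Frames

end KirchhoffConoid

namespace KirchhoffConoid

section OrdinaryDifferentialEquations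

open Set Metric Filter Topology NNReal

theorem gronwallBound_mul (η K x : ℝ) : gronwallBound η K η x = η * gronwallBound 1 K 1 x := by
  unfold gronwallBound
  split_ifs <;> ring

theorem gronwallBound_one_nonneg {K x : ℝ} (hK : 0 ≤ K) (hx : 0 ≤ x) :
    0 ≤ gronwallBound 1 K 1 x :=
  zero_le_one.trans <| by
    simpa [gronwallBound_x0] using gronwallBound_mono zero_le_one zero_le_one hK hx

/-- Clamping of a real number to the interval `[0, ε]`. -/
noncomputable def clamp (ε t : ℝ) : ℝ := max 0 (min t ε)

theorem continuous_clamp (ε : ℝ) : Continuous (clamp ε) := by unfold clamp; fun_prop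

theorem clamp_mem {ε : ℝ} (hε : 0 ≤ ε) (t : ℝ) : clamp ε t ∈ Icc 0 ε :=
  ⟨le_max_left _ _, max_le hε (min_le_right _ _)⟩

theorem clamp_of_mem {ε t : ℝ} (ht : t ∈ Icc 0 ε) : clamp ε t = t := by
  simp [clamp, ht.1, ht.2]

theorem exists_picard_solution {Z : Type*} [NormedAddCommGroup Z] [NormedSpace ℝ Z]
    [CompleteSpace Z] {G : ℝ → Z → Z} {y₀ : Z} {ε : ℝ} {ρ L K : ℝ≥0} (hε : 0 ≤ ε)
    (hK : ∀ t ∈ Icc 0 ε, LipschitzOnWith K (G t) (closedBall y₀ ρ))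
    (hc : ∀ y ∈ closedBall y₀ ρ, ContinuousOn (G · y) (Icc 0 ε))
    (hL : ∀ t ∈ Icc 0 ε, ∀ y ∈ closedBall y₀ ρ, ‖G t y‖ ≤ L) (hLε : L * ε ≤ ρ) :
    ∃ y : ℝ → Z, y 0 = y₀ ∧ ∀ t ∈ Icc 0 ε, y t ∈ closedBall y₀ ρ ∧
      HasDerivWithinAt y (G t (y t)) (Icc 0 ε) t := by
  have hP : IsPicardLindelof G (⟨0, left_mem_Icc.2 hε⟩ : Icc 0 ε) y₀ ρ 0 L K :=
    ⟨hK, hc, hL, by simpa [hε] using hLε⟩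
  obtain ⟨α, hα⟩ := ODE.FunSpace.exists_isFixedPt_next hP (mem_closedBall_self le_rfl)
  refine ⟨α.compProj, ?_, fun t ht ↦ ⟨α.compProj_mem_closedBall hP.mul_max_le, ?_⟩⟩
  · have := ODE.FunSpace.compProj_val (α := α) (t := (⟨0, left_mem_Icc.2 hε⟩ : Icc 0 ε))
    rw [← hα, ODE.FunSpace.next_apply₀] at this
    rw [← hα]; exact this
  · apply ODE.hasDerivWithinAt_picard_Icc (left_mem_Icc.2 hε) hP.continuousOn_uncurry
      α.continuous_compProj.continuousOn (fun _ _ ↦ α.compProj_mem_closedBall hP.mul_max_le)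
      y₀ ht |>.congr_of_mem _ ht
    intro t' ht'
    nth_rw 1 [← hα]
    rw [ODE.FunSpace.compProj_of_mem ht', ODE.FunSpace.next_apply]

theorem _root_.HasDerivWithinAt.Ici_of_Icc {Z : Type*} [NormedAddCommGroup Z] [NormedSpace ℝ Z]
    {f : ℝ → Z} {f' : Z} {a b t : ℝ} (h : HasDerivWithinAt f f' (Icc a b) t) (ht : t ∈ Ico a b) :
    HasDerivWithinAt f f' (Ici t) t :=
  h.mono_of_mem_nhdsWithin <| mem_of_superset (Icc_mem_nhdsGE ht.2) (Icc_subset_Icc_left ht.1)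

/-- A family of initial value problems depending continuously on a parameter in a compact space
has solutions on a common interval, jointly continuous in time and parameter. -/
theorem exists_ode_family {P Z : Type*} [TopologicalSpace P] [CompactSpace P]
    [NormedAddCommGroup Z] [NormedSpace ℝ Z] [CompleteSpace Z]
    {G : ℝ → P → Z → Z} {Y₀ : P → Z} (hY₀ : Continuous Y₀) {T ρ : ℝ} (hT : 0 < T) (hρ : 0 < ρ)
    {K : ℝ≥0} {M : ℝ}
    (hG : ContinuousOn (fun x : ℝ × P × Z => G x.1 x.2.1 x.2.2)
      {x | x.1 ∈ Icc 0 T ∧ dist x.2.2 (Y₀ x.2.1) ≤ ρ})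
    (hK : ∀ t ∈ Icc 0 T, ∀ π, LipschitzOnWith K (G t π) (closedBall (Y₀ π) ρ))
    (hM : ∀ t ∈ Icc 0 T, ∀ π, ∀ y ∈ closedBall (Y₀ π) ρ, ‖G t π y‖ ≤ M) :
    ∃ ε, 0 < ε ∧ ε ≤ T ∧ ∃ Y : ℝ → P → Z,
      ContinuousOn (fun x : ℝ × P => Y x.1 x.2) (Icc 0 ε ×ˢ univ) ∧ (∀ π, Y 0 π = Y₀ π) ∧
      ∀ π, ∀ t ∈ Icc 0 ε, Y t π ∈ closedBall (Y₀ π) ρ ∧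
        HasDerivWithinAt (fun t => Y t π) (G t π (Y t π)) (Icc 0 ε) t := by
  set L : ℝ := max M 1 with hL
  have hL1 : 1 ≤ L := le_max_right _ _
  set ε : ℝ := min T (ρ / 2 / L) with hε
  have hε0 : 0 < ε := lt_min hT (by positivity)
  have hεT : ε ≤ T := min_le_left _ _
  have hsub : Icc 0 ε ⊆ Icc 0 T := Icc_subset_Icc_right hεT
  have hLε : L * ε ≤ ρ / 2 := by
    calc L * ε ≤ L * (ρ / 2 / L) := by gcongr; exact min_le_right _ _
      _ = ρ / 2 := by field_simp
  have hball : ∀ π, closedBall (Y₀ π) (ρ / 2) ⊆ closedBall (Y₀ π) ρ :=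
    fun π => closedBall_subset_closedBall (by linarith)
  have hex : ∀ π, ∃ y : ℝ → Z, y 0 = Y₀ π ∧ ∀ t ∈ Icc 0 ε, y t ∈ closedBall (Y₀ π) (ρ / 2) ∧
      HasDerivWithinAt y (G t π (y t)) (Icc 0 ε) t := by
    intro π
    have := exists_picard_solution (G := fun t => G t π) (y₀ := Y₀ π) (ε := ε)
      (ρ := ⟨ρ / 2, by positivity⟩) (L := ⟨L, by positivity⟩) (K := K) hε0.le
      (fun t ht => (hK t (hsub ht) π).mono (hball π))
      (fun y hy => ?_) (fun t ht y hy => (hM t (hsub ht) π y (hball π hy)).trans (le_max_left _ _))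
      hLε
    · exact this
    · refine hG.comp (f := fun t : ℝ => (t, π, y)) (by fun_prop) fun t ht => ⟨hsub ht, ?_⟩
      exact hball π hy
  choose Y hY0 hY using hex
  refine ⟨ε, hε0, hεT, fun t π => Y π t, ?_, hY0, fun π t ht =>
    ⟨hball π (hY π t ht).1, (hY π t ht).2⟩⟩
  have hcont : ∀ π, ContinuousOn (Y π) (Icc 0 ε) := fun π t ht => (hY π t ht).2.continuousWithinAt
  rintro ⟨t₀, π₀⟩ ⟨ht₀, -⟩
  rw [Metric.continuousWithinAt_iff']
  intro η hη
  set C := gronwallBound 1 K 1 ε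
  have hC : 0 ≤ C := gronwallBound_one_nonneg K.2 hε0.le
  set η' := η / 2 / (C + 1) with hη'
  have hη'0 : 0 < η' := by positivity
  have h1 : ∀ᶠ π in 𝓝 π₀, dist (Y₀ π) (Y₀ π₀) < min η' (ρ / 2) :=
    hY₀.continuousAt.eventually (ball_mem_nhds _ (by positivity))
  have h2 : ∀ᶠ π in 𝓝 π₀, ∀ t ∈ Icc 0 ε,
      dist (G (clamp ε t) π (Y π₀ (clamp ε t))) (G (clamp ε t) π₀ (Y π₀ (clamp ε t))) < η' := by
    refine isCompact_Icc.eventually_forall_of_forall_eventually fun t _ => ?_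
    have hcl : Continuous fun t => Y π₀ (clamp ε t) :=
      (hcont π₀).comp_continuous (continuous_clamp ε) fun t => clamp_mem hε0.le t
    have hmem : ∀ᶠ z : P × ℝ in 𝓝 (π₀, t),
        (clamp ε z.2, z.1, Y π₀ (clamp ε z.2)) ∈
          {x : ℝ × P × Z | x.1 ∈ Icc 0 T ∧ dist x.2.2 (Y₀ x.2.1) ≤ ρ} := by
      filter_upwards [(continuous_fst.tendsto (π₀, t)).eventually h1] with z hz
      refine ⟨hsub (clamp_mem hε0.le _), ?_⟩
      have := (hY π₀ _ (clamp_mem hε0.le z.2)).1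
      have h3 := dist_triangle (Y π₀ (clamp ε z.2)) (Y₀ π₀) (Y₀ z.1)
      rw [mem_closedBall] at this
      have h4 := hz.trans_le (min_le_right _ _)
      rw [dist_comm] at h4
      show dist (Y π₀ (clamp ε z.2)) (Y₀ z.1) ≤ ρ
      linarith
    have hca : ContinuousAt (fun z : P × ℝ => G (clamp ε z.2) z.1 (Y π₀ (clamp ε z.2))) (π₀, t) := by
      have := (hG _ hmem.self_of_nhds).tendsto.comp (tendsto_nhdsWithin_iff.2
        ⟨(Continuous.tendsto (f := fun z : P × ℝ => (clamp ε z.2, z.1, Y π₀ (clamp ε z.2)))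
          (((continuous_clamp ε).comp continuous_snd).prodMk (continuous_fst.prodMk
            (hcl.comp continuous_snd))) (π₀, t)), hmem⟩)
      exact this
    have hca' : ContinuousAt (fun z : P × ℝ => G (clamp ε z.2) π₀ (Y π₀ (clamp ε z.2))) (π₀, t) := by
      have h5 : ContinuousAt (fun z : P × ℝ => (π₀, z.2)) (π₀, t) := by fun_prop
      exact ContinuousAt.comp (f := fun z : P × ℝ => (π₀, z.2)) (x := (π₀, t)) hca h5
    exact Filter.Tendsto.eventually_lt_const (by simpa using hη'0) (Filter.Tendsto.dist hca hca')
  have h3 : ∀ᶠ t in 𝓝[Icc 0 ε] t₀, dist (Y π₀ t) (Y π₀ t₀) < η / 2 :=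
    (hcont π₀ t₀ ht₀).eventually (ball_mem_nhds _ (by positivity))
  rw [nhdsWithin_prod_eq, nhdsWithin_univ]
  filter_upwards [h3.prod_mk (h1.and h2), prod_mem_prod self_mem_nhdsWithin univ_mem]
    with ⟨t, π⟩ ⟨ha, hb, hc⟩ ⟨ht, _⟩
  simp only at ha hb hc ht ⊢
  have hmain := dist_le_of_approx_trajectories_ODE_of_mem (v := fun t => G t π) (K := K)
    (s := fun _ => closedBall (Y₀ π) ρ) (f := Y π) (g := Y π₀) (f' := fun t => G t π (Y π t))
    (g' := fun t => G t π₀ (Y π₀ t)) (a := 0) (b := ε) (εf := 0) (εg := η') (δ := η')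
    (fun t ht => hK t (hsub (Ico_subset_Icc_self ht)) π) (hcont π)
    (fun t ht => (hY π t (Ico_subset_Icc_self ht)).2.Ici_of_Icc ht) (fun t _ => by simp)
    (fun t ht => hball π (hY π t (Ico_subset_Icc_self ht)).1) (hcont π₀)
    (fun t ht => (hY π₀ t (Ico_subset_Icc_self ht)).2.Ici_of_Icc ht)
    (fun t ht => by
      have := hc t (Ico_subset_Icc_self ht)
      rw [clamp_of_mem (Ico_subset_Icc_self ht), dist_comm] at this
      exact this.le)
    (fun t ht => by
      have := (hY π₀ t (Ico_subset_Icc_self ht)).1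
      rw [mem_closedBall] at this ⊢
      have h3 := dist_triangle (Y π₀ t) (Y₀ π₀) (Y₀ π)
      have h4 := hb.trans_le (min_le_right _ _)
      rw [dist_comm] at h4
      linarith)
    (by rw [hY0, hY0]; exact (hb.trans_le (min_le_left _ _)).le) t ht
  rw [zero_add, gronwallBound_mul, sub_zero] at hmain
  have h6 : gronwallBound 1 K 1 t ≤ C := gronwallBound_mono zero_le_one zero_le_one K.2 ht.2
  have h7 : η' * C < η / 2 := by
    rw [hη', div_mul_eq_mul_div, div_lt_iff₀ (by positivity)]
    nlinarith
  calc dist (Y π t) (Y π₀ t₀) ≤ dist (Y π t) (Y π₀ t) + dist (Y π₀ t) (Y π₀ t₀) :=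
        dist_triangle _ _ _
    _ < η' * C + η / 2 := add_lt_add_of_le_of_lt (hmain.trans (by gcongr)) ha
    _ < η := by linarith

/-- Differentiability of the solutions of an initial value problem with respect to a parameter: the
derivative is the solution of the linearised equation. -/
theorem hasFDerivAt_ode_family {Q Z : Type*} [NormedAddCommGroup Q] [NormedSpace ℝ Q]
    [NormedAddCommGroup Z] [NormedSpace ℝ Z] {G : Z → Z} {O : Set Z} (hO : IsOpen O)
    (hG : ContDiffOn ℝ 1 G O) {Y : ℝ → Q → Z} {ε : ℝ} (hε : 0 ≤ ε) {U : Set Q} (hU : IsOpen U)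
    (hYc : ContinuousOn (fun x : ℝ × Q => Y x.1 x.2) (Icc 0 ε ×ˢ U))
    (hYO : ∀ q ∈ U, ∀ t ∈ Icc 0 ε, Y t q ∈ O)
    (hY : ∀ q ∈ U, ∀ t ∈ Icc 0 ε, HasDerivWithinAt (fun t => Y t q) (G (Y t q)) (Icc 0 ε) t)
    {q₀ : Q} (hq₀ : q₀ ∈ U) {D : ℝ → Q →L[ℝ] Z}
    (hD : ∀ t ∈ Icc 0 ε, HasDerivWithinAt D ((fderiv ℝ G (Y t q₀)).comp (D t)) (Icc 0 ε) t)
    (h0 : HasFDerivAt (Y 0) (D 0) q₀) :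
    ∀ t ∈ Icc 0 ε, HasFDerivAt (Y t) (D t) q₀ := by
  have hYc0 : ContinuousOn (fun t => Y t q₀) (Icc 0 ε) :=
    fun t ht => (hY q₀ hq₀ t ht).continuousWithinAt
  have hDc : ContinuousOn D (Icc 0 ε) := fun t ht => (hD t ht).continuousWithinAt
  have hfd : ContinuousOn (fderiv ℝ G) O := hG.continuousOn_fderiv_of_isOpen hO le_rfl
  have hcl : Continuous fun t => Y (clamp ε t) q₀ :=
    hYc0.comp_continuous (continuous_clamp ε) fun t => clamp_mem hε t
  obtain ⟨M, hM⟩ := isCompact_Icc.exists_bound_of_continuousOn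
    (hfd.comp hYc0 fun t ht => hYO q₀ hq₀ t ht)
  obtain ⟨M', hM'⟩ := isCompact_Icc.exists_bound_of_continuousOn hDc
  have hM0 : 0 ≤ M := (norm_nonneg _).trans (hM 0 (left_mem_Icc.2 hε))
  have hM'0 : 0 ≤ M' := (norm_nonneg _).trans (hM' 0 (left_mem_Icc.2 hε))
  set K : ℝ≥0 := ⟨M + 1, by positivity⟩
  set C := gronwallBound 1 K 1 ε with hC
  have hC0 : 0 ≤ C := gronwallBound_one_nonneg K.2 hε
  -- uniform approximation near the compact trajectory
  have key : ∀ η : ℝ, 0 < η → ∃ r > 0, ∀ t ∈ Icc 0 ε, ∀ z ∈ closedBall (Y t q₀) r,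
      z ∈ O ∧ ‖fderiv ℝ G z - fderiv ℝ G (Y t q₀)‖ ≤ η := by
    intro η hη
    have : ∀ᶠ h in 𝓝 (0 : Z), ∀ t ∈ Icc 0 ε, Y (clamp ε t) q₀ + h ∈ O ∧
        ‖fderiv ℝ G (Y (clamp ε t) q₀ + h) - fderiv ℝ G (Y (clamp ε t) q₀)‖ < η := by
      refine isCompact_Icc.eventually_forall_of_forall_eventually fun t _ => ?_
      have hO' : ∀ t, O ∈ 𝓝 (Y (clamp ε t) q₀) :=
        fun t => hO.mem_nhds (hYO q₀ hq₀ _ (clamp_mem hε t))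
      have h1 : ContinuousAt (fun z : Z × ℝ => Y (clamp ε z.2) q₀ + z.1) (0, t) :=
        ((hcl.comp continuous_snd).add continuous_fst).continuousAt
      have h1' : Tendsto (fun z : Z × ℝ => Y (clamp ε z.2) q₀ + z.1) (𝓝 (0, t))
          (𝓝 (Y (clamp ε t) q₀)) := by simpa using h1.tendsto
      have h2 : Tendsto (fun z : Z × ℝ => Y (clamp ε z.2) q₀) (𝓝 (0, t))
          (𝓝 (Y (clamp ε t) q₀)) := (hcl.comp continuous_snd).tendsto (0, t)
      have h3 := (hfd.continuousAt (hO' t)).tendsto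
      have h4 := ((h3.comp h1').sub (h3.comp h2)).norm
      rw [sub_self, norm_zero] at h4
      exact (h1'.eventually (hO' t)).and (h4.eventually_lt_const hη)
    obtain ⟨r, hr, hball⟩ := Metric.eventually_nhds_iff_ball.1 this
    refine ⟨r / 2, half_pos hr, fun t ht z hz => ?_⟩
    have := hball (z - Y t q₀) (by
      rw [mem_ball_zero_iff]; rw [mem_closedBall, dist_eq_norm] at hz; linarith) t ht
    rw [clamp_of_mem ht, add_sub_cancel] at this
    exact ⟨this.1, this.2.le⟩
  obtain ⟨r₁, hr₁, hr₁'⟩ := key 1 one_pos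
  have hLip : ∀ t ∈ Icc 0 ε, LipschitzOnWith K G (closedBall (Y t q₀) r₁) := by
    intro t ht
    refine (convex_closedBall _ _).lipschitzOnWith_of_nnnorm_fderiv_le
      (fun z hz => (hG.differentiableOn one_ne_zero).differentiableAt
        (hO.mem_nhds (hr₁' t ht z hz).1)) fun z hz => ?_
    have h1 := (hr₁' t ht z hz).2
    have h2 := hM t ht
    have h3 := norm_le_insert' (fderiv ℝ G z) (fderiv ℝ G (Y t q₀))
    simp only [Function.comp_apply] at h2
    exact NNReal.coe_le_coe.1 (show ‖fderiv ℝ G z‖ ≤ M + 1 by linarith)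
  have huni : ∀ r > 0, ∀ᶠ q in 𝓝 q₀, ∀ t ∈ Icc 0 ε, dist (Y t q) (Y t q₀) < r := by
    intro r hr
    have : ∀ᶠ q in 𝓝 q₀, ∀ t ∈ Icc 0 ε, dist (Y (clamp ε t) q) (Y (clamp ε t) q₀) < r := by
      refine isCompact_Icc.eventually_forall_of_forall_eventually fun t _ => ?_
      have h1 : ContinuousAt (fun z : Q × ℝ => Y (clamp ε z.2) z.1) (q₀, t) := by
        have hm : ∀ᶠ z : Q × ℝ in 𝓝 (q₀, t), (clamp ε z.2, z.1) ∈ Icc 0 ε ×ˢ U := by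
          filter_upwards [(continuous_fst.tendsto (q₀, t)).eventually (hU.mem_nhds hq₀)] with z hz
          exact ⟨clamp_mem hε _, hz⟩
        exact (hYc _ hm.self_of_nhds).tendsto.comp (tendsto_nhdsWithin_iff.2
          ⟨(((continuous_clamp ε).comp continuous_snd).prodMk continuous_fst).tendsto (q₀, t), hm⟩)
      have h2 : ContinuousAt (fun z : Q × ℝ => Y (clamp ε z.2) q₀) (q₀, t) :=
        (hcl.comp continuous_snd).continuousAt
      exact Filter.Tendsto.eventually_lt_const (by simpa using hr) (Filter.Tendsto.dist h1 h2)
    filter_upwards [this] with q hq t ht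
    simpa [clamp_of_mem ht] using hq t ht
  intro t ht
  rw [hasFDerivAt_iff_isLittleO_nhds_zero, Asymptotics.isLittleO_iff]
  intro c hc
  set η := c / ((M' + 1) * (C + 1)) with hη
  have hη0 : 0 < η := by positivity
  obtain ⟨r₂, hr₂, hr₂'⟩ := key η hη0
  set r := min r₁ r₂ with hr
  have hr0 : 0 < r := lt_min hr₁ hr₂
  have hq0 : Tendsto (fun h : Q => q₀ + h) (𝓝 0) (𝓝 q₀) := by
    have : Continuous fun h : Q => q₀ + h := by fun_prop
    simpa using this.tendsto 0
  have hsmall : ∀ᶠ h in 𝓝 (0 : Q), M' * ‖h‖ < r := by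
    have : Tendsto (fun h : Q => M' * ‖h‖) (𝓝 0) (𝓝 (M' * ‖(0 : Q)‖)) :=
      (continuous_const.mul continuous_norm).tendsto 0
    exact this.eventually_lt_const (by simpa using hr0)
  have h0' := Asymptotics.isLittleO_iff.1 (hasFDerivAt_iff_isLittleO_nhds_zero.1 h0) hη0
  filter_upwards [h0', hq0.eventually (huni r hr0), hq0.eventually (hU.mem_nhds hq₀), hsmall]
    with h hh0 hhr hhU hhs
  have hDh : ∀ t ∈ Icc 0 ε, ‖D t h‖ ≤ M' * ‖h‖ := fun t ht =>
    ((D t).le_opNorm h).trans (by gcongr; exact hM' t ht)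
  have hg' : ∀ t ∈ Icc 0 ε, HasDerivWithinAt (fun t => Y t q₀ + D t h)
      (G (Y t q₀) + fderiv ℝ G (Y t q₀) (D t h)) (Icc 0 ε) t := fun t ht =>
    (hY q₀ hq₀ t ht).add ((hD t ht).clm_apply (hasDerivWithinAt_const t _ h) |>.congr_deriv (by simp))
  have hgs : ∀ t ∈ Icc 0 ε, ∀ r' ≥ r, Y t q₀ + D t h ∈ closedBall (Y t q₀) r' := fun t ht r' hr' => by
    rw [mem_closedBall, dist_eq_norm, add_sub_cancel_left]
    exact (hDh t ht).trans (hhs.le.trans hr')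
  have hIco : Ico 0 ε ⊆ Icc 0 ε := Ico_subset_Icc_self
  have hmain := dist_le_of_approx_trajectories_ODE_of_mem (v := fun _ => G) (K := K)
    (s := fun t => closedBall (Y t q₀) r₁) (f := fun t => Y t (q₀ + h))
    (g := fun t => Y t q₀ + D t h) (f' := fun t => G (Y t (q₀ + h)))
    (g' := fun t => G (Y t q₀) + fderiv ℝ G (Y t q₀) (D t h)) (a := 0) (b := ε) (εf := 0)
    (εg := η * ((M' + 1) * ‖h‖)) (δ := η * ((M' + 1) * ‖h‖))
    (fun t ht => hLip t (hIco ht)) (fun t ht => (hY _ hhU t ht).continuousWithinAt)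
    (fun t ht => (hY _ hhU t (hIco ht)).Ici_of_Icc ht) (fun t _ => by simp)
    (fun t ht => (hhr t (hIco ht)).le.trans (min_le_left _ _))
    (fun t ht => (hg' t ht).continuousWithinAt)
    (fun t ht => (hg' t (hIco ht)).Ici_of_Icc ht)
    (fun t ht => by
      have h1 := (convex_closedBall (Y t q₀) r₂).norm_image_sub_le_of_norm_fderiv_le'
        (f := G) (φ := fderiv ℝ G (Y t q₀)) (C := η)
        (fun z hz => (hG.differentiableOn one_ne_zero).differentiableAt
          (hO.mem_nhds (hr₂' t (hIco ht) z hz).1)) (fun z hz => (hr₂' t (hIco ht) z hz).2)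
        (mem_closedBall_self hr₂.le) (hgs t (hIco ht) r₂ (min_le_right _ _))
      rw [add_sub_cancel_left] at h1
      rw [dist_comm, dist_eq_norm, ← sub_sub]
      refine h1.trans ?_
      have := hDh t (hIco ht)
      have := norm_nonneg h
      gcongr
      linarith)
    (fun t ht => hgs t (hIco ht) r₁ (min_le_left _ _))
    (by
      rw [dist_eq_norm, ← sub_sub]
      refine hh0.trans ?_
      have := norm_nonneg h
      gcongr
      nlinarith) t ht
  rw [zero_add, gronwallBound_mul, sub_zero, dist_eq_norm, ← sub_sub] at hmain
  refine hmain.trans ?_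
  have h6 : gronwallBound 1 K 1 t ≤ C + 1 :=
    (gronwallBound_mono zero_le_one zero_le_one K.2 ht.2).trans
      (show C ≤ C + 1 by linarith)
  calc η * ((M' + 1) * ‖h‖) * gronwallBound 1 K 1 t ≤ η * ((M' + 1) * ‖h‖) * (C + 1) := by gcongr
    _ = c * ‖h‖ := by rw [hη]; field_simp

/-- Uniqueness of the solutions of `Z' = g(Z)` when `g` is Lipschitz continuous for a group of
components that evolve by themselves, and Lipschitz continuous in the remaining components when
those of the group are fixed. -/
theorem eqOn_of_integral_eq {Z : Type*} [NormedAddCommGroup Z] [NormedSpace ℝ Z] [CompleteSpace Z]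
    {g : Z → Z} {O : Set Z} (hO : IsOpen O) (hg : ContinuousOn g O) (π : Z →L[ℝ] Z)
    (hloc : ∀ P ∈ O, ∃ K : ℝ, ∃ B ∈ 𝓝 P, ∀ z ∈ B, ∀ z' ∈ B,
      ‖π (g z) - π (g z')‖ ≤ K * ‖π z - π z'‖ ∧ (π z = π z' → ‖g z - g z'‖ ≤ K * ‖z - z'‖))
    {y y' : ℝ → Z} {z₀ : Z} {ε : ℝ} (hyc : ContinuousOn y (Icc 0 ε))
    (hyc' : ContinuousOn y' (Icc 0 ε)) (hyO : ∀ t ∈ Icc 0 ε, y t ∈ O)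
    (hy : ∀ t ∈ Icc 0 ε, y t = z₀ + ∫ τ in (0 : ℝ)..t, g (y τ))
    (hy' : ∀ t ∈ Icc 0 ε, ContinuousOn (fun τ => g (y' τ)) (Icc 0 t) →
      y' t = z₀ + ∫ τ in (0 : ℝ)..t, g (y' τ)) :
    EqOn y y' (Icc 0 ε) := by
  by_contra hne
  obtain ⟨t₁, ht₁, hne₁⟩ : ∃ t ∈ Icc 0 ε, y t ≠ y' t := by
    simpa only [EqOn, not_forall, exists_prop] using hne
  set N := {t ∈ Icc 0 ε | y t ≠ y' t} with hN
  have hNne : N.Nonempty := ⟨t₁, ht₁, hne₁⟩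
  have hNb : BddBelow N := ⟨0, fun t ht => ht.1.1⟩
  set a := sInf N with ha
  have ha0 : 0 ≤ a := le_csInf hNne fun t ht => ht.1.1
  have haε : a ≤ ε := (csInf_le hNb ⟨ht₁, hne₁⟩).trans ht₁.2
  have haI : a ∈ Icc 0 ε := ⟨ha0, haε⟩
  have hlt : EqOn y y' (Ico 0 a) := by
    intro t ht
    by_contra h
    exact (csInf_le hNb ⟨⟨ht.1, ht.2.le.trans haε⟩, h⟩).not_gt ht.2
  have hle : EqOn y y' (Icc 0 a) := by
    rcases ha0.eq_or_lt with h | h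
    · rw [← h]
      rintro t ⟨h1, h2⟩
      obtain rfl := le_antisymm h2 h1
      have h0 : (0 : ℝ) ∈ Icc 0 ε := ⟨le_rfl, ha0.trans haε⟩
      rw [hy 0 h0, hy' 0 h0 (by simp [Icc_self])]
      simp
    · refine hlt.of_subset_closure (hyc.mono (Icc_subset_Icc_right haε))
        (hyc'.mono (Icc_subset_Icc_right haε)) Ico_subset_Icc_self ?_
      rw [closure_Ico h.ne]
  obtain ⟨K, B, hB, hKB⟩ := hloc (y a) (hyO a haI)
  have hB' : B ∩ O ∈ 𝓝 (y a) := inter_mem hB (hO.mem_nhds (hyO a haI))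
  have hB'' : B ∩ O ∈ 𝓝 (y' a) := by rwa [← hle (right_mem_Icc.2 ha0)]
  have hev : ∀ᶠ t in 𝓝[Icc 0 ε] a, y t ∈ B ∩ O ∧ y' t ∈ B ∩ O :=
    ((hyc a haI).eventually hB').and ((hyc' a haI).eventually hB'')
  obtain ⟨δ, hδ, hδB⟩ := Metric.mem_nhdsWithin_iff.1 hev
  obtain ⟨t₂, ht₂N, ht₂⟩ := exists_lt_of_csInf_lt hNne (show sInf N < a + δ by linarith)
  have hat₂ : a ≤ t₂ := csInf_le hNb ht₂N
  have hI : ∀ t ∈ Icc a t₂, y t ∈ B ∩ O ∧ y' t ∈ B ∩ O := fun t ht =>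
    hδB ⟨by rw [mem_ball, Real.dist_eq, abs_lt]; constructor <;> linarith [ht.1, ht.2],
      ⟨ha0.trans ht.1, ht.2.trans ht₂N.1.2⟩⟩
  have hsub : Icc 0 t₂ ⊆ Icc 0 ε := Icc_subset_Icc_right ht₂N.1.2
  have hO' : ∀ t ∈ Icc 0 t₂, y' t ∈ O := fun t ht => by
    rcases le_total t a with h | h
    · rw [← hle ⟨ht.1, h⟩]; exact hyO t (hsub ht)
    · exact (hI t ⟨h, ht.2⟩).2.2
  have hgy' : ContinuousOn (fun τ => g (y' τ)) (Icc 0 t₂) := hg.comp (hyc'.mono hsub) hO'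
  have hd : ∀ y : ℝ → Z, ContinuousOn y (Icc 0 t₂) → (∀ t ∈ Icc 0 t₂, y t ∈ O) →
      (∀ t ∈ Icc 0 t₂, y t = z₀ + ∫ τ in (0 : ℝ)..t, g (y τ)) →
      ∀ t ∈ Icc 0 t₂, HasDerivWithinAt y (g (y t)) (Icc 0 t₂) t := by
    intro y hyc hyO hy t ht
    refine (ODE.hasDerivWithinAt_picard_Icc (f := fun _ => g) (u := O)
      (left_mem_Icc.2 (ha0.trans hat₂)) (hg.comp continuousOn_snd fun x hx => hx.2) hyc hyO z₀
      ht).congr_of_mem (fun t ht => ?_) ht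
    rw [hy t ht, ODE.picard_apply]
  have hdy := hd y (hyc.mono hsub) (fun t ht => hyO t (hsub ht)) fun t ht => hy t (hsub ht)
  have hdy' := hd y' (hyc'.mono hsub) hO' fun t ht =>
    hy' t (hsub ht) (hgy'.mono (Icc_subset_Icc_right ht.2))
  have hsub' : Icc a t₂ ⊆ Icc 0 t₂ := Icc_subset_Icc_left ha0
  have hde : ∀ t ∈ Ico a t₂, HasDerivWithinAt (fun t => y t - y' t) (g (y t) - g (y' t)) (Ici t) t :=
    fun t ht => (((hdy t (hsub' (Ico_subset_Icc_self ht))).mono hsub').Ici_of_Icc ht).sub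
      (((hdy' t (hsub' (Ico_subset_Icc_self ht))).mono hsub').Ici_of_Icc ht)
  have hce : ContinuousOn (fun t => y t - y' t) (Icc a t₂) :=
    (hyc.mono (hsub'.trans hsub)).sub (hyc'.mono (hsub'.trans hsub))
  have ha' : y a - y' a = 0 := sub_eq_zero.2 (hle (right_mem_Icc.2 ha0))
  have h1 := eq_zero_of_abs_deriv_le_mul_abs_self_of_eq_zero_right (K := K)
    (f := fun t => π (y t - y' t)) (f' := fun t => π (g (y t) - g (y' t)))
    (π.continuous.comp_continuousOn hce)
    (fun t ht => π.hasFDerivAt.comp_hasDerivWithinAt t (hde t ht)) (by simp [ha'])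
    (fun t ht => by
      have := hI t (Ico_subset_Icc_self ht)
      simpa using (hKB _ this.1.1 _ this.2.1).1)
  have h2 := eq_zero_of_abs_deriv_le_mul_abs_self_of_eq_zero_right (K := K) hce hde ha'
    (fun t ht => by
      have := hI t (Ico_subset_Icc_self ht)
      exact (hKB _ this.1.1 _ this.2.1).2 (sub_eq_zero.1 (by
        simpa using h1 t (Ico_subset_Icc_self ht))))
  exact ht₂N.2 (sub_eq_zero.1 (h2 t₂ (right_mem_Icc.2 hat₂)))

end OrdinaryDifferentialEquations


section Derivatives

variable {P V W : Type*} [NormedAddCommGroup P] [NormedSpace ℝ P] [NormedAddCommGroup V]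
  [NormedSpace ℝ V] [NormedAddCommGroup W] [NormedSpace ℝ W]

theorem contDiffAt_fderiv_param {f : P → V → W} {p : P} {v : V} {m k : WithTop ℕ∞}
    (hf : ContDiffAt ℝ k (fun x : P × V => f x.1 x.2) (p, v)) (hk : m + 1 ≤ k) :
    ContDiffAt ℝ m (fun x : P × V => fderiv ℝ (f x.1) x.2) (p, v) := by
  refine ContDiffAt.fderiv (f := fun x : P × V => f x.1) (g := fun x : P × V => x.2) (n := k)
    ?_ contDiffAt_snd hk
  exact ContDiffAt.comp (f := fun x : (P × V) × V => (x.1.1, x.2)) (x := ((p, v), v)) hf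
    (by fun_prop)

theorem iteratedFDeriv_three_apply {f : V → W} {v : V} (hf : ContDiffAt ℝ 3 f v) (a b c : V) :
    iteratedFDeriv ℝ 3 f v ![a, b, c] = fderiv ℝ (fderiv ℝ (fderiv ℝ f)) v a b c := by
  have h2 : DifferentiableAt ℝ (iteratedFDeriv ℝ 2 f) v :=
    (hf.iteratedFDeriv_right (m := 1) (i := 2) (by norm_num)).differentiableAt one_ne_zero
  have h3 : DifferentiableAt ℝ (fderiv ℝ (fderiv ℝ f)) v :=
    ((hf.fderiv_right (m := 2) (by norm_num)).fderiv_right (m := 1)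
      (by norm_num)).differentiableAt one_ne_zero
  rw [iteratedFDeriv_succ_apply_left]
  have e1 : HasFDerivAt (fun v' => iteratedFDeriv ℝ 2 f v' ![b, c])
      ((ContinuousMultilinearMap.apply ℝ (fun _ : Fin 2 => V) W ![b, c]).comp
        (fderiv ℝ (iteratedFDeriv ℝ 2 f) v)) v :=
    (ContinuousMultilinearMap.apply ℝ (fun _ : Fin 2 => V) W ![b, c]).hasFDerivAt.comp v
      h2.hasFDerivAt
  have e2 := (h3.hasFDerivAt.clm_apply (hasFDerivAt_const b v)).clm_apply (hasFDerivAt_const c v)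
  have e3 : (fun v' => iteratedFDeriv ℝ 2 f v' ![b, c]) =
      fun v' => fderiv ℝ (fderiv ℝ f) v' b c := by
    funext v'
    rw [iteratedFDeriv_two_apply]; rfl
  rw [e3] at e1
  simpa using congrArg (fun T : V →L[ℝ] W => T a) (e1.unique e2)

theorem fderiv_fderiv_comm {f : V → W} {v : V} (hf : ContDiffAt ℝ 2 f v) (a b : V) :
    fderiv ℝ (fderiv ℝ f) v a b = fderiv ℝ (fderiv ℝ f) v b a :=
  hf.isSymmSndFDerivAt (by simp) a b

theorem fderiv_fderiv_fderiv_comm {f : V → W} {v : V} (hf : ContDiffAt ℝ 3 f v) (a b c : V) :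
    fderiv ℝ (fderiv ℝ (fderiv ℝ f)) v a b c = fderiv ℝ (fderiv ℝ (fderiv ℝ f)) v b c a := by
  have h1 : fderiv ℝ (fderiv ℝ (fderiv ℝ f)) v a b = fderiv ℝ (fderiv ℝ (fderiv ℝ f)) v b a :=
    fderiv_fderiv_comm (hf.fderiv_right (m := 2) (by norm_num)) a b
  rw [h1]
  have h3 : DifferentiableAt ℝ (fderiv ℝ (fderiv ℝ f)) v :=
    ((hf.fderiv_right (m := 2) (by norm_num)).fderiv_right (m := 1)
      (by norm_num)).differentiableAt one_ne_zero
  have e := fun x y : V =>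
    (h3.hasFDerivAt.clm_apply (hasFDerivAt_const x v)).clm_apply (hasFDerivAt_const y v)
  have e3 : (fun v' => fderiv ℝ (fderiv ℝ f) v' a c) =ᶠ[nhds v]
      fun v' => fderiv ℝ (fderiv ℝ f) v' c a := by
    filter_upwards [hf.eventually (by simp)] with v' hv'
    exact fderiv_fderiv_comm (hv'.of_le (by norm_num)) a c
  simpa using congrArg (fun T : V →L[ℝ] W => T b) (((e a c).congr_of_eventuallyEq e3.symm).unique (e c a))

theorem hasDerivAt_fderiv_apply {f : V → W} {v : V} (hf : ContDiffAt ℝ 2 f v) {γ a : ℝ → V}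
    {γ' a' : V} {t : ℝ} (hγ : HasDerivAt γ γ' t) (ha : HasDerivAt a a' t) (hv : γ t = v) :
    HasDerivAt (fun t => fderiv ℝ f (γ t) (a t))
      (fderiv ℝ (fderiv ℝ f) v γ' (a t) + fderiv ℝ f v a') t := by
  subst hv
  have h1 : HasFDerivAt (fderiv ℝ f) (fderiv ℝ (fderiv ℝ f) (γ t)) (γ t) :=
    ((hf.fderiv_right (m := 1) (by norm_num)).differentiableAt one_ne_zero).hasFDerivAt
  exact (h1.comp_hasDerivAt t hγ).clm_apply ha

theorem hasDerivAt_fderiv_fderiv_apply {f : V → W} {v : V} (hf : ContDiffAt ℝ 3 f v)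
    {γ a b : ℝ → V} {γ' a' b' : V} {t : ℝ} (hγ : HasDerivAt γ γ' t) (ha : HasDerivAt a a' t)
    (hb : HasDerivAt b b' t) (hv : γ t = v) :
    HasDerivAt (fun t => fderiv ℝ (fderiv ℝ f) (γ t) (a t) (b t))
      (fderiv ℝ (fderiv ℝ (fderiv ℝ f)) v γ' (a t) (b t) + fderiv ℝ (fderiv ℝ f) v a' (b t)
        + fderiv ℝ (fderiv ℝ f) v (a t) b') t := by
  subst hv
  exact ((hasDerivAt_fderiv_apply (hf.fderiv_right (m := 2) (by norm_num)) hγ ha rfl).clm_apply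
    hb)

end Derivatives

section Fields

/-- The values of the auxiliary functions `X` and `Ω` together. -/
abbrev ZVal (n : ℕ) := XVal × WVal n

variable {n : ℕ}

set_option synthInstance.maxHeartbeats 200000 in
instance : ContinuousSMul ℝ (ZVal n) := inferInstance

set_option synthInstance.maxHeartbeats 200000 in
instance : IsTopologicalAddGroup (ZVal n) := inferInstance

/-- The truncation that discards the derivatives of top order. -/
def tr : ZVal n →L[ℝ] ZVal n where
  toFun Z := ((Z.1.1, Z.1.2.1, Z.1.2.2.1, 0), (Z.2.1, Z.2.2.1, 0))
  map_add' _ _ := by simp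
  map_smul' _ _ := by simp
  cont := by fun_prop

/-- The entries of the next order: the formal derivative with respect to `p⁰_k`. -/
def nx (k : Fin 3) : ZVal n →L[ℝ] ZVal n where
  toFun Z := ((Z.1.2.1 k, fun j => Z.1.2.2.1 j k, fun j h => Z.1.2.2.2 j h k, 0),
    (Z.2.2.1 k, fun j => Z.2.2.2 j k, 0))
  map_add' _ _ := by simp; exact ⟨⟨rfl, rfl⟩, rfl⟩
  map_smul' _ _ := by simp; exact ⟨⟨rfl, rfl⟩, rfl⟩
  cont := by fun_prop

/-- The right-hand side of the equations for `X` and `Ω` together. -/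
noncomputable def efull (A : CoefA) (B : CoefB n) (Z : ZVal n) : ZVal n :=
  (E A Z.1, EW A B Z.1 Z.2)

/-- The right-hand side of the equations for the entries that are not of top order. -/
noncomputable def elow (A : CoefA) (B : CoefB n) (Z : ZVal n) : ZVal n := tr (efull A B Z)

theorem tr_tr (Z : ZVal n) : tr (tr Z) = tr Z := rfl

theorem nx_tr (k : Fin 3) (Z : ZVal n) : tr (nx k Z) = nx k Z := rfl

theorem elow_tr (A : CoefA) (B : CoefB n) (Z : ZVal n) : elow A B (tr Z) = elow A B Z := rfl

theorem elow_eq (A : CoefA) (B : CoefB n) (Z : ZVal n) : elow A B Z =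
    ((bichar A Z.1.1, fun j => fderiv ℝ (bichar A) Z.1.1 (Z.1.2.1 j),
      fun j h => fderiv ℝ (fderiv ℝ (bichar A)) Z.1.1 (Z.1.2.1 j) (Z.1.2.1 h)
        + fderiv ℝ (bichar A) Z.1.1 (Z.1.2.2.1 j h), 0),
     (mmul (transport A B Z.1.1) Z.2.1,
      fun j => mmul (fderiv ℝ (transport A B) Z.1.1 (Z.1.2.1 j)) Z.2.1
        + mmul (transport A B Z.1.1) (Z.2.2.1 j), 0)) := by
  refine Prod.ext (Prod.ext rfl (Prod.ext rfl (Prod.ext ?_ rfl))) rfl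
  funext j h
  show iteratedFDeriv ℝ 2 (bichar A) Z.1.1 ![_, _] + _ = _
  rw [iteratedFDeriv_two_apply]
  rfl

theorem contDiffAt_mmul {V : Type*} [NormedAddCommGroup V] [NormedSpace ℝ V] {k : WithTop ℕ∞}
    {f g : V → Mat n} {v : V} (hf : ContDiffAt ℝ k f v) (hg : ContDiffAt ℝ k g v) :
    ContDiffAt ℝ k (fun v => mmul (f v) (g v)) v := by
  rw [contDiffAt_pi] at hf hg
  refine contDiffAt_pi.2 fun r => contDiffAt_pi.2 fun s => ContDiffAt.sum fun t _ => ?_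
  exact (contDiffAt_pi.1 (hf r) t).mul (contDiffAt_pi.1 (hg t) s)

theorem hasDerivAt_mmul {f g : ℝ → Mat n} {f' g' : Mat n} {t : ℝ} (hf : HasDerivAt f f' t)
    (hg : HasDerivAt g g' t) :
    HasDerivAt (fun t => mmul (f t) (g t)) (mmul f' (g t) + mmul (f t) g') t := by
  simp only [hasDerivAt_pi] at hf hg ⊢
  intro r s
  have := HasDerivAt.fun_sum (u := Finset.univ) fun k _ => (hf r k).mul (hg k s)
  refine this.congr_deriv ?_
  simp [mmul, Finset.sum_add_distrib]

variable {P : Type*} [NormedAddCommGroup P] [NormedSpace ℝ P]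

theorem contDiffAt_elow_param {Aθ : P → CoefA} {Bθ : P → CoefB n} {p : P} {Z : ZVal n}
    (h1 : ContDiffAt ℝ 3 (fun x : P × Ph => bichar (Aθ x.1) x.2) (p, Z.1.1))
    (h2 : ContDiffAt ℝ 2 (fun x : P × Ph => transport (Aθ x.1) (Bθ x.1) x.2) (p, Z.1.1)) :
    ContDiffAt ℝ 1 (fun x : P × ZVal n => elow (Aθ x.1) (Bθ x.1) x.2) (p, Z) := by
  simp only [elow_eq]
  have hπ : ∀ k, ContDiffAt ℝ k (fun x : P × ZVal n => (x.1, x.2.1.1)) (p, Z) :=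
    fun k => by fun_prop
  have f1 := contDiffAt_fderiv_param (f := fun p => bichar (Aθ p)) (m := 2) h1 (by norm_num)
  have f2 := contDiffAt_fderiv_param (f := fun p => fderiv ℝ (bichar (Aθ p))) (m := 1) f1
    (by norm_num)
  have g1 := contDiffAt_fderiv_param (f := fun p => transport (Aθ p) (Bθ p)) (m := 1) h2
    (by norm_num)
  have H0 := (h1.comp (p, Z) (hπ 3)).of_le (show (1 : WithTop ℕ∞) ≤ 3 by norm_num)
  have H1 := (f1.comp (p, Z) (hπ 2)).of_le (show (1 : WithTop ℕ∞) ≤ 2 by norm_num)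
  have H2 := f2.comp (p, Z) (hπ 1)
  have T0 := (h2.comp (p, Z) (hπ 2)).of_le (show (1 : WithTop ℕ∞) ≤ 2 by norm_num)
  have T1 := g1.comp (p, Z) (hπ 1)
  refine ContDiffAt.prodMk (ContDiffAt.prodMk H0 (ContDiffAt.prodMk ?_ (ContDiffAt.prodMk ?_
    contDiffAt_const))) (ContDiffAt.prodMk ?_ (ContDiffAt.prodMk ?_ contDiffAt_const))
  · exact contDiffAt_pi.2 fun j => H1.clm_apply (by fun_prop)
  · exact contDiffAt_pi.2 fun j => contDiffAt_pi.2 fun h =>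
      ((H2.clm_apply (by fun_prop)).clm_apply (by fun_prop)).add (H1.clm_apply (by fun_prop))
  · exact contDiffAt_mmul T0 (by fun_prop)
  · exact contDiffAt_pi.2 fun j => (contDiffAt_mmul (T1.clm_apply (by fun_prop))
      (by fun_prop)).add (contDiffAt_mmul T0 (by fun_prop))

theorem continuousAt_efull_param {Aθ : P → CoefA} {Bθ : P → CoefB n} {p : P} {Z : ZVal n}
    (h1 : ContDiffAt ℝ 3 (fun x : P × Ph => bichar (Aθ x.1) x.2) (p, Z.1.1))
    (h2 : ContDiffAt ℝ 2 (fun x : P × Ph => transport (Aθ x.1) (Bθ x.1) x.2) (p, Z.1.1)) :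
    ContinuousAt (fun x : P × ZVal n => efull (Aθ x.1) (Bθ x.1) x.2) (p, Z) := by
  have hπ : ∀ k, ContDiffAt ℝ k (fun x : P × ZVal n => (x.1, x.2.1.1)) (p, Z) :=
    fun k => by fun_prop
  have hlow := (contDiffAt_elow_param h1 h2).continuousAt
  have f1 := contDiffAt_fderiv_param (f := fun p => bichar (Aθ p)) (m := 2) h1 (by norm_num)
  have f2 := contDiffAt_fderiv_param (f := fun p => fderiv ℝ (bichar (Aθ p))) (m := 1) f1
    (by norm_num)
  have f3 := contDiffAt_fderiv_param (f := fun p => fderiv ℝ (fderiv ℝ (bichar (Aθ p)))) (m := 0) f2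
    (by norm_num)
  have g1 := contDiffAt_fderiv_param (f := fun p => transport (Aθ p) (Bθ p)) (m := 1) h2
    (by norm_num)
  have g2 := contDiffAt_fderiv_param (f := fun p => fderiv ℝ (transport (Aθ p) (Bθ p))) (m := 0) g1
    (by norm_num)
  have H1 := (f1.comp (p, Z) (hπ 2)).of_le (show (0 : WithTop ℕ∞) ≤ 2 by norm_num)
  have H2 := (f2.comp (p, Z) (hπ 1)).of_le (show (0 : WithTop ℕ∞) ≤ 1 by norm_num)
  have H3 := f3.comp (p, Z) (hπ 0)
  have T0 := (h2.comp (p, Z) (hπ 2)).of_le (show (0 : WithTop ℕ∞) ≤ 2 by norm_num)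
  have T1 := (g1.comp (p, Z) (hπ 1)).of_le (show (0 : WithTop ℕ∞) ≤ 1 by norm_num)
  have T2 := g2.comp (p, Z) (hπ 0)
  have hX : ContinuousAt (fun x : P × ZVal n => fun j h k =>
      fderiv ℝ (fderiv ℝ (fderiv ℝ (bichar (Aθ x.1)))) x.2.1.1
        (x.2.1.2.1 j) (x.2.1.2.1 h) (x.2.1.2.1 k)
      + fderiv ℝ (fderiv ℝ (bichar (Aθ x.1))) x.2.1.1 (x.2.1.2.2.1 j h) (x.2.1.2.1 k)
      + fderiv ℝ (fderiv ℝ (bichar (Aθ x.1))) x.2.1.1 (x.2.1.2.2.1 j k) (x.2.1.2.1 h)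
      + fderiv ℝ (fderiv ℝ (bichar (Aθ x.1))) x.2.1.1 (x.2.1.2.2.1 h k) (x.2.1.2.1 j)
      + fderiv ℝ (bichar (Aθ x.1)) x.2.1.1 (x.2.1.2.2.2 j h k)) (p, Z) := by
    refine continuousAt_pi.2 fun j => continuousAt_pi.2 fun h => continuousAt_pi.2 fun k => ?_
    refine ContDiffAt.continuousAt (n := 0) (𝕜 := ℝ) ?_
    exact ((((((H3.clm_apply (by fun_prop)).clm_apply (by fun_prop)).clm_apply (by fun_prop)).add
      ((H2.clm_apply (by fun_prop)).clm_apply (by fun_prop))).add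
      ((H2.clm_apply (by fun_prop)).clm_apply (by fun_prop))).add
      ((H2.clm_apply (by fun_prop)).clm_apply (by fun_prop))).add (H1.clm_apply (by fun_prop))
  have hW : ContinuousAt (fun x : P × ZVal n => fun j h =>
      mmul (fderiv ℝ (fderiv ℝ (transport (Aθ x.1) (Bθ x.1))) x.2.1.1 (x.2.1.2.1 j) (x.2.1.2.1 h)
        + fderiv ℝ (transport (Aθ x.1) (Bθ x.1)) x.2.1.1 (x.2.1.2.2.1 j h)) x.2.2.1
      + mmul (fderiv ℝ (transport (Aθ x.1) (Bθ x.1)) x.2.1.1 (x.2.1.2.1 j)) (x.2.2.2.1 h)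
      + mmul (fderiv ℝ (transport (Aθ x.1) (Bθ x.1)) x.2.1.1 (x.2.1.2.1 h)) (x.2.2.2.1 j)
      + mmul (transport (Aθ x.1) (Bθ x.1) x.2.1.1) (x.2.2.2.2 j h)) (p, Z) := by
    refine continuousAt_pi.2 fun j => continuousAt_pi.2 fun h => ?_
    refine ContDiffAt.continuousAt (n := 0) (𝕜 := ℝ) ?_
    exact (((contDiffAt_mmul (((T2.clm_apply (by fun_prop)).clm_apply (by fun_prop)).add
      (T1.clm_apply (by fun_prop))) (by fun_prop)).add
      (contDiffAt_mmul (T1.clm_apply (by fun_prop)) (by fun_prop))).add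
      (contDiffAt_mmul (T1.clm_apply (by fun_prop)) (by fun_prop))).add
      (contDiffAt_mmul T0 (by fun_prop))
  have hev : ∀ᶠ x : P × ZVal n in nhds (p, Z),
      ContDiffAt ℝ 3 (fun x : P × Ph => bichar (Aθ x.1) x.2) (x.1, x.2.1.1) :=
    (hπ 0).continuousAt.eventually (h1.eventually (by simp))
  have hl := hlow
  refine ContinuousAt.congr (f := fun x : P × ZVal n =>
    (((elow (Aθ x.1) (Bθ x.1) x.2).1.1, (elow (Aθ x.1) (Bθ x.1) x.2).1.2.1,
      (elow (Aθ x.1) (Bθ x.1) x.2).1.2.2.1, _), ((elow (Aθ x.1) (Bθ x.1) x.2).2.1,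
      (elow (Aθ x.1) (Bθ x.1) x.2).2.2.1, _)))
    (((hl.fst.fst).prodMk ((hl.fst.snd.fst).prodMk ((hl.fst.snd.snd.fst).prodMk hX))).prodMk
      ((hl.snd.fst).prodMk ((hl.snd.snd.fst).prodMk hW))) ?_
  filter_upwards [hev] with x hx
  have hx' : ContDiffAt ℝ 3 (bichar (Aθ x.1)) x.2.1.1 :=
    ContDiffAt.comp (f := fun v : Ph => (x.1, v)) (x := x.2.1.1) hx (by fun_prop)
  refine Prod.ext (Prod.ext rfl (Prod.ext rfl (Prod.ext rfl ?_))) (Prod.ext rfl (Prod.ext rfl ?_))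
  · funext j h k
    show _ = iteratedFDeriv ℝ 3 _ _ ![_, _, _] + iteratedFDeriv ℝ 2 _ _ ![_, _]
      + iteratedFDeriv ℝ 2 _ _ ![_, _] + iteratedFDeriv ℝ 2 _ _ ![_, _] + _
    rw [iteratedFDeriv_three_apply hx', iteratedFDeriv_two_apply, iteratedFDeriv_two_apply,
      iteratedFDeriv_two_apply]
    rfl
  · funext j h
    show _ = mmul (iteratedFDeriv ℝ 2 _ _ ![_, _] + _) _ + _ + _ + _
    rw [iteratedFDeriv_two_apply]
    rfl

theorem contDiffAt_elow {A : CoefA} {B : CoefB n} {Z : ZVal n}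
    (h1 : ContDiffAt ℝ 3 (bichar A) Z.1.1) (h2 : ContDiffAt ℝ 2 (transport A B) Z.1.1) :
    ContDiffAt ℝ 1 (elow A B) Z :=
  (contDiffAt_elow_param (P := ℝ) (Aθ := fun _ => A) (Bθ := fun _ => B) (p := 0) (Z := Z)
    (h1.comp (f := Prod.snd) (0, Z.1.1) contDiffAt_snd)
    (h2.comp (f := Prod.snd) (0, Z.1.1) contDiffAt_snd)).comp (f := fun Z => ((0 : ℝ), Z)) Z
      (by fun_prop)

set_option synthInstance.maxHeartbeats 200000 in
set_option maxHeartbeats 1000000 in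
/-- The equations for the entries of the next order are the linearised equations. -/
theorem nx_efull {A : CoefA} {B : CoefB n} {Z : ZVal n}
    (h1 : ContDiffAt ℝ 3 (bichar A) Z.1.1) (h2 : ContDiffAt ℝ 2 (transport A B) Z.1.1)
    (k : Fin 3) : nx k (efull A B Z) = fderiv ℝ (elow A B) Z (nx k Z) := by
  have hl : HasDerivAt (fun ε : ℝ => Z + ε • nx k Z) (nx k Z) 0 := by
    simpa using ((hasDerivAt_id (0 : ℝ)).smul_const (nx k Z)).const_add Z
  have hd : HasFDerivAt (elow A B) (fderiv ℝ (elow A B) Z) (Z + (0 : ℝ) • nx k Z) := by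
    simpa using ((contDiffAt_elow h1 h2).differentiableAt one_ne_zero).hasFDerivAt
  have hc := hd.comp_hasDerivAt (0 : ℝ) hl
  refine HasDerivAt.unique ?_ hc
  have hZ : Z + (0 : ℝ) • nx k Z = Z := by simp
  have l1 := hl.fst.fst
  have l2 : ∀ j, HasDerivAt (fun ε : ℝ => (Z + ε • nx k Z).1.2.1 j) (Z.1.2.2.1 j k) 0 :=
    hasDerivAt_pi.1 hl.fst.snd.fst
  have l3 : ∀ j h, HasDerivAt (fun ε : ℝ => (Z + ε • nx k Z).1.2.2.1 j h) (Z.1.2.2.2 j h k) 0 :=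
    fun j => hasDerivAt_pi.1 (hasDerivAt_pi.1 hl.fst.snd.snd.fst j)
  have m1 := hl.snd.fst
  have m2 : ∀ j, HasDerivAt (fun ε : ℝ => (Z + ε • nx k Z).2.2.1 j) (Z.2.2.2 j k) 0 :=
    hasDerivAt_pi.1 hl.snd.snd.fst
  have hv : (Z + (0 : ℝ) • nx k Z).1.1 = Z.1.1 := by rw [hZ]
  have hP := (show HasFDerivAt (transport A B) (fderiv ℝ (transport A B) Z.1.1)
    (Z + (0 : ℝ) • nx k Z).1.1 by
      rw [hv]; exact (h2.differentiableAt two_ne_zero).hasFDerivAt).comp_hasDerivAt (0 : ℝ) l1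
  have hf := (show HasFDerivAt (bichar A) (fderiv ℝ (bichar A) Z.1.1)
    (Z + (0 : ℝ) • nx k Z).1.1 by
      rw [hv]; exact (h1.differentiableAt three_ne_zero).hasFDerivAt).comp_hasDerivAt (0 : ℝ) l1
  have h1' : ContDiffAt ℝ 2 (bichar A) Z.1.1 := h1.of_le (by norm_num)
  show HasDerivAt (fun ε : ℝ => elow A B (Z + ε • nx k Z)) _ 0
  simp only [elow_eq]
  refine HasDerivAt.prodMk (HasDerivAt.prodMk hf (HasDerivAt.prodMk ?_ (HasDerivAt.prodMk ?_
    (hasDerivAt_const _ _)))) (HasDerivAt.prodMk ?_ (HasDerivAt.prodMk ?_ (hasDerivAt_const _ _)))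
  · refine hasDerivAt_pi.2 fun j => (hasDerivAt_fderiv_apply h1' l1 (l2 j) hv).congr_deriv ?_
    rw [hZ, fderiv_fderiv_comm h1']
    show _ = iteratedFDeriv ℝ 2 _ _ ![_, _] + _
    rw [iteratedFDeriv_two_apply]
    rfl
  · refine hasDerivAt_pi.2 fun j => hasDerivAt_pi.2 fun h =>
      ((hasDerivAt_fderiv_fderiv_apply h1 l1 (l2 j) (l2 h) hv).add
        (hasDerivAt_fderiv_apply h1' l1 (l3 j h) hv)).congr_deriv ?_
    show _ = iteratedFDeriv ℝ 3 _ _ ![_, _, _] + iteratedFDeriv ℝ 2 _ _ ![_, _]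
      + iteratedFDeriv ℝ 2 _ _ ![_, _] + iteratedFDeriv ℝ 2 _ _ ![_, _] + _
    rw [iteratedFDeriv_three_apply h1, iteratedFDeriv_two_apply, iteratedFDeriv_two_apply,
      iteratedFDeriv_two_apply, hZ, fderiv_fderiv_fderiv_comm h1,
      fderiv_fderiv_comm h1' (Z.1.2.1 j), fderiv_fderiv_comm h1' (nx k Z).1.1]
    show fderiv ℝ (fderiv ℝ (fderiv ℝ (bichar A))) Z.1.1 (Z.1.2.1 j) (Z.1.2.1 h) (Z.1.2.1 k)
      + fderiv ℝ (fderiv ℝ (bichar A)) Z.1.1 (Z.1.2.2.1 j k) (Z.1.2.1 h)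
      + fderiv ℝ (fderiv ℝ (bichar A)) Z.1.1 (Z.1.2.2.1 h k) (Z.1.2.1 j)
      + (fderiv ℝ (fderiv ℝ (bichar A)) Z.1.1 (Z.1.2.2.1 j h) (Z.1.2.1 k)
      + fderiv ℝ (bichar A) Z.1.1 (Z.1.2.2.2 j h k)) =
      fderiv ℝ (fderiv ℝ (fderiv ℝ (bichar A))) Z.1.1 (Z.1.2.1 j) (Z.1.2.1 h) (Z.1.2.1 k)
      + fderiv ℝ (fderiv ℝ (bichar A)) Z.1.1 (Z.1.2.2.1 j h) (Z.1.2.1 k)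
      + fderiv ℝ (fderiv ℝ (bichar A)) Z.1.1 (Z.1.2.2.1 j k) (Z.1.2.1 h)
      + fderiv ℝ (fderiv ℝ (bichar A)) Z.1.1 (Z.1.2.2.1 h k) (Z.1.2.1 j)
      + fderiv ℝ (bichar A) Z.1.1 (Z.1.2.2.2 j h k)
    abel
  · refine (hasDerivAt_mmul hP m1).congr_deriv ?_
    rw [hZ, Function.comp_apply, hZ]; rfl
  · refine hasDerivAt_pi.2 fun j => ((hasDerivAt_mmul
      (hasDerivAt_fderiv_apply h2 l1 (l2 j) hv) m1).add (hasDerivAt_mmul hP (m2 j))).congr_deriv ?_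
    rw [hZ, fderiv_fderiv_comm h2]
    show _ = mmul (iteratedFDeriv ℝ 2 _ _ ![_, _] + _) _ + _ + _ + _
    rw [iteratedFDeriv_two_apply]
    show mmul _ _ + mmul _ _ + (mmul _ _ + mmul _ _) = _
    rw [Function.comp_apply, hZ, ← add_assoc]
    rfl

end Fields


section Smoothness

theorem cov_castSucc (p : Fin 3 → ℝ) (i : Fin 3) : cov p i.castSucc = p i := by
  unfold cov; exact Fin.snoc_castSucc (α := fun _ => ℝ) _ _ i

theorem cov_three (p : Fin 3 → ℝ) : cov p 3 = 1 := by
  unfold cov; exact Fin.snoc_last (α := fun _ => ℝ) _ _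

theorem sum_four (g : Fin 4 → ℝ) : ∑ α, g α = (∑ i : Fin 3, g i.castSucc) + g 3 :=
  Fin.sum_univ_castSucc g

theorem contDiff_cov (k : WithTop ℕ∞) : ContDiff ℝ k cov := by
  refine contDiff_pi.2 fun β => ?_
  induction β using Fin.lastCases with
  | last => 
    rw [show (fun p => cov p (Fin.last 3)) = fun _ => (1 : ℝ) from funext cov_three]
    exact contDiff_const
  | cast i => 
    rw [show (fun p => cov p i.castSucc) = fun p => p i from funext fun p => cov_castSucc p i]
    exact contDiff_apply ℝ ℝ i

variable {n : ℕ} {P : Type*} [NormedAddCommGroup P] [NormedSpace ℝ P]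

theorem contDiffAt_pd_param {Q : Type*} [NormedAddCommGroup Q] [NormedSpace ℝ Q]
    {g : Q → Pt → ℝ} {q : Q} {y : Pt} {m k : WithTop ℕ∞}
    (hg : ContDiffAt ℝ k (fun x : Q × Pt => g x.1 x.2) (q, y)) (hk : m + 1 ≤ k) (α : Fin 4) :
    ContDiffAt ℝ m (fun x : Q × Pt => pd α (g x.1) x.2) (q, y) :=
  (contDiffAt_fderiv_param hg hk).clm_apply contDiffAt_const

theorem contDiffAt_bichar_param {Aθ : P → CoefA} {p : P} {v : Ph}
    (hA : ∀ α β, ContDiffAt ℝ 4 (fun x : P × Pt => Aθ x.1 x.2 α β) (p, v.1)) :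
    ContDiffAt ℝ 3 (fun x : P × Ph => bichar (Aθ x.1) x.2) (p, v) := by
  have hcov : ∀ β, ContDiffAt ℝ 3 (fun x : P × Ph => cov x.2.2 β) (p, v) := fun β =>
    (contDiffAt_pi.1 (((contDiff_cov 3).comp (f := fun x : P × Ph => x.2.2)
      (by fun_prop)).contDiffAt) β)
  have hA' : ∀ α β, ContDiffAt ℝ 3 (fun x : P × Ph => Aθ x.1 x.2.1 α β) (p, v) := fun α β =>
    ((hA α β).of_le (by norm_num)).comp (f := fun x : P × Ph => (x.1, x.2.1)) (p, v) (by fun_prop)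
  have hF : ContDiffAt ℝ 4 (fun x : (P × (Fin 3 → ℝ)) × Pt => F (Aθ x.1.1) x.1.2 x.2)
      ((p, v.2), v.1) := by
    have hc : ∀ β, ContDiffAt ℝ 4 (fun x : (P × (Fin 3 → ℝ)) × Pt => cov x.1.2 β)
        ((p, v.2), v.1) := fun β =>
      (contDiffAt_pi.1 (((contDiff_cov 4).comp (f := fun x : (P × (Fin 3 → ℝ)) × Pt => x.1.2)
        (by fun_prop)).contDiffAt) β)
    refine ContDiffAt.sum fun α _ => ContDiffAt.sum fun β _ => ?_
    exact (((hA α β).comp (f := fun x : (P × (Fin 3 → ℝ)) × Pt => (x.1.1, x.2)) ((p, v.2), v.1)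
      (by fun_prop)).mul (hc α)).mul (hc β)
  have hpd : ∀ α, ContDiffAt ℝ 3 (fun x : P × Ph => pd α (F (Aθ x.1) x.2.2) x.2.1) (p, v) :=
    fun α => (contDiffAt_pd_param (g := fun x : P × (Fin 3 → ℝ) => F (Aθ x.1) x.2) (m := 3) hF
      (by norm_num) α).comp (f := fun x : P × Ph => ((x.1, x.2.2), x.2.1)) (p, v) (by fun_prop)
  refine ContDiffAt.prodMk (contDiffAt_pi.2 fun α => ContDiffAt.sum fun β _ => (hA' α β).mul (hcov β))
    (contDiffAt_pi.2 fun i => contDiffAt_const.mul ((hpd _).sub (ContDiffAt.mul ?_ (hpd _))))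
  fun_prop

theorem contDiffAt_transport_param {Aθ : P → CoefA} {Bθ : P → CoefB n} {p : P} {v : Ph}
    (hA : ∀ α β, ContDiffAt ℝ 4 (fun x : P × Pt => Aθ x.1 x.2 α β) (p, v.1))
    (hB : ∀ r s μ, ContDiffAt ℝ 2 (fun x : P × Pt => Bθ x.1 r s μ x.2) (p, v.1)) :
    ContDiffAt ℝ 2 (fun x : P × Ph => transport (Aθ x.1) (Bθ x.1) x.2) (p, v) := by
  have hcov : ∀ β, ContDiffAt ℝ 2 (fun x : P × Ph => cov x.2.2 β) (p, v) := fun β =>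
    (contDiffAt_pi.1 (((contDiff_cov 2).comp (f := fun x : P × Ph => x.2.2)
      (by fun_prop)).contDiffAt) β)
  have hB' : ∀ r s μ, ContDiffAt ℝ 2 (fun x : P × Ph => Bθ x.1 r s μ x.2.1) (p, v) :=
    fun r s μ => (hB r s μ).comp (f := fun x : P × Ph => (x.1, x.2.1)) (p, v) (by fun_prop)
  have hpd : ∀ μ α β, ContDiffAt ℝ 2 (fun x : P × Ph => pd μ (fun y => Aθ x.1 y α β) x.2.1) (p, v) :=
    fun μ α β => (contDiffAt_pd_param (g := fun (p : P) y => Aθ p y α β) (m := 2) (hA α β)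
      (by norm_num) μ).comp (f := fun x : P × Ph => (x.1, x.2.1)) (p, v) (by fun_prop)
  refine contDiffAt_pi.2 fun r => contDiffAt_pi.2 fun t => ContDiffAt.add (contDiffAt_const.mul
    (ContDiffAt.sum fun α _ => (hB' _ _ _).mul (hcov α))) ?_
  split_ifs
  · refine contDiffAt_const.mul (ContDiffAt.sum fun i _ => ContDiffAt.sum fun β _ =>
      (hcov β).mul ((hpd _ _ _).sub (ContDiffAt.mul ?_ (hpd _ _ _))))
    fun_prop
  · exact contDiffAt_const

/-- The coefficients are of class `C⁴` (`A`) and `C²` (`B`) in the open set `Ω`, with symmetric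
`A`. -/
structure SmoothCoef (A : CoefA) (B : CoefB n) (Ω : Set Pt) : Prop where
  isOpen : IsOpen Ω
  symm : ∀ y ∈ Ω, ∀ α β, A y α β = A y β α
  smoothA : ∀ y ∈ Ω, ∀ α β, ContDiffAt ℝ 4 (fun y => A y α β) y
  smoothB : ∀ y ∈ Ω, ∀ r s μ, ContDiffAt ℝ 2 (B r s μ) y

variable {A : CoefA} {B : CoefB n} {Ω : Set Pt}

theorem SmoothCoef.bichar (h : SmoothCoef A B Ω) {v : Ph} (hv : v.1 ∈ Ω) :
    ContDiffAt ℝ 3 (bichar A) v :=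
  (contDiffAt_bichar_param (P := ℝ) (Aθ := fun _ => A) (p := 0) (v := v) fun α β =>
    (h.smoothA _ hv α β).comp (f := Prod.snd) (0, v.1) contDiffAt_snd).comp
      (f := fun v : Ph => ((0 : ℝ), v)) v (by fun_prop)

theorem SmoothCoef.transport (h : SmoothCoef A B Ω) {v : Ph} (hv : v.1 ∈ Ω) :
    ContDiffAt ℝ 2 (transport A B) v :=
  (contDiffAt_transport_param (P := ℝ) (Aθ := fun _ => A) (Bθ := fun _ => B) (p := 0) (v := v)
    (fun α β => (h.smoothA _ hv α β).comp (f := Prod.snd) (0, v.1) contDiffAt_snd)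
    (fun r s μ => (h.smoothB _ hv r s μ).comp (f := Prod.snd) (0, v.1) contDiffAt_snd)).comp
      (f := fun v : Ph => ((0 : ℝ), v)) v (by fun_prop)

theorem SmoothCoef.elow (h : SmoothCoef A B Ω) {Z : ZVal n} (hv : Z.1.1.1 ∈ Ω) :
    ContDiffAt ℝ 1 (elow A B) Z :=
  contDiffAt_elow (h.bichar hv) (h.transport hv)

theorem SmoothCoef.efull (h : SmoothCoef A B Ω) {Z : ZVal n} (hv : Z.1.1.1 ∈ Ω) :
    ContinuousAt (efull A B) Z :=
  ContinuousAt.comp (f := fun Z : ZVal n => ((0 : ℝ), Z))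
    (g := fun x : ℝ × ZVal n => KirchhoffConoid.efull A B x.2)
    (continuousAt_efull_param (P := ℝ) (Aθ := fun _ => A) (Bθ := fun _ => B) (p := 0) (Z := Z)
      ((h.bichar hv).comp (f := Prod.snd) (0, Z.1.1) contDiffAt_snd)
      ((h.transport hv).comp (f := Prod.snd) (0, Z.1.1) contDiffAt_snd)) (by fun_prop)

end Smoothness


section FrameLemmas

/-- The Minkowski form. -/
def mink (α β : Fin 4) : ℝ := if α = β then (if α = 3 then 1 else -1) else 0

/-- Hyperbolicity of the quadratic form `A₀` with `x⁴` temporal. -/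
structure Hyperbolic (A₀ : Fin 4 → Fin 4 → ℝ) : Prop where
  symm : ∀ α β, A₀ α β = A₀ β α
  temporal : 0 < A₀ 3 3
  spatial : ∀ ξ : Fin 3 → ℝ, ξ ≠ 0 →
    (∑ i : Fin 3, ∑ j : Fin 3, A₀ i.castSucc j.castSucc * ξ i * ξ j) < 0

theorem eq_zero_of_quadratic_eq_zero {M : Fin 4 → Fin 4 → ℝ} (hs : ∀ l m, M l m = M m l)
    (h : ∀ ξ : Fin 4 → ℝ, ∑ l, ∑ m, M l m * ξ l * ξ m = 0) (l m : Fin 4) : M l m = 0 := by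
  have h1 : ∀ l, M l l = 0 := fun l => by simpa [Pi.single_apply] using h (Pi.single l 1)
  have h2 := h (Pi.single l 1 + Pi.single m 1)
  simp only [Pi.add_apply, mul_add, add_mul, Finset.sum_add_distrib] at h2
  simp [Pi.single_apply, h1] at h2
  have := hs l m
  linarith

variable {A₀ : Fin 4 → Fin 4 → ℝ} {a : Matrix (Fin 4) (Fin 4) ℝ}

theorem IsFrame.entries (hA : ∀ l m, A₀ l m = A₀ m l) (h : IsFrame A₀ a) (l m : Fin 4) :
    A₀ l m = a 3 l * a 3 m - ∑ i : Fin 3, a i.castSucc l * a i.castSucc m := by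
  rw [← sub_eq_zero]
  refine eq_zero_of_quadratic_eq_zero
    (M := fun l m => A₀ l m - (a 3 l * a 3 m - ∑ i : Fin 3, a i.castSucc l * a i.castSucc m))
    (fun l m => ?_) (fun ξ => ?_) l m
  · simp only [hA l m, mul_comm]
  · have := h.reduces ξ
    simp only [Fin.sum_univ_four, Fin.sum_univ_three] at this ⊢
    linear_combination this

theorem IsFrame.det_ne_zero (hA : Hyperbolic A₀) (h : IsFrame A₀ a) : a.det ≠ 0 := by
  intro h0
  obtain ⟨ξ, hξ, hz⟩ := Matrix.exists_mulVec_eq_zero_iff.2 h0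
  have hz' : ∀ α, ∑ β, a α β * ξ β = 0 := fun α => congrFun hz α
  set ζ : Fin 3 → ℝ := fun i => ξ i.castSucc with hζ
  have hi : ∀ i : Fin 3, ∑ j : Fin 3, a i.castSucc j.castSucc * ζ j = 0 := fun i => by
    have := hz' i.castSucc
    rw [sum_four, h.adapted] at this
    simpa using this
  have hζ0 : ζ = 0 := by
    by_contra hne
    have h1 := hA.spatial ζ hne
    have h2 := h.reduces (Fin.snoc ζ 0)
    have e1 : ∀ i : Fin 3, (Fin.snoc ζ 0 : Fin 4 → ℝ) i.castSucc = ζ i :=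
      fun i => Fin.snoc_castSucc (α := fun _ => ℝ) _ _ i
    have e2 : (Fin.snoc ζ 0 : Fin 4 → ℝ) 3 = 0 := Fin.snoc_last (α := fun _ => ℝ) _ _
    simp only [sum_four, e1, e2, mul_zero, zero_mul, Finset.sum_const_zero, add_zero, hi] at h2
    rw [h2] at h1
    have := sq_nonneg (∑ x : Fin 3, a 3 x.castSucc * ζ x)
    simp at h1
    linarith
  have h3 : ξ 3 = 0 := by
    have := hz' 3
    rw [sum_four] at this
    have e : ∀ i : Fin 3, ξ i.castSucc = 0 := fun i => congrFun hζ0 i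
    simp only [e, mul_zero, Finset.sum_const_zero, zero_add] at this
    exact (mul_eq_zero.1 this).resolve_left h.pos.ne'
  apply hξ
  funext β
  induction β using Fin.lastCases with
  | last => exact h3
  | cast i => exact congrFun hζ0 i

theorem sum_frame_inv (ha : a.det ≠ 0) (γ α : Fin 4) :
    ∑ l, a γ l * inv a α l = if γ = α then 1 else 0 := by
  have := congrFun (congrFun (Matrix.mul_nonsing_inv a (isUnit_iff_ne_zero.2 ha)) γ) α
  rw [Matrix.mul_apply, Matrix.one_apply] at this
  exact this

theorem sum_frame_inv' (ha : a.det ≠ 0) (β γ : Fin 4) :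
    ∑ α, a α β * inv a α γ = if β = γ then 1 else 0 := by
  have := congrFun (congrFun (Matrix.nonsing_inv_mul a (isUnit_iff_ne_zero.2 ha)) γ) β
  rw [Matrix.mul_apply, Matrix.one_apply] at this
  simp only [eq_comm (a := β)]
  rw [← this]
  exact Finset.sum_congr rfl fun α _ => mul_comm _ _

theorem toX_toY (ha : a.det ≠ 0) (x : Pt) : toX a (toY a x) = x := by
  funext β
  simp only [toX, toY, Finset.mul_sum]
  rw [Finset.sum_comm]
  simp only [← mul_assoc, ← Finset.sum_mul, sum_frame_inv' ha]
  simp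

theorem IsFrame.toX_three (h : IsFrame A₀ a) (y : Pt) : toX a y 3 = a 3 3 * y 3 := by
  simp [toX, sum_four, h.adapted]

theorem IsFrame.mul_inv (h : IsFrame A₀ a) (ha : a.det ≠ 0) : a 3 3 * inv a 3 3 = 1 := by
  simpa [sum_four, h.adapted] using sum_frame_inv' ha 3 3

theorem IsFrame.vertex (hA : Hyperbolic A₀) (h : IsFrame A₀ a) (α β : Fin 4) :
    ∑ l, ∑ m, A₀ l m * inv a α l * inv a β m = mink α β := by
  have ha := h.det_ne_zero hA
  have e := sum_frame_inv ha
  have h1 : ∑ l, ∑ m, A₀ l m * inv a α l * inv a β m =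
      (∑ l, a 3 l * inv a α l) * (∑ m, a 3 m * inv a β m)
        - ∑ i : Fin 3, (∑ l, a i.castSucc l * inv a α l) * (∑ m, a i.castSucc m * inv a β m) := by
    simp only [h.entries hA.symm]
    simp only [Fin.sum_univ_four, Fin.sum_univ_three]
    ring
  rw [h1]
  simp only [e]
  unfold mink
  have c0 : Fin.castSucc (0 : Fin 3) = (0 : Fin 4) := rfl
  have c1 : Fin.castSucc (1 : Fin 3) = (1 : Fin 4) := rfl
  have c2 : Fin.castSucc (2 : Fin 3) = (2 : Fin 4) := rfl
  simp only [Fin.sum_univ_three, c0, c1, c2]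
  fin_cases α <;> fin_cases β <;> simp

open scoped MatrixOrder Matrix.Norms.L2Operator in
theorem exists_conjTranspose_mul_self {S : Matrix (Fin 3) (Fin 3) ℝ} (hS : S.PosSemidef) :
    ∃ N : Matrix (Fin 3) (Fin 3) ℝ, S = N.conjTranspose * N :=
  CStarAlgebra.nonneg_iff_eq_star_mul_self.mp hS.nonneg

theorem exists_isFrame (hA : Hyperbolic A₀) : ∃ a, IsFrame A₀ a := by
  set c := Real.sqrt (A₀ 3 3) with hc
  have hc0 : 0 < c := Real.sqrt_pos.2 hA.temporal
  have hcc : c * c = A₀ 3 3 := Real.mul_self_sqrt hA.temporal.le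
  set S : Matrix (Fin 3) (Fin 3) ℝ := Matrix.of fun i j =>
    A₀ 3 i.castSucc * A₀ 3 j.castSucc / A₀ 3 3 - A₀ i.castSucc j.castSucc with hS
  have hquad : ∀ ξ : Fin 3 → ℝ, ξ ⬝ᵥ (S.mulVec ξ) = (∑ i, A₀ 3 i.castSucc * ξ i) ^ 2 / A₀ 3 3
      - ∑ i : Fin 3, ∑ j : Fin 3, A₀ i.castSucc j.castSucc * ξ i * ξ j := by
    intro ξ
    simp only [hS, dotProduct, Matrix.mulVec, Matrix.of_apply, Fin.sum_univ_three]
    ring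
  have hpos : S.PosSemidef := by
    refine Matrix.PosSemidef.of_dotProduct_mulVec_nonneg ?_ fun ξ => ?_
    · ext i j
      simp only [Matrix.conjTranspose_apply, hS, Matrix.of_apply, star_trivial]
      rw [hA.symm i.castSucc, mul_comm]
    · simp only [star_trivial]
      rw [hquad]
      rcases eq_or_ne ξ 0 with rfl | hne
      · simp
      · have h1 := hA.spatial ξ hne
        have h2 := div_nonneg (sq_nonneg (∑ i, A₀ 3 i.castSucc * ξ i)) hA.temporal.le
        linarith
  obtain ⟨N, hN⟩ := exists_conjTranspose_mul_self hpos
  let a : Fin 4 → Fin 4 → ℝ := Fin.snoc (α := fun _ => Fin 4 → ℝ)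
    (fun i : Fin 3 => Fin.snoc (α := fun _ => ℝ) (N i) 0) (fun β => A₀ 3 β / c)
  have a1 : ∀ i : Fin 3, a i.castSucc = Fin.snoc (α := fun _ => ℝ) (N i) 0 := fun i =>
    Fin.snoc_castSucc (α := fun _ => Fin 4 → ℝ) _ _ i
  have a2 : a 3 = fun β => A₀ 3 β / c := Fin.snoc_last (α := fun _ => Fin 4 → ℝ) _ _
  have a3 : ∀ i j : Fin 3, a i.castSucc j.castSucc = N i j := fun i j => by
    rw [a1]; exact Fin.snoc_castSucc (α := fun _ => ℝ) _ _ j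
  have a4 : ∀ i : Fin 3, a i.castSucc 3 = 0 := fun i => by
    rw [a1]; exact Fin.snoc_last (α := fun _ => ℝ) _ _
  refine ⟨Matrix.of a, ?_, a4, ?_⟩
  all_goals simp only [Matrix.of_apply]
  · intro ξ
    have h1 := hquad fun i => ξ i.castSucc
    have h2 : (fun i : Fin 3 => ξ i.castSucc) ⬝ᵥ (S.mulVec fun i => ξ i.castSucc) =
        ∑ i : Fin 3, (∑ j : Fin 3, N i j * ξ j.castSucc) ^ 2 := by
      rw [hN]
      simp only [dotProduct, Matrix.mulVec, Matrix.mul_apply, Matrix.conjTranspose_apply,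
        star_trivial, Fin.sum_univ_three]
      ring
    rw [h2] at h1
    have h3 : (∑ β, A₀ 3 β / c * ξ β) ^ 2 =
        (∑ i : Fin 3, A₀ 3 i.castSucc * ξ i.castSucc + A₀ 3 3 * ξ 3) ^ 2 / A₀ 3 3 := by
      rw [← hcc]
      rw [show (∑ β, A₀ 3 β / c * ξ β) =
        (∑ i : Fin 3, A₀ 3 i.castSucc * ξ i.castSucc + A₀ 3 3 * ξ 3) / c by
          simp only [sum_four, Fin.sum_univ_three]; ring, div_pow, sq c, hcc]
    have h4 : ∀ i : Fin 3, ∑ α, a i.castSucc α * ξ α = ∑ j : Fin 3, N i j * ξ j.castSucc :=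
      fun i => by simp only [sum_four (fun α => a i.castSucc α * ξ α), a3, a4, zero_mul, add_zero]
    simp only [h4, a2]
    rw [h3, h1]
    have hne : A₀ 3 3 ≠ 0 := hA.temporal.ne'
    simp only [sum_four, Fin.sum_univ_three]
    field_simp
    rw [hA.symm (Fin.castSucc 0) 3, hA.symm (Fin.castSucc 1) 3, hA.symm (Fin.castSucc 2) 3]
    ring
  · rw [a2]
    exact div_pos hA.temporal hc0

/-- The entries of a frame are bounded in terms of the form. -/
theorem IsFrame.sq_le (hA : ∀ l m, A₀ l m = A₀ m l) (h : IsFrame A₀ a) {M m : ℝ} (hm : 0 < m)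
    (hmA : m ≤ A₀ 3 3) (hM : ∀ α β, |A₀ α β| ≤ M) (α β : Fin 4) :
    a α β ^ 2 ≤ M ^ 2 / m + M := by
  have hM0 : 0 ≤ M := (abs_nonneg _).trans (hM 0 0)
  have e33 : A₀ 3 3 = a 3 3 ^ 2 := by
    have := h.entries hA 3 3
    simp only [h.adapted, mul_zero, Finset.sum_const_zero, sub_zero] at this
    rw [this, sq]
  have e3 : ∀ β, A₀ 3 β = a 3 3 * a 3 β := fun β => by
    have := h.entries hA 3 β
    simpa only [h.adapted, zero_mul, Finset.sum_const_zero, sub_zero] using this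
  have b3 : ∀ β, a 3 β ^ 2 ≤ M ^ 2 / m := fun β => by
    rw [le_div_iff₀ hm]
    have h1 : a 3 β ^ 2 * A₀ 3 3 = A₀ 3 β ^ 2 := by rw [e3 β, e33]; ring
    have h2 : A₀ 3 β ^ 2 ≤ M ^ 2 := sq_le_sq' (abs_le.1 (hM 3 β)).1 (abs_le.1 (hM 3 β)).2
    nlinarith [sq_nonneg (a 3 β)]
  induction α using Fin.lastCases with
  | last => exact (b3 β).trans (by linarith)
  | cast i =>
    have h1 := h.entries hA β β
    have h2 : a i.castSucc β * a i.castSucc β ≤ ∑ i : Fin 3, a i.castSucc β * a i.castSucc β :=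
      Finset.single_le_sum (f := fun i : Fin 3 => a i.castSucc β * a i.castSucc β)
        (fun i _ => mul_self_nonneg _) (Finset.mem_univ i)
    have h3 := (abs_le.1 (hM β β)).1
    have h4 := b3 β
    nlinarith

/-- The frames at the points of a compact set form a compact set. -/
theorem isCompact_frames {A : CoefA} {D : Set Pt} (hD : IsCompact D)
    (hA : ∀ α β, ContinuousOn (fun x => A x α β) D) (hyp : ∀ x ∈ D, Hyperbolic (A x)) :
    IsCompact {z : Pt × (Fin 4 → Fin 4 → ℝ) | z.1 ∈ D ∧ IsFrame (A z.1) (Matrix.of z.2)} := by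
  rcases D.eq_empty_or_nonempty with rfl | hne
  · simp
  obtain ⟨x₁, hx₁, hmin⟩ := hD.exists_isMinOn hne (hA 3 3)
  have hm := (hyp x₁ hx₁).temporal
  have hbd : ∀ α β, ∃ C, ∀ x ∈ D, |A x α β| ≤ C := fun α β =>
    hD.exists_bound_of_continuousOn (hA α β)
  choose C hC using hbd
  set M := ∑ α, ∑ β, |C α β| with hM
  have hMb : ∀ x ∈ D, ∀ α β, |A x α β| ≤ M := fun x hx α β =>
    ((hC α β x hx).trans (le_abs_self _)).trans <|
      (Finset.single_le_sum (f := fun β => |C α β|) (fun _ _ => abs_nonneg _)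
        (Finset.mem_univ β)).trans <|
      Finset.single_le_sum (f := fun α => ∑ β, |C α β|)
        (fun _ _ => Finset.sum_nonneg fun _ _ => abs_nonneg _) (Finset.mem_univ α)
  set R := Real.sqrt (M ^ 2 / A x₁ 3 3 + M) with hR
  have hR0 : 0 ≤ R := Real.sqrt_nonneg _
  have hK : IsCompact (D ×ˢ Metric.closedBall (0 : Fin 4 → Fin 4 → ℝ) R) :=
    hD.prod (isCompact_closedBall _ _)
  have heq : {z : Pt × (Fin 4 → Fin 4 → ℝ) | z.1 ∈ D ∧ IsFrame (A z.1) (Matrix.of z.2)} =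
      (D ×ˢ Metric.closedBall (0 : Fin 4 → Fin 4 → ℝ) R) ∩ {z | 0 ≤ z.2 3 3} ∩
        {z | ∀ i : Fin 3, z.2 i.castSucc 3 = 0} ∩
        ⋂ ξ : Fin 4 → ℝ, (D ×ˢ Metric.closedBall (0 : Fin 4 → Fin 4 → ℝ) R) ∩
          (fun z : Pt × (Fin 4 → Fin 4 → ℝ) => (∑ l, ∑ m, A z.1 l m * ξ l * ξ m) -
            ((∑ α, z.2 3 α * ξ α) ^ 2 - ∑ i : Fin 3, (∑ α, z.2 i.castSucc α * ξ α) ^ 2)) ⁻¹' {0} := by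
    ext ⟨x, a⟩
    simp only [Set.mem_ofPred_eq, Set.mem_inter_iff, Set.mem_prod, Set.mem_iInter, Set.mem_preimage,
      Set.mem_singleton_iff, sub_eq_zero]
    constructor
    · rintro ⟨hx, hf⟩
      have hb : a ∈ Metric.closedBall (0 : Fin 4 → Fin 4 → ℝ) R := by
        rw [mem_closedBall_zero_iff, pi_norm_le_iff_of_nonneg hR0]
        intro α
        rw [pi_norm_le_iff_of_nonneg hR0]
        intro β
        exact Real.abs_le_sqrt (hf.sq_le (hyp x hx).symm hm (hmin hx) (hMb x hx) α β)
      exact ⟨⟨⟨⟨hx, hb⟩, hf.pos.le⟩, hf.adapted⟩, fun ξ => ⟨⟨hx, hb⟩, hf.reduces ξ⟩⟩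
    · rintro ⟨⟨⟨⟨hx, hb⟩, hp⟩, had⟩, hred⟩
      refine ⟨hx, fun ξ => (hred ξ).2, had, hp.lt_of_ne fun h0 => ?_⟩
      have h1 := (hred (Pi.single 3 1)).2
      simp [Pi.single_apply, had, ← h0] at h1
      exact (hyp x hx).temporal.ne' h1
  rw [heq]
  refine IsCompact.of_isClosed_subset hK ?_ fun z hz => hz.1.1.1
  refine IsClosed.inter (IsClosed.inter (IsClosed.inter hK.isClosed ?_) ?_) ?_
  · exact isClosed_le continuous_const (by fun_prop)
  · rw [Set.ofPred_forall]
    exact isClosed_iInter fun i => isClosed_eq (by fun_prop) continuous_const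
  · refine isClosed_iInter fun ξ => ContinuousOn.preimage_isClosed_of_isClosed ?_ hK.isClosed
      isClosed_singleton
    refine ContinuousOn.sub (continuousOn_finsetSum _ fun l _ => continuousOn_finsetSum _
      fun m _ => ((ContinuousOn.mul ?_ continuousOn_const).mul continuousOn_const))
      (Continuous.continuousOn (by fun_prop))
    exact (hA l m).comp continuousOn_fst fun z hz => hz.1

theorem continuousOn_inv {S : Set (Fin 4 → Fin 4 → ℝ)} (hS : ∀ a ∈ S, (Matrix.of a).det ≠ 0) :
    ContinuousOn (fun a : Fin 4 → Fin 4 → ℝ => (inv (Matrix.of a) : Fin 4 → Fin 4 → ℝ)) S := by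
  have hc : Continuous fun a : Fin 4 → Fin 4 → ℝ => Matrix.of a := by
    exact continuous_id
  refine continuousOn_pi.2 fun α => continuousOn_pi.2 fun β => ?_
  have : ∀ a : Fin 4 → Fin 4 → ℝ, inv (Matrix.of a) α β =
      ((Matrix.of a).det)⁻¹ * (Matrix.of a).adjugate β α := fun a => by
    simp [inv, Matrix.inv_def, Ring.inverse_eq_inv']
  simp only [this]
  refine ContinuousOn.mul (ContinuousOn.inv₀ hc.matrix_det.continuousOn hS) ?_
  exact (hc.matrix_adjugate.matrix_elem β α).continuousOn

end FrameLemmas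


section ExplicitDerivatives

theorem fderiv_apply_eq_sum_pd (g : Pt → ℝ) (x w : Pt) : fderiv ℝ g x w = ∑ μ, pd μ g x * w μ := by
  have : w = ∑ μ, w μ • (Pi.single μ (1 : ℝ) : Pt) := by
    funext β; simp [Pi.single_apply]
  conv_lhs => rw [this, map_sum]
  exact Finset.sum_congr rfl fun μ _ => by rw [map_smul, smul_eq_mul, mul_comm]; rfl

/-- The covector `(w₁, w₂, w₃, 0)`. -/
def dcov (w : Fin 3 → ℝ) : Fin 4 → ℝ := Fin.snoc w 0

theorem dcov_castSucc (w : Fin 3 → ℝ) (i : Fin 3) : dcov w i.castSucc = w i := by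
  unfold dcov; exact Fin.snoc_castSucc (α := fun _ => ℝ) _ _ i

theorem dcov_three (w : Fin 3 → ℝ) : dcov w 3 = 0 := by
  unfold dcov; exact Fin.snoc_last (α := fun _ => ℝ) _ _

theorem hasDerivAt_cov {γ : ℝ → Fin 3 → ℝ} {γ' : Fin 3 → ℝ} {t : ℝ} (h : HasDerivAt γ γ' t)
    (β : Fin 4) : HasDerivAt (fun t => cov (γ t) β) (dcov γ' β) t := by
  induction β using Fin.lastCases with
  | last =>
    rw [show (fun t => cov (γ t) (Fin.last 3)) = fun _ => (1 : ℝ) from funext fun t => cov_three _,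
      show dcov γ' (Fin.last 3) = 0 from dcov_three _]
    exact hasDerivAt_const _ _
  | cast i =>
    rw [show (fun t => cov (γ t) i.castSucc) = fun t => γ t i from funext fun t => cov_castSucc _ i,
      dcov_castSucc]
    exact hasDerivAt_pi.1 h i

theorem hasDerivAt_comp_pd {g : Pt → ℝ} {γ : ℝ → Pt} {γ' : Pt} {t : ℝ}
    (hg : DifferentiableAt ℝ g (γ t)) (h : HasDerivAt γ γ' t) :
    HasDerivAt (fun t => g (γ t)) (∑ μ, pd μ g (γ t) * γ' μ) t := by
  rw [← fderiv_apply_eq_sum_pd]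
  exact hg.hasFDerivAt.comp_hasDerivAt t h

/-- The differential of `T^α` in the direction `w`. -/
noncomputable def dT (A : CoefA) (v w : Ph) (α : Fin 4) : ℝ :=
  ∑ β, ((∑ μ, pd μ (fun y => A y α β) v.1 * w.1 μ) * cov v.2 β + A v.1 α β * dcov w.2 β)

theorem hasDerivAt_T {A : CoefA} {γ : ℝ → Ph} {γ' : Ph} {t : ℝ}
    (hA : ∀ α β, DifferentiableAt ℝ (fun y => A y α β) (γ t).1) (h : HasDerivAt γ γ' t)
    (α : Fin 4) : HasDerivAt (fun t => T A (γ t) α) (dT A (γ t) γ' α) t := by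
  have h1 := h.fst
  have h2 := h.snd
  exact HasDerivAt.fun_sum fun β _ =>
    (hasDerivAt_comp_pd (γ := fun t => (γ t).1) (hA α β) h1).mul (hasDerivAt_cov h2 β)

variable {n : ℕ} {A : CoefA} {B : CoefB n} {Ω : Set Pt}

theorem SmoothCoef.differentiableAt (h : SmoothCoef A B Ω) {y : Pt} (hy : y ∈ Ω) (α β : Fin 4) :
    DifferentiableAt ℝ (fun y => A y α β) y :=
  (h.smoothA y hy α β).differentiableAt four_ne_zero

theorem SmoothCoef.contDiffAt_T (h : SmoothCoef A B Ω) {v : Ph} (hv : v.1 ∈ Ω) (α : Fin 4) :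
    ContDiffAt ℝ 3 (fun v => T A v α) v :=
  contDiffAt_pi.1 (contDiffAt_fst.comp v (h.bichar hv)) α

theorem fderiv_bichar_apply {v : Ph} (hb : DifferentiableAt ℝ (bichar A) v)
    (hA : ∀ α β, DifferentiableAt ℝ (fun y => A y α β) v.1) (w : Ph)
    (α : Fin 4) : (fderiv ℝ (bichar A) v w).1 α = dT A v w α := by
  have hl : HasDerivAt (fun ε : ℝ => v + ε • w) w 0 := by
    simpa using ((hasDerivAt_id (0 : ℝ)).smul_const w).const_add v
  have h0 : v + (0 : ℝ) • w = v := by simp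
  have h1 := hasDerivAt_T (A := A) (γ := fun ε : ℝ => v + ε • w) (γ' := w) (t := 0)
    (fun α β => by simpa only [h0] using hA α β) hl α
  have h2 : HasFDerivAt (bichar A) (fderiv ℝ (bichar A) v)
      (v + (0 : ℝ) • w) := by
    rw [h0]; exact hb.hasFDerivAt
  have h4 := h2.comp_hasDerivAt (0 : ℝ) hl
  have h3 := hasDerivAt_pi.1 h4.fst α
  simp only [h0] at h1
  exact h3.unique h1

theorem SmoothCoef.fderiv_bichar (h : SmoothCoef A B Ω) {v : Ph} (hv : v.1 ∈ Ω) (w : Ph)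
    (α : Fin 4) : (fderiv ℝ (KirchhoffConoid.bichar A) v w).1 α = dT A v w α :=
  fderiv_bichar_apply ((h.bichar hv).differentiableAt three_ne_zero)
    (fun α β => h.differentiableAt hv α β) w α

theorem SmoothCoef.fderiv_T (h : SmoothCoef A B Ω) {v : Ph} (hv : v.1 ∈ Ω) (w : Ph)
    (α : Fin 4) : fderiv ℝ (fun v => T A v α) v w = dT A v w α := by
  rw [← h.fderiv_bichar hv]
  have h2 := ((h.bichar hv).differentiableAt three_ne_zero).hasFDerivAt
  have := (hasFDerivAt_pi'.1 (h2.fst)) α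
  rw [show (fun v => T A v α) = fun v => (KirchhoffConoid.bichar A v).1 α from rfl,
    HasFDerivAt.fderiv this]
  rfl

theorem norm_mmul_le (P w : Mat n) : ‖mmul P w‖ ≤ n * ‖P‖ * ‖w‖ := by
  have h0 : 0 ≤ n * ‖P‖ * ‖w‖ := by positivity
  refine (pi_norm_le_iff_of_nonneg h0).2 fun r => (pi_norm_le_iff_of_nonneg h0).2 fun s => ?_
  refine (norm_sum_le _ _).trans ?_
  have : ∀ t ∈ Finset.univ, ‖P r t * w t s‖ ≤ ‖P‖ * ‖w‖ := fun t _ => by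
    rw [norm_mul]
    gcongr
    · exact (norm_le_pi_norm (P r) t).trans (norm_le_pi_norm P r)
    · exact (norm_le_pi_norm (w t) s).trans (norm_le_pi_norm w t)
  refine (Finset.sum_le_card_nsmul _ _ _ this).trans ?_
  simp [mul_assoc]

theorem mmul_sub_right (P w w' : Mat n) : mmul P w - mmul P w' = mmul P (w - w') := by
  funext r s; simp [mmul, mul_sub, Finset.sum_sub_distrib]

theorem norm_efull_sub_le (A : CoefA) (B : CoefB n) {Z Z' : ZVal n} (h : tr Z = tr Z') :
    ‖efull A B Z - efull A B Z'‖ ≤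
      (‖fderiv ℝ (bichar A) Z.1.1‖ + n * ‖transport A B Z.1.1‖) * ‖Z - Z'‖ := by
  obtain ⟨⟨v, v₁, v₂, v₃⟩, ⟨w, w₁, w₂⟩⟩ := Z
  obtain ⟨⟨v', v₁', v₂', v₃'⟩, ⟨w', w₁', w₂'⟩⟩ := Z'
  simp only [tr, ContinuousLinearMap.coe_mk', LinearMap.coe_mk, AddHom.coe_mk, Prod.mk.injEq,
    and_true] at h
  obtain ⟨⟨rfl, rfl, rfl⟩, rfl, rfl⟩ := h
  have e : efull A B ((v, v₁, v₂, v₃), w, w₁, w₂) - efull A B ((v, v₁, v₂, v₃'), w, w₁, w₂') =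
      ((0, 0, 0, fun j h k => fderiv ℝ (bichar A) v ((v₃ - v₃') j h k)),
        (0, 0, fun j h => mmul (transport A B v) ((w₂ - w₂') j h))) := by
    refine Prod.ext (Prod.ext (sub_self _) (Prod.ext (sub_self _) (Prod.ext (sub_self _) ?_)))
      (Prod.ext (sub_self _) (Prod.ext (sub_self _) ?_))
    · funext j h k
      show (_ + fderiv ℝ (bichar A) v (v₃ j h k)) - (_ + fderiv ℝ (bichar A) v (v₃' j h k)) = _
      rw [add_sub_add_left_eq_sub, ← map_sub]; rfl
    · funext j h
      show (_ + mmul (transport A B v) (w₂ j h)) - (_ + mmul (transport A B v) (w₂' j h)) = _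
      rw [add_sub_add_left_eq_sub, mmul_sub_right]; rfl
  rw [e]
  set c := ‖fderiv ℝ (bichar A) v‖ + n * ‖transport A B v‖ with hc
  have hc1 : ‖fderiv ℝ (bichar A) v‖ ≤ c := le_add_of_nonneg_right (by positivity)
  have hc2 : n * ‖transport A B v‖ ≤ c := le_add_of_nonneg_left (by positivity)
  have hc0 : 0 ≤ c := by positivity
  set N := ‖(((v, v₁, v₂, v₃), w, w₁, w₂) : ZVal n) - ((v, v₁, v₂, v₃'), w, w₁, w₂')‖ with hN
  have hN0 : 0 ≤ N := norm_nonneg _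
  have hn1 : ‖v₃ - v₃'‖ ≤ N :=
    (norm_snd_le (v₂ - v₂, v₃ - v₃')).trans ((norm_snd_le (v₁ - v₁, v₂ - v₂, v₃ - v₃')).trans
      ((norm_snd_le (v - v, v₁ - v₁, v₂ - v₂, v₃ - v₃')).trans
        (norm_fst_le ((v - v, v₁ - v₁, v₂ - v₂, v₃ - v₃'), (w - w, w₁ - w₁, w₂ - w₂')))))
  have hn2 : ‖w₂ - w₂'‖ ≤ N :=
    (norm_snd_le (w₁ - w₁, w₂ - w₂')).trans ((norm_snd_le (w - w, w₁ - w₁, w₂ - w₂')).trans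
        (norm_snd_le ((v - v, v₁ - v₁, v₂ - v₂, v₃ - v₃'), (w - w, w₁ - w₁, w₂ - w₂'))))
  have hcN : 0 ≤ c * N := mul_nonneg hc0 hN0
  have k1 : ‖fun j h k => fderiv ℝ (bichar A) v ((v₃ - v₃') j h k)‖ ≤ c * N := by
    refine (pi_norm_le_iff_of_nonneg hcN).2 fun j => (pi_norm_le_iff_of_nonneg hcN).2 fun h =>
      (pi_norm_le_iff_of_nonneg hcN).2 fun k => (ContinuousLinearMap.le_opNorm _ _).trans ?_
    gcongr
    exact (norm_le_pi_norm _ k).trans ((norm_le_pi_norm _ h).trans ((norm_le_pi_norm _ j).trans hn1))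
  have k2 : ‖fun j h => mmul (transport A B v) ((w₂ - w₂') j h)‖ ≤ c * N := by
    refine (pi_norm_le_iff_of_nonneg hcN).2 fun j => (pi_norm_le_iff_of_nonneg hcN).2 fun h =>
      (norm_mmul_le _ _).trans ?_
    gcongr
    exact (norm_le_pi_norm _ h).trans ((norm_le_pi_norm _ j).trans hn2)
  simp only [Prod.norm_mk, norm_zero, max_le_iff]
  exact ⟨⟨hcN, hcN, hcN, k1⟩, hcN, hcN, k2⟩

end ExplicitDerivatives


section FlowFamily

open Set Metric NNReal

variable {n : ℕ}

set_option synthInstance.maxHeartbeats 200000 in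
instance : ProperSpace (ZVal n) := inferInstance

set_option synthInstance.maxHeartbeats 200000 in
instance : CompleteSpace (ZVal n) := inferInstance

theorem eqOn_of_hasDerivWithinAt_eq {Z : Type*} [NormedAddCommGroup Z] [NormedSpace ℝ Z]
    {f g f' : ℝ → Z} {ε : ℝ} (hf : ∀ t ∈ Icc 0 ε, HasDerivWithinAt f (f' t) (Icc 0 ε) t)
    (hg : ∀ t ∈ Icc 0 ε, HasDerivWithinAt g (f' t) (Icc 0 ε) t) (h0 : f 0 = g 0) :
    EqOn f g (Icc 0 ε) := by
  intro t ht
  have := eq_zero_of_abs_deriv_le_mul_abs_self_of_eq_zero_right (K := 0) (a := 0) (b := ε)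
    (f := fun t => f t - g t) (f' := fun t => f' t - f' t)
    (fun t ht => ((hf t ht).sub (hg t ht)).continuousWithinAt)
    (fun t ht => ((hf t (Ico_subset_Icc_self ht)).sub (hg t (Ico_subset_Icc_self ht))).Ici_of_Icc ht)
    (sub_eq_zero.2 h0) (fun t _ => by simp) t ht
  exact sub_eq_zero.1 this

theorem tr_initial (y₀ : Pt) (q : Fin 3 → ℝ) : tr (X0 y₀ q, W0 n) = (X0 y₀ q, W0 n) := rfl

variable {P : Type*} [TopologicalSpace P] {Θ : Type*} [NormedAddCommGroup Θ] [NormedSpace ℝ Θ]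

/-- The common hypotheses on a family of coefficients and initial data. -/
structure IsFlowFamily (Aθ : Θ → CoefA) (Bθ : Θ → CoefB n) (O₁ : Set (Θ × Pt)) (θ : P → Θ)
    (y₀ : P → Pt) (q : P → Fin 3 → ℝ) (κ : P → ℝ) : Prop where
  isOpen : IsOpen O₁
  smoothA : ∀ x ∈ O₁, ∀ α β, ContDiffAt ℝ 4 (fun x : Θ × Pt => Aθ x.1 x.2 α β) x
  smoothB : ∀ x ∈ O₁, ∀ r s μ, ContDiffAt ℝ 2 (fun x : Θ × Pt => Bθ x.1 r s μ x.2) x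
  contθ : Continuous θ
  conty : Continuous y₀
  contq : Continuous q
  contκ : Continuous κ
  mem : ∀ π, (θ π, y₀ π) ∈ O₁
  pos : ∀ π, 0 < T (Aθ (θ π)) (y₀ π, q π) 3

variable {Aθ : Θ → CoefA} {Bθ : Θ → CoefB n} {O₁ : Set (Θ × Pt)} {θ : P → Θ}
    {y₀ : P → Pt} {q : P → Fin 3 → ℝ} {κ : P → ℝ}

theorem IsFlowFamily.contDiffAt_bichar (h : IsFlowFamily Aθ Bθ O₁ θ y₀ q κ) {p : Θ} {v : Ph}
    (hv : (p, v.1) ∈ O₁) : ContDiffAt ℝ 3 (fun x : Θ × Ph => bichar (Aθ x.1) x.2) (p, v) :=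
  contDiffAt_bichar_param (h.smoothA _ hv)

theorem IsFlowFamily.contDiffAt_transport (h : IsFlowFamily Aθ Bθ O₁ θ y₀ q κ) {p : Θ} {v : Ph}
    (hv : (p, v.1) ∈ O₁) :
    ContDiffAt ℝ 2 (fun x : Θ × Ph => transport (Aθ x.1) (Bθ x.1) x.2) (p, v) :=
  contDiffAt_transport_param (h.smoothA _ hv) (h.smoothB _ hv)

theorem IsFlowFamily.contDiffAt_T (h : IsFlowFamily Aθ Bθ O₁ θ y₀ q κ) {x : Θ × ZVal n}
    (hv : (x.1, x.2.1.1.1) ∈ O₁) :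
    ContDiffAt ℝ 3 (fun x : Θ × ZVal n => T (Aθ x.1) x.2.1.1 3) x :=
  (contDiffAt_pi.1 (contDiffAt_fst.comp _ (h.contDiffAt_bichar (p := x.1) (v := x.2.1.1) hv)) 3).comp
    (f := fun x : Θ × ZVal n => (x.1, x.2.1.1)) x (by fun_prop)

theorem IsFlowFamily.contDiffAt_elow (h : IsFlowFamily Aθ Bθ O₁ θ y₀ q κ) {x : Θ × ZVal n}
    (hv : (x.1, x.2.1.1.1) ∈ O₁) :
    ContDiffAt ℝ 1 (fun x : Θ × ZVal n => elow (Aθ x.1) (Bθ x.1) x.2) x :=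
  contDiffAt_elow_param (h.contDiffAt_bichar (p := x.1) (v := x.2.1.1) hv)
    (h.contDiffAt_transport (p := x.1) (v := x.2.1.1) hv)

variable [CompactSpace P] [ProperSpace Θ]

/-- The equations for the entries that are not of top order. -/
theorem IsFlowFamily.exists_low (h : IsFlowFamily Aθ Bθ O₁ θ y₀ q κ) :
    ∃ ε > 0, ∃ Y : ℝ → P → ZVal n,
      ContinuousOn (fun x : ℝ × P => Y x.1 x.2) (Icc 0 ε ×ˢ univ) ∧
      (∀ π, Y 0 π = (X0 (y₀ π) (q π), W0 n)) ∧
      ∀ π, ∀ t ∈ Icc 0 ε, (θ π, (Y t π).1.1.1) ∈ O₁ ∧ 0 < T (Aθ (θ π)) (Y t π).1.1 3 ∧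
        HasDerivWithinAt (fun t => Y t π) ((κ π / T (Aθ (θ π)) (Y t π).1.1 3) •
          elow (Aθ (θ π)) (Bθ (θ π)) (Y t π)) (Icc 0 ε) t := by
  set O' : Set (Θ × ZVal n) := (fun x : Θ × ZVal n => (x.1, x.2.1.1.1)) ⁻¹' O₁ with hO'
  have hO'o : IsOpen O' := h.isOpen.preimage (by fun_prop)
  set O : Set (Θ × ZVal n) := O' ∩ (fun x : Θ × ZVal n => T (Aθ x.1) x.2.1.1 3) ⁻¹' Ioi 0 with hO
  have hOo : IsOpen O := ContinuousOn.isOpen_inter_preimage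
    (fun x hx => (h.contDiffAt_T hx).continuousAt.continuousWithinAt) hO'o isOpen_Ioi
  set g : Θ × ZVal n → ZVal n := fun x =>
    (T (Aθ x.1) x.2.1.1 3)⁻¹ • elow (Aθ x.1) (Bθ x.1) x.2 with hg
  have hgd : ContDiffOn ℝ 1 g O := fun x hx =>
    ((((h.contDiffAt_T hx.1).of_le (by norm_num)).inv (ne_of_gt hx.2)).smul
      (h.contDiffAt_elow hx.1)).contDiffWithinAt
  set Y₀ : P → ZVal n := fun π => (X0 (y₀ π) (q π), W0 n) with hY₀
  have hY₀c : Continuous Y₀ := by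
    have := h.conty
    have := h.contq
    simp only [hY₀, X0]
    fun_prop
  have hΓ : Continuous fun π => (θ π, Y₀ π) := h.contθ.prodMk hY₀c
  set Q := range fun π => (θ π, Y₀ π) with hQ
  have hQc : IsCompact Q := isCompact_range hΓ
  have hQO : Q ⊆ O := by
    rintro _ ⟨π, rfl⟩
    exact ⟨h.mem π, h.pos π⟩
  obtain ⟨ρ, hρ, hρO⟩ := hQc.exists_cthickening_subset_open hOo hQO
  have hcc : IsCompact (cthickening ρ Q) := hQc.cthickening
  have hsub : ∀ π, ∀ y ∈ closedBall (Y₀ π) ρ, (θ π, y) ∈ cthickening ρ Q := fun π y hy =>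
    closedBall_subset_cthickening (show (θ π, Y₀ π) ∈ Q from ⟨π, rfl⟩) ρ <| by
      rw [mem_closedBall, Prod.dist_eq]; simpa [hρ.le] using hy
  obtain ⟨M, hM⟩ := hcc.exists_bound_of_continuousOn
    ((hgd.continuousOn_fderiv_of_isOpen hOo le_rfl).mono hρO)
  obtain ⟨M₁, hM₁⟩ := hcc.exists_bound_of_continuousOn (hgd.continuousOn.mono hρO)
  obtain ⟨k, hk⟩ := isCompact_univ.exists_bound_of_continuousOn h.contκ.continuousOn
  have hgl : ∀ π, LipschitzOnWith (Real.toNNReal M) (fun y => g (θ π, y)) (closedBall (Y₀ π) ρ) := by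
    intro π
    have h1 : LipschitzOnWith (Real.toNNReal M) g (closedBall (θ π, Y₀ π) ρ) := by
      have hs : closedBall (θ π, Y₀ π) ρ ⊆ cthickening ρ Q :=
        closedBall_subset_cthickening (show (θ π, Y₀ π) ∈ Q from ⟨π, rfl⟩) ρ
      refine (convex_closedBall _ _).lipschitzOnWith_of_nnnorm_fderiv_le
        (fun z hz => (hgd.differentiableOn one_ne_zero).differentiableAt
          (hOo.mem_nhds (hρO (hs hz)))) fun z hz => ?_
      rw [← norm_toNNReal]
      exact Real.toNNReal_le_toNNReal (hM z (hs hz))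
    have h2 : LipschitzWith 1 fun y : ZVal n => (θ π, y) := LipschitzWith.prodMk_left (θ π)
    have := h1.comp h2.lipschitzOnWith (s := closedBall (Y₀ π) ρ) (fun y hy => by
      rw [mem_closedBall, Prod.dist_eq]; simpa [hρ.le] using hy)
    simpa [Function.comp_def] using this
  obtain ⟨ε, hε, -, Y, hYc, hY0, hY⟩ := exists_ode_family (P := P) (Z := ZVal n)
    (G := fun _ π y => κ π • g (θ π, y)) hY₀c one_pos hρ
    (K := Real.toNNReal k * Real.toNNReal M) (M := |k| * M₁)
    (by
      refine ContinuousOn.smul (h.contκ.comp (by fun_prop)).continuousOn (hgd.continuousOn.comp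
        (f := fun x : ℝ × P × ZVal n => (θ x.2.1, x.2.2)) ?_ fun x hx => hρO (hsub _ _ hx.2))
      exact ((h.contθ.comp (by fun_prop)).prodMk (by fun_prop)).continuousOn)
    (fun t _ π => by
      refine LipschitzOnWith.of_dist_le_mul fun y hy z hz => ?_
      rw [dist_smul₀]
      have h1 := (hgl π).dist_le_mul y hy z hz
      have h2 : ‖κ π‖ ≤ (Real.toNNReal k : ℝ) := (hk π (mem_univ π)).trans (Real.le_coe_toNNReal k)
      rw [NNReal.coe_mul, mul_assoc]
      gcongr)
    (fun t _ π y hy => by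
      rw [norm_smul]
      have h2 := hM₁ _ (hsub π y hy)
      have h3 : ‖κ π‖ ≤ |k| := (hk π (mem_univ π)).trans (le_abs_self k)
      gcongr)
  refine ⟨ε, hε, Y, hYc, hY0, fun π t ht => ?_⟩
  have hmem := hρO (hsub π _ (hY π t ht).1)
  refine ⟨hmem.1, hmem.2, ?_⟩
  have := (hY π t ht).2
  simp only [hg, smul_smul] at this
  rw [div_eq_mul_inv]
  exact this

/-- Solutions of the equations for the components in the range of the projection `tr` extend to
solutions of the full equations when these are Lipschitz in the other components. -/
theorem exists_ode_family_of_projection {Z : Type*} [NormedAddCommGroup Z] [NormedSpace ℝ Z]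
    [ProperSpace Z] (tr : Z →L[ℝ] Z) (htr2 : ∀ z, tr (tr z) = tr z) {ε₁ M : ℝ} (hε₁ : 0 < ε₁)
    {Y : ℝ → P → Z} {Y₀ : P → Z} {Φ : P → Z → Z} {c : ℝ × P → ℝ} (hY₀c : Continuous Y₀)
    (hYc : ContinuousOn (fun x : ℝ × P => Y x.1 x.2) (Icc 0 ε₁ ×ˢ univ))
    (hY0 : ∀ π, Y 0 π = tr (Y₀ π))
    (hcc' : ContinuousOn c (Icc 0 ε₁ ×ˢ univ))
    (hM : 0 ≤ M)
    (hlip : ∀ t ∈ Icc 0 ε₁, ∀ π z z', tr z = tr (Y t π) → tr z = tr z' →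
      ‖Φ π z - Φ π z'‖ ≤ M * ‖z - z'‖)
    (hcont : ∀ t ∈ Icc 0 ε₁, ∀ π z, tr z = tr (Y t π) →
      ContinuousAt (fun x : P × Z => Φ x.1 x.2) (π, z))
    (hΦ : ∀ π z, tr (Φ π (tr z)) = tr (Φ π z))
    (hY : ∀ π, ∀ t ∈ Icc 0 ε₁, HasDerivWithinAt (fun t => Y t π) (c (t, π) • tr (Φ π (Y t π)))
      (Icc 0 ε₁) t) :
    ∃ ε > 0, ε ≤ ε₁ ∧ ∃ z : ℝ → P → Z,
      ContinuousOn (fun x : ℝ × P => z x.1 x.2) (Icc 0 ε ×ˢ univ) ∧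
      (∀ π, z 0 π = Y₀ π) ∧
      ∀ π, ∀ t ∈ Icc 0 ε, tr (z t π) = Y t π ∧
        HasDerivWithinAt (fun t => z t π) (c (t, π) • Φ π (z t π)) (Icc 0 ε) t := by
  let mix : Z → Z → Z := fun y z => tr y + (z - tr z)
  have hmixt : ∀ y z : Z, tr (mix y z) = tr y := fun y z => by
    simp only [mix, map_add, map_sub, htr2, sub_self, add_zero]
  have hmixc : Continuous fun x : Z × Z => mix x.1 x.2 := by
    simp only [mix]
    fun_prop
  have hcc : IsCompact (Icc 0 ε₁ ×ˢ (univ : Set P)) := isCompact_Icc.prod isCompact_univ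
  obtain ⟨k, hk⟩ := hcc.exists_bound_of_continuousOn hcc'
  have hGc : ContinuousOn (fun x : ℝ × P × Z => c (x.1, x.2.1) • Φ x.2.1 (mix (Y x.1 x.2.1) x.2.2))
      {x | x.1 ∈ Icc 0 ε₁ ∧ dist x.2.2 (Y₀ x.2.1) ≤ 1} := by
    have hp : MapsTo (fun x : ℝ × P × Z => (x.1, x.2.1))
        {x | x.1 ∈ Icc 0 ε₁ ∧ dist x.2.2 (Y₀ x.2.1) ≤ 1} (Icc 0 ε₁ ×ˢ univ) :=
      fun x hx => ⟨hx.1, mem_univ _⟩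
    have hpc : ContinuousOn (fun x : ℝ × P × Z => (x.1, x.2.1))
        {x | x.1 ∈ Icc 0 ε₁ ∧ dist x.2.2 (Y₀ x.2.1) ≤ 1} := by fun_prop
    refine (hcc'.comp hpc hp).smul fun x hx => ?_
    have h1 := hcont x.1 hx.1 x.2.1 (mix (Y x.1 x.2.1) x.2.2) (hmixt _ _)
    have h2 : ContinuousOn (fun x : ℝ × P × Z => (x.2.1, mix (Y x.1 x.2.1) x.2.2))
        {x | x.1 ∈ Icc 0 ε₁ ∧ dist x.2.2 (Y₀ x.2.1) ≤ 1} :=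
      (by fun_prop : Continuous fun x : ℝ × P × Z => x.2.1).continuousOn.prodMk
        (hmixc.comp_continuousOn ((hYc.comp hpc hp).prodMk (by fun_prop)))
    exact h1.tendsto.comp (h2 x hx)
  obtain ⟨R, hR⟩ := isCompact_univ.exists_bound_of_continuousOn hY₀c.continuousOn
  have hSc : IsCompact {x : ℝ × P × Z | x.1 ∈ Icc 0 ε₁ ∧ dist x.2.2 (Y₀ x.2.1) ≤ 1} := by
    refine IsCompact.of_isClosed_subset ((isCompact_Icc (a := (0 : ℝ)) (b := ε₁)).prod (isCompact_univ.prod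
      (isCompact_closedBall (0 : Z) (R + 1)))) ?_ ?_
    · have h1 : Continuous fun x : ℝ × P × Z => dist x.2.2 (Y₀ x.2.1) :=
        (by fun_prop : Continuous fun x : ℝ × P × Z => x.2.2).dist (hY₀c.comp (by fun_prop))
      have h2 : IsClosed {x : ℝ × P × Z | dist x.2.2 (Y₀ x.2.1) ≤ 1} :=
        isClosed_le h1 continuous_const
      exact (isClosed_Icc.preimage continuous_fst).inter h2
    · rintro x ⟨h1, h2⟩
      refine ⟨h1, mem_univ _, ?_⟩
      rw [mem_closedBall_zero_iff]
      have h3 := hR x.2.1 (mem_univ _)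
      have h4 := norm_le_norm_add_norm_sub' x.2.2 (Y₀ x.2.1)
      rw [dist_eq_norm] at h2
      linarith
  obtain ⟨N, hN⟩ := hSc.exists_bound_of_continuousOn hGc
  obtain ⟨ε, hε, hεε₁, z, hZc, hZ0, hZ⟩ := exists_ode_family (P := P) (Z := Z)
    (G := fun t π z => c (t, π) • Φ π (mix (Y t π) z)) hY₀c hε₁ one_pos
    (K := Real.toNNReal k * Real.toNNReal (M * (1 + ‖tr‖)))
    (M := N) hGc
    (fun t ht π => by
      refine LipschitzOnWith.of_dist_le_mul fun y hy z hz => ?_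
      rw [dist_smul₀, dist_eq_norm, dist_eq_norm]
      have hx' : (t, π) ∈ Icc 0 ε₁ ×ˢ (univ : Set P) := ⟨ht, mem_univ _⟩
      have h1 := hlip t ht π (mix (Y t π) y) (mix (Y t π) z) (hmixt _ _) (by rw [hmixt, hmixt])
      have h2 : ‖c (t, π)‖ ≤ (Real.toNNReal k : ℝ) := (hk _ hx').trans (Real.le_coe_toNNReal k)
      have h3 : ‖mix (Y t π) y - mix (Y t π) z‖ ≤ (1 + ‖tr‖) * ‖y - z‖ := by
        have : mix (Y t π) y - mix (Y t π) z = (y - z) - tr (y - z) := by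
          simp only [mix, map_sub]; abel
        rw [this, add_mul, one_mul]
        exact (norm_sub_le _ _).trans (by gcongr; exact tr.le_opNorm _)
      rw [NNReal.coe_mul, mul_assoc]
      refine mul_le_mul h2 (h1.trans ?_) (norm_nonneg _) (NNReal.coe_nonneg _)
      rw [Real.coe_toNNReal _ (by positivity), mul_assoc]
      gcongr)
    (fun t ht π y hy => hN (t, π, y) ⟨ht, hy⟩)
  have hsub : Icc 0 ε ⊆ Icc 0 ε₁ := Icc_subset_Icc_right hεε₁
  have htr : ∀ π, ∀ t ∈ Icc 0 ε, tr (z t π) = Y t π := fun π => by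
    refine eqOn_of_hasDerivWithinAt_eq (f := fun t => tr (z t π)) (g := fun t => Y t π)
      (f' := fun t => c (t, π) • tr (Φ π (Y t π))) (fun t ht => ?_)
      (fun t ht => (hY π t (hsub ht)).mono hsub) ?_
    · have h1 := tr.hasFDerivAt.comp_hasDerivWithinAt t (hZ π t ht).2
      rw [map_smul, ← hΦ π (mix _ _), hmixt, hΦ] at h1
      exact h1
    · show tr (z 0 π) = Y 0 π
      rw [hZ0, hY0]
  refine ⟨ε, hε, hεε₁, z, hZc, hZ0, fun π t ht => ⟨htr π t ht, ?_⟩⟩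
  have h1 : mix (Y t π) (z t π) = z t π := by
    simp only [mix, ← htr π t ht, htr2]
    abel
  have := (hZ π t ht).2
  rwa [h1] at this

set_option maxHeartbeats 2000000 in
/-- The full system for the auxiliary functions has solutions on a common interval. -/
theorem IsFlowFamily.exists_flow (h : IsFlowFamily Aθ Bθ O₁ θ y₀ q κ) :
    ∃ ε > 0, ∃ Z : ℝ → P → ZVal n,
      ContinuousOn (fun x : ℝ × P => Z x.1 x.2) (Icc 0 ε ×ˢ univ) ∧
      (∀ π, Z 0 π = (X0 (y₀ π) (q π), W0 n)) ∧
      ∀ π, ∀ t ∈ Icc 0 ε, (θ π, (Z t π).1.1.1) ∈ O₁ ∧ 0 < T (Aθ (θ π)) (Z t π).1.1 3 ∧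
        HasDerivWithinAt (fun t => Z t π) ((κ π / T (Aθ (θ π)) (Z t π).1.1 3) •
          efull (Aθ (θ π)) (Bθ (θ π)) (Z t π)) (Icc 0 ε) t := by
  obtain ⟨ε₁, hε₁, Y, hYc, hY0, hY⟩ := h.exists_low
  have hY₀c : Continuous (fun π => (X0 (y₀ π) (q π), W0 n) : P → ZVal n) := by
    have := h.conty
    have := h.contq
    simp only [X0]
    fun_prop
  have hv1 : ∀ z : ZVal n, (tr z).1.1 = z.1.1 := fun z => rfl
  have hv : ∀ {y z : ZVal n}, tr z = tr y → z.1.1 = y.1.1 := fun {y z} hyz => by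
    rw [← hv1 z, hyz, hv1]
  have hcov : ∀ x : ℝ × P, x ∈ Icc 0 ε₁ ×ˢ (univ : Set P) → (θ x.2, (Y x.1 x.2).1.1.1) ∈ O₁ :=
    fun x hx => (hY x.2 x.1 hx.1).1
  have hθY : ContinuousOn (fun x : ℝ × P => (θ x.2, Y x.1 x.2)) (Icc 0 ε₁ ×ˢ univ) :=
    (h.contθ.comp continuous_snd).continuousOn.prodMk hYc
  have hTc : ContinuousOn (fun x : ℝ × P => T (Aθ (θ x.2)) (Y x.1 x.2).1.1 3) (Icc 0 ε₁ ×ˢ univ) :=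
    fun x hx => ((h.contDiffAt_T (x := (θ x.2, Y x.1 x.2)) (hcov x hx)).continuousAt.tendsto.comp
      (hθY x hx))
  have hcc : IsCompact (Icc 0 ε₁ ×ˢ (univ : Set P)) := isCompact_Icc.prod isCompact_univ
  have hcc' : ContinuousOn (fun x : ℝ × P => κ x.2 / T (Aθ (θ x.2)) (Y x.1 x.2).1.1 3)
      (Icc 0 ε₁ ×ˢ univ) :=
    (h.contκ.comp continuous_snd).continuousOn.div hTc fun x hx => (hY x.2 x.1 hx.1).2.1.ne'
  have hb1 : ContinuousOn (fun x : ℝ × P => fderiv ℝ (bichar (Aθ (θ x.2))) (Y x.1 x.2).1.1)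
      (Icc 0 ε₁ ×ˢ univ) := fun x hx => by
    have h1 := (contDiffAt_fderiv_param (f := fun p => bichar (Aθ p)) (m := 0)
      (h.contDiffAt_bichar (p := θ x.2) (v := (Y x.1 x.2).1.1) (hcov x hx)) (by norm_num)).continuousAt
    exact h1.tendsto.comp ((h.contθ.comp continuous_snd).continuousOn.prodMk hYc.fst.fst x hx)
  have hb2 : ContinuousOn (fun x : ℝ × P => transport (Aθ (θ x.2)) (Bθ (θ x.2)) (Y x.1 x.2).1.1)
      (Icc 0 ε₁ ×ˢ univ) := fun x hx => by
    have h1 := (h.contDiffAt_transport (p := θ x.2) (v := (Y x.1 x.2).1.1) (hcov x hx)).continuousAt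
    exact h1.tendsto.comp ((h.contθ.comp continuous_snd).continuousOn.prodMk hYc.fst.fst x hx)
  obtain ⟨M₁, hM₁⟩ := hcc.exists_bound_of_continuousOn hb1
  obtain ⟨M₂, hM₂⟩ := hcc.exists_bound_of_continuousOn hb2
  obtain ⟨ε, hε, hεε₁, Z, hZc, hZ0, hZ⟩ := exists_ode_family_of_projection (tr (n := n)) tr_tr hε₁
    (M := |M₁| + n * |M₂|) (Φ := fun π => efull (Aθ (θ π)) (Bθ (θ π))) hY₀c hYc
    (fun π => (hY0 π).trans (tr_initial _ _).symm) hcc' (by positivity)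
    (fun t ht π z z' hz hz' => by
      refine (norm_efull_sub_le (Aθ (θ π)) (Bθ (θ π)) hz').trans ?_
      have hx' : (t, π) ∈ Icc 0 ε₁ ×ˢ (univ : Set P) := ⟨ht, mem_univ _⟩
      rw [hv hz]
      gcongr
      · exact (hM₁ _ hx').trans (le_abs_self _)
      · exact (hM₂ _ hx').trans (le_abs_self _))
    (fun t ht π z hz => by
      have hx' : (t, π) ∈ Icc 0 ε₁ ×ˢ (univ : Set P) := ⟨ht, mem_univ _⟩
      have hm := hcov _ hx'
      have h1 := continuousAt_efull_param (Aθ := Aθ) (Bθ := Bθ) (p := θ π) (Z := z)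
        (h.contDiffAt_bichar (by rw [hv hz]; exact hm))
        (h.contDiffAt_transport (by rw [hv hz]; exact hm))
      exact ContinuousAt.comp (x := (π, z)) (g := fun x : Θ × ZVal n => efull (Aθ x.1) (Bθ x.1) x.2)
        (f := fun x : P × ZVal n => (θ x.1, x.2)) h1
        ((h.contθ.comp continuous_fst).prodMk continuous_snd).continuousAt)
    (fun π z => elow_tr _ _ _)
    (fun π t ht => (hY π t ht).2.2)
  refine ⟨ε, hε, Z, hZc, hZ0, fun π t ht => ?_⟩
  have h1 := hY π t ⟨ht.1, ht.2.trans hεε₁⟩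
  have h2 : (Y t π).1.1 = (Z t π).1.1 := by rw [← (hZ π t ht).1]; exact hv1 _
  have h3 := (hZ π t ht).2
  simp only [h2] at h1 h3
  exact ⟨h1.1, h1.2.1, h3⟩

end FlowFamily


section Vertex

variable {A : CoefA} {y₀ : Pt}

theorem T_vertex_castSucc (h : ∀ α β, A y₀ α β = mink α β) (q : Fin 3 → ℝ) (i : Fin 3) :
    T A (y₀, q) i.castSucc = -q i := by
  fin_cases i <;> simp [T, h, mink, cov] <;> rfl

theorem T_vertex_three (h : ∀ α β, A y₀ α β = mink α β) (q : Fin 3 → ℝ) : T A (y₀, q) 3 = 1 := by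
  simp [T, h, mink, cov_three]

theorem dT_vertex (h : ∀ α β, A y₀ α β = mink α β) (q w : Fin 3 → ℝ) (i : Fin 3) :
    dT A (y₀, q) (0, w) i.castSucc = -w i := by
  have hi : i.castSucc ≠ 3 := (Fin.castSucc_lt_last i).ne
  simp [dT, h, mink, hi, dcov_castSucc]

end Vertex

section Determinant

variable {n : ℕ}

/-- The rows `T`, `Y₁`, `Y₂`, `Y₃` enter the determinant of the matrix `K` in this combination. -/
def detForm (q t : Fin 3 → ℝ) (Y : Fin 3 → Fin 3 → ℝ) : ℝ :=
  q 0 * (Matrix.of ![t, Y 1, Y 2]).det + q 1 * (Matrix.of ![Y 0, t, Y 2]).det +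
    q 2 * (Matrix.of ![Y 0, Y 1, t]).det

theorem continuous_detForm :
    Continuous fun x : (Fin 3 → ℝ) × (Fin 3 → ℝ) × (Fin 3 → Fin 3 → ℝ) =>
      detForm x.1 x.2.1 x.2.2 := by
  simp only [detForm, Matrix.det_fin_three, Matrix.of_apply, Matrix.cons_val_zero,
    Matrix.cons_val_one, Matrix.cons_val]
  fun_prop

theorem detForm_smul (q t : Fin 3 → ℝ) (Y : Fin 3 → Fin 3 → ℝ) (c : ℝ) :
    detForm q t (c • Y) = c ^ 2 * detForm q t Y := by
  simp [detForm, Matrix.det_fin_three]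
  ring

theorem det_K (A : CoefA) (S : Jet n) : (K A S).det =
    (1 - ∑ i, S.1 i ^ 2) * (Matrix.of fun h i : Fin 3 => (S.2.1.2.1 h).1 i.castSucc).det +
      detForm S.1 (fun i => T A S.2.1.1 i.castSucc)
        (fun h i => (S.2.1.2.1 h).1 i.castSucc) := by
  simp only [K, Matrix.det_fin_three, Matrix.of_apply, detForm, Fin.sum_univ_three,
    Matrix.cons_val_zero, Matrix.cons_val_one, Matrix.cons_val]
  simp
  ring

end Determinant

section ConoidFlow

open Set Metric Filter Topology

variable {n : ℕ}

/-- The auxiliary functions, as functions of the time elapsed since the vertex and of the initial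
direction, for coefficients that are reduced to the Minkowski form at the vertex. -/
structure ConoidFlow (A : CoefA) (B : CoefB n) (Ω : Set Pt) (y₀ : Pt) (κ ε : ℝ)
    (Z : ℝ → (Fin 3 → ℝ) → ZVal n) : Prop where
  smooth : SmoothCoef A B Ω
  vertex : ∀ α β, A y₀ α β = mink α β
  eps_pos : 0 < ε
  kap_ne : κ ≠ 0
  cont : ContinuousOn (fun x : ℝ × (Fin 3 → ℝ) => Z x.1 x.2) (Icc 0 ε ×ˢ closedBall 0 2)
  init : ∀ q ∈ closedBall (0 : Fin 3 → ℝ) 2, Z 0 q = (X0 y₀ q, W0 n)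
  mem : ∀ q ∈ closedBall (0 : Fin 3 → ℝ) 2, ∀ t ∈ Icc 0 ε, (Z t q).1.1.1 ∈ Ω
  pos : ∀ q ∈ closedBall (0 : Fin 3 → ℝ) 2, ∀ t ∈ Icc 0 ε, 0 < T A (Z t q).1.1 3
  deriv : ∀ q ∈ closedBall (0 : Fin 3 → ℝ) 2, ∀ t ∈ Icc 0 ε, HasDerivWithinAt (fun t => Z t q)
    ((κ / T A (Z t q).1.1 3) • efull A B (Z t q)) (Icc 0 ε) t
  det_ne : ∀ q : Fin 3 → ℝ, ∑ i, q i ^ 2 = 1 → ∀ t ∈ Ioc 0 ε, (K A (q, Z t q)).det ≠ 0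

theorem tendsto_slope_family {P Z : Type*} [TopologicalSpace P] [NormedAddCommGroup Z]
    [NormedSpace ℝ Z] {f f' : ℝ → P → Z} {ε : ℝ} (hε : 0 ≤ ε) (h0 : ∀ π, f 0 π = 0)
    (hf : ∀ π, ∀ t ∈ Icc 0 ε, HasDerivWithinAt (fun t => f t π) (f' t π) (Icc 0 ε) t)
    (hc : ContinuousOn (fun x : ℝ × P => f' x.1 x.2) (Icc 0 ε ×ˢ univ)) (π₀ : P) :
    Tendsto (fun x : ℝ × P => x.1⁻¹ • f x.1 x.2) (𝓝[Ioc 0 ε ×ˢ univ] (0, π₀)) (𝓝 (f' 0 π₀)) := by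
  rw [Metric.tendsto_nhds]
  intro η hη
  have h1 := Metric.tendsto_nhds.1 (hc (0, π₀) ⟨left_mem_Icc.2 hε, mem_univ _⟩) (η / 2) (half_pos hη)
  rw [eventually_nhdsWithin_iff, nhds_prod_eq, eventually_prod_iff] at h1
  obtain ⟨p, hp, r, hr, hpr⟩ := h1
  obtain ⟨δ, hδ, hδp⟩ := Metric.eventually_nhds_iff.1 hp
  rw [eventually_nhdsWithin_iff, nhds_prod_eq, eventually_prod_iff]
  refine ⟨fun t => dist t 0 < δ, Metric.eventually_nhds_iff.2 ⟨δ, hδ, fun _ h => h⟩, r, hr, ?_⟩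
  rintro t ht π hπ ⟨⟨ht0, htε⟩, -⟩
  simp only at ht0 htε
  have hsub : Icc 0 t ⊆ Icc 0 ε := Icc_subset_Icc_right htε
  have h2 := (convex_Icc (0 : ℝ) t).norm_image_sub_le_of_norm_hasDerivWithin_le
    (f := fun s => f s π - s • f' 0 π₀) (f' := fun s => f' s π - f' 0 π₀) (C := η / 2)
    (fun s hs => (((hf π s (hsub hs)).mono hsub).sub
      (((hasDerivWithinAt_id s _).smul_const (f' 0 π₀)).congr_deriv (one_smul _ _))))
    (fun s hs => by
      rw [← dist_eq_norm]
      refine (hpr (x := s) (hδp ?_) hπ ⟨hsub hs, mem_univ _⟩).le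
      refine lt_of_le_of_lt ?_ ht
      simp only [dist_zero_right, Real.norm_eq_abs, abs_of_nonneg hs.1, abs_of_pos ht0]
      exact hs.2) (left_mem_Icc.2 ht0.le) (right_mem_Icc.2 ht0.le)
  simp only [h0, zero_smul, sub_zero] at h2
  rw [dist_eq_norm]
  have h3 : t⁻¹ • f t π - f' 0 π₀ = t⁻¹ • (f t π - t • f' 0 π₀) := by
    rw [smul_sub, smul_smul, inv_mul_cancel₀ ht0.ne', one_smul]
  rw [h3, norm_smul, norm_inv]
  calc ‖t‖⁻¹ * ‖f t π - t • f' 0 π₀‖ ≤ ‖t‖⁻¹ * (η / 2 * ‖t‖) := by gcongr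
    _ = η / 2 := by
      have : ‖t‖ ≠ 0 := norm_ne_zero_iff.2 ht0.ne'
      field_simp
    _ < η := half_lt_self hη

variable {P : Type*} [TopologicalSpace P] [CompactSpace P] {Θ : Type*} [NormedAddCommGroup Θ]
  [NormedSpace ℝ Θ] {Aθ : Θ → CoefA} {Bθ : Θ → CoefB n} {O₁ : Set (Θ × Pt)} {θ : P → Θ}
  {y₀ : P → Pt} {q : P → Fin 3 → ℝ} {κ : P → ℝ}

theorem IsFlowFamily.exists_det_ne (h : IsFlowFamily Aθ Bθ O₁ θ y₀ q κ)
    (hv : ∀ π α β, Aθ (θ π) (y₀ π) α β = mink α β) (hκ : ∀ π, κ π ≠ 0)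
    {ε : ℝ} (hε : 0 < ε) {Z : ℝ → P → ZVal n}
    (hZc : ContinuousOn (fun x : ℝ × P => Z x.1 x.2) (Icc 0 ε ×ˢ univ))
    (hZ0 : ∀ π, Z 0 π = (X0 (y₀ π) (q π), W0 n))
    (hZ : ∀ π, ∀ t ∈ Icc 0 ε, (θ π, (Z t π).1.1.1) ∈ O₁ ∧ 0 < T (Aθ (θ π)) (Z t π).1.1 3 ∧
        HasDerivWithinAt (fun t => Z t π) ((κ π / T (Aθ (θ π)) (Z t π).1.1 3) •
          efull (Aθ (θ π)) (Bθ (θ π)) (Z t π)) (Icc 0 ε) t) :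
    ∃ ε' > 0, ε' ≤ ε ∧ ∀ π, ∑ i, q π i ^ 2 = 1 → ∀ t ∈ Ioc 0 ε',
      (K (Aθ (θ π)) (q π, Z t π)).det ≠ 0 := by
  have hθZ : ContinuousOn (fun x : ℝ × P => (θ x.2, Z x.1 x.2)) (Icc 0 ε ×ˢ univ) :=
    (h.contθ.comp continuous_snd).continuousOn.prodMk hZc
  have hTc : ∀ α, ContinuousOn (fun x : ℝ × P => T (Aθ (θ x.2)) (Z x.1 x.2).1.1 α)
      (Icc 0 ε ×ˢ univ) := fun α x hx =>
    (continuousAt_pi.1 (h.contDiffAt_bichar (p := θ x.2) (v := (Z x.1 x.2).1.1)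
      (hZ x.2 x.1 hx.1).1).continuousAt.fst α).tendsto.comp
      (f := fun x : ℝ × P => (θ x.2, (Z x.1 x.2).1.1))
        ((h.contθ.comp continuous_snd).continuousOn.prodMk hZc.fst.fst x hx)
  have hgc : ContinuousOn (fun x : ℝ × P => (κ x.2 / T (Aθ (θ x.2)) (Z x.1 x.2).1.1 3) •
      efull (Aθ (θ x.2)) (Bθ (θ x.2)) (Z x.1 x.2)) (Icc 0 ε ×ˢ univ) := by
    refine ((h.contκ.comp continuous_snd).continuousOn.div (hTc 3)
      fun x hx => (hZ x.2 x.1 hx.1).2.1.ne').smul fun x hx => ?_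
    exact (continuousAt_efull_param (Aθ := Aθ) (Bθ := Bθ) (p := θ x.2) (Z := Z x.1 x.2)
      (h.contDiffAt_bichar (hZ x.2 x.1 hx.1).1)
      (h.contDiffAt_transport (hZ x.2 x.1 hx.1).1)).tendsto.comp (hθZ x hx)
  have hsub : ∀ {ε' : ℝ}, ε' ≤ ε → Ioc 0 ε' ×ˢ (univ : Set P) ⊆ Icc 0 ε ×ˢ univ := fun he x hx =>
    ⟨⟨hx.1.1.le, hx.1.2.trans he⟩, mem_univ _⟩
  have key : ∀ π₀, ∑ i, q π₀ i ^ 2 = 1 → ∀ᶠ x : ℝ × P in 𝓝[Ioc 0 ε ×ˢ univ] (0, π₀),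
      detForm (q x.2) (fun i => T (Aθ (θ x.2)) (Z x.1 x.2).1.1 i.castSucc)
        (fun h i => ((Z x.1 x.2).1.2.1 h).1 i.castSucc) ≠ 0 := fun π₀ hq => by
    have h0m : ((0 : ℝ), π₀) ∈ Icc 0 ε ×ˢ (univ : Set P) := ⟨left_mem_Icc.2 hε.le, mem_univ _⟩
    have t1 : Tendsto (fun x : ℝ × P => q x.2) (𝓝[Ioc 0 ε ×ˢ univ] (0, π₀)) (𝓝 (q π₀)) :=
      (h.contq.comp continuous_snd).continuousAt.tendsto.mono_left nhdsWithin_le_nhds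
    have t2 : Tendsto (fun x : ℝ × P => fun i : Fin 3 => T (Aθ (θ x.2)) (Z x.1 x.2).1.1 i.castSucc)
        (𝓝[Ioc 0 ε ×ˢ univ] (0, π₀)) (𝓝 fun i => -q π₀ i) := by
      refine tendsto_pi_nhds.2 fun i => ?_
      have := (hTc i.castSucc (0, π₀) h0m).mono_left (nhdsWithin_mono _ (hsub le_rfl))
      simp only [hZ0] at this
      rwa [show T (Aθ (θ π₀)) (X0 (y₀ π₀) (q π₀)).1 i.castSucc = -q π₀ i from
        T_vertex_castSucc (hv π₀) _ i] at this
    have t3 : Tendsto (fun x : ℝ × P => x.1⁻¹ • fun h i : Fin 3 =>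
        ((Z x.1 x.2).1.2.1 h).1 i.castSucc) (𝓝[Ioc 0 ε ×ˢ univ] (0, π₀))
        (𝓝 fun h i => -κ π₀ * (Pi.single h 1 : Fin 3 → ℝ) i) := by
      refine tendsto_pi_nhds.2 fun k => tendsto_pi_nhds.2 fun i => ?_
      have hl : Continuous fun z : ZVal n => (z.1.2.1 k).1 i.castSucc := by fun_prop
      have := tendsto_slope_family (f := fun t π => ((Z t π).1.2.1 k).1 i.castSucc)
        (f' := fun t π => (((κ π / T (Aθ (θ π)) (Z t π).1.1 3) •
          efull (Aθ (θ π)) (Bθ (θ π)) (Z t π)).1.2.1 k).1 i.castSucc) hε.le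
        (fun π => by rw [hZ0]; rfl)
        (fun π t ht => hasDerivWithinAt_pi.1
          (hasDerivWithinAt_pi.1 (hZ π t ht).2.2.fst.snd.fst k).fst i.castSucc)
        (hl.comp_continuousOn hgc) π₀
      refine (Tendsto.congr (fun x => ?_) this).trans_eq ?_
      · rfl
      · congr 1
        have hp : ∀ {V : Type} [NormedAddCommGroup V] [NormedSpace ℝ V] (v : V),
            DifferentiableAt ℝ (fun v : V => (θ π₀, v)) v := fun v => by fun_prop
        have h1 := fderiv_bichar_apply (A := Aθ (θ π₀)) (v := (y₀ π₀, q π₀))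
          (((h.contDiffAt_bichar (p := θ π₀) (h.mem π₀)).differentiableAt three_ne_zero).comp
            (f := fun v : Ph => (θ π₀, v)) _ (hp _))
          (fun α β => ((h.smoothA _ (h.mem π₀) α β).differentiableAt four_ne_zero).comp
            (f := fun v : Pt => (θ π₀, v)) _ (hp _)) (0, Pi.single k 1) i.castSucc
        rw [dT_vertex (hv π₀)] at h1
        simp only [hZ0]
        show κ π₀ / T (Aθ (θ π₀)) (y₀ π₀, q π₀) 3 *
          (fderiv ℝ (bichar (Aθ (θ π₀))) (y₀ π₀, q π₀) (0, Pi.single k 1)).1 i.castSucc = _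
        rw [h1, T_vertex_three (hv π₀)]
        ring
    have t4 := (continuous_detForm.tendsto _).comp (t1.prodMk_nhds (t2.prodMk_nhds t3))
    have t5 : detForm (q π₀) (fun i => -q π₀ i)
        (fun h i => -κ π₀ * (Pi.single h 1 : Fin 3 → ℝ) i) = -κ π₀ ^ 2 := by
      rw [Fin.sum_univ_three] at hq
      simp [detForm, Matrix.det_fin_three]
      linear_combination -κ π₀ ^ 2 * hq
    simp only [Function.comp_def] at t4
    rw [t5] at t4
    filter_upwards [t4.eventually_ne (neg_ne_zero.2 (pow_ne_zero 2 (hκ π₀)))] with x hx hx0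
    rw [detForm_smul, hx0, mul_zero] at hx
    exact hx rfl
  have hcl : IsCompact {π | ∑ i, q π i ^ 2 = 1} := by
    refine IsClosed.isCompact (isClosed_eq ?_ continuous_const)
    have := h.contq
    fun_prop
  have := hcl.eventually_forall_of_forall_eventually (x₀ := (0 : ℝ))
    (P := fun t π => (t, π) ∈ Ioc 0 ε ×ˢ (univ : Set P) →
      detForm (q π) (fun i => T (Aθ (θ π)) (Z t π).1.1 i.castSucc)
        (fun h i => ((Z t π).1.2.1 h).1 i.castSucc) ≠ 0)
    (fun π hπ => eventually_nhdsWithin_iff.1 (key π hπ))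
  obtain ⟨δ, hδ, hδp⟩ := Metric.eventually_nhds_iff.1 this
  refine ⟨min (δ / 2) ε, by positivity, min_le_right _ _, fun π hπ t ht => ?_⟩
  rw [det_K, hπ, sub_self, zero_mul, zero_add]
  refine hδp ?_ π hπ ⟨⟨ht.1, ht.2.trans (min_le_right _ _)⟩, mem_univ _⟩
  rw [dist_zero_right, Real.norm_eq_abs, abs_of_pos ht.1]
  linarith [ht.2.trans (min_le_left _ _)]

end ConoidFlow

section Existence

open Set Metric

variable {n : ℕ}

/-- The coefficients `A^{*αβ}` in coordinates with the matrices `a^{αβ}`, `a⁰_{αβ}` as independent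
parameters. -/
def coordA (A : CoefA) (θ : (Fin 4 → Fin 4 → ℝ) × (Fin 4 → Fin 4 → ℝ)) : CoefA := fun y α β =>
  ∑ l, ∑ m, A (toX (Matrix.of θ.1) y) l m * θ.2 α l * θ.2 β m

/-- The coefficients `B^{*α}` in coordinates with the matrices `a^{αβ}`, `a⁰_{αβ}` as independent
parameters. -/
def coordB (B : CoefB n) (θ : (Fin 4 → Fin 4 → ℝ) × (Fin 4 → Fin 4 → ℝ)) : CoefB n :=
  fun r s α y => ∑ l, B r s l (toX (Matrix.of θ.1) y) * θ.2 α l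

theorem contDiff_toX_param {m : WithTop ℕ∞} :
    ContDiff ℝ m fun x : ((Fin 4 → Fin 4 → ℝ) × (Fin 4 → Fin 4 → ℝ)) × Pt =>
      toX (Matrix.of x.1.1) x.2 := by
  refine contDiff_pi.2 fun β => ?_
  simp only [toX, Matrix.of_apply]
  fun_prop

theorem contDiff_toX {m : WithTop ℕ∞} (a : Matrix (Fin 4) (Fin 4) ℝ) : ContDiff ℝ m (toX a) := by
  refine contDiff_pi.2 fun β => ?_
  simp only [toX]
  fun_prop

theorem isOpen_box (c : Fin 3 → ℝ) (d e : ℝ) : IsOpen (box c d e) := by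
  have h1 : box c d e = (⋂ i : Fin 3, {x : Pt | |x i.castSucc - c i| < d}) ∩ {x | |x 3| < e} := by
    ext x; simp [box]
  rw [h1]
  exact (isOpen_iInter_of_finite fun i => isOpen_lt (by fun_prop) continuous_const).inter
    (isOpen_lt (by fun_prop) continuous_const)

variable {A : CoefA} {B : CoefB n} {c : Fin 3 → ℝ} {d e : ℝ}

theorem GoodCoef.hyperbolic {Ω : Set Pt} (h : GoodCoef A B Ω) {x : Pt} (hx : x ∈ Ω) :
    Hyperbolic (A x) :=
  ⟨h.symm x hx, h.temporal x hx, h.spatial x hx⟩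

theorem contDiffAt_coordA (h : GoodCoef A B (box c d e))
    {x : ((Fin 4 → Fin 4 → ℝ) × (Fin 4 → Fin 4 → ℝ)) × Pt}
    (hx : toX (Matrix.of x.1.1) x.2 ∈ box c d e) (α β : Fin 4) :
    ContDiffAt ℝ 4 (fun x : ((Fin 4 → Fin 4 → ℝ) × (Fin 4 → Fin 4 → ℝ)) × Pt =>
      coordA A x.1 x.2 α β) x := by
  refine ContDiffAt.sum fun l _ => ContDiffAt.sum fun m _ => ?_
  refine ContDiffAt.mul (ContDiffAt.mul ?_ (by fun_prop)) (by fun_prop)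
  exact ((h.smoothA l m).contDiffAt ((isOpen_box c d e).mem_nhds hx)).comp
    (f := fun x : ((Fin 4 → Fin 4 → ℝ) × (Fin 4 → Fin 4 → ℝ)) × Pt => toX (Matrix.of x.1.1) x.2) x
    contDiff_toX_param.contDiffAt

theorem contDiffAt_coordB (h : GoodCoef A B (box c d e))
    {x : ((Fin 4 → Fin 4 → ℝ) × (Fin 4 → Fin 4 → ℝ)) × Pt}
    (hx : toX (Matrix.of x.1.1) x.2 ∈ box c d e) (r s : Fin n) (α : Fin 4) :
    ContDiffAt ℝ 2 (fun x : ((Fin 4 → Fin 4 → ℝ) × (Fin 4 → Fin 4 → ℝ)) × Pt =>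
      coordB B x.1 r s α x.2) x := by
  refine ContDiffAt.sum fun l _ => ContDiffAt.mul ?_ (by fun_prop)
  exact ((h.smoothB r s l).contDiffAt ((isOpen_box c d e).mem_nhds hx)).comp
    (f := fun x : ((Fin 4 → Fin 4 → ℝ) × (Fin 4 → Fin 4 → ℝ)) × Pt => toX (Matrix.of x.1.1) x.2) x
    contDiff_toX_param.contDiffAt

/-- A frame and its inverse frame. -/
noncomputable def frameParam (a : Matrix (Fin 4) (Fin 4) ℝ) :
    (Fin 4 → Fin 4 → ℝ) × (Fin 4 → Fin 4 → ℝ) := (a, inv a)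

theorem GoodCoef.smoothCoef_star (h : GoodCoef A B (box c d e)) (a : Matrix (Fin 4) (Fin 4) ℝ) :
    SmoothCoef (AStar a A) (BStar a B) (toX a ⁻¹' box c d e) where
  isOpen := (isOpen_box c d e).preimage (contDiff_toX (m := 0) a).continuous
  symm y hy α β := by
    simp only [AStar]
    rw [Finset.sum_comm]
    exact Finset.sum_congr rfl fun l _ => Finset.sum_congr rfl fun m _ => by
      rw [h.symm _ hy]; ring
  smoothA y hy α β := (contDiffAt_coordA h (x := (frameParam a, y)) hy α β).comp
    (f := fun y : Pt => (frameParam a, y)) y (by fun_prop)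
  smoothB y hy r s α := (contDiffAt_coordB h (x := (frameParam a, y)) hy r s α).comp
    (f := fun y : Pt => (frameParam a, y)) y (by fun_prop)

/-- The auxiliary functions exist on a common interval of time for all vertices in a compact part
of the domain and all frames. -/
theorem GoodCoef.exists_conoidFlow (h : GoodCoef A B (box c d e)) (he : 0 < e) {d₀ : ℝ}
    (hd : d₀ < d) {ς : ℝ} (hς : ς ≠ 0) :
    ∃ ε > 0, ∀ x₀ : Pt, (∀ i : Fin 3, |x₀ i.castSucc - c i| ≤ d₀) → |x₀ 3| ≤ e / 2 →
      ∀ a, IsFrame (A x₀) a → ∃ Z, ConoidFlow (AStar a A) (BStar a B) (toX a ⁻¹' box c d e)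
        (toY a x₀) (ς * inv a 3 3) ε Z := by
  set D : Set Pt := {x | (∀ i : Fin 3, |x i.castSucc - c i| ≤ d₀) ∧ |x 3| ≤ e / 2} with hD
  have hDb : D ⊆ box c d e := fun x hx => ⟨fun i => (hx.1 i).trans_lt hd,
    hx.2.trans_lt (half_lt_self he)⟩
  have hDc : IsCompact D := by
    refine Metric.isCompact_of_isClosed_isBounded ?_ ?_
    · have h1 : D = (⋂ i : Fin 3, {x : Pt | |x i.castSucc - c i| ≤ d₀}) ∩ {x | |x 3| ≤ e / 2} := by
        ext x; simp [hD]
      rw [h1]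
      exact (isClosed_iInter fun i => isClosed_le (by fun_prop) continuous_const).inter
        (isClosed_le (by fun_prop) continuous_const)
    · refine (Metric.isBounded_iff_subset_closedBall 0).2 ⟨|d₀| + ‖c‖ + e, fun x hx => ?_⟩
      rw [mem_closedBall_zero_iff, pi_norm_le_iff_of_nonneg (by positivity)]
      intro α
      induction α using Fin.lastCases with
      | last =>
        have := hx.2
        have h2 : ‖x (Fin.last 3)‖ ≤ e / 2 := this
        have h3 := abs_nonneg d₀
        have h4 := norm_nonneg c
        linarith
      | cast i =>
        have h1 := hx.1 i
        have h2 := norm_le_norm_add_norm_sub' (x i.castSucc) (c i)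
        have h3 := norm_le_pi_norm c i
        have h4 := le_abs_self d₀
        rw [← Real.norm_eq_abs] at h1
        linarith
  have hyp : ∀ x ∈ D, Hyperbolic (A x) := fun x hx => h.hyperbolic (hDb hx)
  have hAc : ∀ α β, ContinuousOn (fun x => A x α β) D := fun α β =>
    (h.smoothA α β).continuousOn.mono hDb
  set C := {z : Pt × (Fin 4 → Fin 4 → ℝ) | z.1 ∈ D ∧ IsFrame (A z.1) (Matrix.of z.2)} with hC
  have hCc : IsCompact C := isCompact_frames hDc hAc hyp
  set C' := C ×ˢ closedBall (0 : Fin 3 → ℝ) 2 with hC'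
  have hC'c : IsCompact C' := hCc.prod (isCompact_closedBall _ _)
  have : CompactSpace C' := isCompact_iff_compactSpace.1 hC'c
  have hdet : ∀ z ∈ C, (Matrix.of z.2).det ≠ 0 := fun z hz => hz.2.det_ne_zero (hyp _ hz.1)
  have hinv : Continuous fun z : C' => (inv (Matrix.of z.1.1.2) : Fin 4 → Fin 4 → ℝ) :=
    (continuousOn_inv (S := {a | (Matrix.of a).det ≠ 0}) fun a ha => ha).comp_continuous
      (by fun_prop : Continuous fun z : C' => z.1.1.2) fun z => hdet _ z.2.1
  have hy : Continuous fun z : C' => toY (Matrix.of z.1.1.2) z.1.1.1 := by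
    refine continuous_pi fun α => ?_
    simp only [toY]
    refine continuous_finsetSum _ fun β _ => ?_
    exact ((continuous_apply β).comp ((continuous_apply α).comp hinv)).mul (by fun_prop)
  have hv : ∀ z : C', ∀ α β, coordA A (z.1.1.2, inv (Matrix.of z.1.1.2))
      (toY (Matrix.of z.1.1.2) z.1.1.1) α β = mink α β := fun z α β => by
    simp only [coordA]
    rw [toX_toY (hdet _ z.2.1)]
    exact z.2.1.2.vertex (hyp _ z.2.1.1) α β
  have hfam : IsFlowFamily (coordA A) (coordB B) {x | toX (Matrix.of x.1.1) x.2 ∈ box c d e}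
      (fun z : C' => (z.1.1.2, inv (Matrix.of z.1.1.2)))
      (fun z => toY (Matrix.of z.1.1.2) z.1.1.1) (fun z => z.1.2)
      (fun z => ς * inv (Matrix.of z.1.1.2) 3 3) :=
    { isOpen := (isOpen_box c d e).preimage (contDiff_toX_param (m := 0)).continuous
      smoothA := fun x hx α β => contDiffAt_coordA h hx α β
      smoothB := fun x hx r s α => contDiffAt_coordB h hx r s α
      contθ := Continuous.prodMk (by fun_prop) hinv
      conty := hy
      contq := by fun_prop
      contκ := continuous_const.mul ((continuous_apply 3).comp ((continuous_apply 3).comp hinv))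
      mem := fun z => by
        show toX (Matrix.of z.1.1.2) (toY (Matrix.of z.1.1.2) z.1.1.1) ∈ box c d e
        rw [toX_toY (hdet _ z.2.1)]
        exact hDb z.2.1.1
      pos := fun z => by rw [T_vertex_three (hv z)]; exact one_pos }
  have hκ : ∀ z : C', ς * inv (Matrix.of z.1.1.2) 3 3 ≠ 0 := fun z =>
    mul_ne_zero hς (right_ne_zero_of_mul_eq_one (z.2.1.2.mul_inv (hdet _ z.2.1)))
  obtain ⟨ε₁, hε₁, Z, hZc, hZ0, hZ⟩ := hfam.exists_flow
  obtain ⟨ε, hε, hεε₁, hK⟩ := hfam.exists_det_ne hv hκ hε₁ hZc hZ0 hZ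
  refine ⟨ε, hε, fun x₀ h1 h2 a ha => ?_⟩
  have hz : ∀ q ∈ closedBall (0 : Fin 3 → ℝ) 2, ((x₀, a), q) ∈ C' := fun q hq =>
    ⟨⟨⟨h1, h2⟩, ha⟩, hq⟩
  have hsub : Icc 0 ε ⊆ Icc 0 ε₁ := Icc_subset_Icc_right hεε₁
  classical
  let Z' : ℝ → (Fin 3 → ℝ) → ZVal n := fun t q =>
    if hq : q ∈ closedBall (0 : Fin 3 → ℝ) 2 then Z t ⟨_, hz q hq⟩ else 0
  have hZ' : ∀ t, ∀ q (hq : q ∈ closedBall (0 : Fin 3 → ℝ) 2), Z' t q = Z t ⟨_, hz q hq⟩ :=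
    fun t q hq => dif_pos hq
  have hZt : ∀ q (hq : q ∈ closedBall (0 : Fin 3 → ℝ) 2),
      (fun t => Z' t q) = fun t => Z t ⟨_, hz q hq⟩ := fun q hq => funext fun t => hZ' t q hq
  refine ⟨Z', h.smoothCoef_star a, ?_, hε, ?_, ?_, fun q hq => ?_, fun q hq t ht => ?_,
    fun q hq t ht => ?_, fun q hq t ht => ?_, fun q hq t ht => ?_⟩
  · intro α β
    exact hv ⟨_, hz 0 (by simp)⟩ α β
  · exact hκ ⟨_, hz 0 (by simp)⟩
  · rw [continuousOn_iff_continuous_domRestrict] at hZc ⊢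
    have h3 : Continuous fun x : ↥(Icc 0 ε ×ˢ closedBall (0 : Fin 3 → ℝ) 2) =>
        (⟨(x.1.1, ⟨_, hz x.1.2 x.2.2⟩), ⟨hsub x.2.1, mem_univ _⟩⟩ :
          ↥(Icc 0 ε₁ ×ˢ (univ : Set C'))) := by fun_prop
    refine (hZc.comp h3).congr fun x => ?_
    exact (hZ' x.1.1 x.1.2 x.2.2).symm
  · rw [hZ' 0 q hq, hZ0]; rfl
  · rw [hZ' t q hq]; exact (hZ ⟨_, hz q hq⟩ t (hsub ht)).1
  · rw [hZ' t q hq]; exact (hZ ⟨_, hz q hq⟩ t (hsub ht)).2.1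
  · rw [hZt q hq, hZ' t q hq]; exact (hZ ⟨_, hz q hq⟩ t (hsub ht)).2.2.mono hsub
  · have hq' : q ∈ closedBall (0 : Fin 3 → ℝ) 2 := by
      rw [mem_closedBall_zero_iff, pi_norm_le_iff_of_nonneg two_pos.le]
      intro i
      have h4 : q i ^ 2 ≤ ∑ i, q i ^ 2 :=
        Finset.single_le_sum (f := fun i => q i ^ 2) (fun i _ => sq_nonneg _) (Finset.mem_univ i)
      rw [Real.norm_eq_abs]
      have h5 := (sq_le_one_iff_abs_le_one (q i)).1 (hq ▸ h4)
      linarith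
    rw [hZ' t q hq']
    exact hK ⟨_, hz q hq'⟩ hq t ht

end Existence


section ConoidDerivative

open Filter Topology

variable {n : ℕ} {A : CoefA} {B : CoefB n} {Ω : Set Pt}

/-- `∂λ₁/∂x^i`. -/
noncomputable def dl (A : CoefA) (i : Fin 3) (S : Jet n) : ℝ := ∑ k, S.1 k * (K A S)⁻¹ k i

/-- `∂p⁰_h/∂x^i`. -/
noncomputable def dq (A : CoefA) (i h : Fin 3) (S : Jet n) : ℝ := (K A S)⁻¹ h i - S.1 h * dl A i S

theorem disp_fst (i : Fin 3) (S : Jet n) : (disp A B i S).1 = fun h => dq A i h S := rfl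

theorem disp_snd (i : Fin 3) (S : Jet n) :
    (disp A B i S).2 = dl A i S • elow A B S.2 + ∑ h, dq A i h S • nx h S.2 := by
  simp only [disp, Fin.sum_univ_three]
  refine Prod.ext (Prod.ext ?_ (Prod.ext ?_ (Prod.ext ?_ ?_))) (Prod.ext ?_ (Prod.ext ?_ ?_))
  · simp [elow, efull, tr, nx, dl, dq, Fin.sum_univ_three]
  · funext j
    simp [elow, efull, tr, nx, dl, dq, Fin.sum_univ_three]
  · funext j k
    simp [elow, efull, tr, nx, dl, dq, Fin.sum_univ_three]
  · simp [elow, efull, tr, nx]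
  · simp [elow, efull, tr, nx, dl, dq, Fin.sum_univ_three]
  · funext j
    simp [elow, efull, tr, nx, dl, dq, Fin.sum_univ_three]
  · simp [elow, efull, tr, nx]

theorem dx_entry (ℓ : ZVal n →L[ℝ] ℝ) (i : Fin 3) (S : Jet n) :
    dx A B i (fun S => ℓ S.2) S = dl A i S * ℓ (elow A B S.2) + ∑ h, dq A i h S * ℓ (nx h S.2) := by
  have h1 : HasFDerivAt (fun S : Jet n => ℓ S.2) (ℓ.comp (ContinuousLinearMap.snd ℝ _ _)) S :=
    ContinuousLinearMap.hasFDerivAt (ℓ.comp (ContinuousLinearMap.snd ℝ (Fin 3 → ℝ) (ZVal n)))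
  rw [dx, h1.fderiv, ContinuousLinearMap.comp_apply, ContinuousLinearMap.coe_snd', disp_snd,
    map_add, map_sum, map_smul, smul_eq_mul]
  simp only [map_smul, smul_eq_mul]

theorem dx_q (i h : Fin 3) (S : Jet n) : dx A B i (fun S => S.1 h) S = dq A i h S := by
  have h1 : HasFDerivAt (fun S : Jet n => S.1 h)
      ((ContinuousLinearMap.proj h).comp (ContinuousLinearMap.fst ℝ _ _)) S :=
    ContinuousLinearMap.hasFDerivAt ((ContinuousLinearMap.proj (R := ℝ) (φ := fun _ : Fin 3 => ℝ) h).comp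
      (ContinuousLinearMap.fst ℝ (Fin 3 → ℝ) (ZVal n)))
  rw [dx, h1.fderiv]
  rfl

section Rules

variable {i : Fin 3} {S : Jet n} {φ ψ : Jet n → ℝ}

theorem dx_congr (h : φ =ᶠ[𝓝 S] ψ) : dx A B i φ S = dx A B i ψ S := by
  rw [dx, dx, h.fderiv_eq]

theorem dx_const (c : ℝ) : dx A B i (fun _ => c) S = 0 := by simp [dx]

theorem dx_add (hφ : DifferentiableAt ℝ φ S) (hψ : DifferentiableAt ℝ ψ S) :
    dx A B i (fun S => φ S + ψ S) S = dx A B i φ S + dx A B i ψ S := by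
  simp only [dx]
  rw [fderiv_fun_add hφ hψ]; rfl

theorem dx_neg : dx A B i (fun S => -φ S) S = -dx A B i φ S := by
  simp only [dx]
  rw [fderiv_fun_neg]; rfl

theorem dx_sub (hφ : DifferentiableAt ℝ φ S) (hψ : DifferentiableAt ℝ ψ S) :
    dx A B i (fun S => φ S - ψ S) S = dx A B i φ S - dx A B i ψ S := by
  simp only [dx]
  rw [fderiv_fun_sub hφ hψ]; rfl

theorem dx_mul (hφ : DifferentiableAt ℝ φ S) (hψ : DifferentiableAt ℝ ψ S) :
    dx A B i (fun S => φ S * ψ S) S = dx A B i φ S * ψ S + φ S * dx A B i ψ S := by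
  simp only [dx]
  rw [fderiv_fun_mul hφ hψ]
  simp only [add_apply, smul_apply, smul_eq_mul]
  ring

theorem dx_sum {ι : Type*} {s : Finset ι} {φ : ι → Jet n → ℝ}
    (h : ∀ j ∈ s, DifferentiableAt ℝ (φ j) S) :
    dx A B i (fun S => ∑ j ∈ s, φ j S) S = ∑ j ∈ s, dx A B i (φ j) S := by
  simp only [dx]
  rw [fderiv_fun_sum h]
  simp

theorem dx_comp {g : ℝ → ℝ} {g' : ℝ} (hg : HasDerivAt g g' (φ S)) (hφ : DifferentiableAt ℝ φ S) :
    dx A B i (fun S => g (φ S)) S = g' * dx A B i φ S := by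
  simp only [dx]
  have := (hg.comp_hasFDerivAt S hφ.hasFDerivAt).fderiv
  simp only [Function.comp_def] at this
  rw [this]; rfl

end Rules

/-- The coordinate `y^α` of the auxiliary functions. -/
def yco (α : Fin 4) : ZVal n →L[ℝ] ℝ :=
  (ContinuousLinearMap.proj α).comp ((ContinuousLinearMap.fst ℝ Pt (Fin 3 → ℝ)).comp
    ((ContinuousLinearMap.fst ℝ Ph _).comp (ContinuousLinearMap.fst ℝ XVal (WVal n))))

/-- The coordinate `p_i` of the auxiliary functions. -/
def pco (i : Fin 3) : ZVal n →L[ℝ] ℝ :=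
  (ContinuousLinearMap.proj i).comp ((ContinuousLinearMap.snd ℝ Pt (Fin 3 → ℝ)).comp
    ((ContinuousLinearMap.fst ℝ Ph _).comp (ContinuousLinearMap.fst ℝ XVal (WVal n))))

/-- The coordinate `ω^r_s` of the auxiliary functions. -/
def wco (r s : Fin n) : ZVal n →L[ℝ] ℝ :=
  (ContinuousLinearMap.proj s).comp ((ContinuousLinearMap.proj r).comp
    ((ContinuousLinearMap.fst ℝ (Mat n) _).comp (ContinuousLinearMap.snd ℝ XVal (WVal n))))

theorem dx_yco (α : Fin 4) (i : Fin 3) (S : Jet n) :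
    dx A B i (fun S => S.2.1.1.1 α) S =
      dl A i S * T A S.2.1.1 α + ∑ h, dq A i h S * (S.2.1.2.1 h).1 α :=
  dx_entry (A := A) (B := B) (yco α) i S

theorem dx_pco (j i : Fin 3) (S : Jet n) :
    dx A B i (fun S => S.2.1.1.2 j) S =
      dl A i S * R A S.2.1.1 j + ∑ h, dq A i h S * (S.2.1.2.1 h).2 j :=
  dx_entry (A := A) (B := B) (pco j) i S

theorem K_mul_inv {S : Jet n} (hS : (K A S).det ≠ 0) (j i : Fin 3) :
    ∑ k, K A S j k * (K A S)⁻¹ k i = if j = i then 1 else 0 := by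
  have := congrFun (congrFun (Matrix.mul_nonsing_inv (K A S) (isUnit_iff_ne_zero.2 hS)) j) i
  rwa [Matrix.mul_apply, Matrix.one_apply] at this

theorem inv_mul_K {S : Jet n} (hS : (K A S).det ≠ 0) (j i : Fin 3) :
    ∑ k, (K A S)⁻¹ j k * K A S k i = if j = i then 1 else 0 := by
  have := congrFun (congrFun (Matrix.nonsing_inv_mul (K A S) (isUnit_iff_ne_zero.2 hS)) j) i
  rwa [Matrix.mul_apply, Matrix.one_apply] at this

/-- A combination of `∂/∂λ₁` and of the `∂/∂p⁰_h` in terms of the columns that enter `K`. -/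
theorem dl_dq_eq (a : ℝ) (b : Fin 3 → ℝ) (i : Fin 3) (S : Jet n) :
    dl A i S * a + ∑ h, dq A i h S * b h =
      ∑ k, (K A S)⁻¹ k i * (S.1 k * a + ∑ h, ((if h = k then 1 else 0) - S.1 h * S.1 k) * b h) := by
  simp only [dl, dq, Fin.sum_univ_three]
  simp
  ring

theorem dx_yco_castSucc {S : Jet n} (hS : (K A S).det ≠ 0) (j i : Fin 3) :
    dx A B i (fun S => S.2.1.1.1 j.castSucc) S = if j = i then 1 else 0 := by
  rw [dx_yco, dl_dq_eq, ← K_mul_inv hS]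
  refine Finset.sum_congr rfl fun k _ => ?_
  simp only [K, Matrix.of_apply, Fin.sum_univ_three]
  ring

/-- The jets on the conoid. -/
structure IsConeJet (A : CoefA) (Ω : Set Pt) (S : Jet n) : Prop where
  unit : ∑ i, S.1 i ^ 2 = 1
  mem : S.2.1.1.1 ∈ Ω
  det_ne : (K A S).det ≠ 0
  pos : 0 < T A S.2.1.1 3
  char : ∑ α, T A S.2.1.1 α * cov S.2.1.1.2 α = 0
  orth : ∀ η : Fin 3 → ℝ, ∑ j, η j * S.1 j = 0 →
    ∑ j, η j * ∑ α, cov S.2.1.1.2 α * (S.2.1.2.1 j).1 α = 0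

theorem dx_yco_three {S : Jet n} (hS : IsConeJet A Ω S) (i : Fin 3) :
    dx A B i (fun S => S.2.1.1.1 3) S = -S.2.1.1.2 i := by
  have e : ∀ k, S.1 k * T A S.2.1.1 3 +
      ∑ h, ((if h = k then 1 else 0) - S.1 h * S.1 k) * (S.2.1.2.1 h).1 3 =
      -∑ j, S.2.1.1.2 j * K A S j k := fun k => by
    have h1 := hS.char
    have h2 := hS.orth (fun h => (if h = k then 1 else 0) - S.1 h * S.1 k) (by
      have := hS.unit
      simp only [sub_mul, Finset.sum_sub_distrib, ite_mul, one_mul, zero_mul, Finset.sum_ite_eq',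
        Finset.mem_univ, if_true]
      have e2 : ∑ x, S.1 x * S.1 k * S.1 x = S.1 k * ∑ x, S.1 x ^ 2 := by
        rw [Finset.mul_sum]; exact Finset.sum_congr rfl fun _ _ => by ring
      rw [e2, this]; ring)
    simp only [Fin.sum_univ_castSucc (n := 3), cov_castSucc] at h1 h2
    rw [show Fin.last 3 = 3 from rfl] at h1 h2
    simp only [cov_three] at h1 h2
    simp only [K, Matrix.of_apply, Fin.sum_univ_three] at h1 h2 ⊢
    linear_combination S.1 k * h1 + h2
  rw [dx_yco, dl_dq_eq]
  simp only [e]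
  have h3 : ∀ k, (K A S)⁻¹ k i * -∑ j, S.2.1.1.2 j * K A S j k =
      -∑ j, S.2.1.1.2 j * (K A S j k * (K A S)⁻¹ k i) := fun k => by
    rw [mul_neg, Finset.mul_sum]
    congr 1
    exact Finset.sum_congr rfl fun j _ => by ring
  simp only [h3, Finset.sum_neg_distrib]
  rw [Finset.sum_comm]
  simp only [← Finset.mul_sum, K_mul_inv hS.det_ne]
  simp

/-- Along a bicharacteristic. -/
theorem sum_T_mul_dl_dq {S : Jet n} (hu : ∑ i, S.1 i ^ 2 = 1) (hS : (K A S).det ≠ 0) :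
    ∑ i, T A S.2.1.1 i.castSucc * dl A i S = 1 ∧
      ∀ h, ∑ i, T A S.2.1.1 i.castSucc * dq A i h S = 0 := by
  have h1 : ∀ k, ∑ i, (K A S)⁻¹ k i * T A S.2.1.1 i.castSucc = S.1 k := fun k => by
    have e : ∀ i, T A S.2.1.1 i.castSucc = ∑ m, K A S i m * S.1 m := fun i => by
      simp only [K, Matrix.of_apply, Fin.sum_univ_three] at hu ⊢
      simp
      linear_combination (-T A S.2.1.1 i.castSucc + (S.2.1.2.1 0).1 i.castSucc * S.1 0 +
        (S.2.1.2.1 1).1 i.castSucc * S.1 1 + (S.2.1.2.1 2).1 i.castSucc * S.1 2) * hu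
    simp only [e, Finset.mul_sum]
    rw [Finset.sum_comm]
    simp only [← mul_assoc, ← Finset.sum_mul, inv_mul_K hS]
    simp
  have h2 : ∑ i, T A S.2.1.1 i.castSucc * dl A i S = 1 := by
    simp only [dl, Finset.mul_sum]
    rw [Finset.sum_comm, ← hu]
    refine Finset.sum_congr rfl fun k _ => ?_
    rw [sq]
    nth_rw 2 [← h1 k]
    rw [Finset.sum_mul]
    exact Finset.sum_congr rfl fun i _ => by ring
  refine ⟨h2, fun h => ?_⟩
  have : ∀ i, T A S.2.1.1 i.castSucc * dq A i h S = (K A S)⁻¹ h i * T A S.2.1.1 i.castSucc -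
      S.1 h * (T A S.2.1.1 i.castSucc * dl A i S) := fun i => by rw [dq]; ring
  simp only [this, Finset.sum_sub_distrib, ← Finset.mul_sum, h1, h2]
  ring

theorem sum_T_smul_disp {S : Jet n} (hu : ∑ i, S.1 i ^ 2 = 1) (hS : (K A S).det ≠ 0) :
    ∑ i, T A S.2.1.1 i.castSucc • disp A B i S = (0, elow A B S.2) := by
  obtain ⟨h1, h2⟩ := sum_T_mul_dl_dq hu hS
  refine Prod.ext ?_ ?_
  · rw [Prod.fst_sum]
    funext h
    simpa [disp_fst] using h2 h
  · rw [Prod.snd_sum]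
    simp only [Prod.smul_snd, disp_snd, smul_add, smul_smul, Finset.sum_add_distrib,
      ← Finset.sum_smul, h1, one_smul, Finset.smul_sum]
    rw [Finset.sum_comm]
    simp [← Finset.sum_smul, h2]

/-- Directions tangent to the sphere of initial directions. -/
theorem sum_smul_disp_of_orth {S : Jet n} (hS : (K A S).det ≠ 0) {η : Fin 3 → ℝ}
    (hη : ∑ j, η j * S.1 j = 0) :
    ∑ i, (∑ j, η j * (S.2.1.2.1 j).1 i.castSucc) • disp A B i S = (η, ∑ j, η j • nx j S.2) := by
  have e : ∀ i, ∑ j, η j * (S.2.1.2.1 j).1 i.castSucc = ∑ m, K A S i m * η m := fun i => by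
    simp only [K, Matrix.of_apply, Fin.sum_univ_three] at hη ⊢
    simp
    linear_combination (-T A S.2.1.1 i.castSucc + (S.2.1.2.1 0).1 i.castSucc * S.1 0 +
        (S.2.1.2.1 1).1 i.castSucc * S.1 1 + (S.2.1.2.1 2).1 i.castSucc * S.1 2) * hη
  have h1 : ∀ k, ∑ i, (∑ m, K A S i m * η m) * (K A S)⁻¹ k i = η k := fun k => by
    simp only [Finset.sum_mul]
    rw [Finset.sum_comm]
    have : ∀ m i, K A S i m * η m * (K A S)⁻¹ k i = η m * ((K A S)⁻¹ k i * K A S i m) :=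
      fun m i => by ring
    simp only [this, ← Finset.mul_sum, inv_mul_K hS]
    simp
  have h2 : ∑ i, (∑ m, K A S i m * η m) * dl A i S = 0 := by
    simp only [dl, Finset.mul_sum]
    rw [Finset.sum_comm, ← hη]
    refine Finset.sum_congr rfl fun k _ => ?_
    rw [← h1 k, Finset.sum_mul]
    exact Finset.sum_congr rfl fun i _ => by ring
  have h3 : ∀ h, ∑ i, (∑ m, K A S i m * η m) * dq A i h S = η h := fun h => by
    have : ∀ i, (∑ m, K A S i m * η m) * dq A i h S = (∑ m, K A S i m * η m) * (K A S)⁻¹ h i -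
        S.1 h * ((∑ m, K A S i m * η m) * dl A i S) := fun i => by rw [dq]; ring
    simp only [this, Finset.sum_sub_distrib, ← Finset.mul_sum, h1, h2]
    ring
  simp only [e]
  refine Prod.ext ?_ ?_
  · rw [Prod.fst_sum]
    funext h
    simpa [disp_fst] using h3 h
  · rw [Prod.snd_sum]
    simp only [Prod.smul_snd, disp_snd, smul_add, smul_smul, Finset.sum_add_distrib,
      ← Finset.sum_smul, h2, zero_smul, zero_add, Finset.smul_sum]
    rw [Finset.sum_comm]
    simp only [← Finset.sum_smul, h3]

end ConoidDerivative


section Characteristic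

open Set Metric Filter Topology

variable {n : ℕ} {A : CoefA} {B : CoefB n} {Ω : Set Pt} {y₀ : Pt} {κ ε : ℝ}
  {Z : ℝ → (Fin 3 → ℝ) → ZVal n}

theorem pd_F {y : Pt} (hA : ∀ α β, DifferentiableAt ℝ (fun y => A y α β) y) (p : Fin 3 → ℝ)
    (μ : Fin 4) :
    pd μ (F A p) y = ∑ α, ∑ β, pd μ (fun y => A y α β) y * cov p α * cov p β := by
  have h1 : HasFDerivAt (F A p) (∑ α, ∑ β, cov p β • cov p α • fderiv ℝ (fun y => A y α β) y) y :=
    HasFDerivAt.fun_sum fun α _ => HasFDerivAt.fun_sum fun β _ =>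
      ((hA α β).hasFDerivAt.mul_const _).mul_const _
  rw [pd, h1.fderiv]
  simp only [sum_apply, smul_apply, smul_eq_mul, pd]
  exact Finset.sum_congr rfl fun α _ => Finset.sum_congr rfl fun β _ => by ring

theorem F_eq (v : Ph) : F A v.2 v.1 = ∑ α, T A v α * cov v.2 α := by
  simp only [F, T, Finset.sum_mul]
  exact Finset.sum_congr rfl fun α _ => Finset.sum_congr rfl fun β _ => by ring

theorem sum_mul_dcov (f : Fin 4 → ℝ) (w : Fin 3 → ℝ) :
    ∑ α, f α * dcov w α = ∑ i : Fin 3, f i.castSucc * w i := by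
  rw [Fin.sum_univ_castSucc]
  simp only [dcov_castSucc]
  rw [show Fin.last 3 = 3 from rfl, dcov_three, mul_zero, add_zero]

theorem sum_dT_mul_cov {v : Ph} (hA : ∀ α β, DifferentiableAt ℝ (fun y => A y α β) v.1)
    (hs : ∀ α β, A v.1 α β = A v.1 β α) (w : Ph) :
    ∑ α, dT A v w α * cov v.2 α =
      ∑ μ, pd μ (F A v.2) v.1 * w.1 μ + ∑ i : Fin 3, T A v i.castSucc * w.2 i := by
  have h1 : ∑ α, (∑ β, (∑ μ, pd μ (fun y => A y α β) v.1 * w.1 μ) * cov v.2 β) * cov v.2 α =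
      ∑ μ, pd μ (F A v.2) v.1 * w.1 μ := by
    simp only [pd_F hA, Finset.sum_mul]
    refine (Finset.sum_congr rfl fun α _ => Finset.sum_comm).trans (Finset.sum_comm.trans ?_)
    exact Finset.sum_congr rfl fun μ _ => Finset.sum_congr rfl fun α _ =>
      Finset.sum_congr rfl fun β _ => by ring
  have h2 : ∑ α, (∑ β, A v.1 α β * dcov w.2 β) * cov v.2 α =
      ∑ i : Fin 3, T A v i.castSucc * w.2 i := by
    rw [← sum_mul_dcov (T A v)]
    simp only [T, Finset.sum_mul]
    rw [Finset.sum_comm]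
    exact Finset.sum_congr rfl fun α _ => Finset.sum_congr rfl fun β _ => by rw [hs]; ring
  rw [← h1, ← h2, ← Finset.sum_add_distrib]
  refine Finset.sum_congr rfl fun α _ => ?_
  rw [dT, Finset.sum_add_distrib, add_mul]

variable (h : SmoothCoef A B Ω)
include h

theorem SmoothCoef.contDiffAt_F {v : Ph} (hv : v.1 ∈ Ω) :
    ContDiffAt ℝ 3 (fun v : Ph => F A v.2 v.1) v := by
  simp only [F_eq]
  exact ContDiffAt.sum fun α _ => (h.contDiffAt_T hv α).mul
    (contDiffAt_pi.1 (((contDiff_cov 3).comp (f := fun x : Ph => x.2)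
      (by fun_prop)).contDiffAt) α)

theorem SmoothCoef.fderiv_F {v : Ph} (hv : v.1 ∈ Ω) (w : Ph) :
    fderiv ℝ (fun v : Ph => F A v.2 v.1) v w =
      ∑ μ, pd μ (F A v.2) v.1 * w.1 μ + 2 * ∑ i : Fin 3, T A v i.castSucc * w.2 i := by
  have hl : HasDerivAt (fun ε : ℝ => v + ε • w) w 0 := by
    simpa using ((hasDerivAt_id (0 : ℝ)).smul_const w).const_add v
  have h0 : v + (0 : ℝ) • w = v := by simp
  have h1 := HasDerivAt.fun_sum (u := Finset.univ) fun α _ => (hasDerivAt_T (A := A)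
    (γ := fun ε : ℝ => v + ε • w) (γ' := w) (t := 0)
    (fun α β => by simpa only [h0] using h.differentiableAt hv α β) hl α).mul (hasDerivAt_cov hl.snd α)
  have h2 : HasFDerivAt (fun v : Ph => F A v.2 v.1) (fderiv ℝ (fun v : Ph => F A v.2 v.1) v)
      (v + (0 : ℝ) • w) := by
    rw [h0]; exact ((h.contDiffAt_F hv).differentiableAt three_ne_zero).hasFDerivAt
  have h4 := h2.comp_hasDerivAt (0 : ℝ) hl
  simp only [F_eq, Function.comp_def] at h4
  simp only [h0] at h1
  rw [show (fun v : Ph => F A v.2 v.1) = fun v => ∑ α, T A v α * cov v.2 α from funext F_eq,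
    h4.unique h1, Finset.sum_add_distrib, sum_mul_dcov,
    sum_dT_mul_cov (fun α β => h.differentiableAt hv α β) (h.symm _ hv)]
  ring

theorem SmoothCoef.fderiv_F_bichar {v : Ph} (hv : v.1 ∈ Ω) :
    fderiv ℝ (fun v : Ph => F A v.2 v.1) v (KirchhoffConoid.bichar A v) =
      fderiv ℝ (fun v : Ph => F A v.2 v.1) v (Pi.single 3 1, 0) * F A v.2 v.1 := by
  rw [h.fderiv_F hv, h.fderiv_F hv, F_eq]
  simp only [KirchhoffConoid.bichar, R, pdCon, Fin.sum_univ_castSucc (n := 3), cov_castSucc]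
  rw [show Fin.last 3 = 3 from rfl, cov_three]
  simp [Fin.sum_univ_three]
  ring

theorem SmoothCoef.cov_identity {v : Ph} (hv : v.1 ∈ Ω) (w : Ph) :
    ∑ α, dT A v w α * cov v.2 α + ∑ i : Fin 3, R A v i * w.1 i.castSucc =
      1 / 2 * fderiv ℝ (fun v : Ph => F A v.2 v.1) v w +
        1 / 2 * fderiv ℝ (fun v : Ph => F A v.2 v.1) v (Pi.single 3 1, 0) *
          ∑ α, cov v.2 α * w.1 α := by
  rw [h.fderiv_F hv, h.fderiv_F hv, sum_dT_mul_cov (fun α β => h.differentiableAt hv α β)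
    (h.symm _ hv)]
  simp only [R, pdCon, Fin.sum_univ_castSucc (n := 3), cov_castSucc]
  rw [show Fin.last 3 = 3 from rfl, cov_three]
  simp [Fin.sum_univ_three]
  ring

omit h

theorem unit_mem_ball {q : Fin 3 → ℝ} (hq : ∑ i, q i ^ 2 = 1) : q ∈ ball (0 : Fin 3 → ℝ) 2 := by
  rw [mem_ball_zero_iff, pi_norm_lt_iff two_pos]
  intro i
  have h4 : q i ^ 2 ≤ ∑ i, q i ^ 2 :=
    Finset.single_le_sum (f := fun i => q i ^ 2) (fun i _ => sq_nonneg _) (Finset.mem_univ i)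
  rw [Real.norm_eq_abs]
  have h5 := (sq_le_one_iff_abs_le_one (q i)).1 (hq ▸ h4)
  linarith

theorem eq_zero_of_hasDerivWithinAt_mul {f a : ℝ → ℝ} {ε : ℝ}
    (hf : ∀ t ∈ Icc 0 ε, HasDerivWithinAt f (a t * f t) (Icc 0 ε) t)
    (ha : ContinuousOn a (Icc 0 ε)) (h0 : f 0 = 0) : ∀ t ∈ Icc 0 ε, f t = 0 := by
  obtain ⟨k, hk⟩ := isCompact_Icc.exists_bound_of_continuousOn ha
  intro t ht
  refine eq_zero_of_abs_deriv_le_mul_abs_self_of_eq_zero_right (K := k) (a := 0) (b := ε)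
    (f := f) (f' := fun t => a t * f t) (fun t ht => (hf t ht).continuousWithinAt)
    (fun t ht => (hf t (Ico_subset_Icc_self ht)).Ici_of_Icc ht) h0 (fun t ht => ?_) t ht
  rw [norm_mul]
  gcongr
  exact hk t (Ico_subset_Icc_self ht)

theorem fderiv_fderiv_add_of_eventuallyEq {V : Type*} [NormedAddCommGroup V] [NormedSpace ℝ V]
    {f a : V → ℝ} {b : V → V} {v : V} (hf : ContDiffAt ℝ 2 f v) (hb : DifferentiableAt ℝ b v)
    (ha : DifferentiableAt ℝ a v)
    (e : ∀ᶠ v in 𝓝 v, fderiv ℝ f v (b v) = a v * f v) (h0 : f v = 0) (w : V) :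
    fderiv ℝ (fderiv ℝ f) v (b v) w + fderiv ℝ f v (fderiv ℝ b v w) = a v * fderiv ℝ f v w := by
  have hd1 : HasFDerivAt (fderiv ℝ f) (fderiv ℝ (fderiv ℝ f) v) v :=
    ((hf.fderiv_right (m := 1) (by norm_num)).differentiableAt one_ne_zero).hasFDerivAt
  have e1 : (fun v => fderiv ℝ f v (b v)) =ᶠ[𝓝 v] fun v => a v * f v := e
  have e2 := (hd1.clm_apply hb.hasFDerivAt).congr_of_eventuallyEq e1.symm
  have e3 := ha.hasFDerivAt.mul (hf.differentiableAt two_ne_zero).hasFDerivAt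
  have e4 := congrArg (fun L : V →L[ℝ] ℝ => L w) (e2.unique e3)
  simp only [add_apply, smul_apply, ContinuousLinearMap.comp_apply, ContinuousLinearMap.flip_apply,
    smul_eq_mul, h0, zero_mul, add_zero] at e4
  rw [fderiv_fderiv_comm hf]
  linear_combination e4

theorem hasDerivWithinAt_fderiv_apply {V : Type*} [NormedAddCommGroup V] [NormedSpace ℝ V]
    {f : V → ℝ} {γ w : ℝ → V} {γ' w' : V} {s : Set ℝ} {t : ℝ}
    (hf : DifferentiableAt ℝ (fderiv ℝ f) (γ t)) (hγ : HasDerivWithinAt γ γ' s t)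
    (hw : HasDerivWithinAt w w' s t) :
    HasDerivWithinAt (fun t => fderiv ℝ f (γ t) (w t))
      (fderiv ℝ (fderiv ℝ f) (γ t) γ' (w t) + fderiv ℝ f (γ t) w') s t :=
  (hf.hasFDerivAt.comp_hasDerivWithinAt t hγ).clm_apply hw

namespace ConoidFlow

variable (H : ConoidFlow A B Ω y₀ κ ε Z) {q : Fin 3 → ℝ}
include H

theorem continuousOn_time (hq : q ∈ closedBall (0 : Fin 3 → ℝ) 2) :
    ContinuousOn (fun t => Z t q) (Icc 0 ε) :=
  fun t ht => (H.deriv q hq t ht).continuousWithinAt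

theorem deriv_entry (hq : q ∈ closedBall (0 : Fin 3 → ℝ) 2) {t : ℝ} (ht : t ∈ Icc 0 ε)
    (ℓ : ZVal n →L[ℝ] ℝ) : HasDerivWithinAt (fun t => ℓ (Z t q))
      (κ / T A (Z t q).1.1 3 * ℓ (efull A B (Z t q))) (Icc 0 ε) t := by
  have := ℓ.hasFDerivAt.comp_hasDerivWithinAt t (H.deriv q hq t ht)
  rwa [map_smul, smul_eq_mul] at this

theorem y_three (hq : q ∈ closedBall (0 : Fin 3 → ℝ) 2) {t : ℝ} (ht : t ∈ Icc 0 ε) :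
    (Z t q).1.1.1 3 = y₀ 3 + κ * t := by
  refine eqOn_of_hasDerivWithinAt_eq (f := fun t => (Z t q).1.1.1 3)
    (g := fun t => y₀ 3 + κ * t) (f' := fun _ => κ) (fun t ht => ?_) (fun t _ => ?_) ?_ ht
  · have h1 := H.deriv_entry hq ht (yco 3)
    have h2 : κ / T A (Z t q).1.1 3 * yco 3 (efull A B (Z t q)) = κ :=
      div_mul_cancel₀ _ (H.pos q hq t ht).ne'
    rwa [h2] at h1
  · simpa using (((hasDerivAt_id t).const_mul κ).const_add (y₀ 3)).hasDerivWithinAt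
  · simp [H.init q hq, X0]

theorem continuousOn_T (hq : q ∈ closedBall (0 : Fin 3 → ℝ) 2) (α : Fin 4) :
    ContinuousOn (fun t => T A (Z t q).1.1 α) (Icc 0 ε) := fun t ht =>
  (H.smooth.contDiffAt_T (H.mem q hq t ht) α).continuousAt.comp_continuousWithinAt
    (f := fun t => (Z t q).1.1) (H.continuousOn_time hq t ht).fst.fst

/-- The factor `κ/T⁴ · ∂F/∂y⁴` of the linear equations satisfied by `F` and by its derivatives. -/
theorem continuousOn_factor (hq : q ∈ closedBall (0 : Fin 3 → ℝ) 2) :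
    ContinuousOn (fun t => κ / T A (Z t q).1.1 3 *
      fderiv ℝ (fun v : Ph => F A v.2 v.1) (Z t q).1.1 (Pi.single 3 1, 0)) (Icc 0 ε) := by
  refine (continuousOn_const.div (H.continuousOn_T hq 3) fun t ht => (H.pos q hq t ht).ne').mul ?_
  intro t ht
  have h1 : ContinuousAt (fderiv ℝ (fun v : Ph => F A v.2 v.1)) (Z t q).1.1 :=
    ((H.smooth.contDiffAt_F (H.mem q hq t ht)).fderiv_right (m := 2) (by norm_num)).continuousAt
  exact (h1.comp_continuousWithinAt (f := fun t => (Z t q).1.1)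
    (H.continuousOn_time hq t ht).fst.fst).clm_apply continuousWithinAt_const

theorem deriv_v (hq : q ∈ closedBall (0 : Fin 3 → ℝ) 2) {t : ℝ} (ht : t ∈ Icc 0 ε) :
    HasDerivWithinAt (fun t => (Z t q).1.1) ((κ / T A (Z t q).1.1 3) • bichar A (Z t q).1.1)
      (Icc 0 ε) t :=
  (H.deriv q hq t ht).fst.fst

theorem deriv_v₁ (hq : q ∈ closedBall (0 : Fin 3 → ℝ) 2) {t : ℝ} (ht : t ∈ Icc 0 ε) (j : Fin 3) :
    HasDerivWithinAt (fun t => (Z t q).1.2.1 j)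
      ((κ / T A (Z t q).1.1 3) • fderiv ℝ (bichar A) (Z t q).1.1 ((Z t q).1.2.1 j)) (Icc 0 ε) t :=
  hasDerivWithinAt_pi.1 (H.deriv q hq t ht).fst.snd.fst j

theorem F_eq_zero (hq : ∑ i, q i ^ 2 = 1) {t : ℝ} (ht : t ∈ Icc 0 ε) :
    F A (Z t q).1.1.2 (Z t q).1.1.1 = 0 := by
  have hqb := ball_subset_closedBall (unit_mem_ball hq)
  refine eq_zero_of_hasDerivWithinAt_mul (f := fun t => F A (Z t q).1.1.2 (Z t q).1.1.1)
    (fun t ht => ?_) (H.continuousOn_factor hqb) ?_ t ht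
  · have h1 := ((H.smooth.contDiffAt_F (H.mem q hqb t ht)).differentiableAt
      three_ne_zero).hasFDerivAt.comp_hasDerivWithinAt t (H.deriv_v hqb ht)
    rw [map_smul, H.smooth.fderiv_F_bichar (H.mem q hqb t ht), smul_eq_mul, ← mul_assoc] at h1
    exact h1
  · have h2 : (Z 0 q).1.1 = (y₀, q) := by rw [H.init q hqb]; rfl
    rw [h2, F_eq (y₀, q), Fin.sum_univ_castSucc]
    simp only [T_vertex_castSucc H.vertex, cov_castSucc]
    rw [show Fin.last 3 = 3 from rfl, T_vertex_three H.vertex, cov_three]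
    have : ∀ i, -q i * q i = -(q i ^ 2) := fun i => by ring
    simp only [this, Finset.sum_neg_distrib, hq]
    norm_num

theorem deriv_dir (hq : q ∈ closedBall (0 : Fin 3 → ℝ) 2) {t : ℝ} (ht : t ∈ Icc 0 ε)
    (η : Fin 3 → ℝ) : HasDerivWithinAt (fun t => ∑ j, η j • (Z t q).1.2.1 j)
      ((κ / T A (Z t q).1.1 3) • fderiv ℝ (bichar A) (Z t q).1.1 (∑ j, η j • (Z t q).1.2.1 j))
      (Icc 0 ε) t := by
  have := HasDerivWithinAt.fun_sum (u := Finset.univ) fun j _ => (H.deriv_v₁ hq ht j).const_smul (η j)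
  refine this.congr_deriv ?_
  rw [map_sum, Finset.smul_sum]
  exact Finset.sum_congr rfl fun j _ => by rw [map_smul, smul_comm]

theorem dF_eq_zero (hq : ∑ i, q i ^ 2 = 1) {η : Fin 3 → ℝ} (hη : ∑ j, η j * q j = 0) {t : ℝ}
    (ht : t ∈ Icc 0 ε) :
    fderiv ℝ (fun v : Ph => F A v.2 v.1) (Z t q).1.1 (∑ j, η j • (Z t q).1.2.1 j) = 0 := by
  have hqb := ball_subset_closedBall (unit_mem_ball hq)
  refine eq_zero_of_hasDerivWithinAt_mul (f := fun t =>
    fderiv ℝ (fun v : Ph => F A v.2 v.1) (Z t q).1.1 (∑ j, η j • (Z t q).1.2.1 j))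
    (fun t ht => ?_) (H.continuousOn_factor hqb) ?_ t ht
  · have hm := H.mem q hqb t ht
    have hc := H.smooth.contDiffAt_F hm
    have hc1 : ContDiffAt ℝ 2 (fderiv ℝ fun v : Ph => F A v.2 v.1) (Z t q).1.1 :=
      hc.fderiv_right (by norm_num)
    refine (hasDerivWithinAt_fderiv_apply (hc1.differentiableAt two_ne_zero) (H.deriv_v hqb ht)
      (H.deriv_dir hqb ht η)).congr_deriv ?_
    have e := fderiv_fderiv_add_of_eventuallyEq (hc.of_le (by norm_num))
      ((H.smooth.bichar hm).differentiableAt three_ne_zero)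
      ((hc1.differentiableAt two_ne_zero).clm_apply (differentiableAt_const
        ((Pi.single 3 1, 0) : Ph)))
      (Filter.mem_of_superset ((H.smooth.isOpen.preimage continuous_fst).mem_nhds hm)
        fun v' hv' => H.smooth.fderiv_F_bichar hv') (H.F_eq_zero hq ht) (∑ j, η j • (Z t q).1.2.1 j)
    simp only [map_smul, smul_apply, smul_eq_mul]
    linear_combination (κ / T A (Z t q).1.1 3) * e
  · have h2 : (Z 0 q).1.1 = (y₀, q) := by rw [H.init q hqb]; rfl
    have h3 : ∀ j, (Z 0 q).1.2.1 j = (0, Pi.single j 1) := by rw [H.init q hqb]; exact fun j => rfl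
    have h4 : y₀ ∈ Ω := by
      have := H.mem q hqb 0 (left_mem_Icc.2 H.eps_pos.le)
      rwa [h2] at this
    rw [h2, H.smooth.fderiv_F (v := (y₀, q)) h4]
    simp only [h3, Prod.fst_sum, Prod.snd_sum, T_vertex_castSucc H.vertex, Prod.smul_mk,
      smul_zero, Finset.sum_const_zero]
    simp only [Fin.sum_univ_three] at hη ⊢
    simp
    linear_combination -1 * hη

theorem orth (hq : ∑ i, q i ^ 2 = 1) {η : Fin 3 → ℝ} (hη : ∑ j, η j * q j = 0) {t : ℝ}
    (ht : t ∈ Icc 0 ε) :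
    ∑ α, cov (Z t q).1.1.2 α * (∑ j, η j • (Z t q).1.2.1 j).1 α = 0 := by
  have hqb := ball_subset_closedBall (unit_mem_ball hq)
  refine eq_zero_of_hasDerivWithinAt_mul (f := fun t =>
    ∑ α, cov (Z t q).1.1.2 α * (∑ j, η j • (Z t q).1.2.1 j).1 α)
    (fun t ht => ?_) ((H.continuousOn_factor hqb).const_mul (1 / 2)) ?_ t ht
  · have hm := H.mem q hqb t ht
    have hdc : ∀ α, HasDerivWithinAt (fun t => cov (Z t q).1.1.2 α)
        (dcov ((κ / T A (Z t q).1.1 3) • R A (Z t q).1.1) α) (Icc 0 ε) t := fun α => by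
      induction α using Fin.lastCases with
      | last =>
        rw [show (fun t => cov (Z t q).1.1.2 (Fin.last 3)) = fun _ => (1 : ℝ) from
          funext fun t => cov_three _, show ∀ w, dcov w (Fin.last 3) = 0 from dcov_three]
        exact hasDerivWithinAt_const _ _ _
      | cast i =>
        rw [show (fun t => cov (Z t q).1.1.2 i.castSucc) = fun t => (Z t q).1.1.2 i from
          funext fun t => cov_castSucc _ i, dcov_castSucc]
        exact hasDerivWithinAt_pi.1 (H.deriv_v hqb ht).snd i
    have h1 := HasDerivWithinAt.fun_sum (u := Finset.univ) fun α _ =>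
      (hdc α).mul (hasDerivWithinAt_pi.1 (H.deriv_dir hqb ht η).fst α)
    refine h1.congr_deriv ?_
    set w := ∑ j, η j • (Z t q).1.2.1 j with hw
    have e1 := H.smooth.cov_identity hm w
    rw [H.dF_eq_zero hq hη ht] at e1
    have e2 : ∀ α, ((κ / T A (Z t q).1.1 3) • fderiv ℝ (bichar A) (Z t q).1.1 w).1 α =
        (κ / T A (Z t q).1.1 3) * dT A (Z t q).1.1 w α := fun α => by
      rw [← H.smooth.fderiv_bichar hm]; rfl
    simp only [e2, Finset.sum_add_distrib]
    have e3 : ∑ α, dcov ((κ / T A (Z t q).1.1 3) • R A (Z t q).1.1) α * w.1 α =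
        (κ / T A (Z t q).1.1 3) * ∑ i : Fin 3, R A (Z t q).1.1 i * w.1 i.castSucc := by
      simp only [mul_comm (dcov _ _)]
      rw [sum_mul_dcov, Finset.mul_sum]
      exact Finset.sum_congr rfl fun i _ => by simp; ring
    have e4 : ∑ α, cov (Z t q).1.1.2 α * (κ / T A (Z t q).1.1 3 * dT A (Z t q).1.1 w α) =
        (κ / T A (Z t q).1.1 3) * ∑ α, dT A (Z t q).1.1 w α * cov (Z t q).1.1.2 α := by
      rw [Finset.mul_sum]
      exact Finset.sum_congr rfl fun i _ => by ring
    rw [e3, e4]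
    linear_combination (κ / T A (Z t q).1.1 3) * e1
  · have h3 : ∀ j, (Z 0 q).1.2.1 j = (0, Pi.single j 1) := by rw [H.init q hqb]; exact fun j => rfl
    simp [h3, Prod.fst_sum]

theorem isConeJet (hq : ∑ i, q i ^ 2 = 1) {t : ℝ} (ht : t ∈ Ioc 0 ε) :
    IsConeJet A Ω ((q, Z t q) : Jet n) := by
  have hqb := ball_subset_closedBall (unit_mem_ball hq)
  have ht' : t ∈ Icc 0 ε := Ioc_subset_Icc_self ht
  refine ⟨hq, H.mem q hqb t ht', H.det_ne q hq t ht, H.pos q hqb t ht', ?_, fun η hη => ?_⟩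
  · rw [← F_eq]; exact H.F_eq_zero hq ht'
  · rw [← H.orth hq hη ht']
    simp only [Prod.fst_sum, Prod.smul_fst, Finset.sum_apply, Pi.smul_apply, smul_eq_mul,
      Finset.mul_sum]
    rw [Finset.sum_comm]
    exact Finset.sum_congr rfl fun j _ => Finset.sum_congr rfl fun α _ => by ring

end ConoidFlow

end Characteristic


section Dependence

open Set Metric Filter Topology

variable {n : ℕ} {A : CoefA} {B : CoefB n} {Ω : Set Pt} {y₀ : Pt} {κ ε : ℝ}
  {Z : ℝ → (Fin 3 → ℝ) → ZVal n}

/-- Derivation of the equations with the time `a` as independent variable with respect to a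
parameter. -/
theorem hasDerivWithinAt_normalized {V : Type*} [NormedAddCommGroup V] [NormedSpace ℝ V]
    {E : V → V} {τ : V → ℝ} {E' : V →L[ℝ] V} {τ' : V →L[ℝ] ℝ} {z N : ℝ → V} {a : ℝ → ℝ} {κ t : ℝ}
    {s : Set ℝ} (hE : HasFDerivAt E E' (z t)) (hτ : HasFDerivAt τ τ' (z t)) (h0 : τ (z t) ≠ 0)
    (hz : HasDerivWithinAt z ((κ / τ (z t)) • E (z t)) s t)
    (hN : HasDerivWithinAt N ((κ / τ (z t)) • E' (N t)) s t)
    (ha : HasDerivWithinAt a (κ / τ (z t) * τ' (N t)) s t) :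
    HasDerivWithinAt (fun t => N t - (a t / τ (z t)) • E (z t))
      (fderiv ℝ (fun z => (κ / τ z) • E z) (z t) (N t - (a t / τ (z t)) • E (z t))) s t := by
  have h1 : HasFDerivAt (fun z => κ / τ z) ((-κ / τ (z t) ^ 2) • τ') (z t) := by
    have := ((hasDerivAt_inv h0).const_mul κ).comp_hasFDerivAt (z t) hτ
    simp only [Function.comp_def, ← div_eq_mul_inv] at this
    refine this.congr_fderiv ?_
    congr 1
    field_simp
  have h2 : HasFDerivAt (fun z => (κ / τ z) • E z) _ (z t) := h1.smul hE
  rw [h2.fderiv]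
  have h3 := hN.sub ((ha.div (hτ.comp_hasDerivWithinAt t hz) h0).smul
    (hE.comp_hasDerivWithinAt t hz))
  refine h3.congr_deriv ?_
  simp only [Function.comp, Pi.div_apply, map_sub, map_smul, add_apply, smul_apply,
    ContinuousLinearMap.smulRight_apply, smul_eq_mul]
  match_scalars <;> field_simp <;> ring

theorem hasDerivWithinAt_sum_smulRight {ι V : Type*} [Fintype ι] [NormedAddCommGroup V]
    [NormedSpace ℝ V] {f : ι → ℝ → V} {f' : ι → V} {s : Set ℝ} {t : ℝ}
    (hf : ∀ k, HasDerivWithinAt (f k) (f' k) s t) :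
    HasDerivWithinAt (fun t => ∑ k, (ContinuousLinearMap.proj k : (ι → ℝ) →L[ℝ] ℝ).smulRight (f k t))
      (∑ k, (ContinuousLinearMap.proj k : (ι → ℝ) →L[ℝ] ℝ).smulRight (f' k)) s t :=
  HasDerivWithinAt.fun_sum fun k _ => (ContinuousLinearMap.smulRightL ℝ (ι → ℝ) V
    (ContinuousLinearMap.proj k)).hasFDerivAt.comp_hasDerivWithinAt t (hf k)

theorem sum_smulRight_comp {ι V : Type*} [Fintype ι] [NormedAddCommGroup V]
    [NormedSpace ℝ V] (L : V →L[ℝ] V) (d : ι → V) :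
    ∑ k, (ContinuousLinearMap.proj k : (ι → ℝ) →L[ℝ] ℝ).smulRight (L (d k)) =
      L.comp (∑ k, (ContinuousLinearMap.proj k : (ι → ℝ) →L[ℝ] ℝ).smulRight (d k)) := by
  ext w
  simp [sum_apply]

theorem continuousAt_sum_smulRight {ι V X : Type*} [Fintype ι] [NormedAddCommGroup V]
    [NormedSpace ℝ V] [TopologicalSpace X] {f : ι → X → V} {x : X}
    (hf : ∀ k, ContinuousAt (f k) x) :
    ContinuousAt (fun x => ∑ k, (ContinuousLinearMap.proj k : (ι → ℝ) →L[ℝ] ℝ).smulRight (f k x))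
      x :=
  tendsto_finsetSum _ fun k _ => (ContinuousLinearMap.smulRightL ℝ (ι → ℝ) V
    (ContinuousLinearMap.proj k)).continuous.continuousAt.comp (hf k)

theorem continuousAt_toSpanSingleton {V X : Type*} [NormedAddCommGroup V]
    [NormedSpace ℝ V] [TopologicalSpace X] {f : X → V} {x : X} (hf : ContinuousAt f x) :
    ContinuousAt (fun x => ContinuousLinearMap.toSpanSingleton ℝ (f x)) x :=
  (ContinuousLinearMap.toSpanSingletonCLE (𝕜 := ℝ) (E := V)).continuous.continuousAt.comp hf

theorem SmoothCoef.fderiv_elow_tr (h : SmoothCoef A B Ω) {z : ZVal n} (hz : z.1.1.1 ∈ Ω)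
    (w : ZVal n) :
    fderiv ℝ (KirchhoffConoid.elow A B) z w = fderiv ℝ (KirchhoffConoid.elow A B) (tr z) (tr w) := by
  have h1 : HasFDerivAt (KirchhoffConoid.elow A B) (fderiv ℝ (KirchhoffConoid.elow A B) (tr z))
      (tr z) := ((h.elow (Z := tr z) hz).differentiableAt one_ne_zero).hasFDerivAt
  have h2 := h1.comp z (tr (n := n)).hasFDerivAt
  have h3 : KirchhoffConoid.elow A B ∘ tr = KirchhoffConoid.elow A B := funext (elow_tr A B)
  rw [h3] at h2
  rw [h2.fderiv]; rfl

/-- The right-hand side of the equations for the entries that are not of top order, with the time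
as independent variable. -/
noncomputable def timeField (A : CoefA) (B : CoefB n) (κ : ℝ) (z : ZVal n) : ZVal n :=
  (κ / T A z.1.1 3) • elow A B z

theorem SmoothCoef.contDiffAt_T_three (h : SmoothCoef A B Ω) {z : ZVal n} (hz : z.1.1.1 ∈ Ω) :
    ContDiffAt ℝ 3 (fun z : ZVal n => T A z.1.1 3) z :=
  (h.contDiffAt_T hz 3).comp (f := fun z : ZVal n => z.1.1) z (by fun_prop)

theorem SmoothCoef.contDiffAt_timeField (h : SmoothCoef A B Ω) {z : ZVal n} (hz : z.1.1.1 ∈ Ω)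
    (hT : T A z.1.1 3 ≠ 0) : ContDiffAt ℝ 1 (timeField A B κ) z :=
  (contDiffAt_const.div ((h.contDiffAt_T_three hz).of_le (by norm_num)) hT).smul (h.elow hz)

theorem SmoothCoef.isOpen_regular (h : SmoothCoef A B Ω) :
    IsOpen {z : ZVal n | z.1.1.1 ∈ Ω ∧ 0 < T A z.1.1 3} :=
  ContinuousOn.isOpen_inter_preimage (f := fun z : ZVal n => T A z.1.1 3)
    (fun _ hz => (h.contDiffAt_T_three hz).continuousAt.continuousWithinAt)
    (h.isOpen.preimage (by fun_prop : Continuous fun z : ZVal n => z.1.1.1)) isOpen_Ioi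

/-- The derivative with respect to `p⁰_k` for a fixed value of the time. -/
noncomputable def dirDeriv (A : CoefA) (B : CoefB n) (k : Fin 3) (z : ZVal n) : ZVal n :=
  nx k z - ((z.1.2.1 k).1 3 / T A z.1.1 3) • elow A B z

/-- The differential with respect to `p⁰` for a fixed value of the time. -/
noncomputable def dirDiff (A : CoefA) (B : CoefB n) (z : ZVal n) : (Fin 3 → ℝ) →L[ℝ] ZVal n :=
  ∑ k, (ContinuousLinearMap.proj k : (Fin 3 → ℝ) →L[ℝ] ℝ).smulRight (dirDeriv A B k z)

theorem dirDiff_apply (z : ZVal n) (w : Fin 3 → ℝ) :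
    dirDiff A B z w = ∑ k, w k • dirDeriv A B k z := by
  simp [dirDiff]

theorem SmoothCoef.continuousAt_dirDeriv (h : SmoothCoef A B Ω) {z : ZVal n} (hz : z.1.1.1 ∈ Ω)
    (hT : T A z.1.1 3 ≠ 0) (k : Fin 3) : ContinuousAt (dirDeriv A B k) z := by
  have h1 : ContinuousAt (fun z : ZVal n => T A z.1.1 3) z :=
    (h.contDiffAt_T hz 3).continuousAt.comp (f := fun z : ZVal n => z.1.1)
      continuous_fst.fst.continuousAt
  have h2 : ContinuousAt (fun z : ZVal n => (z.1.2.1 k).1 3) z := by fun_prop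
  exact (nx k).continuous.continuousAt.sub ((h2.div h1 hT).smul (h.elow hz).continuousAt)

theorem hasFDerivAt_initial (y₀ : Pt) (q : Fin 3 → ℝ) :
    HasFDerivAt (fun q => ((X0 y₀ q, W0 n) : ZVal n))
      (∑ k, (ContinuousLinearMap.proj k : (Fin 3 → ℝ) →L[ℝ] ℝ).smulRight
        (nx k ((X0 y₀ q, W0 n) : ZVal n))) q := by
  have h1 : HasFDerivAt (fun q => ((X0 y₀ q, W0 n) : ZVal n)) (((((0 : (Fin 3 → ℝ) →L[ℝ] Pt).prod
      (ContinuousLinearMap.id ℝ _)).prod 0).prod 0)) q :=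
    HasFDerivAt.prodMk (HasFDerivAt.prodMk (HasFDerivAt.prodMk (hasFDerivAt_const _ _)
      (hasFDerivAt_id _)) (hasFDerivAt_const _ _)) (hasFDerivAt_const _ _)
  refine h1.congr_fderiv (ContinuousLinearMap.ext fun w => ?_)
  rw [sum_apply, Fin.sum_univ_three]
  refine Prod.ext (Prod.ext (Prod.ext ?_ ?_) (Prod.ext ?_ (Prod.ext ?_ ?_))) (Prod.ext ?_ (Prod.ext ?_ ?_))
  · simp [nx, X0]
  · funext j
    fin_cases j <;> simp [nx, X0]
  all_goals simp [nx, X0, W0]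
  · funext j; simp
  · funext j k; simp
  · funext j; simp

namespace ConoidFlow

variable (H : ConoidFlow A B Ω y₀ κ ε Z) {q : Fin 3 → ℝ}
include H

theorem deriv_tr (hq : q ∈ closedBall (0 : Fin 3 → ℝ) 2) {t : ℝ} (ht : t ∈ Icc 0 ε) :
    HasDerivWithinAt (fun t => tr (Z t q)) (timeField A B κ (tr (Z t q))) (Icc 0 ε) t := by
  have h1 := (tr (n := n)).hasFDerivAt.comp_hasDerivWithinAt t (H.deriv q hq t ht)
  rw [map_smul] at h1
  exact h1

theorem deriv_dirDeriv (hq : q ∈ closedBall (0 : Fin 3 → ℝ) 2) {t : ℝ} (ht : t ∈ Icc 0 ε)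
    (k : Fin 3) : HasDerivWithinAt (fun t => dirDeriv A B k (Z t q))
      (fderiv ℝ (timeField A B κ) (tr (Z t q)) (dirDeriv A B k (Z t q))) (Icc 0 ε) t := by
  have hm := H.mem q hq t ht
  have hp := H.pos q hq t ht
  have hT' : HasFDerivAt (fun z : ZVal n => T A z.1.1 3)
      (fderiv ℝ (fun z : ZVal n => T A z.1.1 3) (tr (Z t q))) (tr (Z t q)) :=
    ((H.smooth.contDiffAt_T_three (z := tr (Z t q)) hm).differentiableAt three_ne_zero).hasFDerivAt
  have hE' : HasFDerivAt (elow A B) (fderiv ℝ (elow A B) (tr (Z t q))) (tr (Z t q)) :=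
    ((H.smooth.elow (Z := tr (Z t q)) hm).differentiableAt one_ne_zero).hasFDerivAt
  have hN : HasDerivWithinAt (fun t => nx k (Z t q)) ((κ / T A (Z t q).1.1 3) •
      fderiv ℝ (elow A B) (tr (Z t q)) (nx k (Z t q))) (Icc 0 ε) t := by
    have h1 := (nx (n := n) k).hasFDerivAt.comp_hasDerivWithinAt t (H.deriv q hq t ht)
    rw [map_smul, nx_efull (H.smooth.bichar hm) (H.smooth.transport hm),
      H.smooth.fderiv_elow_tr hm, nx_tr] at h1
    exact h1
  have ha : HasDerivWithinAt (fun t => ((Z t q).1.2.1 k).1 3) (κ / T A (Z t q).1.1 3 *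
      fderiv ℝ (fun z : ZVal n => T A z.1.1 3) (tr (Z t q)) (nx k (Z t q))) (Icc 0 ε) t := by
    have h1 := hasDerivWithinAt_pi.1 (H.deriv_v₁ hq ht k).fst 3
    refine h1.congr_deriv ?_
    show κ / T A (Z t q).1.1 3 * (fderiv ℝ (bichar A) (Z t q).1.1 ((Z t q).1.2.1 k)).1 3 = _
    rw [H.smooth.fderiv_bichar hm, ← H.smooth.fderiv_T hm]
    congr 1
    have h2 : HasFDerivAt (fun v => T A v 3) (fderiv ℝ (fun v => T A v 3) (tr (Z t q)).1.1)
        (tr (Z t q)).1.1 :=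
      ((H.smooth.contDiffAt_T hm 3).differentiableAt three_ne_zero).hasFDerivAt
    have h3 := h2.comp (tr (Z t q)) (((ContinuousLinearMap.fst ℝ Ph _).comp
      (ContinuousLinearMap.fst ℝ XVal (WVal n))).hasFDerivAt)
    exact (congrArg (fun L : ZVal n →L[ℝ] ℝ => L (nx k (Z t q))) (hT'.unique h3)).symm
  exact hasDerivWithinAt_normalized (E := elow A B) (τ := fun z : ZVal n => T A z.1.1 3)
    (z := fun t => tr (Z t q)) (N := fun t => nx k (Z t q))
    (a := fun t => ((Z t q).1.2.1 k).1 3) hE' hT' hp.ne' (H.deriv_tr hq ht) hN ha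

set_option synthInstance.maxSize 10000 in
set_option synthInstance.maxHeartbeats 400000 in
set_option maxHeartbeats 1000000 in
theorem hasFDerivAt_direction (hq : q ∈ ball (0 : Fin 3 → ℝ) 2) {t : ℝ} (ht : t ∈ Icc 0 ε) :
    HasFDerivAt (fun q => tr (Z t q)) (dirDiff A B (Z t q)) q := by
  have hb : ∀ {q : Fin 3 → ℝ}, q ∈ ball (0 : Fin 3 → ℝ) 2 → q ∈ closedBall (0 : Fin 3 → ℝ) 2 :=
    fun hq => ball_subset_closedBall hq
  have hYc : ContinuousOn (fun x : ℝ × (Fin 3 → ℝ) => tr (Z x.1 x.2)) (Icc 0 ε ×ˢ ball 0 2) :=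
    (tr (n := n)).continuous.comp_continuousOn (H.cont.mono (prod_mono_right ball_subset_closedBall))
  refine hasFDerivAt_ode_family (G := timeField A B κ) (Y := fun t q => tr (Z t q))
    (D := fun t => dirDiff A B (Z t q)) H.smooth.isOpen_regular
    (fun z hz => (H.smooth.contDiffAt_timeField hz.1 hz.2.ne').contDiffWithinAt)
    H.eps_pos.le isOpen_ball hYc
    (fun q hq t ht => ⟨H.mem q (hb hq) t ht, H.pos q (hb hq) t ht⟩)
    (fun q hq t ht => H.deriv_tr (hb hq) ht) hq (fun t ht => ?_) ?_ t ht
  · have h1 : HasDerivWithinAt (fun t => dirDiff A B (Z t q)) _ (Icc 0 ε) t :=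
      hasDerivWithinAt_sum_smulRight fun k => H.deriv_dirDeriv (hb hq) ht k
    exact h1.congr_deriv (sum_smulRight_comp _ _)
  · have h0 : dirDiff A B (Z 0 q) = ∑ k, (ContinuousLinearMap.proj k : (Fin 3 → ℝ) →L[ℝ] ℝ).smulRight
        (nx k ((X0 y₀ q, W0 n) : ZVal n)) := by
      rw [H.init q (hb hq)]
      refine Finset.sum_congr rfl fun k _ => ?_
      simp [dirDeriv, X0]
    show HasFDerivAt (fun q => tr (Z 0 q)) (dirDiff A B (Z 0 q)) q
    rw [h0]
    refine (hasFDerivAt_initial y₀ q).congr_of_eventuallyEq ?_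
    filter_upwards [isOpen_ball.mem_nhds hq] with q' hq'
    rw [H.init q' (hb hq'), tr_initial]

theorem continuousAt_joint (hq : q ∈ ball (0 : Fin 3 → ℝ) 2) {t : ℝ} (ht : t ∈ Ioo 0 ε) :
    ContinuousAt (fun x : ℝ × (Fin 3 → ℝ) => Z x.1 x.2) (t, q) :=
  H.cont.continuousAt (prod_mem_nhds (Icc_mem_nhds ht.1 ht.2)
    (mem_of_superset (isOpen_ball.mem_nhds hq) ball_subset_closedBall))

set_option maxHeartbeats 1000000 in
theorem hasFDerivAt_joint (hq : q ∈ ball (0 : Fin 3 → ℝ) 2) {t : ℝ} (ht : t ∈ Ioo 0 ε) :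
    HasFDerivAt (fun x : ℝ × (Fin 3 → ℝ) => tr (Z x.1 x.2))
      (((ContinuousLinearMap.toSpanSingleton ℝ (timeField A B κ (Z t q)))).coprod
        (dirDiff A B (Z t q))) (t, q) := by
  have hb : ∀ {q : Fin 3 → ℝ}, q ∈ ball (0 : Fin 3 → ℝ) 2 → q ∈ closedBall (0 : Fin 3 → ℝ) 2 :=
    fun hq => ball_subset_closedBall hq
  have hnh : ∀ᶠ x : ℝ × (Fin 3 → ℝ) in 𝓝 (t, q), x.1 ∈ Ioo 0 ε ∧ x.2 ∈ ball (0 : Fin 3 → ℝ) 2 :=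
    prod_mem_nhds (isOpen_Ioo.mem_nhds ht) (isOpen_ball.mem_nhds hq)
  have hm := H.mem q (hb hq) t (Ioo_subset_Icc_self ht)
  have hp := H.pos q (hb hq) t (Ioo_subset_Icc_self ht)
  have hZ := H.continuousAt_joint hq ht
  refine (hasStrictFDerivAt_uncurry_coprod (f := fun t q => tr (Z t q)) (u := (t, q))
    (f₁ := fun t q => ContinuousLinearMap.toSpanSingleton ℝ (timeField A B κ (Z t q)))
    (f₂ := fun t q => dirDiff A B (Z t q)) ?_ ?_ ?_ ?_).hasFDerivAt
  · filter_upwards [hnh] with x hx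
    have h1 := H.deriv_tr (hb hx.2) (Ioo_subset_Icc_self hx.1)
    exact (h1.hasDerivAt (Icc_mem_nhds hx.1.1 hx.1.2)).hasFDerivAt
  · filter_upwards [hnh] with x hx
    exact H.hasFDerivAt_direction hx.2 (Ioo_subset_Icc_self hx.1)
  · exact continuousAt_toSpanSingleton
      (ContinuousAt.comp (g := timeField A B κ)
        (f := fun x : ℝ × (Fin 3 → ℝ) => Z x.1 x.2)
        (H.smooth.contDiffAt_timeField (κ := κ) hm hp.ne').continuousAt hZ)
  · have h1 : ContinuousAt (fun z : ZVal n => dirDiff A B z) (Z t q) := by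
      simp only [dirDiff]
      exact continuousAt_sum_smulRight fun k => H.smooth.continuousAt_dirDeriv hm hp.ne' k
    exact h1.comp (f := fun x : ℝ × (Fin 3 → ℝ) => Z x.1 x.2) hZ

theorem integral_eq (hq : q ∈ closedBall (0 : Fin 3 → ℝ) 2) {t : ℝ} (ht : t ∈ Icc 0 ε) :
    Z t q = (X0 y₀ q, W0 n) + ∫ τ in (0 : ℝ)..t, (κ / T A (Z τ q).1.1 3) • efull A B (Z τ q) := by
  have hc : ContinuousOn (fun τ => (κ / T A (Z τ q).1.1 3) • efull A B (Z τ q)) (Icc 0 ε) :=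
    (continuousOn_const.div (H.continuousOn_T hq 3) fun t ht => (H.pos q hq t ht).ne').smul
      fun τ hτ => (H.smooth.efull (H.mem q hq τ hτ)).comp_continuousWithinAt
        (f := fun τ => Z τ q) (H.continuousOn_time hq τ hτ)
  have hsub : Icc 0 t ⊆ Icc 0 ε := Icc_subset_Icc_right ht.2
  rw [intervalIntegral.integral_eq_sub_of_hasDeriv_right_of_le (f := fun t => Z t q) ht.1
    ((H.continuousOn_time hq).mono hsub)
    (fun x hx => ((H.deriv q hq x ⟨hx.1.le, hx.2.le.trans ht.2⟩).hasDerivAt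
      (Icc_mem_nhds hx.1 (hx.2.trans_le ht.2))).hasDerivWithinAt)
    ((hc.mono hsub).intervalIntegrable_of_Icc ht.1), H.init q hq]
  abel

/-- Uniqueness for the integral equations. -/
theorem unique (hq : q ∈ closedBall (0 : Fin 3 → ℝ) 2) {ε' : ℝ} (hε' : ε' ≤ ε) {y : ℝ → ZVal n}
    (hyc : ContinuousOn y (Icc 0 ε'))
    (hy : ∀ t ∈ Icc 0 ε', ContinuousOn (fun τ => (κ / T A (y τ).1.1 3) • efull A B (y τ)) (Icc 0 t) →
      y t = (X0 y₀ q, W0 n) + ∫ τ in (0 : ℝ)..t, (κ / T A (y τ).1.1 3) • efull A B (y τ)) :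
    EqOn (fun t => Z t q) y (Icc 0 ε') := by
  have hsub : Icc 0 ε' ⊆ Icc 0 ε := Icc_subset_Icc_right hε'
  refine eqOn_of_integral_eq (g := fun z : ZVal n => (κ / T A z.1.1 3) • efull A B z)
    H.smooth.isOpen_regular ?_ tr ?_
    ((H.continuousOn_time hq).mono hsub) hyc
    (fun t ht => ⟨H.mem q hq t (hsub ht), H.pos q hq t (hsub ht)⟩)
    (fun t ht => H.integral_eq hq (hsub ht)) hy
  · exact fun z hz => ((continuousAt_const.div (H.smooth.contDiffAt_T_three hz.1).continuousAt (ne_of_gt hz.2)).smul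
      (H.smooth.efull hz.1)).continuousWithinAt
  · intro P hP
    have hG : ContDiffAt ℝ 1 (timeField A B κ) (tr P) :=
      H.smooth.contDiffAt_timeField (z := tr P) hP.1 hP.2.ne'
    obtain ⟨K, s, hs, hK⟩ := hG.exists_lipschitzOnWith
    have hc1 : ContinuousAt (fun z : ZVal n => |κ / T A z.1.1 3| * (‖fderiv ℝ (bichar A) z.1.1‖ +
        n * ‖transport A B z.1.1‖)) P := by
      have hv : ContinuousAt (fun z : ZVal n => z.1.1) P := by fun_prop
      refine (continuousAt_const.div (H.smooth.contDiffAt_T_three hP.1).continuousAt (ne_of_gt hP.2)).abs.mul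
        (ContinuousAt.add ?_ (continuousAt_const.mul ?_))
      · exact (((H.smooth.bichar hP.1).fderiv_right (m := 2) (by norm_num)).continuousAt.comp
          (f := fun z : ZVal n => z.1.1) hv).norm
      · exact ((H.smooth.transport hP.1).continuousAt.comp (f := fun z : ZVal n => z.1.1) hv).norm
    set M := |κ / T A P.1.1 3| * (‖fderiv ℝ (bichar A) P.1.1‖ + n * ‖transport A B P.1.1‖) + 1
      with hM
    have h1 := hc1.eventually_lt_const (show _ < M from lt_add_one _)
    have h2 : tr ⁻¹' s ∈ 𝓝 P := (tr (n := n)).continuous.continuousAt.preimage_mem_nhds hs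
    refine ⟨max K M, _, inter_mem h2 h1, fun z hz z' hz' => ⟨?_, fun htr => ?_⟩⟩
    · have h3 := hK.dist_le_mul _ hz.1 _ hz'.1
      rw [dist_eq_norm, dist_eq_norm] at h3
      rw [map_smul, map_smul]
      refine le_trans h3 ?_
      gcongr
      exact le_max_left _ _
    · have hv1 : ∀ z : ZVal n, (tr z).1.1 = z.1.1 := fun z => rfl
      have hv : z.1.1 = z'.1.1 := by rw [← hv1 z, htr, hv1]
      rw [hv, ← smul_sub, ← hv, norm_smul, Real.norm_eq_abs]
      have h3 := norm_efull_sub_le A B htr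
      have h4 : |κ / T A z.1.1 3| * (‖fderiv ℝ (bichar A) z.1.1‖ + n * ‖transport A B z.1.1‖) < M :=
        hz.2
      calc _ ≤ |κ / T A z.1.1 3| * ((‖fderiv ℝ (bichar A) z.1.1‖ + n * ‖transport A B z.1.1‖) *
            ‖z - z'‖) := by gcongr
        _ ≤ M * ‖z - z'‖ := by rw [← mul_assoc]; gcongr
        _ ≤ _ := by gcongr; exact le_max_right _ _

end ConoidFlow

end Dependence


section RegularJets

open Filter Topology

variable {n : ℕ} {A : CoefA} {B : CoefB n} {Ω : Set Pt}

/-- The entries of the adjugate of a `3 × 3` matrix. -/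
def adj3 (M : Fin 3 → Fin 3 → ℝ) (k i : Fin 3) : ℝ :=
  M (i + 1) (k + 1) * M (i + 2) (k + 2) - M (i + 1) (k + 2) * M (i + 2) (k + 1)

theorem inv_eq_adj3 (M : Matrix (Fin 3) (Fin 3) ℝ) (k i : Fin 3) :
    M⁻¹ k i = M.det⁻¹ * adj3 M k i := by
  rw [Matrix.inv_def, Ring.inverse_eq_inv', Matrix.smul_apply, smul_eq_mul,
    Matrix.adjugate_fin_three]
  congr 1
  fin_cases k <;> fin_cases i <;> simp [adj3] <;> ring

/-- The jets at which the derivatives along the conoid make sense. -/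
def IsRegular (A : CoefA) (Ω : Set Pt) (S : Jet n) : Prop := S.2.1.1.1 ∈ Ω ∧ (K A S).det ≠ 0

theorem IsConeJet.isRegular {S : Jet n} (hS : IsConeJet A Ω S) : IsRegular A Ω S :=
  ⟨hS.mem, hS.det_ne⟩

section

variable (h : SmoothCoef A B Ω)
include h

theorem SmoothCoef.contDiffAt_T_jet {S : Jet n} (hS : S.2.1.1.1 ∈ Ω) (α : Fin 4) :
    ContDiffAt ℝ 3 (fun S : Jet n => T A S.2.1.1 α) S :=
  (h.contDiffAt_T hS α).comp (f := fun S : Jet n => S.2.1.1) S (by fun_prop)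

theorem SmoothCoef.contDiffAt_K {S : Jet n} (hS : S.2.1.1.1 ∈ Ω) (i j : Fin 3) :
    ContDiffAt ℝ 3 (fun S : Jet n => K A S i j) S := by
  simp only [K, Matrix.of_apply]
  refine ((h.contDiffAt_T_jet hS _).mul (by fun_prop)).add (ContDiffAt.sum fun k _ => ?_)
  fun_prop

theorem SmoothCoef.contDiffAt_det {S : Jet n} (hS : S.2.1.1.1 ∈ Ω) :
    ContDiffAt ℝ 3 (fun S : Jet n => (K A S).det) S := by
  have hK := h.contDiffAt_K hS
  simp only [Matrix.det_fin_three]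
  exact (((((((hK 0 0).mul (hK 1 1)).mul (hK 2 2)).sub (((hK 0 0).mul (hK 1 2)).mul (hK 2 1))).sub
    (((hK 0 1).mul (hK 1 0)).mul (hK 2 2))).add (((hK 0 1).mul (hK 1 2)).mul (hK 2 0))).add
    (((hK 0 2).mul (hK 1 0)).mul (hK 2 1))).sub (((hK 0 2).mul (hK 1 1)).mul (hK 2 0))

theorem SmoothCoef.isOpen_isRegular : IsOpen {S : Jet n | IsRegular A Ω S} :=
  ContinuousOn.isOpen_inter_preimage (f := fun S : Jet n => (K A S).det)
    (fun _ hS => (h.contDiffAt_det hS).continuousAt.continuousWithinAt)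
    (h.isOpen.preimage (by fun_prop : Continuous fun S : Jet n => S.2.1.1.1)) isOpen_ne

theorem SmoothCoef.eventually_isRegular {S : Jet n} (hS : IsRegular A Ω S) :
    ∀ᶠ S in 𝓝 S, IsRegular A Ω S :=
  h.isOpen_isRegular.mem_nhds hS

theorem SmoothCoef.contDiffAt_inv_K {S : Jet n} (hS : IsRegular A Ω S) (k i : Fin 3) :
    ContDiffAt ℝ 3 (fun S : Jet n => (K A S)⁻¹ k i) S := by
  have hK := h.contDiffAt_K hS.1
  simp only [inv_eq_adj3, adj3]
  exact ((h.contDiffAt_det hS.1).inv hS.2).mul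
    (((hK _ _).mul (hK _ _)).sub ((hK _ _).mul (hK _ _)))

theorem SmoothCoef.contDiffAt_dl {S : Jet n} (hS : IsRegular A Ω S) (i : Fin 3) :
    ContDiffAt ℝ 3 (fun S : Jet n => dl A i S) S := by
  simp only [dl]
  exact ContDiffAt.sum fun k _ => ContDiffAt.mul (by fun_prop) (h.contDiffAt_inv_K hS k i)

theorem SmoothCoef.contDiffAt_dq {S : Jet n} (hS : IsRegular A Ω S) (i k : Fin 3) :
    ContDiffAt ℝ 3 (fun S : Jet n => dq A i k S) S := by
  simp only [dq]
  exact (h.contDiffAt_inv_K hS k i).sub (ContDiffAt.mul (by fun_prop) (h.contDiffAt_dl hS i))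

theorem SmoothCoef.contDiffAt_disp {S : Jet n} (hS : IsRegular A Ω S) (i : Fin 3) :
    ContDiffAt ℝ 1 (disp A B i) S := by
  have e : disp A B i = fun S => ((fun k => dq A i k S), dl A i S • KirchhoffConoid.elow A B S.2 +
      ∑ k, dq A i k S • nx k S.2) := funext fun S => Prod.ext rfl (disp_snd i S)
  rw [e]
  refine ContDiffAt.prodMk (contDiffAt_pi.2 fun k => (h.contDiffAt_dq hS i k).of_le (by norm_num)) ?_
  have h1 : ContDiffAt ℝ 1 (fun S : Jet n => KirchhoffConoid.elow A B S.2) S :=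
    (h.elow (Z := S.2) hS.1).comp S contDiffAt_snd
  refine (((h.contDiffAt_dl hS i).of_le (by norm_num)).smul h1).add
    (ContDiffAt.sum fun k _ => ((h.contDiffAt_dq hS i k).of_le (by norm_num)).smul ?_)
  exact (nx (n := n) k).contDiff.contDiffAt.comp S contDiffAt_snd

theorem SmoothCoef.contDiffAt_sigma {S : Jet n} (hS : IsRegular A Ω S) :
    ContDiffAt ℝ 3 (fun S : Jet n => sigma A S) S := by
  have h1 : ContDiffAt ℝ 3 (fun S : Jet n => |(K A S).det|) S :=
    (contDiffAt_abs hS.2).comp (g := fun x : ℝ => |x|) (f := fun S : Jet n => (K A S).det) S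
      (h.contDiffAt_det hS.1)
  exact (h1.sqrt (abs_ne_zero.2 hS.2)).inv (Real.sqrt_ne_zero'.2 (abs_pos.2 hS.2))

theorem SmoothCoef.contDiffAt_sig {S : Jet n} (hS : IsRegular A Ω S) (r s : Fin n) :
    ContDiffAt ℝ 3 (fun S : Jet n => sig A r s S) S :=
  (h.contDiffAt_sigma hS).mul (by fun_prop)

theorem SmoothCoef.contDiffAt_A_jet {S : Jet n} (hS : IsRegular A Ω S) (α β : Fin 4) :
    ContDiffAt ℝ 4 (fun S : Jet n => A S.2.1.1.1 α β) S :=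
  (h.smoothA _ hS.1 α β).comp (f := fun S : Jet n => S.2.1.1.1) S (by fun_prop)

theorem SmoothCoef.contDiffAt_B_jet {S : Jet n} (hS : IsRegular A Ω S) (r s : Fin n) (α : Fin 4) :
    ContDiffAt ℝ 2 (fun S : Jet n => B r s α S.2.1.1.1) S :=
  (h.smoothB _ hS.1 r s α).comp (f := fun S : Jet n => S.2.1.1.1) S (by fun_prop)

theorem SmoothCoef.contDiffAt_A_sig {S : Jet n} (hS : IsRegular A Ω S) (α β : Fin 4) (r s : Fin n) :
    ContDiffAt ℝ 3 (fun S : Jet n => A S.2.1.1.1 α β * sig A r s S) S :=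
  ((h.contDiffAt_A_jet hS α β).of_le (by norm_num)).mul (h.contDiffAt_sig hS r s)

theorem SmoothCoef.contDiffAt_B_sig {S : Jet n} (hS : IsRegular A Ω S) (r t : Fin n) (α : Fin 4)
    (s : Fin n) : ContDiffAt ℝ 2 (fun S : Jet n => B r t α S.2.1.1.1 * sig A r s S) S :=
  (h.contDiffAt_B_jet hS r t α).mul ((h.contDiffAt_sig hS r s).of_le (by norm_num))

theorem SmoothCoef.contDiffAt_dx {S : Jet n} (hS : IsRegular A Ω S) {φ : Jet n → ℝ}
    {m k : WithTop ℕ∞} (hφ : ContDiffAt ℝ k φ S) (hk : m + 1 ≤ k) (hm : m ≤ 1) (i : Fin 3) :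
    ContDiffAt ℝ m (dx A B i φ) S :=
  (hφ.fderiv_right hk).clm_apply ((h.contDiffAt_disp hS i).of_le hm)

end

section ConeDerivatives

variable {S : Jet n}

theorem dx_comp_y {g : Pt → ℝ} (hg : DifferentiableAt ℝ g S.2.1.1.1) (i : Fin 3) :
    dx A B i (fun S => g S.2.1.1.1) S =
      ∑ μ, pd μ g S.2.1.1.1 * dx A B i (fun S => S.2.1.1.1 μ) S := by
  have h1 : HasFDerivAt (fun S : Jet n => S.2.1.1.1) ((ContinuousLinearMap.fst ℝ Pt (Fin 3 → ℝ)).comp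
    ((ContinuousLinearMap.fst ℝ Ph _).comp ((ContinuousLinearMap.fst ℝ XVal (WVal n)).comp
      (ContinuousLinearMap.snd ℝ (Fin 3 → ℝ) (ZVal n))))) S :=
    ContinuousLinearMap.hasFDerivAt ((ContinuousLinearMap.fst ℝ Pt (Fin 3 → ℝ)).comp
    ((ContinuousLinearMap.fst ℝ Ph _).comp ((ContinuousLinearMap.fst ℝ XVal (WVal n)).comp
      (ContinuousLinearMap.snd ℝ (Fin 3 → ℝ) (ZVal n)))))
  have h2 : ∀ μ, dx A B i (fun S => S.2.1.1.1 μ) S = (disp A B i S).2.1.1.1 μ := fun μ => by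
    rw [dx, ((hasFDerivAt_pi'.1 h1) μ).fderiv]; rfl
  simp only [h2]
  have h3 := hg.hasFDerivAt.comp S h1
  simp only [Function.comp_def] at h3
  rw [dx, h3.fderiv, ContinuousLinearMap.comp_apply, fderiv_apply_eq_sum_pd]
  rfl

theorem dx_comp_y_cone (hS : IsConeJet A Ω S) {g : Pt → ℝ} (hg : DifferentiableAt ℝ g S.2.1.1.1)
    (i : Fin 3) : dx A B i (fun S => g S.2.1.1.1) S = pdCon i g S.2.1.1 := by
  rw [dx_comp_y hg, Fin.sum_univ_castSucc]
  simp only [dx_yco_castSucc hS.det_ne]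
  rw [show Fin.last 3 = 3 from rfl, dx_yco_three hS, pdCon]
  simp
  ring

theorem differentiableAt_p (j : Fin 3) : DifferentiableAt ℝ (fun S : Jet n => S.2.1.1.2 j) S := by
  fun_prop

theorem differentiableAt_cov (β : Fin 4) :
    DifferentiableAt ℝ (fun S : Jet n => cov S.2.1.1.2 β) S := by
  have := (contDiffAt_pi.1 (((contDiff_cov 1).comp (f := fun S : Jet n => S.2.1.1.2)
      (by fun_prop)).contDiffAt (x := S)) β)
  exact this.differentiableAt one_ne_zero

theorem dx_cov (i : Fin 3) (β : Fin 4) : dx A B i (fun S => cov S.2.1.1.2 β) S =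
    dcov (fun j => dx A B i (fun S => S.2.1.1.2 j) S) β := by
  induction β using Fin.lastCases with
  | last =>
    rw [show (fun S : Jet n => cov S.2.1.1.2 (Fin.last 3)) = fun _ => (1 : ℝ) from
      funext fun S => cov_three _, dx_const]
    exact (dcov_three _).symm
  | cast j =>
    rw [dcov_castSucc]
    simp only [cov_castSucc]

theorem SmoothCoef.dx_T (h : SmoothCoef A B Ω) (hS : S.2.1.1.1 ∈ Ω) (i : Fin 3) (α : Fin 4) :
    dx A B i (fun S => T A S.2.1.1 α) S = ∑ k, (K A S)⁻¹ k i *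
      (S.1 k * dT A S.2.1.1 (KirchhoffConoid.bichar A S.2.1.1) α + ∑ l,
        ((if l = k then 1 else 0) - S.1 l * S.1 k) * dT A S.2.1.1 (S.2.1.2.1 l) α) := by
  have h1 : HasFDerivAt (fun S : Jet n => S.2.1.1) ((ContinuousLinearMap.fst ℝ Ph _).comp
      ((ContinuousLinearMap.fst ℝ XVal (WVal n)).comp
        (ContinuousLinearMap.snd ℝ (Fin 3 → ℝ) (ZVal n)))) S :=
    ContinuousLinearMap.hasFDerivAt ((ContinuousLinearMap.fst ℝ Ph _).comp
      ((ContinuousLinearMap.fst ℝ XVal (WVal n)).comp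
        (ContinuousLinearMap.snd ℝ (Fin 3 → ℝ) (ZVal n))))
  have h2 := ((h.contDiffAt_T hS α).differentiableAt three_ne_zero).hasFDerivAt
  have h3 := HasFDerivAt.comp (f := fun S : Jet n => S.2.1.1) S h2 h1
  simp only [Function.comp_def] at h3
  have h4 : (disp A B i S).2.1.1 = dl A i S • KirchhoffConoid.bichar A S.2.1.1 +
      ∑ k, dq A i k S • S.2.1.2.1 k := rfl
  rw [dx, h3.fderiv, ← dl_dq_eq]
  show fderiv ℝ (fun v => T A v α) S.2.1.1 (disp A B i S).2.1.1 = _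
  rw [h4, map_add, map_sum, map_smul, h.fderiv_T hS, smul_eq_mul]
  exact congrArg₂ _ rfl (Finset.sum_congr rfl fun k _ => by
    rw [map_smul, h.fderiv_T hS, smul_eq_mul])

theorem SmoothCoef.sum_dx_T (h : SmoothCoef A B Ω) (hS : IsConeJet A Ω S) :
    ∑ i, dx A B i (fun S => T A S.2.1.1 i.castSucc) S =
      (∑ i : Fin 3, ∑ β, cov S.2.1.1.2 β * pdCon i (fun x => A x i.castSucc β) S.2.1.1) +
      ∑ i : Fin 3, ∑ j : Fin 3, A S.2.1.1.1 i.castSucc j.castSucc *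
        dx A B i (fun S => S.2.1.1.2 j) S := by
  rw [← Finset.sum_add_distrib]
  refine Finset.sum_congr rfl fun i _ => ?_
  have hA : ∀ β, DifferentiableAt ℝ (fun S : Jet n => A S.2.1.1.1 i.castSucc β) S := fun β =>
    (h.contDiffAt_A_jet hS.isRegular _ _).differentiableAt four_ne_zero
  simp only [T]
  rw [dx_sum (φ := fun β (S : Jet n) => A S.2.1.1.1 i.castSucc β * cov S.2.1.1.2 β)
    fun β _ => (hA β).mul (differentiableAt_cov β)]
  have e : ∀ β, dx A B i (fun S => A S.2.1.1.1 i.castSucc β * cov S.2.1.1.2 β) S =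
      cov S.2.1.1.2 β * pdCon i (fun x => A x i.castSucc β) S.2.1.1 +
        A S.2.1.1.1 i.castSucc β * dcov (fun j => dx A B i (fun S => S.2.1.1.2 j) S) β := fun β => by
    rw [dx_mul (hA β) (differentiableAt_cov β), dx_cov,
      dx_comp_y_cone hS (g := fun x => A x i.castSucc β) (h.differentiableAt hS.mem _ _)]
    ring
  simp only [e, Finset.sum_add_distrib, sum_mul_dcov]

end ConeDerivatives

section Liouville

variable {S : Jet n}

theorem hasDerivAt_det_three {M : ℝ → Matrix (Fin 3) (Fin 3) ℝ} {M' : Fin 3 → Fin 3 → ℝ} {t : ℝ}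
    (hM : ∀ i j, HasDerivAt (fun t => M t i j) (M' i j) t) :
    HasDerivAt (fun t => (M t).det) (∑ i, ∑ j, adj3 (M t) j i * M' i j) t := by
  simp only [Matrix.det_fin_three]
  refine ((((((((hM 0 0).mul (hM 1 1)).mul (hM 2 2)).sub
    (((hM 0 0).mul (hM 1 2)).mul (hM 2 1))).sub
    (((hM 0 1).mul (hM 1 0)).mul (hM 2 2))).add (((hM 0 1).mul (hM 1 2)).mul (hM 2 0))).add
    (((hM 0 2).mul (hM 1 0)).mul (hM 2 1))).sub
    (((hM 0 2).mul (hM 1 1)).mul (hM 2 0))).congr_deriv ?_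
  simp [Fin.sum_univ_three, adj3]
  ring

/-- Logarithmic derivative of `det K` along the bicharacteristics. -/
theorem SmoothCoef.fderiv_det (h : SmoothCoef A B Ω) (hS : IsRegular A Ω S) :
    fderiv ℝ (fun S : Jet n => (K A S).det) S (0, KirchhoffConoid.elow A B S.2) =
      (K A S).det * ∑ i, dx A B i (fun S => T A S.2.1.1 i.castSucc) S := by
  have hl : HasDerivAt (fun ε : ℝ => S + ε • ((0, KirchhoffConoid.elow A B S.2) : Jet n))
      (0, KirchhoffConoid.elow A B S.2) 0 := by
    generalize ((0, KirchhoffConoid.elow A B S.2) : Jet n) = w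
    have := ((hasDerivAt_id (0 : ℝ)).smul_const w).const_add S
    rwa [one_smul] at this
  have h0 : S + (0 : ℝ) • ((0, KirchhoffConoid.elow A B S.2) : Jet n) = S := by simp
  have hK : ∀ i j, HasDerivAt
      (fun ε : ℝ => K A (S + ε • ((0, KirchhoffConoid.elow A B S.2) : Jet n)) i j)
      (S.1 j * dT A S.2.1.1 (KirchhoffConoid.bichar A S.2.1.1) i.castSucc + ∑ l,
        ((if l = j then 1 else 0) - S.1 l * S.1 j) * dT A S.2.1.1 (S.2.1.2.1 l) i.castSucc) 0 :=
    fun i j => by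
    have hq : ∀ k, HasDerivAt (fun ε : ℝ => (S + ε • ((0, KirchhoffConoid.elow A B S.2) : Jet n)).1 k)
        0 0 := fun k => hasDerivAt_pi.1 hl.fst k
    have hT := hasDerivAt_T (A := A) (γ := fun ε : ℝ =>
      (S + ε • ((0, KirchhoffConoid.elow A B S.2) : Jet n)).2.1.1) (t := 0)
      (γ' := KirchhoffConoid.bichar A S.2.1.1)
      (fun α β => by rw [h0]; exact h.differentiableAt hS.1 α β) hl.snd.fst.fst i.castSucc
    have hy : ∀ l, HasDerivAt (fun ε : ℝ =>
        ((S + ε • ((0, KirchhoffConoid.elow A B S.2) : Jet n)).2.1.2.1 l).1 i.castSucc)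
        (dT A S.2.1.1 (S.2.1.2.1 l) i.castSucc) 0 := fun l => by
      rw [← h.fderiv_bichar hS.1]
      exact hasDerivAt_pi.1 (hasDerivAt_pi.1 hl.snd.fst.snd.fst l).fst i.castSucc
    simp only [K, Matrix.of_apply]
    refine ((hT.mul (hq j)).add (HasDerivAt.fun_sum fun l _ => (hy l).mul
      (((hasDerivAt_const (0 : ℝ) (if l = j then (1 : ℝ) else 0))).sub
        ((hq l).mul (hq j))))).congr_deriv ?_
    simp only [h0, mul_zero, zero_mul, add_zero, sub_zero]
    rw [mul_comm]
    congr 1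
    exact Finset.sum_congr rfl fun l _ => by simp [mul_comm]
  have h2 : HasFDerivAt (fun S : Jet n => (K A S).det) (fderiv ℝ (fun S : Jet n => (K A S).det) S)
      (S + (0 : ℝ) • ((0, KirchhoffConoid.elow A B S.2) : Jet n)) := by
    rw [h0]; exact ((h.contDiffAt_det hS.1).differentiableAt three_ne_zero).hasFDerivAt
  have h3 := h2.comp_hasDerivAt (0 : ℝ) hl
  have h4 := hasDerivAt_det_three hK
  simp only [h0] at h4
  rw [h3.unique h4]
  simp only [h.dx_T hS.1, inv_eq_adj3, Finset.mul_sum]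
  refine Finset.sum_congr rfl fun i _ => Finset.sum_congr rfl fun j _ => ?_
  have hd := hS.2
  field_simp

theorem hasDerivAt_invSqrt {x : ℝ} (hx : x ≠ 0) :
    HasDerivAt (fun x => (Real.sqrt |x|)⁻¹) (-(1 / 2) * (Real.sqrt |x|)⁻¹ * x⁻¹) x := by
  have hs : Real.sqrt |x| ≠ 0 := Real.sqrt_ne_zero'.2 (abs_pos.2 hx)
  have h1 := (((hasDerivAt_abs hx)).sqrt (abs_ne_zero.2 hx)).inv hs
  refine h1.congr_deriv ?_
  rw [Real.sq_sqrt (abs_nonneg x)]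
  rcases hx.lt_or_gt with h | h
  · rw [abs_of_neg h, sign_neg h] at *
    field_simp
    simp
  · rw [abs_of_pos h, sign_pos h] at *
    field_simp
    simp

theorem SmoothCoef.fderiv_sigma (h : SmoothCoef A B Ω) (hS : IsRegular A Ω S) (w : Jet n) :
    fderiv ℝ (fun S : Jet n => sigma A S) S w =
      -(1 / 2) * sigma A S * (K A S).det⁻¹ * fderiv ℝ (fun S : Jet n => (K A S).det) S w := by
  have h1 := (hasDerivAt_invSqrt hS.2).comp_hasFDerivAt S
    ((h.contDiffAt_det hS.1).differentiableAt three_ne_zero).hasFDerivAt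
  have h2 : HasFDerivAt (fun S : Jet n => sigma A S) _ S := h1
  rw [h2.fderiv]
  rfl

/-- The transport equations of the `σ^r_s`. -/
theorem SmoothCoef.transport_identity (h : SmoothCoef A B Ω) (hS : IsConeJet A Ω S) (r s : Fin n) :
    2 * ∑ i, dx A B i (fun S => sig A r s S * T A S.2.1.1 i.castSucc) S =
      sig A r s S * (∑ i : Fin 3, ∑ j : Fin 3, A S.2.1.1.1 i.castSucc j.castSucc *
        dx A B i (fun S => S.2.1.1.2 j) S) +
      ∑ t, (∑ α, B t r α S.2.1.1.1 * cov S.2.1.1.2 α) * sig A t s S := by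
  have hr := hS.isRegular
  have hsd : DifferentiableAt ℝ (fun S : Jet n => sigma A S) S :=
    (h.contDiffAt_sigma hr).differentiableAt three_ne_zero
  have hwd : DifferentiableAt ℝ (fun S : Jet n => S.2.2.1 r s) S := by fun_prop
  have hgd : DifferentiableAt ℝ (fun S : Jet n => sig A r s S) S :=
    (h.contDiffAt_sig hr r s).differentiableAt three_ne_zero
  have hTd : ∀ i : Fin 3, DifferentiableAt ℝ (fun S : Jet n => T A S.2.1.1 i.castSucc) S := fun i =>
    (h.contDiffAt_T_jet hr.1 _).differentiableAt three_ne_zero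
  have along : ∀ φ : Jet n → ℝ, ∑ i, T A S.2.1.1 i.castSucc * dx A B i φ S =
      fderiv ℝ φ S (0, KirchhoffConoid.elow A B S.2) := fun φ => by
    rw [← sum_T_smul_disp hS.unit hS.det_ne, map_sum]
    exact Finset.sum_congr rfl fun i _ => by rw [map_smul, smul_eq_mul, dx]
  have e1 : ∑ i, dx A B i (fun S => sig A r s S * T A S.2.1.1 i.castSucc) S =
      fderiv ℝ (fun S : Jet n => sig A r s S) S (0, KirchhoffConoid.elow A B S.2) +
        sig A r s S * ∑ i, dx A B i (fun S => T A S.2.1.1 i.castSucc) S := by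
    rw [← along, Finset.mul_sum, ← Finset.sum_add_distrib]
    exact Finset.sum_congr rfl fun i _ => by rw [dx_mul hgd (hTd i)]; ring
  have e2 : fderiv ℝ (fun S : Jet n => sig A r s S) S (0, KirchhoffConoid.elow A B S.2) =
      fderiv ℝ (fun S : Jet n => sigma A S) S (0, KirchhoffConoid.elow A B S.2) * S.2.2.1 r s +
        sigma A S * mmul (KirchhoffConoid.transport A B S.2.1.1) S.2.2.1 r s := by
    have h1 : HasFDerivAt (fun S : Jet n => S.2.2.1 r s)
        ((wco r s).comp (ContinuousLinearMap.snd ℝ (Fin 3 → ℝ) (ZVal n))) S :=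
      ContinuousLinearMap.hasFDerivAt ((wco r s).comp
        (ContinuousLinearMap.snd ℝ (Fin 3 → ℝ) (ZVal n)))
    have h2 : HasFDerivAt (fun S : Jet n => sig A r s S) _ S := hsd.hasFDerivAt.mul h1
    rw [h2.fderiv]
    simp only [add_apply, smul_apply, smul_eq_mul]
    have h3 : ((wco r s).comp (ContinuousLinearMap.snd ℝ (Fin 3 → ℝ) (ZVal n)))
      (0, KirchhoffConoid.elow A B S.2) =
        mmul (KirchhoffConoid.transport A B S.2.1.1) S.2.2.1 r s := rfl
    rw [h3]
    ring
  have e3 : mmul (KirchhoffConoid.transport A B S.2.1.1) S.2.2.1 r s =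
      1 / 2 * ∑ t, (∑ α, B t r α S.2.1.1.1 * cov S.2.1.1.2 α) * S.2.2.1 t s -
        1 / 2 * (∑ i : Fin 3, ∑ β, cov S.2.1.1.2 β * pdCon i (fun x => A x i.castSucc β) S.2.1.1) *
          S.2.2.1 r s := by
    simp only [mmul, KirchhoffConoid.transport, add_mul, Finset.sum_add_distrib, ite_mul, zero_mul,
      Finset.sum_ite_eq, Finset.mem_univ, if_true]
    generalize (∑ i : Fin 3, ∑ β, cov S.2.1.1.2 β * pdCon i (fun x => A x i.castSucc β) S.2.1.1) = Y
    have : ∀ t, 1 / 2 * (∑ α, B t r α S.2.1.1.1 * cov S.2.1.1.2 α) * S.2.2.1 t s =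
      1 / 2 * ((∑ α, B t r α S.2.1.1.1 * cov S.2.1.1.2 α) * S.2.2.1 t s) := fun t => by ring
    simp only [this]
    rw [← Finset.mul_sum]
    ring
  have e4 : ∑ t, (∑ α, B t r α S.2.1.1.1 * cov S.2.1.1.2 α) * sig A t s S =
      sigma A S * ∑ t, (∑ α, B t r α S.2.1.1.1 * cov S.2.1.1.2 α) * S.2.2.1 t s := by
    rw [Finset.mul_sum]
    exact Finset.sum_congr rfl fun t _ => by rw [sig]; ring
  rw [e1, e2, h.fderiv_sigma hr, h.fderiv_det hr, e3, h.sum_dx_T hS, e4]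
  have hd := hS.det_ne
  simp only [sig]
  field_simp
  ring

end Liouville

end RegularJets


section Divergence

open Filter Topology

variable {n : ℕ} {A : CoefA} {B : CoefB n} {Ω : Set Pt}

theorem wave_identity {a W : Fin 4 → Fin 4 → ℝ} {p : Fin 3 → ℝ} (ha : ∀ α β, a α β = a β α)
    (hW : ∀ α β, W α β = W β α) (hp : ∑ α, (∑ β, a α β * cov p β) * cov p α = 0) :
    (∑ i : Fin 3, ∑ j : Fin 3, a i.castSucc j.castSucc *
        ((W i.castSucc j.castSucc - p i * W 3 j.castSucc) - p j * (W i.castSucc 3 - p i * W 3 3))) +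
      2 * ∑ i : Fin 3, (∑ β, a i.castSucc β * cov p β) * (W i.castSucc 3 - p i * W 3 3) =
      ∑ l, ∑ m, a l m * W l m := by
  have a10 := ha 1 0
  have a20 := ha 2 0
  have a21 := ha 2 1
  have a30 := ha 3 0
  have a31 := ha 3 1
  have a32 := ha 3 2
  have w10 := hW 1 0
  have w20 := hW 2 0
  have w21 := hW 2 1
  have w30 := hW 3 0
  have w31 := hW 3 1
  have w32 := hW 3 2
  have c0 : cov p 0 = p 0 := cov_castSucc p 0
  have c1 : cov p 1 = p 1 := cov_castSucc p 1
  have c2 : cov p 2 = p 2 := cov_castSucc p 2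
  have c3 : cov p 3 = 1 := cov_three p
  simp only [Fin.sum_univ_three, Fin.sum_univ_four, c0, c1, c2, c3] at hp ⊢
  rw [show Fin.castSucc (0 : Fin 3) = 0 from rfl, show Fin.castSucc (1 : Fin 3) = 1 from rfl,
    show Fin.castSucc (2 : Fin 3) = 2 from rfl]
  rw [a10, a20, a21, a30, a31, a32] at hp ⊢
  rw [w10, w20, w21, w30, w31, w32]
  linear_combination (-W 3 3) * hp

section

variable {f u : Fin n → Pt → ℝ} (hu : IsSolution A B f Ω u) (hΩ : IsOpen Ω)
include hu hΩ

theorem IsSolution.contDiffAt {x : Pt} (hx : x ∈ Ω) (r : Fin n) : ContDiffAt ℝ 1 (u r) x :=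
  (hu.contDiffOn r).contDiffAt (hΩ.mem_nhds hx)

theorem IsSolution.differentiableAt {x : Pt} (hx : x ∈ Ω) (r : Fin n) :
    DifferentiableAt ℝ (u r) x :=
  (hu.contDiffAt hΩ hx r).differentiableAt one_ne_zero

omit hΩ in
theorem IsSolution.hasFDerivAt_pd {x : Pt} (hx : x ∈ Ω) (r : Fin n) (α : Fin 4) :
    HasFDerivAt (pd α (u r)) ((ContinuousLinearMap.apply ℝ ℝ (Pi.single α 1 : Pt)).comp
      (fderiv ℝ (fderiv ℝ (u r)) x)) x :=
  (ContinuousLinearMap.apply ℝ ℝ (Pi.single α 1 : Pt)).hasFDerivAt.comp x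
    (hu.twice r x hx).hasFDerivAt

omit hΩ in
theorem IsSolution.differentiableAt_pd {x : Pt} (hx : x ∈ Ω) (r : Fin n) (α : Fin 4) :
    DifferentiableAt ℝ (pd α (u r)) x :=
  (hu.hasFDerivAt_pd hx r α).differentiableAt

theorem IsSolution.pd_comm {x : Pt} (hx : x ∈ Ω) (r : Fin n) (α β : Fin 4) :
    pd α (pd β (u r)) x = pd β (pd α (u r)) x := by
  have e : ∀ α β : Fin 4, pd α (pd β (u r)) x =
      fderiv ℝ (fderiv ℝ (u r)) x (Pi.single α 1) (Pi.single β 1) := fun α β => by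
    rw [pd, (hu.hasFDerivAt_pd hx r β).fderiv]; rfl
  rw [e, e]
  refine second_derivative_symmetric_of_eventually (f := u r) (f' := fderiv ℝ (u r)) (x := x) ?_
    (hu.twice r x hx).hasFDerivAt _ _
  filter_upwards [hΩ.mem_nhds hx] with y hy
  exact (hu.differentiableAt hΩ hy r).hasFDerivAt

end

section

variable {f u : Fin n → Pt → ℝ} {S : Jet n}

theorem differentiableAt_comp_y {g : Pt → ℝ} (hg : DifferentiableAt ℝ g S.2.1.1.1) :
    DifferentiableAt ℝ (fun S : Jet n => g S.2.1.1.1) S :=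
  hg.comp (f := fun S : Jet n => S.2.1.1.1) S (by fun_prop)

theorem IsSolution.differentiableAt_pdCon (hu : IsSolution A B f Ω u) (hS : S.2.1.1.1 ∈ Ω)
    (j : Fin 3) (r : Fin n) : DifferentiableAt ℝ (fun S : Jet n => pdCon j (u r) S.2.1.1) S :=
  (differentiableAt_comp_y (hu.differentiableAt_pd hS r _)).sub
    ((differentiableAt_p j).mul (differentiableAt_comp_y (hu.differentiableAt_pd hS r _)))

theorem IsSolution.dx_pdCon (hu : IsSolution A B f Ω u) (hS : IsConeJet A Ω S)
    (i j : Fin 3) (r : Fin n) : dx A B i (fun S : Jet n => pdCon j (u r) S.2.1.1) S =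
      pdCon i (pd j.castSucc (u r)) S.2.1.1 - dx A B i (fun S => S.2.1.1.2 j) S *
        pd 3 (u r) S.2.1.1.1 - S.2.1.1.2 j * pdCon i (pd 3 (u r)) S.2.1.1 := by
  have h3 := hu.differentiableAt_pd hS.mem r 3
  have hj := hu.differentiableAt_pd hS.mem r j.castSucc
  show dx A B i (fun S : Jet n => pd j.castSucc (u r) S.2.1.1.1 -
    S.2.1.1.2 j * pd 3 (u r) S.2.1.1.1) S = _
  rw [dx_sub (differentiableAt_comp_y hj)
    ((differentiableAt_p j).fun_mul (differentiableAt_comp_y h3)),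
    dx_mul (differentiableAt_p j) (differentiableAt_comp_y h3), dx_comp_y_cone hS hj,
    dx_comp_y_cone hS h3]
  ring

variable (h : SmoothCoef A B Ω) (hu : IsSolution A B f Ω u)
include h hu

theorem SmoothCoef.differentiableAt_flux_terms (hS : IsRegular A Ω S) (i : Fin 3) (s : Fin n) :
    (∀ j r, DifferentiableAt ℝ (fun S : Jet n =>
      A S.2.1.1.1 i.castSucc j.castSucc * sig A r s S * pdCon j (u r) S.2.1.1 -
      u r S.2.1.1.1 * dx A B j (fun S' => A S'.2.1.1.1 i.castSucc j.castSucc * sig A r s S') S) S) ∧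
    (∀ r, DifferentiableAt ℝ (fun S : Jet n =>
      sig A r s S * T A S.2.1.1 i.castSucc * pd 3 (u r) S.2.1.1.1) S) ∧
    ∀ r t, DifferentiableAt ℝ (fun S : Jet n =>
      B r t i.castSucc S.2.1.1.1 * u t S.2.1.1.1 * sig A r s S) S := by
  have hG := fun j r => h.contDiffAt_A_sig hS i.castSucc (Fin.castSucc j) r s
  refine ⟨fun j r => ?_, fun r => ?_, fun r t => ?_⟩
  · refine (((hG j r).differentiableAt three_ne_zero).mul
      (hu.differentiableAt_pdCon hS.1 j r)).sub
      ((differentiableAt_comp_y (hu.differentiableAt h.isOpen hS.1 r)).mul ?_)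
    exact (h.contDiffAt_dx (B := B) hS (hG j r) (m := 1) (by norm_num) le_rfl j).differentiableAt
      one_ne_zero
  · exact (((h.contDiffAt_sig hS r s).differentiableAt three_ne_zero).mul
      ((h.contDiffAt_T_jet hS.1 _).differentiableAt three_ne_zero)).mul
      (differentiableAt_comp_y (hu.differentiableAt_pd hS.1 r _))
  · exact (((h.contDiffAt_B_jet hS r t _).differentiableAt two_ne_zero).mul
      (differentiableAt_comp_y (hu.differentiableAt h.isOpen hS.1 t))).mul
      ((h.contDiffAt_sig hS r s).differentiableAt three_ne_zero)

theorem SmoothCoef.differentiableAt_flux (hS : IsRegular A Ω S) (i : Fin 3) (s : Fin n) :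
    DifferentiableAt ℝ (flux A B u i s) S := by
  obtain ⟨h1, h2, h3⟩ := h.differentiableAt_flux_terms hu hS i s
  exact ((DifferentiableAt.fun_sum fun j _ => DifferentiableAt.fun_sum fun r _ => h1 j r).add
    ((DifferentiableAt.fun_sum fun r _ => h2 r).const_mul 2)).add
    (DifferentiableAt.fun_sum fun r _ => DifferentiableAt.fun_sum fun t _ => h3 r t)

theorem SmoothCoef.dx_flux (hS : IsConeJet A Ω S) (i : Fin 3) (s : Fin n) :
    dx A B i (flux A B u i s) S =
      (∑ r, ∑ j : Fin 3,
        (dx A B i (fun S => A S.2.1.1.1 i.castSucc j.castSucc * sig A r s S) S *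
            pdCon j (u r) S.2.1.1 +
          A S.2.1.1.1 i.castSucc j.castSucc * sig A r s S *
            dx A B i (fun S => pdCon j (u r) S.2.1.1) S -
          (pdCon i (u r) S.2.1.1 *
            dx A B j (fun S => A S.2.1.1.1 i.castSucc j.castSucc * sig A r s S) S +
          u r S.2.1.1.1 * dx A B i (dx A B j fun S =>
            A S.2.1.1.1 i.castSucc j.castSucc * sig A r s S) S))) +
      ∑ r, (2 * (dx A B i (fun S => sig A r s S * T A S.2.1.1 i.castSucc) S *
          pd 3 (u r) S.2.1.1.1 +
        sig A r s S * T A S.2.1.1 i.castSucc * pdCon i (pd 3 (u r)) S.2.1.1) +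
      ∑ t, (u r S.2.1.1.1 * dx A B i (fun S => B t r i.castSucc S.2.1.1.1 * sig A t s S) S +
        B t r i.castSucc S.2.1.1.1 * sig A t s S * pdCon i (u r) S.2.1.1)) := by
  have hr := hS.isRegular
  obtain ⟨h1, h2, h3⟩ := h.differentiableAt_flux_terms hu hr i s
  have hG := fun j r => h.contDiffAt_A_sig hr i.castSucc (Fin.castSucc j) r s
  have hud := fun r => differentiableAt_comp_y (hu.differentiableAt h.isOpen hr.1 r)
  have hsd := fun r => (h.contDiffAt_sig hr r s).differentiableAt three_ne_zero
  have hTd := (h.contDiffAt_T_jet (n := n) hr.1 i.castSucc).differentiableAt three_ne_zero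
  have H1 := DifferentiableAt.fun_sum fun j (_ : j ∈ Finset.univ) =>
    DifferentiableAt.fun_sum fun r (_ : r ∈ Finset.univ) => h1 j r
  have H2 := (DifferentiableAt.fun_sum fun r (_ : r ∈ Finset.univ) => h2 r).const_mul 2
  have H3 := DifferentiableAt.fun_sum fun r (_ : r ∈ Finset.univ) =>
    DifferentiableAt.fun_sum fun t (_ : t ∈ Finset.univ) => h3 r t
  have e1 : ∀ j r, dx A B i (fun S : Jet n =>
      A S.2.1.1.1 i.castSucc j.castSucc * sig A r s S * pdCon j (u r) S.2.1.1 -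
      u r S.2.1.1.1 * dx A B j (fun S' => A S'.2.1.1.1 i.castSucc j.castSucc * sig A r s S') S) S =
      (dx A B i (fun S => A S.2.1.1.1 i.castSucc j.castSucc * sig A r s S) S *
            pdCon j (u r) S.2.1.1 +
          A S.2.1.1.1 i.castSucc j.castSucc * sig A r s S *
            dx A B i (fun S => pdCon j (u r) S.2.1.1) S -
          (pdCon i (u r) S.2.1.1 *
            dx A B j (fun S => A S.2.1.1.1 i.castSucc j.castSucc * sig A r s S) S +
          u r S.2.1.1.1 * dx A B i (dx A B j fun S =>
            A S.2.1.1.1 i.castSucc j.castSucc * sig A r s S) S)) := fun j r => by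
    have g1 := (hG j r).differentiableAt three_ne_zero
    have g2 := (h.contDiffAt_dx (B := B) hr (hG j r) (m := 1) (by norm_num) le_rfl j).differentiableAt
      one_ne_zero
    have g3 := hu.differentiableAt_pdCon hr.1 j r
    rw [dx_sub (g1.fun_mul g3) ((hud r).fun_mul g2), dx_mul g1 g3, dx_mul (hud r) g2,
      dx_comp_y_cone hS (hu.differentiableAt h.isOpen hr.1 r)]
  have e2 : ∀ r, dx A B i (fun S : Jet n =>
      sig A r s S * T A S.2.1.1 i.castSucc * pd 3 (u r) S.2.1.1.1) S =
      dx A B i (fun S => sig A r s S * T A S.2.1.1 i.castSucc) S *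
          pd 3 (u r) S.2.1.1.1 +
        sig A r s S * T A S.2.1.1 i.castSucc * pdCon i (pd 3 (u r)) S.2.1.1 := fun r => by
    have g3 := hu.differentiableAt_pd hr.1 r 3
    rw [dx_mul ((hsd r).fun_mul hTd) (differentiableAt_comp_y g3), dx_comp_y_cone hS g3]
  have e3 : ∀ r t, dx A B i (fun S : Jet n =>
      B r t i.castSucc S.2.1.1.1 * u t S.2.1.1.1 * sig A r s S) S =
      u t S.2.1.1.1 * dx A B i (fun S => B r t i.castSucc S.2.1.1.1 * sig A r s S) S +
        B r t i.castSucc S.2.1.1.1 * sig A r s S * pdCon i (u t) S.2.1.1 := fun r t => by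
    have g1 := (h.contDiffAt_B_sig hr r t i.castSucc s).differentiableAt two_ne_zero
    rw [show (fun S : Jet n => B r t i.castSucc S.2.1.1.1 * u t S.2.1.1.1 * sig A r s S) =
      fun S : Jet n => (B r t i.castSucc S.2.1.1.1 * sig A r s S) * u t S.2.1.1.1 from
      funext fun _ => by ring, dx_mul g1 (hud t),
      dx_comp_y_cone hS (hu.differentiableAt h.isOpen hr.1 t)]
    ring
  have e : flux A B u i s = fun S => ((∑ j, ∑ r,
      (A S.2.1.1.1 i.castSucc j.castSucc * sig A r s S * pdCon j (u r) S.2.1.1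
      - u r S.2.1.1.1 * dx A B j (fun S' => A S'.2.1.1.1 i.castSucc j.castSucc * sig A r s S') S))
    + 2 * ∑ r, sig A r s S * T A S.2.1.1 i.castSucc * pd 3 (u r) S.2.1.1.1)
    + ∑ r, ∑ t, B r t i.castSucc S.2.1.1.1 * u t S.2.1.1.1 * sig A r s S := rfl
  rw [e, dx_add (H1.fun_add H2) H3, dx_add H1 H2]
  rw [dx_sum fun j _ => DifferentiableAt.fun_sum fun r (_ : r ∈ Finset.univ) => h1 j r]
  rw [dx_sum fun r _ => DifferentiableAt.fun_sum fun t (_ : t ∈ Finset.univ) => h3 r t]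
  rw [dx_mul (differentiableAt_const 2) (DifferentiableAt.fun_sum fun r _ => h2 r), dx_const,
    zero_mul, zero_add, dx_sum fun r _ => h2 r]
  simp only [dx_sum fun r _ => h1 _ r, dx_sum fun t _ => h3 _ t, e1, e2, e3]
  rw [Finset.sum_comm, add_assoc, Finset.mul_sum]
  congr 1
  rw [Finset.sum_add_distrib]
  congr 1
  rw [Finset.sum_comm]

/-- The fundamental identity on the characteristic conoid. -/
theorem SmoothCoef.sum_dx_flux (hS : IsConeJet A Ω S) (s : Fin n) :
    ∑ i, dx A B i (flux A B u i s) S =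
      -∑ r, (u r S.2.1.1.1 * L A B r s S + sig A r s S * f r S.2.1.1.1) := by
  have hr := hS.isRegular
  have hsymm : ∀ i j : Fin 3, ∀ r k,
      dx A B k (fun S => A S.2.1.1.1 i.castSucc j.castSucc * sig A r s S) S =
      dx A B k (fun S => A S.2.1.1.1 j.castSucc i.castSucc * sig A r s S) S := fun i j r k => by
    refine dx_congr ?_
    filter_upwards [h.eventually_isRegular hr] with S' hS'
    rw [h.symm _ hS'.1]
  have wave : ∀ r, (∑ i : Fin 3, ∑ j : Fin 3, A S.2.1.1.1 i.castSucc j.castSucc *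
        (pdCon i (pd j.castSucc (u r)) S.2.1.1 - S.2.1.1.2 j * pdCon i (pd 3 (u r)) S.2.1.1)) +
      2 * ∑ i : Fin 3, T A S.2.1.1 i.castSucc * pdCon i (pd 3 (u r)) S.2.1.1 =
      -(∑ t, ∑ α, B r t α S.2.1.1.1 * pd α (u t) S.2.1.1.1) - f r S.2.1.1.1 := fun r => by
    have := wave_identity (a := A S.2.1.1.1) (W := fun α β => pd α (pd β (u r)) S.2.1.1.1)
      (p := S.2.1.1.2) (h.symm _ hr.1) (hu.pd_comm h.isOpen hr.1 r) hS.char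
    have h2 := hu.eqn r _ hr.1
    rw [← this] at h2
    simp only [pdCon, T]
    linear_combination h2
  have cross : ∀ r, ∑ i : Fin 3, ∑ j : Fin 3,
        dx A B i (fun S => A S.2.1.1.1 i.castSucc j.castSucc * sig A r s S) S *
            pdCon j (u r) S.2.1.1 =
      ∑ i : Fin 3, ∑ j : Fin 3, pdCon i (u r) S.2.1.1 *
            dx A B j (fun S => A S.2.1.1.1 i.castSucc j.castSucc * sig A r s S) S := fun r => by
    rw [Finset.sum_comm]
    refine Finset.sum_congr rfl fun i _ => Finset.sum_congr rfl fun j _ => ?_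
    rw [hsymm, mul_comm]
  have key1 : ∀ r, ∑ i : Fin 3, ∑ j : Fin 3,
        (dx A B i (fun S => A S.2.1.1.1 i.castSucc j.castSucc * sig A r s S) S *
            pdCon j (u r) S.2.1.1 +
          A S.2.1.1.1 i.castSucc j.castSucc * sig A r s S *
            (pdCon i (pd j.castSucc (u r)) S.2.1.1 - dx A B i (fun S => S.2.1.1.2 j) S *
              pd 3 (u r) S.2.1.1.1 - S.2.1.1.2 j * pdCon i (pd 3 (u r)) S.2.1.1) -
          (pdCon i (u r) S.2.1.1 *
            dx A B j (fun S => A S.2.1.1.1 i.castSucc j.castSucc * sig A r s S) S +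
          u r S.2.1.1.1 * dx A B i (dx A B j fun S =>
            A S.2.1.1.1 i.castSucc j.castSucc * sig A r s S) S)) =
      sig A r s S * (∑ i : Fin 3, ∑ j : Fin 3, A S.2.1.1.1 i.castSucc j.castSucc *
        (pdCon i (pd j.castSucc (u r)) S.2.1.1 - S.2.1.1.2 j * pdCon i (pd 3 (u r)) S.2.1.1)) -
      pd 3 (u r) S.2.1.1.1 * (sig A r s S * ∑ i : Fin 3, ∑ j : Fin 3,
        A S.2.1.1.1 i.castSucc j.castSucc * dx A B i (fun S => S.2.1.1.2 j) S) -
      u r S.2.1.1.1 * ∑ i, ∑ j, dx A B i (dx A B j fun S =>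
            A S.2.1.1.1 i.castSucc j.castSucc * sig A r s S) S := fun r => by
    rw [← add_zero (sig A r s S * _), ← sub_eq_zero.2 (cross r)]
    simp only [Finset.mul_sum, ← Finset.sum_add_distrib, ← Finset.sum_sub_distrib]
    exact Finset.sum_congr rfl fun i _ => Finset.sum_congr rfl fun j _ => by ring
  have key2 : ∀ r, ∑ i : Fin 3, (2 * (dx A B i (fun S => sig A r s S * T A S.2.1.1 i.castSucc) S *
          pd 3 (u r) S.2.1.1.1 +
        sig A r s S * T A S.2.1.1 i.castSucc * pdCon i (pd 3 (u r)) S.2.1.1) +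
      ∑ t, (u r S.2.1.1.1 * dx A B i (fun S => B t r i.castSucc S.2.1.1.1 * sig A t s S) S +
        B t r i.castSucc S.2.1.1.1 * sig A t s S * pdCon i (u r) S.2.1.1)) =
      pd 3 (u r) S.2.1.1.1 * (2 * ∑ i, dx A B i (fun S => sig A r s S * T A S.2.1.1 i.castSucc) S) +
      sig A r s S * (2 * ∑ i : Fin 3, T A S.2.1.1 i.castSucc * pdCon i (pd 3 (u r)) S.2.1.1) +
      u r S.2.1.1.1 * (∑ i, ∑ t, dx A B i
        (fun S => B t r i.castSucc S.2.1.1.1 * sig A t s S) S) +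
      ∑ i : Fin 3, ∑ t, B t r i.castSucc S.2.1.1.1 * sig A t s S * pdCon i (u r) S.2.1.1 := fun r => by
    simp only [Finset.mul_sum, ← Finset.sum_add_distrib]
    refine Finset.sum_congr rfl fun i _ => ?_
    rw [Finset.sum_add_distrib]
    ring
  have key3 : ∀ r, pd 3 (u r) S.2.1.1.1 *
        ∑ t, (∑ α, B t r α S.2.1.1.1 * cov S.2.1.1.2 α) * sig A t s S +
      ∑ i : Fin 3, ∑ t, B t r i.castSucc S.2.1.1.1 * sig A t s S * pdCon i (u r) S.2.1.1 =
      ∑ t, sig A t s S * ∑ α, B t r α S.2.1.1.1 * pd α (u r) S.2.1.1.1 := fun r => by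
    rw [Finset.sum_comm, Finset.mul_sum, ← Finset.sum_add_distrib]
    refine Finset.sum_congr rfl fun t _ => ?_
    simp only [Fin.sum_univ_castSucc (n := 3)]
    simp only [cov_castSucc, pdCon, Fin.sum_univ_three]
    rw [show Fin.last 3 = 3 from rfl, cov_three]
    ring
  simp only [h.dx_flux hu hS, hu.dx_pdCon hS]
  rw [Finset.sum_add_distrib, Finset.sum_comm]
  rw [Finset.sum_comm (f := fun i r => 2 * (dx A B i
    (fun S => sig A r s S * T A S.2.1.1 i.castSucc) S * pd 3 (u r) S.2.1.1.1 +
      sig A r s S * T A S.2.1.1 i.castSucc * pdCon i (pd 3 (u r)) S.2.1.1) +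
      ∑ t, (u r S.2.1.1.1 * dx A B i (fun S => B t r i.castSucc S.2.1.1.1 * sig A t s S) S +
        B t r i.castSucc S.2.1.1.1 * sig A t s S * pdCon i (u r) S.2.1.1)), ← Finset.sum_add_distrib]
  simp only [key1, key2]
  have swap : ∑ r, ∑ t, sig A t s S * ∑ α, B t r α S.2.1.1.1 * pd α (u r) S.2.1.1.1 =
      ∑ r, sig A r s S * ∑ t, ∑ α, B r t α S.2.1.1.1 * pd α (u t) S.2.1.1.1 := by
    rw [Finset.sum_comm]
    simp only [Finset.mul_sum]
  rw [← sub_eq_zero] at swap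
  rw [← sub_zero (-∑ r, _), ← neg_zero, ← swap, ← Finset.sum_sub_distrib, ← Finset.sum_neg_distrib,
    ← Finset.sum_neg_distrib, ← Finset.sum_sub_distrib]
  refine Finset.sum_congr rfl fun r _ => ?_
  rw [← key3, h.transport_identity hS r s, L]
  linear_combination sig A r s S * wave r

end

end Divergence


section OrderCalculus

open Filter Topology

variable {V : Type*} [NormedAddCommGroup V] [NormedSpace ℝ V]

/-- A space with vector fields `D i`, an open set `U` and a set `P` of points of `U` to each of which
a number `t ∈ (0, 1]` is attached. -/
structure GradedDomain (V : Type*) [NormedAddCommGroup V] [NormedSpace ℝ V] where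
  D : Fin 3 → V → V
  U : Set V
  P : Set (V × ℝ)
  isOpen : IsOpen U
  mem : ∀ x ∈ P, x.1 ∈ U
  pos : ∀ x ∈ P, 0 < x.2
  le_one : ∀ x ∈ P, x.2 ≤ 1

namespace GradedDomain

variable (G : GradedDomain V)

/-- The derivative along the vector field `D i`. -/
noncomputable def d (i : Fin 3) (φ : V → ℝ) (S : V) : ℝ := fderiv ℝ φ S (G.D i S)

/-- `φ = O(t ^ k)` on the points of `G`. -/
def Bd (k : ℤ) (φ : V → ℝ) : Prop := ∃ C : ℝ, ∀ x ∈ G.P, |φ x.1| ≤ C * x.2 ^ k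

/-- `φ = O(t ^ k)`, with derivatives up to the order `m`, each of which loses one power of `t`. -/
def Ord : ℕ → ℤ → (V → ℝ) → Prop
  | 0, k, φ => G.Bd k φ
  | m + 1, k, φ => G.Bd k φ ∧ (∀ S ∈ G.U, DifferentiableAt ℝ φ S) ∧ ∀ i, Ord m (k - 1) (G.d i φ)

variable {G} {m : ℕ} {k l : ℤ} {φ ψ : V → ℝ}

theorem Bd.nonneg_bound (h : G.Bd k φ) : ∃ C : ℝ, 0 ≤ C ∧ ∀ x ∈ G.P, |φ x.1| ≤ C * x.2 ^ k := by
  obtain ⟨C, hC⟩ := h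
  refine ⟨max C 0, le_max_right _ _, fun x hx => (hC x hx).trans ?_⟩
  exact mul_le_mul_of_nonneg_right (le_max_left _ _) (zpow_pos (G.pos x hx) k).le

theorem Bd.mono (h : G.Bd k φ) (hl : l ≤ k) : G.Bd l φ := by
  obtain ⟨C, hC0, hC⟩ := h.nonneg_bound
  refine ⟨C, fun x hx => (hC x hx).trans (mul_le_mul_of_nonneg_left ?_ hC0)⟩
  exact zpow_le_zpow_right_of_le_one₀ (G.pos x hx) (G.le_one x hx) hl

theorem Bd.congr (h : G.Bd k φ) (e : ∀ x ∈ G.P, φ x.1 = ψ x.1) : G.Bd k ψ := by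
  obtain ⟨C, hC⟩ := h
  exact ⟨C, fun x hx => e x hx ▸ hC x hx⟩

theorem Bd.of_abs_le (h : G.Bd k φ) (e : ∀ x ∈ G.P, |ψ x.1| ≤ |φ x.1|) : G.Bd k ψ := by
  obtain ⟨C, hC⟩ := h
  exact ⟨C, fun x hx => (e x hx).trans (hC x hx)⟩

theorem Bd.add (h : G.Bd k φ) (h' : G.Bd k ψ) : G.Bd k fun S => φ S + ψ S := by
  obtain ⟨C, hC⟩ := h
  obtain ⟨C', hC'⟩ := h'
  refine ⟨C + C', fun x hx => (abs_add_le _ _).trans ?_⟩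
  rw [add_mul]
  exact add_le_add (hC x hx) (hC' x hx)

theorem Bd.mul (h : G.Bd k φ) (h' : G.Bd l ψ) : G.Bd (k + l) fun S => φ S * ψ S := by
  obtain ⟨C, hC0, hC⟩ := h.nonneg_bound
  obtain ⟨C', hC'0, hC'⟩ := h'.nonneg_bound
  refine ⟨C * C', fun x hx => ?_⟩
  rw [abs_mul, zpow_add₀ (G.pos x hx).ne']
  calc |φ x.1| * |ψ x.1| ≤ (C * x.2 ^ k) * (C' * x.2 ^ l) :=
        mul_le_mul (hC x hx) (hC' x hx) (abs_nonneg _)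
          (mul_nonneg hC0 (zpow_pos (G.pos x hx) k).le)
    _ = C * C' * (x.2 ^ k * x.2 ^ l) := by ring

theorem Ord.bd (h : G.Ord m k φ) : G.Bd k φ := by
  cases m with
  | zero => exact h
  | succ m => exact h.1

theorem d_congr (e : ∀ S ∈ G.U, φ S = ψ S) (i : Fin 3) {S : V} (hS : S ∈ G.U) :
    G.d i φ S = G.d i ψ S := by
  rw [d, d, (Filter.eventuallyEq_of_mem (G.isOpen.mem_nhds hS) e).fderiv_eq]

theorem Ord.congr (h : G.Ord m k φ) (e : ∀ S ∈ G.U, φ S = ψ S) : G.Ord m k ψ := by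
  induction m generalizing k φ ψ with
  | zero => exact Bd.congr h fun x hx => e _ (G.mem x hx)
  | succ m ih =>
    refine ⟨h.1.congr fun x hx => e _ (G.mem x hx), fun S hS => ?_,
      fun i => ih (h.2.2 i) fun S hS => d_congr e i hS⟩
    exact (h.2.1 S hS).congr_of_eventuallyEq
      (Filter.eventuallyEq_of_mem (G.isOpen.mem_nhds hS) fun S hS => (e S hS).symm)

theorem Ord.mono (h : G.Ord m k φ) (hl : l ≤ k) : G.Ord m l φ := by
  induction m generalizing k l φ with
  | zero => exact Bd.mono h hl
  | succ m ih => exact ⟨h.1.mono hl, h.2.1, fun i => ih (h.2.2 i) (by linarith)⟩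

theorem Ord.of_succ (h : G.Ord (m + 1) k φ) : G.Ord m k φ := by
  induction m generalizing k φ with
  | zero => exact h.1
  | succ m ih => exact ⟨h.1, h.2.1, fun i => ih (h.2.2 i)⟩

theorem Ord.succ (h : G.Bd k φ) (hd : ∀ S ∈ G.U, DifferentiableAt ℝ φ S) {φ' : Fin 3 → V → ℝ}
    (e : ∀ i, ∀ S ∈ G.U, G.d i φ S = φ' i S) (h' : ∀ i, G.Ord m (k - 1) (φ' i)) :
    G.Ord (m + 1) k φ :=
  ⟨h, hd, fun i => (h' i).congr fun S hS => (e i S hS).symm⟩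

theorem ord_zero (m : ℕ) (k : ℤ) : G.Ord m k fun _ => 0 := by
  induction m generalizing k with
  | zero => exact ⟨0, fun x _ => by simp⟩
  | succ m ih =>
    exact Ord.succ ⟨0, fun x _ => by simp⟩ (fun S _ => differentiableAt_const 0)
      (fun i S _ => by simp [d]) fun i => ih _

theorem ord_const (m : ℕ) (c : ℝ) : G.Ord m 0 fun _ => c := by
  have h : G.Bd 0 fun _ => c := ⟨|c|, fun x _ => by simp⟩
  cases m with
  | zero => exact h
  | succ m =>
    exact Ord.succ h (fun S _ => differentiableAt_const c) (fun i S _ => by simp [d]) fun i =>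
      ord_zero m _

theorem Ord.add (h : G.Ord m k φ) (h' : G.Ord m k ψ) : G.Ord m k fun S => φ S + ψ S := by
  induction m generalizing k φ ψ with
  | zero => exact Bd.add h h'
  | succ m ih =>
    refine Ord.succ (h.1.add h'.1) (fun S hS => (h.2.1 S hS).fun_add (h'.2.1 S hS))
      (fun i S hS => ?_) fun i => ih (h.2.2 i) (h'.2.2 i)
    rw [d, fderiv_fun_add (h.2.1 S hS) (h'.2.1 S hS)]
    rfl

theorem Ord.mul (h : G.Ord m k φ) (h' : G.Ord m l ψ) : G.Ord m (k + l) fun S => φ S * ψ S := by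
  induction m generalizing k l φ ψ with
  | zero => exact Bd.mul h h'
  | succ m ih =>
    refine Ord.succ (h.1.mul h'.1) (fun S hS => (h.2.1 S hS).fun_mul (h'.2.1 S hS))
      (φ' := fun i S => G.d i φ S * ψ S + φ S * G.d i ψ S) (fun i S hS => ?_) fun i => ?_
    · rw [d, fderiv_fun_mul (h.2.1 S hS) (h'.2.1 S hS)]
      simp only [add_apply, smul_apply, smul_eq_mul, d]
      ring
    · exact Ord.add ((ih (h.2.2 i) h'.of_succ).mono (by linarith))
        ((ih h.of_succ (h'.2.2 i)).mono (by linarith))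

theorem Ord.const_mul (h : G.Ord m k φ) (c : ℝ) : G.Ord m k fun S => c * φ S :=
  ((ord_const m c).mul h).mono (by simp)

theorem Ord.neg (h : G.Ord m k φ) : G.Ord m k fun S => -φ S :=
  (h.const_mul (-1)).congr fun S _ => by ring

theorem Ord.sub (h : G.Ord m k φ) (h' : G.Ord m k ψ) : G.Ord m k fun S => φ S - ψ S :=
  (h.add h'.neg).congr fun S _ => by ring

theorem Ord.sum {ι : Type*} {s : Finset ι} {φ : ι → V → ℝ} (h : ∀ j ∈ s, G.Ord m k (φ j)) :
    G.Ord m k fun S => ∑ j ∈ s, φ j S := by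
  induction s using Finset.cons_induction with
  | empty => exact (ord_zero m k).congr fun S _ => by simp
  | cons a s ha ih =>
    refine Ord.congr ((h a (by simp)).add (ih fun j hj => h j (by simp [hj]))) fun S _ => ?_
    rw [Finset.sum_cons]

theorem Bd.inv (h : ∃ c > 0, ∀ x ∈ G.P, c * x.2 ^ k ≤ |φ x.1|) : G.Bd (-k) fun S => (φ S)⁻¹ := by
  obtain ⟨c, hc, h⟩ := h
  refine ⟨c⁻¹, fun x hx => ?_⟩
  have h1 : 0 < c * x.2 ^ k := mul_pos hc (zpow_pos (G.pos x hx) k)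
  rw [abs_inv, zpow_neg, ← mul_inv]
  exact inv_anti₀ h1 (h x hx)

theorem Ord.inv (h : G.Ord m k φ) (h0 : ∀ S ∈ G.U, φ S ≠ 0)
    (hc : ∃ c > 0, ∀ x ∈ G.P, c * x.2 ^ k ≤ |φ x.1|) : G.Ord m (-k) fun S => (φ S)⁻¹ := by
  induction m with
  | zero => exact Bd.inv hc
  | succ m ih =>
    refine Ord.succ (Bd.inv hc) (fun S hS => (h.2.1 S hS).inv (h0 S hS))
      (φ' := fun i S => -((φ S)⁻¹ * (φ S)⁻¹ * G.d i φ S)) (fun i S hS => ?_) fun i => ?_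
    · have h1 := (hasDerivAt_inv (h0 S hS)).comp_hasFDerivAt S (h.2.1 S hS).hasFDerivAt
      have h2 : HasFDerivAt (fun S => (φ S)⁻¹) _ S := h1
      rw [d, h2.fderiv]
      simp only [smul_apply, smul_eq_mul, d]
      rw [sq, mul_inv]
      ring
    · exact (((ih h.of_succ).mul (ih h.of_succ)).mul (h.2.2 i)).neg.mono (by linarith)

theorem Bd.invSqrt (h : ∃ c > 0, ∀ x ∈ G.P, c * x.2 ^ (2 * k) ≤ |φ x.1|) :
    G.Bd (-k) fun S => (Real.sqrt |φ S|)⁻¹ := by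
  obtain ⟨c, hc, h⟩ := h
  refine ⟨(Real.sqrt c)⁻¹, fun x hx => ?_⟩
  have h0 := zpow_pos (G.pos x hx) k
  have h1 : Real.sqrt c * x.2 ^ k ≤ Real.sqrt |φ x.1| := by
    rw [← Real.sqrt_sq h0.le, ← Real.sqrt_mul hc.le]
    refine Real.sqrt_le_sqrt ((le_of_eq ?_).trans (h x hx))
    rw [mul_comm 2 k, zpow_mul]
    rfl
  rw [abs_of_nonneg (by positivity), zpow_neg, ← mul_inv]
  exact inv_anti₀ (mul_pos (Real.sqrt_pos.2 hc) h0) h1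

theorem Ord.invSqrt (h : G.Ord m (2 * k) φ) (h0 : ∀ S ∈ G.U, φ S ≠ 0)
    (hc : ∃ c > 0, ∀ x ∈ G.P, c * x.2 ^ (2 * k) ≤ |φ x.1|) :
    G.Ord m (-k) fun S => (Real.sqrt |φ S|)⁻¹ := by
  have hinv := h.inv h0 hc
  induction m with
  | zero => exact Bd.invSqrt hc
  | succ m ih =>
    have hd : ∀ S ∈ G.U, HasFDerivAt (fun S => (Real.sqrt |φ S|)⁻¹)
        ((-(1 / 2) * (Real.sqrt |φ S|)⁻¹ * (φ S)⁻¹) • fderiv ℝ φ S) S := fun S hS =>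
      (hasDerivAt_invSqrt (h0 S hS)).comp_hasFDerivAt S (h.2.1 S hS).hasFDerivAt
    refine Ord.succ (Bd.invSqrt hc) (fun S hS => (hd S hS).differentiableAt)
      (φ' := fun i S => -(1 / 2) * ((Real.sqrt |φ S|)⁻¹ * (φ S)⁻¹ * G.d i φ S)) (fun i S hS => ?_)
      fun i => ?_
    · rw [d, (hd S hS).fderiv]
      simp only [smul_apply, smul_eq_mul, d]
      ring
    · exact ((((ih h.of_succ hinv.of_succ).mul hinv.of_succ).mul (h.2.2 i)).const_mul _).mono
        (by linarith)

/-- Comparison of inverse square roots. -/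
theorem Ord.invSqrt_sub {φ ψ : V → ℝ} (hφ : G.Ord m (2 * k) φ) (hψ : G.Ord m (2 * k) ψ)
    (h0 : ∀ S ∈ G.U, 0 < φ S) (h0' : ∀ S ∈ G.U, 0 < ψ S)
    (hc : ∃ c > 0, ∀ x ∈ G.P, c * x.2 ^ (2 * k) ≤ |φ x.1|)
    (hc' : ∃ c > 0, ∀ x ∈ G.P, c * x.2 ^ (2 * k) ≤ |ψ x.1|)
    (h : G.Ord m (2 * k + l) fun S => ψ S - φ S) :
    G.Ord m (l - k) fun S => (Real.sqrt |φ S|)⁻¹ - (Real.sqrt |ψ S|)⁻¹ := by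
  have a := hφ.invSqrt (fun S hS => (h0 S hS).ne') hc
  have b := hψ.invSqrt (fun S hS => (h0' S hS).ne') hc'
  have hs : ∀ S ∈ G.U, 0 < (Real.sqrt |φ S|)⁻¹ ∧ 0 < (Real.sqrt |ψ S|)⁻¹ := fun S hS =>
    ⟨inv_pos.2 (Real.sqrt_pos.2 (abs_pos.2 (h0 S hS).ne')),
      inv_pos.2 (Real.sqrt_pos.2 (abs_pos.2 (h0' S hS).ne'))⟩
  have c := (a.add b).inv (fun S hS => (add_pos (hs S hS).1 (hs S hS).2).ne') (by
    obtain ⟨C, hC0, hC⟩ := hφ.bd.nonneg_bound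
    refine ⟨(Real.sqrt (C + 1))⁻¹, by positivity, fun x hx => ?_⟩
    obtain ⟨h1, h2⟩ := hs _ (G.mem x hx)
    have ht := zpow_pos (G.pos x hx) k
    have h3 : Real.sqrt |φ x.1| ≤ Real.sqrt (C + 1) * x.2 ^ k := by
      rw [← Real.sqrt_sq ht.le, ← Real.sqrt_mul (by positivity)]
      refine Real.sqrt_le_sqrt ((hC x hx).trans ?_)
      have : x.2 ^ (2 * k) = (x.2 ^ k) ^ 2 := by rw [mul_comm 2 k, zpow_mul]; rfl
      rw [this]
      nlinarith [sq_nonneg (x.2 ^ k)]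
    rw [abs_of_pos (add_pos h1 h2), zpow_neg, ← mul_inv]
    have h4 : (Real.sqrt (C + 1) * x.2 ^ k)⁻¹ ≤ (Real.sqrt |φ x.1|)⁻¹ :=
      inv_anti₀ (inv_pos.1 h1) h3
    linarith)
  refine Ord.congr ((((h.mul (hφ.inv (fun S hS => (h0 S hS).ne') hc)).mul
    (hψ.inv (fun S hS => (h0' S hS).ne') hc')).mul c).mono (by linarith)) fun S hS => ?_
  obtain ⟨h1, h2⟩ := hs S hS
  have e1 : (φ S)⁻¹ = (Real.sqrt |φ S|)⁻¹ ^ 2 := by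
    rw [inv_pow, Real.sq_sqrt (abs_nonneg _), abs_of_pos (h0 S hS)]
  have e2 : (ψ S)⁻¹ = (Real.sqrt |ψ S|)⁻¹ ^ 2 := by
    rw [inv_pow, Real.sq_sqrt (abs_nonneg _), abs_of_pos (h0' S hS)]
  have e3 : (ψ S - φ S) * (φ S)⁻¹ * (ψ S)⁻¹ = (φ S)⁻¹ - (ψ S)⁻¹ := by
    have := (h0 S hS).ne'
    have := (h0' S hS).ne'
    field_simp
  rw [e3, e1, e2]
  have := (add_pos h1 h2).ne'
  rw [← div_eq_mul_inv, div_eq_iff this]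
  ring

end GradedDomain

end OrderCalculus


section VertexEstimates

open Filter Topology Set Metric

variable {n : ℕ} {A : CoefA} {B : CoefB n} {Ω : Set Pt} {y₀ : Pt} {κ ε : ℝ}
  {Z : ℝ → (Fin 3 → ℝ) → ZVal n}

theorem SmoothCoef.fderiv_bichar_vert (h : SmoothCoef A B Ω) {v : Ph} (hv : v.1 ∈ Ω)
    (p : Fin 3 → ℝ) (α : Fin 4) :
    (fderiv ℝ (KirchhoffConoid.bichar A) v (0, p)).1 α = ∑ β, A v.1 α β * dcov p β := by
  rw [h.fderiv_bichar hv, dT]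
  simp

/-- The `T^α` are linear in `p`. -/
theorem SmoothCoef.fderiv_fderiv_bichar_vert (h : SmoothCoef A B Ω) {v : Ph} (hv : v.1 ∈ Ω)
    (p p' : Fin 3 → ℝ) :
    (fderiv ℝ (fderiv ℝ (KirchhoffConoid.bichar A)) v (0, p) (0, p')).1 = 0 := by
  have hl : HasDerivAt (fun ε : ℝ => v + ε • ((0, p) : Ph)) (0, p) 0 := by
    simpa using ((hasDerivAt_id (0 : ℝ)).smul_const ((0, p) : Ph)).const_add v
  have h1 := hasDerivAt_fderiv_apply ((h.bichar hv).of_le (by norm_num)) hl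
    (hasDerivAt_const (0 : ℝ) ((0, p') : Ph)) (by simp)
  simp only [map_zero, add_zero] at h1
  refine HasDerivAt.unique h1.fst ?_
  have e : (fun ε : ℝ => (fderiv ℝ (KirchhoffConoid.bichar A) (v + ε • ((0, p) : Ph)) (0, p')).1) =
      fun _ => fun α => ∑ β, A v.1 α β * dcov p' β := by
    funext ε α
    have e1 : (v + ε • ((0, p) : Ph)).1 = v.1 := by simp
    rw [h.fderiv_bichar_vert (e1 ▸ hv), e1]
  rw [e]
  exact hasDerivAt_const _ _

theorem SmoothCoef.fderiv_fderiv_fderiv_bichar_vert (h : SmoothCoef A B Ω) {v : Ph} (hv : v.1 ∈ Ω)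
    (p p' p'' : Fin 3 → ℝ) :
    (fderiv ℝ (fderiv ℝ (fderiv ℝ (KirchhoffConoid.bichar A))) v (0, p) (0, p') (0, p'')).1 = 0 := by
  have hl : HasDerivAt (fun ε : ℝ => v + ε • ((0, p) : Ph)) (0, p) 0 := by
    simpa using ((hasDerivAt_id (0 : ℝ)).smul_const ((0, p) : Ph)).const_add v
  have h1 := hasDerivAt_fderiv_fderiv_apply (h.bichar hv) hl
    (hasDerivAt_const (0 : ℝ) ((0, p') : Ph)) (hasDerivAt_const (0 : ℝ) ((0, p'') : Ph))
    (by simp)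
  simp only [map_zero, add_zero, zero_apply] at h1
  refine HasDerivAt.unique h1.fst ?_
  have e : (fun ε : ℝ => (fderiv ℝ (fderiv ℝ (KirchhoffConoid.bichar A)) (v + ε • ((0, p) : Ph))
      (0, p') (0, p'')).1) = fun _ => 0 := by
    funext ε
    have e1 : (v + ε • ((0, p) : Ph)).1 = v.1 := by simp
    exact h.fderiv_fderiv_bichar_vert (e1 ▸ hv) _ _
  rw [e]
  exact hasDerivAt_const _ _

theorem abs_le_of_hasDerivWithinAt_le {f f' : ℝ → ℝ} {ε C : ℝ} {k : ℕ}
    (hf : ∀ t ∈ Icc 0 ε, HasDerivWithinAt f (f' t) (Icc 0 ε) t) (h0 : f 0 = 0) (hC : 0 ≤ C)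
    (hb : ∀ t ∈ Icc 0 ε, |f' t| ≤ C * t ^ k) {t : ℝ} (ht : t ∈ Icc 0 ε) :
    |f t| ≤ C * t ^ (k + 1) := by
  have hsub : Icc 0 t ⊆ Icc 0 ε := Icc_subset_Icc_right ht.2
  have h1 := (convex_Icc (0 : ℝ) t).norm_image_sub_le_of_norm_hasDerivWithin_le
    (f := f) (f' := f') (C := C * t ^ k) (fun s hs => (hf s (hsub hs)).mono hsub)
    (fun s hs => (hb s (hsub hs)).trans (by
      have := pow_le_pow_left₀ hs.1 hs.2 k
      gcongr)) (left_mem_Icc.2 ht.1) (right_mem_Icc.2 ht.1)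
  rw [h0, sub_zero, sub_zero, Real.norm_eq_abs, Real.norm_eq_abs, abs_of_nonneg ht.1] at h1
  rw [pow_succ, ← mul_assoc]
  exact h1

theorem continuousAt_smul {X V : Type*} [TopologicalSpace X] [NormedAddCommGroup V]
    [NormedSpace ℝ V] {f : X → ℝ} {g : X → V} {x : X} (hf : ContinuousAt f x)
    (hg : ContinuousAt g x) : ContinuousAt (fun x => f x • g x) x := hf.smul hg

theorem SmoothCoef.continuousAt_normalized (h : SmoothCoef A B Ω) {S : Jet n}
    (hS : S.2.1.1.1 ∈ Ω) (hT : 0 < T A S.2.1.1 3) :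
    ContinuousAt (fun S : Jet n => (κ / T A S.2.1.1 3) • KirchhoffConoid.efull A B S.2) S :=
  continuousAt_smul (continuousAt_const.div ((h.contDiffAt_T_jet hS 3).continuousAt) hT.ne')
    (ContinuousAt.comp (g := KirchhoffConoid.efull A B) (f := fun S : Jet n => S.2)
      (h.efull (Z := S.2) hS) continuousAt_snd)

namespace ConoidFlow

variable (H : ConoidFlow A B Ω y₀ κ ε Z) {q : Fin 3 → ℝ}
include H

theorem exists_bound {W : Type*} [NormedAddCommGroup W] {Φ : Jet n → W}
    (hΦ : ∀ S : Jet n, S.2.1.1.1 ∈ Ω → 0 < T A S.2.1.1 3 → ContinuousAt Φ S) :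
    ∃ C, 0 ≤ C ∧ ∀ q ∈ closedBall (0 : Fin 3 → ℝ) 2, ∀ t ∈ Icc 0 ε, ‖Φ (q, Z t q)‖ ≤ C := by
  have hc : ContinuousOn (fun x : ℝ × (Fin 3 → ℝ) => Φ (x.2, Z x.1 x.2))
      (Icc 0 ε ×ˢ closedBall 0 2) := fun x hx =>
    (hΦ (x.2, Z x.1 x.2) (H.mem _ hx.2 _ hx.1) (H.pos _ hx.2 _ hx.1)).comp_continuousWithinAt
      (f := fun x : ℝ × (Fin 3 → ℝ) => ((x.2, Z x.1 x.2) : Jet n))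
      (continuousWithinAt_snd.prodMk (H.cont x hx))
  obtain ⟨C, hC⟩ := (isCompact_Icc.prod (isCompact_closedBall _ _)).exists_bound_of_continuousOn hc
  exact ⟨max C 0, le_max_right _ _, fun q hq t ht => (hC (t, q) ⟨ht, hq⟩).trans (le_max_left _ _)⟩

theorem sub_le_of_contDiff {Φ : ZVal n → ℝ}
    (hΦ : ∀ z : ZVal n, z.1.1.1 ∈ Ω → 0 < T A z.1.1 3 → ContDiffAt ℝ 1 Φ z) :
    ∃ C, 0 ≤ C ∧ ∀ q ∈ closedBall (0 : Fin 3 → ℝ) 2, ∀ t ∈ Icc 0 ε,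
      |Φ (Z t q) - Φ (Z 0 q)| ≤ C * t := by
  obtain ⟨C, hC0, hC⟩ := H.exists_bound (Φ := fun S : Jet n =>
    fderiv ℝ Φ S.2 ((κ / T A S.2.1.1 3) • efull A B S.2)) (fun S hS hT => by
      refine ContinuousAt.clm_apply ?_ (H.smooth.continuousAt_normalized hS hT)
      exact ((hΦ S.2 hS hT).fderiv_right (m := 0) (by norm_num)).continuousAt.comp continuousAt_snd)
  refine ⟨C, hC0, fun q hq t ht => ?_⟩
  have := abs_le_of_hasDerivWithinAt_le (f := fun t => Φ (Z t q) - Φ (Z 0 q)) (k := 0)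
    (fun t ht => (((hΦ _ (H.mem q hq t ht) (H.pos q hq t ht)).differentiableAt
      one_ne_zero).hasFDerivAt.comp_hasDerivWithinAt t (H.deriv q hq t ht)).sub_const _)
    (by simp) hC0 (fun t ht => by rw [pow_zero, mul_one]; exact hC q hq t ht) ht
  simpa using this

theorem quadratic_le (ℓ : ZVal n →L[ℝ] ℝ) (hℓ : ∀ z, ℓ (tr z) = ℓ z) :
    ∃ C, 0 ≤ C ∧ ∀ q ∈ closedBall (0 : Fin 3 → ℝ) 2, ∀ t ∈ Icc 0 ε,
      |ℓ (Z t q) - ℓ (Z 0 q) - t * ℓ (timeField A B κ (Z 0 q))| ≤ C * t ^ 2 := by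
  obtain ⟨C, hC0, hC⟩ := H.sub_le_of_contDiff (Φ := fun z => ℓ (timeField A B κ z))
    (fun z hz hT => ℓ.contDiff.contDiffAt.comp z (H.smooth.contDiffAt_timeField hz hT.ne'))
  refine ⟨C, hC0, fun q hq t ht => ?_⟩
  refine abs_le_of_hasDerivWithinAt_le (f := fun t => ℓ (Z t q) - ℓ (Z 0 q) -
    t * ℓ (timeField A B κ (Z 0 q))) (k := 1) (f' := fun t => ℓ (timeField A B κ (Z t q)) -
      ℓ (timeField A B κ (Z 0 q))) (fun t ht => ?_) (by simp) hC0
    (fun t ht => by simpa using hC q hq t ht) ht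
  have h1 := ((H.deriv_entry hq ht ℓ).sub_const (ℓ (Z 0 q))).sub
    (((hasDerivAt_id t).mul_const (ℓ (timeField A B κ (Z 0 q)))).hasDerivWithinAt)
  refine h1.congr_deriv ?_
  rw [one_mul]
  congr 1
  rw [timeField, map_smul, smul_eq_mul, elow, hℓ]

theorem norm_sub_le : ∃ C, 0 ≤ C ∧ ∀ q ∈ closedBall (0 : Fin 3 → ℝ) 2, ∀ t ∈ Icc 0 ε,
    ‖Z t q - Z 0 q‖ ≤ C * t := by
  obtain ⟨C, hC0, hC⟩ := H.exists_bound (Φ := fun S : Jet n =>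
    (κ / T A S.2.1.1 3) • efull A B S.2) fun S hS hT =>
      H.smooth.continuousAt_normalized hS hT
  refine ⟨C, hC0, fun q hq t ht => ?_⟩
  have hsub : Icc 0 t ⊆ Icc 0 ε := Icc_subset_Icc_right ht.2
  have h1 := (convex_Icc (0 : ℝ) t).norm_image_sub_le_of_norm_hasDerivWithin_le
    (f := fun t => Z t q) (C := C) (fun s hs => (H.deriv q hq s (hsub hs)).mono hsub)
    (fun s hs => hC q hq s (hsub hs)) (left_mem_Icc.2 ht.1) (right_mem_Icc.2 ht.1)
  rwa [sub_zero, Real.norm_eq_abs, abs_of_nonneg ht.1] at h1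

set_option synthInstance.maxSize 10000 in
set_option synthInstance.maxHeartbeats 400000 in
set_option maxHeartbeats 1000000 in
/-- The third derivatives of the `y^α`. -/
theorem y_third_le (h k l : Fin 3) (α : Fin 4) :
    ∃ C, 0 ≤ C ∧ ∀ q ∈ closedBall (0 : Fin 3 → ℝ) 2, ∀ t ∈ Icc 0 ε,
      |((Z t q).1.2.2.2 h k l).1 α| ≤ C * t ^ 2 := by
  have hb3 := fun (S : Jet n) (hS : S.2.1.1.1 ∈ Ω) => H.smooth.bichar (v := S.2.1.1) hS
  have hb2 := fun (S : Jet n) (hS : S.2.1.1.1 ∈ Ω) => (hb3 S hS).fderiv_right (m := 2) (by norm_num)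
  have hb1 := fun (S : Jet n) (hS : S.2.1.1.1 ∈ Ω) => (hb2 S hS).fderiv_right (m := 1) (by norm_num)
  have hb0 := fun (S : Jet n) (hS : S.2.1.1.1 ∈ Ω) => (hb1 S hS).fderiv_right (m := 0) (by norm_num)
  have hv : ∀ S : Jet n, ContinuousAt (fun S : Jet n => S.2.1.1) S := fun S => by fun_prop
  obtain ⟨C₁, hC₁0, hC₁⟩ := H.exists_bound (Φ := fun S : Jet n => fderiv ℝ (bichar A) S.2.1.1)
    (fun S hS _ => (hb2 S hS).continuousAt.comp (f := fun S : Jet n => S.2.1.1) (hv S))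
  obtain ⟨C₂, hC₂0, hC₂⟩ := H.exists_bound (Φ := fun S : Jet n =>
    fderiv ℝ (fderiv ℝ (bichar A)) S.2.1.1)
    (fun S hS _ => (hb1 S hS).continuousAt.comp (f := fun S : Jet n => S.2.1.1) (hv S))
  let _i2 : NormedAddCommGroup (Ph →L[ℝ] Ph →L[ℝ] Ph) := inferInstance
  let _j2 : NormedSpace ℝ (Ph →L[ℝ] Ph →L[ℝ] Ph) := inferInstance
  let _i3 : NormedAddCommGroup (Ph →L[ℝ] Ph →L[ℝ] Ph →L[ℝ] Ph) :=
    ContinuousLinearMap.toNormedAddCommGroup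
  obtain ⟨C₃, hC₃0, hC₃⟩ := H.exists_bound (Φ := fun S : Jet n =>
    fderiv ℝ (fderiv ℝ (fderiv ℝ (bichar A))) S.2.1.1)
    (fun S hS _ => (hb0 S hS).continuousAt.comp (f := fun S : Jet n => S.2.1.1) (hv S))
  obtain ⟨M, hM0, hM⟩ := H.exists_bound (Φ := fun S : Jet n => S.2) (fun S _ _ => by fun_prop)
  obtain ⟨N, hN0, hN⟩ := H.exists_bound (Φ := fun S : Jet n => κ / T A S.2.1.1 3)
    (fun S hS hT => continuousAt_const.div ((H.smooth.contDiffAt_T_jet hS 3).continuousAt) hT.ne')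
  obtain ⟨L, hL0, hL⟩ := H.norm_sub_le
  refine ⟨N * (C₃ * L * M * M + C₃ * M * L * M + C₃ * M * M * L + C₂ * L * M + C₂ * L * M +
    C₂ * L * M + C₁ * L), by positivity, fun q hq t ht => ?_⟩
  refine abs_le_of_hasDerivWithinAt_le (f := fun t => ((Z t q).1.2.2.2 h k l).1 α) (k := 1)
    (f' := fun t => κ / T A (Z t q).1.1 3 * ((efull A B (Z t q)).1.2.2.2 h k l).1 α)
    (fun t ht => ?_) ?_ (by positivity) (fun t ht => ?_) ht
  · have h1 := (H.deriv q hq t ht).fst.snd.snd.snd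
    exact hasDerivWithinAt_pi.1 ((hasDerivWithinAt_pi.1 (hasDerivWithinAt_pi.1
      (hasDerivWithinAt_pi.1 h1 h) k) l).fst) α
  · rw [H.init q hq]; rfl
  have hm := H.mem q hq t ht
  have d1 := hC₁ q hq t ht
  have d2 := hC₂ q hq t ht
  have d3 := hC₃ q hq t ht
  have hZM := hM q hq t ht
  have hZ0 := hM q hq 0 ⟨le_rfl, ht.1.trans ht.2⟩
  have hZL := hL q hq t ht
  have hin := H.init q hq
  have hn := hN q hq t ht
  rw [Real.norm_eq_abs] at hn
  simp only at d1 d2 d3 hZM hZ0 hn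
  set z := Z t q with hz
  set z₀ := Z 0 q with hz₀
  clear_value z z₀
  have ht0 := ht.1
  have n1 : ∀ w : ZVal n, ∀ j, ‖w.1.2.1 j‖ ≤ ‖w‖ := fun w j =>
    (norm_le_pi_norm _ j).trans ((norm_fst_le _).trans ((norm_snd_le _).trans (norm_fst_le _)))
  have n2 : ∀ w : ZVal n, ∀ j k, ‖w.1.2.2.1 j k‖ ≤ ‖w‖ := fun w j k =>
    (norm_le_pi_norm _ k).trans ((norm_le_pi_norm _ j).trans ((norm_fst_le _).trans
      ((norm_snd_le _).trans ((norm_snd_le _).trans (norm_fst_le _)))))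
  have n3 : ∀ w : ZVal n, ∀ j k l, ‖w.1.2.2.2 j k l‖ ≤ ‖w‖ := fun w j k l =>
    (norm_le_pi_norm _ l).trans ((norm_le_pi_norm _ k).trans ((norm_le_pi_norm _ j).trans
      ((norm_snd_le _).trans ((norm_snd_le _).trans ((norm_snd_le _).trans (norm_fst_le _))))))
  have a1 : ∀ j, ‖z.1.2.1 j - z₀.1.2.1 j‖ ≤ L * t := fun j => (n1 (z - z₀) j).trans hZL
  have a2 : ∀ j k, ‖z.1.2.2.1 j k‖ ≤ L * t := fun j k => by
    have e : z.1.2.2.1 j k = (z - z₀).1.2.2.1 j k := by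
      rw [hin]; simp [X0]
    rw [e]; exact (n2 _ j k).trans hZL
  have a3 : ‖z.1.2.2.2 h k l‖ ≤ L * t := by
    have e : z.1.2.2.2 h k l = (z - z₀).1.2.2.2 h k l := by
      rw [hin]; simp [X0]
    rw [e]; exact (n3 _ h k l).trans hZL
  have b1 : ∀ j, ‖z.1.2.1 j‖ ≤ M := fun j => (n1 z j).trans hZM
  have b0 : ∀ j, ‖z₀.1.2.1 j‖ ≤ M := fun j => (n1 z₀ j).trans hZ0
  have z0 : ∀ j, z₀.1.2.1 j = (0, Pi.single j 1) := fun j => by rw [hin]; rfl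
  set D₁ := fderiv ℝ (bichar A) z.1.1 with hD₁
  set D₂ := fderiv ℝ (fderiv ℝ (bichar A)) z.1.1 with hD₂
  set D₃ := fderiv ℝ (fderiv ℝ (fderiv ℝ (bichar A))) z.1.1 with hD₃
  have e1 : ((efull A B z).1.2.2.2 h k l).1 α =
      (D₃ (z.1.2.1 h) (z.1.2.1 k) (z.1.2.1 l) - D₃ (z₀.1.2.1 h) (z₀.1.2.1 k) (z₀.1.2.1 l) +
        D₂ (z.1.2.2.1 h k) (z.1.2.1 l) + D₂ (z.1.2.2.1 h l) (z.1.2.1 k) +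
        D₂ (z.1.2.2.1 k l) (z.1.2.1 h) + D₁ (z.1.2.2.2 h k l)).1 α := by
    have e2 : (D₃ (z₀.1.2.1 h) (z₀.1.2.1 k) (z₀.1.2.1 l)).1 = 0 := by
      simp only [z0]
      exact H.smooth.fderiv_fderiv_fderiv_bichar_vert hm _ _ _
    have e3 : (efull A B z).1.2.2.2 h k l = D₃ (z.1.2.1 h) (z.1.2.1 k) (z.1.2.1 l) +
        D₂ (z.1.2.2.1 h k) (z.1.2.1 l) + D₂ (z.1.2.2.1 h l) (z.1.2.1 k) +
        D₂ (z.1.2.2.1 k l) (z.1.2.1 h) + D₁ (z.1.2.2.2 h k l) := by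
      simp only [efull, E, iteratedFDeriv_two_apply]
      rw [iteratedFDeriv_three_apply (H.smooth.bichar hm)]
      rfl
    rw [e3]
    simp only [Prod.fst_add, Prod.fst_sub, Pi.add_apply, Pi.sub_apply, e2]
    simp
  have t3 : ∀ a b c : Ph, ‖D₃ a b c‖ ≤ C₃ * ‖a‖ * ‖b‖ * ‖c‖ := fun a b c => by
    refine ((D₃ a b).le_opNorm c).trans ?_
    refine mul_le_mul_of_nonneg_right (((D₃ a).le_opNorm b).trans ?_) (norm_nonneg _)
    refine mul_le_mul_of_nonneg_right ((D₃.le_opNorm a).trans ?_) (norm_nonneg _)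
    exact mul_le_mul_of_nonneg_right d3 (norm_nonneg _)
  have t2 : ∀ a b : Ph, ‖D₂ a b‖ ≤ C₂ * ‖a‖ * ‖b‖ := fun a b => by
    refine ((D₂ a).le_opNorm b).trans ?_
    refine mul_le_mul_of_nonneg_right ((D₂.le_opNorm a).trans ?_) (norm_nonneg _)
    exact mul_le_mul_of_nonneg_right d2 (norm_nonneg _)
  have t1 : ∀ a : Ph, ‖D₁ a‖ ≤ C₁ * ‖a‖ := fun a =>
    (D₁.le_opNorm a).trans (mul_le_mul_of_nonneg_right d1 (norm_nonneg _))
  have e4 : D₃ (z.1.2.1 h) (z.1.2.1 k) (z.1.2.1 l) - D₃ (z₀.1.2.1 h) (z₀.1.2.1 k) (z₀.1.2.1 l) =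
      D₃ (z.1.2.1 h - z₀.1.2.1 h) (z.1.2.1 k) (z.1.2.1 l) +
      D₃ (z₀.1.2.1 h) (z.1.2.1 k - z₀.1.2.1 k) (z.1.2.1 l) +
      D₃ (z₀.1.2.1 h) (z₀.1.2.1 k) (z.1.2.1 l - z₀.1.2.1 l) := by
    simp only [map_sub, sub_apply]
    abel
  have hLt : 0 ≤ L * t := mul_nonneg hL0 ht0
  have g3 : ∀ a b c : Ph, ∀ x y w, ‖a‖ ≤ x → ‖b‖ ≤ y → ‖c‖ ≤ w → ‖D₃ a b c‖ ≤ C₃ * x * y * w :=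
    fun a b c x y w ha hb hc => (t3 a b c).trans (by
      have := (norm_nonneg a).trans ha
      have := (norm_nonneg b).trans hb
      gcongr)
  have g2 : ∀ a b : Ph, ∀ x y, ‖a‖ ≤ x → ‖b‖ ≤ y → ‖D₂ a b‖ ≤ C₂ * x * y :=
    fun a b x y ha hb => (t2 a b).trans (by
      have := (norm_nonneg a).trans ha
      gcongr)
  have main : ‖D₃ (z.1.2.1 h) (z.1.2.1 k) (z.1.2.1 l) - D₃ (z₀.1.2.1 h) (z₀.1.2.1 k) (z₀.1.2.1 l) +
        D₂ (z.1.2.2.1 h k) (z.1.2.1 l) + D₂ (z.1.2.2.1 h l) (z.1.2.1 k) +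
        D₂ (z.1.2.2.1 k l) (z.1.2.1 h) + D₁ (z.1.2.2.2 h k l)‖ ≤
      C₃ * (L * t) * M * M + C₃ * M * (L * t) * M + C₃ * M * M * (L * t) + C₂ * (L * t) * M +
        C₂ * (L * t) * M + C₂ * (L * t) * M + C₁ * (L * t) := by
    rw [e4]
    refine (norm_add_le _ _).trans (add_le_add ((norm_add_le _ _).trans (add_le_add
      ((norm_add_le _ _).trans (add_le_add ((norm_add_le _ _).trans (add_le_add
        ((norm_add_le _ _).trans (add_le_add ((norm_add_le _ _).trans (add_le_add ?_ ?_)) ?_))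
          ?_)) ?_)) ?_)) ?_)
    · exact g3 _ _ _ _ _ _ (a1 h) (b1 k) (b1 l)
    · exact g3 _ _ _ _ _ _ (b0 h) (a1 k) (b1 l)
    · exact g3 _ _ _ _ _ _ (b0 h) (b0 k) (a1 l)
    · exact g2 _ _ _ _ (a2 h k) (b1 l)
    · exact g2 _ _ _ _ (a2 h l) (b1 k)
    · exact g2 _ _ _ _ (a2 k l) (b1 h)
    · exact (t1 _).trans (mul_le_mul_of_nonneg_left a3 hC₁0)
  rw [e1, abs_mul, pow_one]
  have hp : ∀ w : Ph, |w.1 α| ≤ ‖w‖ := fun w => (norm_le_pi_norm w.1 α).trans (norm_fst_le _)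
  refine (mul_le_mul hn ((hp _).trans main) (abs_nonneg _) hN0).trans (le_of_eq ?_)
  ring

end ConoidFlow

end VertexEstimates


section Coordinates

variable {n : ℕ}

/-- The entries `(y_j, z_j)`. -/
def v1co (j : Fin 3) : ZVal n →L[ℝ] Ph :=
  (ContinuousLinearMap.proj (R := ℝ) (φ := fun _ : Fin 3 => Ph) j).comp
    ((ContinuousLinearMap.fst ℝ (Fin 3 → Ph) _).comp
      ((ContinuousLinearMap.snd ℝ Ph _).comp (ContinuousLinearMap.fst ℝ XVal (WVal n))))

/-- The entries `(y_{jh}, z_{jh})`. -/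
def v2co (j h : Fin 3) : ZVal n →L[ℝ] Ph :=
  (ContinuousLinearMap.proj (R := ℝ) (φ := fun _ : Fin 3 => Ph) h).comp
    ((ContinuousLinearMap.proj (R := ℝ) (φ := fun _ : Fin 3 => Fin 3 → Ph) j).comp
      ((ContinuousLinearMap.fst ℝ (Fin 3 → Fin 3 → Ph) _).comp
        ((ContinuousLinearMap.snd ℝ (Fin 3 → Ph) _).comp
          ((ContinuousLinearMap.snd ℝ Ph _).comp (ContinuousLinearMap.fst ℝ XVal (WVal n))))))

/-- The `y` entries of a contact element. -/
def yPh (α : Fin 4) : Ph →L[ℝ] ℝ :=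
  (ContinuousLinearMap.proj (R := ℝ) (φ := fun _ : Fin 4 => ℝ) α).comp
    (ContinuousLinearMap.fst ℝ Pt (Fin 3 → ℝ))

/-- The `p` entries of a contact element. -/
def pPh (j : Fin 3) : Ph →L[ℝ] ℝ :=
  (ContinuousLinearMap.proj (R := ℝ) (φ := fun _ : Fin 3 => ℝ) j).comp
    (ContinuousLinearMap.snd ℝ Pt (Fin 3 → ℝ))

/-- The entries `ω^r_{sj}`. -/
def w1co (j : Fin 3) (r s : Fin n) : ZVal n →L[ℝ] ℝ :=
  (ContinuousLinearMap.proj (R := ℝ) (φ := fun _ : Fin n => ℝ) s).comp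
    ((ContinuousLinearMap.proj (R := ℝ) (φ := fun _ : Fin n => Fin n → ℝ) r).comp
      ((ContinuousLinearMap.proj (R := ℝ) (φ := fun _ : Fin 3 => Mat n) j).comp
        ((ContinuousLinearMap.fst ℝ (Fin 3 → Mat n) _).comp
          ((ContinuousLinearMap.snd ℝ (Mat n) _).comp (ContinuousLinearMap.snd ℝ XVal (WVal n))))))

/-- The entries `ω^r_{sjh}`. -/
def w2co (j h : Fin 3) (r s : Fin n) : ZVal n →L[ℝ] ℝ :=
  (ContinuousLinearMap.proj (R := ℝ) (φ := fun _ : Fin n => ℝ) s).comp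
    ((ContinuousLinearMap.proj (R := ℝ) (φ := fun _ : Fin n => Fin n → ℝ) r).comp
      ((ContinuousLinearMap.proj (R := ℝ) (φ := fun _ : Fin 3 => Mat n) h).comp
        ((ContinuousLinearMap.proj (R := ℝ) (φ := fun _ : Fin 3 => Fin 3 → Mat n) j).comp
          ((ContinuousLinearMap.snd ℝ (Fin 3 → Mat n) _).comp
            ((ContinuousLinearMap.snd ℝ (Mat n) _).comp
              (ContinuousLinearMap.snd ℝ XVal (WVal n)))))))

end Coordinates

section Adapted

open Filter Topology Set Metric GradedDomain

variable {n : ℕ} {A : CoefA} {B : CoefB n} {Ω : Set Pt} {y₀ : Pt} {κ ε : ℝ}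
  {Z : ℝ → (Fin 3 → ℝ) → ZVal n}

/-- The domain `G` consists of regular jets, its points being jets of the flow `Z`. -/
structure IsAdapted (A : CoefA) (B : CoefB n) (Ω : Set Pt) (ε : ℝ) (Z : ℝ → (Fin 3 → ℝ) → ZVal n)
    (G : GradedDomain (Jet n)) : Prop where
  D_eq : G.D = disp A B
  regular : ∀ S ∈ G.U, IsRegular A Ω S
  unit : ∀ x ∈ G.P, ∑ i, x.1.1 i ^ 2 = 1
  le : ∀ x ∈ G.P, x.2 ≤ ε
  eq : ∀ x ∈ G.P, x.1.2 = Z x.2 x.1.1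

/-- The increment of `y⁴` from the vertex. -/
def lam (y₀ : Pt) (S : Jet n) : ℝ := S.2.1.1.1 3 - y₀ 3

variable {G : GradedDomain (Jet n)}

theorem IsAdapted.d_eq (hG : IsAdapted A B Ω ε Z G) (i : Fin 3) (φ : Jet n → ℝ) (S : Jet n) :
    G.d i φ S = dx A B i φ S := by rw [GradedDomain.d, dx, hG.D_eq]

theorem IsAdapted.mem_ball (hG : IsAdapted A B Ω ε Z G) {x : Jet n × ℝ} (hx : x ∈ G.P) :
    x.1.1 ∈ closedBall (0 : Fin 3 → ℝ) 2 := ball_subset_closedBall (unit_mem_ball (hG.unit x hx))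

theorem IsAdapted.mem_Icc (hG : IsAdapted A B Ω ε Z G) {x : Jet n × ℝ} (hx : x ∈ G.P) :
    x.2 ∈ Icc 0 ε := ⟨(G.pos x hx).le, hG.le x hx⟩

theorem IsAdapted.fst_eq (hG : IsAdapted A B Ω ε Z G) {x : Jet n × ℝ} (hx : x ∈ G.P) :
    x.1 = (x.1.1, Z x.2 x.1.1) := Prod.ext rfl (hG.eq x hx)

section Bounds

variable (H : ConoidFlow A B Ω y₀ κ ε Z) (hG : IsAdapted A B Ω ε Z G)
include H hG

namespace ConoidFlow

theorem bd_zero {Φ : Jet n → ℝ}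
    (hΦ : ∀ S : Jet n, S.2.1.1.1 ∈ Ω → 0 < T A S.2.1.1 3 → ContinuousAt Φ S) : G.Bd 0 Φ := by
  obtain ⟨C, hC0, hC⟩ := H.exists_bound hΦ
  refine ⟨C, fun x hx => ?_⟩
  rw [zpow_zero, mul_one, hG.fst_eq hx]
  exact hC _ (hG.mem_ball hx) _ (hG.mem_Icc hx)

theorem bd_one {Φ : ZVal n → ℝ}
    (hΦ : ∀ z : ZVal n, z.1.1.1 ∈ Ω → 0 < T A z.1.1 3 → ContDiffAt ℝ 1 Φ z) :
    G.Bd 1 fun S => Φ S.2 - Φ (X0 y₀ S.1, W0 n) := by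
  obtain ⟨C, hC0, hC⟩ := H.sub_le_of_contDiff hΦ
  refine ⟨C, fun x hx => ?_⟩
  have := hC _ (hG.mem_ball hx) _ (hG.mem_Icc hx)
  rwa [H.init _ (hG.mem_ball hx), ← hG.eq x hx, ← zpow_one x.2] at this

theorem bd_entry (ℓ : ZVal n →L[ℝ] ℝ) : G.Bd 1 fun S => ℓ S.2 - ℓ (X0 y₀ S.1, W0 n) :=
  H.bd_one hG fun _ _ _ => ℓ.contDiff.contDiffAt

theorem lam_eq {x : Jet n × ℝ} (hx : x ∈ G.P) : lam y₀ x.1 = κ * x.2 := by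
  rw [lam, hG.eq x hx, H.y_three (hG.mem_ball hx) (hG.mem_Icc hx)]
  ring

theorem bd_entry_two (ℓ : ZVal n →L[ℝ] ℝ) (hℓ : ∀ z, ℓ (tr z) = ℓ z) :
    G.Bd 2 fun S => ℓ S.2 - ℓ (X0 y₀ S.1, W0 n) -
      lam y₀ S * ℓ (elow A B (X0 y₀ S.1, W0 n)) := by
  obtain ⟨C, hC0, hC⟩ := H.quadratic_le ℓ hℓ
  refine ⟨C, fun x hx => ?_⟩
  have := hC _ (hG.mem_ball hx) _ (hG.mem_Icc hx)
  rw [H.init _ (hG.mem_ball hx), ← hG.eq x hx, timeField, map_smul, smul_eq_mul] at this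
  beta_reduce
  rw [H.lam_eq hG hx]
  have e : T A ((X0 y₀ x.1.1, W0 n) : ZVal n).1.1 3 = 1 := T_vertex_three H.vertex _
  rw [e, div_one] at this
  rw [show (2 : ℤ) = ((2 : ℕ) : ℤ) from rfl, zpow_natCast]
  convert this using 2
  ring

theorem bd_y (α : Fin 4) : G.Bd 1 fun S => S.2.1.1.1 α - y₀ α := H.bd_entry hG (yco α)

theorem bd_p (j : Fin 3) : G.Bd 1 fun S => S.2.1.1.2 j - S.1 j := H.bd_entry hG (pco j)

theorem bd_y1 (h : Fin 3) (α : Fin 4) : G.Bd 1 fun S => (S.2.1.2.1 h).1 α :=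
  (H.bd_entry hG ((yPh α).comp (v1co h))).congr fun _ _ => sub_zero _

theorem bd_z1 (h j : Fin 3) :
    G.Bd 1 fun S => (S.2.1.2.1 h).2 j - (Pi.single h 1 : Fin 3 → ℝ) j :=
  H.bd_entry hG ((pPh j).comp (v1co h))

theorem bd_z2 (h k j : Fin 3) : G.Bd 1 fun S => (S.2.1.2.2.1 h k).2 j :=
  (H.bd_entry hG ((pPh j).comp (v2co h k))).congr fun _ _ => sub_zero _

theorem bd_w (r s : Fin n) : G.Bd 1 fun S => S.2.2.1 r s - if r = s then 1 else 0 :=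
  H.bd_entry hG (wco r s)

theorem bd_w1 (h : Fin 3) (r s : Fin n) : G.Bd 1 fun S => S.2.2.2.1 h r s :=
  (H.bd_entry hG (w1co h r s)).congr fun _ _ => sub_zero _

theorem bd_w2 (h k : Fin 3) (r s : Fin n) : G.Bd 1 fun S => S.2.2.2.2 h k r s :=
  (H.bd_entry hG (w2co h k r s)).congr fun _ _ => sub_zero _

theorem bd_y3 (h k l : Fin 3) (α : Fin 4) : G.Bd 2 fun S => (S.2.1.2.2.2 h k l).1 α := by
  obtain ⟨C, hC0, hC⟩ := H.y_third_le h k l α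
  refine ⟨C, fun x hx => ?_⟩
  have := hC _ (hG.mem_ball hx) _ (hG.mem_Icc hx)
  rwa [← hG.eq x hx] at this

theorem bd_A (α β : Fin 4) : G.Bd 1 fun S => A S.2.1.1.1 α β - mink α β := by
  refine (H.bd_one hG (Φ := fun z => A z.1.1.1 α β) fun z hz _ => ?_).congr fun x _ => ?_
  · exact ((H.smooth.smoothA _ hz α β).of_le (by norm_num)).comp
      (f := fun z : ZVal n => z.1.1.1) z (by fun_prop)
  · simp only [X0, H.vertex]

omit hG in
theorem mem_vertex : y₀ ∈ Ω := by
  have h0 : (0 : Fin 3 → ℝ) ∈ closedBall (0 : Fin 3 → ℝ) 2 := by simp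
  have := H.mem 0 h0 0 ⟨le_rfl, H.eps_pos.le⟩
  rwa [H.init 0 h0] at this

omit hG in
theorem dT_vertex_eq (q : Fin 3 → ℝ) (h : Fin 3) (α : Fin 4) :
    ((fderiv ℝ (bichar A) (y₀, q) (0, Pi.single h 1)).1) α =
      -(if α = h.castSucc then 1 else 0) := by
  have := H.smooth.fderiv_bichar_vert (v := (y₀, q)) (H.mem_vertex) (Pi.single h 1) α
  rw [this]
  simp only [H.vertex, sum_mul_dcov]
  rw [Finset.sum_eq_single h (fun j _ hj => by simp [hj]) (by simp)]
  have hh : h.castSucc ≠ 3 := (Fin.castSucc_lt_last h).ne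
  simp only [mink, Pi.single_eq_same, mul_one]
  by_cases e : α = h.castSucc
  · simp [e, hh]
  · simp [e]

theorem bd_rho (i : Fin 3) :
    G.Bd 2 fun S => S.2.1.1.1 i.castSucc - y₀ i.castSucc + lam y₀ S * S.1 i := by
  refine (H.bd_entry_two hG (yco i.castSucc) fun _ => rfl).congr fun x _ => ?_
  have e : yco i.castSucc (elow A B (X0 y₀ x.1.1, W0 n)) = -x.1.1 i :=
    T_vertex_castSucc H.vertex _ i
  rw [e]
  show x.1.2.1.1.1 i.castSucc - y₀ i.castSucc - _ = _
  ring

theorem bd_y1_two (h : Fin 3) (α : Fin 4) :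
    G.Bd 2 fun S => (S.2.1.2.1 h).1 α + lam y₀ S * (if α = h.castSucc then 1 else 0) := by
  refine (H.bd_entry_two hG ((yPh α).comp (v1co h)) fun _ => rfl).congr fun x _ => ?_
  have e : ((yPh α).comp (v1co h)) (elow A B (X0 y₀ x.1.1, W0 n)) =
    -(if α = h.castSucc then 1 else 0) := H.dT_vertex_eq _ _ _
  rw [e]
  show (x.1.2.1.2.1 h).1 α - 0 - _ = _
  ring

theorem bd_y1_three (h : Fin 3) : G.Bd 2 fun S => (S.2.1.2.1 h).1 3 :=
  (H.bd_y1_two hG h 3).congr fun x _ => by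
    have hh : (3 : Fin 4) ≠ h.castSucc := (Fin.castSucc_lt_last h).ne'
    simp [hh]

omit hG in
theorem y2_vertex (q : Fin 3 → ℝ) (h k : Fin 3) (α : Fin 4) :
    ((yPh α).comp (v2co h k)) (elow A B (X0 y₀ q, W0 n)) = 0 := by
  have e1 := H.smooth.fderiv_fderiv_bichar_vert (v := (y₀, q)) H.mem_vertex
    (Pi.single h 1) (Pi.single k 1)
  rw [elow_eq]
  show (fderiv ℝ (fderiv ℝ (bichar A)) (y₀, q) (0, Pi.single h 1) (0, Pi.single k 1) +
    fderiv ℝ (bichar A) (y₀, q) 0).1 α = 0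
  rw [map_zero, add_zero, e1]
  rfl

theorem bd_y2 (h k : Fin 3) (α : Fin 4) : G.Bd 2 fun S => (S.2.1.2.2.1 h k).1 α := by
  refine (H.bd_entry_two hG ((yPh α).comp (v2co h k)) fun _ => rfl).congr fun x _ => ?_
  rw [H.y2_vertex]
  show (x.1.2.1.2.2.1 h k).1 α - 0 - _ = _
  ring

end ConoidFlow

end Bounds

end Adapted


section Orders

open Filter Topology Set Metric GradedDomain

variable {n : ℕ} {A : CoefA} {B : CoefB n} {Ω : Set Pt} {y₀ : Pt} {κ ε : ℝ}
  {Z : ℝ → (Fin 3 → ℝ) → ZVal n} {G : GradedDomain (Jet n)} {m : ℕ}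

theorem sum_mul_adj3_K (S : Jet n) (i : Fin 3) :
    ∑ k, S.1 k * adj3 (K A S) k i =
      ∑ k, S.1 k * adj3 (fun i h => (S.2.1.2.1 h).1 i.castSucc) k i := by
  simp only [adj3, K, Matrix.of_apply, Fin.sum_univ_three]
  fin_cases i <;> simp <;> ring

/-- The part of `K` that is orthogonal to the initial direction. -/
def Korth (S : Jet n) (i j : Fin 3) : ℝ :=
  ∑ h, (S.2.1.2.1 h).1 i.castSucc * ((if h = j then 1 else 0) - S.1 h * S.1 j)

theorem adj3_K (S : Jet n) (k i : Fin 3) : adj3 (K A S) k i =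
    T A S.2.1.1 (i + 1).castSucc *
        (S.1 (k + 1) * Korth S (i + 2) (k + 2) - S.1 (k + 2) * Korth S (i + 2) (k + 1)) +
      T A S.2.1.1 (i + 2).castSucc *
        (S.1 (k + 2) * Korth S (i + 1) (k + 1) - S.1 (k + 1) * Korth S (i + 1) (k + 2)) +
      (Korth S (i + 1) (k + 1) * Korth S (i + 2) (k + 2) -
        Korth S (i + 1) (k + 2) * Korth S (i + 2) (k + 1)) := by
  have e : ∀ a b, K A S a b = T A S.2.1.1 a.castSucc * S.1 b + Korth S a b := fun a b => rfl
  simp only [adj3, e]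
  ring

/-- The defect of `p⁰` from being a unit vector. -/
def unitDefect (S : Jet n) : ℝ := 1 - ∑ i, S.1 i ^ 2

theorem det_K_eq (S : Jet n) : (K A S).det =
    unitDefect S * (Matrix.of fun h i : Fin 3 => (S.2.1.2.1 h).1 i.castSucc).det +
      ∑ i, T A S.2.1.1 i.castSucc *
        ∑ k, S.1 k * adj3 (fun i h => (S.2.1.2.1 h).1 i.castSucc) k i := by
  rw [det_K, unitDefect]
  congr 1
  simp [detForm, Matrix.det_fin_three, adj3, Fin.sum_univ_three]
  ring

theorem GradedDomain.Ord.adj3 {M : Fin 3 → Fin 3 → Jet n → ℝ} {k : ℤ}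
    (h : ∀ i j, G.Ord m k (M i j)) (a b : Fin 3) :
    G.Ord m (2 * k) fun S => adj3 (fun i j => M i j S) a b :=
  (((h _ _).mul (h _ _)).sub ((h _ _).mul (h _ _))).mono (by linarith)

/-- The functions that enter the derivatives along the conoid, up to the order `m`. -/
structure BaseOrd (A : CoefA) (G : GradedDomain (Jet n)) (m : ℕ) : Prop where
  q : ∀ h, G.Ord m 0 fun S => S.1 h
  y1 : ∀ h α, G.Ord m 1 fun S => (S.2.1.2.1 h).1 α
  T : ∀ α, G.Ord m 0 fun S => T A S.2.1.1 α

/-- Lower bound for `det K`. -/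
def DetBound (A : CoefA) (G : GradedDomain (Jet n)) : Prop :=
  ∃ c > 0, ∀ x ∈ G.P, c * x.2 ^ (2 : ℤ) ≤ |(K A x.1).det|

namespace BaseOrd

variable (h : BaseOrd A G m)
include h

theorem adjY (k i : Fin 3) :
    G.Ord m 2 fun S => KirchhoffConoid.adj3 (fun i h => (S.2.1.2.1 h).1 i.castSucc) k i :=
  (Ord.adj3 (M := fun i h S => (S.2.1.2.1 h).1 i.castSucc) (fun i j => h.y1 j _) k i).mono
    (by norm_num)

theorem sum_adjY (i : Fin 3) : G.Ord m 2 fun S =>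
    ∑ k, S.1 k * KirchhoffConoid.adj3 (fun i h => (S.2.1.2.1 h).1 i.castSucc) k i :=
  Ord.sum fun k _ => ((h.q k).mul (h.adjY k i)).mono (by norm_num)

theorem detY : G.Ord m 3 fun S =>
    (Matrix.of fun h i : Fin 3 => (S.2.1.2.1 h).1 i.castSucc).det := by
  simp only [Matrix.det_fin_three, Matrix.of_apply]
  have e : ∀ a b c d e f : Fin 3, G.Ord m 3 fun S => (S.2.1.2.1 a).1 b.castSucc *
      (S.2.1.2.1 c).1 d.castSucc * (S.2.1.2.1 e).1 f.castSucc := fun a b c d e f =>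
    (((h.y1 a _).mul (h.y1 c _)).mul (h.y1 e _)).mono (by norm_num)
  exact (((((e _ _ _ _ _ _).sub (e _ _ _ _ _ _)).sub (e _ _ _ _ _ _)).add (e _ _ _ _ _ _)).add
    (e _ _ _ _ _ _)).sub (e _ _ _ _ _ _)

theorem unitDefect : G.Ord m 0 fun S => unitDefect S :=
  (ord_const m 1).sub (Ord.sum fun i _ => (((h.q i).mul (h.q i)).mono (by norm_num)).congr
    fun _ _ => (sq _).symm)

theorem det : G.Ord m 2 fun S => (K A S).det := by
  simp only [det_K_eq]
  exact ((h.unitDefect.mul h.detY).mono (by norm_num)).add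
    (Ord.sum fun i _ => ((h.T _).mul (h.sum_adjY i)).mono (by norm_num))

theorem Korth (i j : Fin 3) : G.Ord m 1 fun S => Korth S i j :=
  Ord.sum fun k _ => ((h.y1 k _).mul ((ord_const m _).sub (((h.q k).mul (h.q j)).mono
    (by norm_num)))).mono (by norm_num)

theorem adjK (k i : Fin 3) : G.Ord m 1 fun S => KirchhoffConoid.adj3 (K A S) k i := by
  simp only [adj3_K]
  have e : ∀ a b c, G.Ord m 1 fun S => S.1 a * KirchhoffConoid.Korth S b c := fun a b c =>
    ((h.q a).mul (h.Korth b c)).mono (by norm_num)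
  have e2 : ∀ a b c d, G.Ord m 1 fun S => KirchhoffConoid.Korth S a b *
      KirchhoffConoid.Korth S c d := fun a b c d =>
    ((h.Korth a b).mul (h.Korth c d)).mono (by norm_num)
  exact ((((h.T _).mul ((e _ _ _).sub (e _ _ _))).mono (by norm_num)).add
    (((h.T _).mul ((e _ _ _).sub (e _ _ _))).mono (by norm_num))).add ((e2 _ _ _ _).sub (e2 _ _ _ _))

variable (hG : IsAdapted A B Ω ε Z G) (hD : DetBound A G)
include hG hD

theorem detInv : G.Ord m (-2) fun S => ((K A S).det)⁻¹ :=
  h.det.inv (fun S hS => (hG.regular S hS).2) hD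

theorem dl (i : Fin 3) : G.Ord m 0 (dl A i) := by
  refine (((h.sum_adjY i).mul (h.detInv hG hD)).mono (by norm_num)).congr fun S _ => ?_
  rw [← sum_mul_adj3_K (A := A), KirchhoffConoid.dl, Finset.sum_mul]
  exact Finset.sum_congr rfl fun k _ => by rw [inv_eq_adj3]; ring

theorem dq (i k : Fin 3) : G.Ord m (-1) (dq A i k) := by
  have e : G.Ord m (-1) fun S => (K A S)⁻¹ k i := by
    simp only [inv_eq_adj3]
    exact ((h.detInv hG hD).mul (h.adjK k i)).mono (by norm_num)
  exact e.sub (((h.q k).mul (h.dl hG hD i)).mono (by norm_num))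

end BaseOrd

section

variable (hG : IsAdapted A B Ω ε Z G)
include hG

theorem IsAdapted.d_entry (ℓ : ZVal n →L[ℝ] ℝ) (c : ℝ) (i : Fin 3) (S : Jet n) :
    G.d i (fun S => ℓ S.2 + c) S =
      dl A i S * ℓ (elow A B S.2) + ∑ h, dq A i h S * ℓ (nx h S.2) := by
  rw [hG.d_eq, ← dx_entry (A := A) (B := B) ℓ i S, dx, dx, fderiv_add_const]

omit hG in
theorem differentiable_entry (ℓ : ZVal n →L[ℝ] ℝ) (c : ℝ) (S : Jet n) :
    DifferentiableAt ℝ (fun S : Jet n => ℓ S.2 + c) S :=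
  (ℓ.differentiableAt.comp (f := fun S : Jet n => S.2) S differentiableAt_snd).add_const c

theorem IsAdapted.ord_entry (ℓ : ZVal n →L[ℝ] ℝ) (c : ℝ) {k : ℤ}
    (hb : G.Bd k fun S => ℓ S.2 + c)
    (h : ∀ i, G.Ord m (k - 1) fun S =>
      dl A i S * ℓ (elow A B S.2) + ∑ h, dq A i h S * ℓ (nx h S.2)) :
    G.Ord (m + 1) k fun S => ℓ S.2 + c :=
  Ord.succ hb (fun S _ => differentiable_entry ℓ c S) (fun i S _ => hG.d_entry ℓ c i S) h

theorem IsAdapted.d_q (i h : Fin 3) (S : Jet n) : G.d i (fun S => S.1 h) S = dq A i h S := by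
  rw [hG.d_eq, dx_q]

theorem IsAdapted.ord_q (hq : ∀ h, G.Ord m 0 fun S => S.1 h)
    (hdq : ∀ i h, G.Ord m (-1) (dq A i h)) (h : Fin 3) : G.Ord (m + 1) 0 fun S => S.1 h :=
  Ord.succ (hq h).bd (fun S _ => by fun_prop) (fun i S _ => hG.d_q i h S)
    fun i => (hdq i h).mono (by norm_num)

theorem IsAdapted.ord_of_contDiff (H : ConoidFlow A B Ω y₀ κ ε Z)
    (hdl : ∀ i, G.Ord 0 0 (dl A i)) (hdq : ∀ i h, G.Ord 0 (-1) (dq A i h)) {g : Ph → ℝ}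
    (hg : ∀ v : Ph, v.1 ∈ Ω → ContDiffAt ℝ 1 g v) : G.Ord 1 0 fun S => g S.2.1.1 := by
  have hc : ∀ S : Jet n, ContinuousAt (fun S : Jet n => S.2.1.1) S := fun S => by fun_prop
  have hf : ∀ S : Jet n, S.2.1.1.1 ∈ Ω → ContinuousAt (fun S : Jet n => fderiv ℝ g S.2.1.1) S :=
    fun S hS => ((hg _ hS).fderiv_right (m := 0) (by norm_num)).continuousAt.comp
      (f := fun S : Jet n => S.2.1.1) (hc S)
  have h1 : ∀ S : Jet n, HasFDerivAt (fun S : Jet n => S.2.1.1)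
      ((ContinuousLinearMap.fst ℝ Ph _).comp ((ContinuousLinearMap.fst ℝ XVal (WVal n)).comp
        (ContinuousLinearMap.snd ℝ (Fin 3 → ℝ) (ZVal n)))) S := fun S =>
    ContinuousLinearMap.hasFDerivAt ((ContinuousLinearMap.fst ℝ Ph _).comp
      ((ContinuousLinearMap.fst ℝ XVal (WVal n)).comp
        (ContinuousLinearMap.snd ℝ (Fin 3 → ℝ) (ZVal n))))
  have hd : ∀ S ∈ G.U, HasFDerivAt (fun S : Jet n => g S.2.1.1) _ S := fun S hS =>
    HasFDerivAt.comp (f := fun S : Jet n => S.2.1.1) S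
      (((hg _ (hG.regular S hS).1).differentiableAt one_ne_zero).hasFDerivAt) (h1 S)
  refine Ord.succ (H.bd_zero hG fun S hS _ => (hg _ hS).continuousAt.comp
    (f := fun S : Jet n => S.2.1.1) (hc S)) (fun S hS => (hd S hS).differentiableAt)
    (φ' := fun i S => dl A i S * fderiv ℝ g S.2.1.1 (bichar A S.2.1.1) +
      ∑ h, dq A i h S * fderiv ℝ g S.2.1.1 (S.2.1.2.1 h)) (fun i S hS => ?_) fun i => ?_
  · rw [hG.d_eq, dx, (hd S hS).fderiv]
    show fderiv ℝ g S.2.1.1 (dl A i S • bichar A S.2.1.1 + ∑ k, dq A i k S • S.2.1.2.1 k) = _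
    rw [map_add, map_sum, map_smul, smul_eq_mul]
    simp only [map_smul, smul_eq_mul]
  · have a1 : G.Ord 0 0 fun S => fderiv ℝ g S.2.1.1 (bichar A S.2.1.1) :=
      H.bd_zero hG fun S hS _ => (hf S hS).clm_apply ((H.smooth.bichar (v := S.2.1.1) hS).continuousAt.comp
        (f := fun S : Jet n => S.2.1.1) (hc S))
    have a2 : ∀ h, G.Ord 0 0 fun S => fderiv ℝ g S.2.1.1 (S.2.1.2.1 h) := fun h =>
      H.bd_zero hG fun S hS _ => (hf S hS).clm_apply (by fun_prop)
    exact (((hdl i).mul a1).mono (by norm_num)).add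
      (Ord.sum fun h _ => ((hdq i h).mul (a2 h)).mono (by norm_num))

end

end Orders


section Levels

open Filter Topology Set Metric GradedDomain

variable {n : ℕ} {A : CoefA} {B : CoefB n} {Ω : Set Pt} {y₀ : Pt} {κ ε : ℝ}
  {Z : ℝ → (Fin 3 → ℝ) → ZVal n} {G : GradedDomain (Jet n)} {m : ℕ}

/-- The functions that enter `det K` and the distance from the vertex, up to the order `m`. -/
structure FineOrd (A : CoefA) (G : GradedDomain (Jet n)) (y₀ : Pt) (m : ℕ) : Prop
    extends BaseOrd A G m where
  lam : G.Ord m 1 (lam y₀)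
  T_add : ∀ i : Fin 3, G.Ord m 1 fun S => KirchhoffConoid.T A S.2.1.1 i.castSucc + S.1 i
  y1_add : ∀ h i : Fin 3, G.Ord m 2 fun S => (S.2.1.2.1 h).1 i.castSucc +
    KirchhoffConoid.lam y₀ S * (if i = h then 1 else 0)
  defect : G.Ord m 1 unitDefect
  rho : ∀ i : Fin 3, G.Ord m 2 fun S => S.2.1.1.1 i.castSucc - y₀ i.castSucc +
    KirchhoffConoid.lam y₀ S * S.1 i

/-- The square of the spatial distance from the vertex. -/
def radSq (y₀ : Pt) (S : Jet n) : ℝ := ∑ i : Fin 3, (S.2.1.1.1 i.castSucc - y₀ i.castSucc) ^ 2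

namespace FineOrd

variable (h : FineOrd A G y₀ m)
include h

theorem adjY_sub (k i : Fin 3) : G.Ord m 3 fun S =>
    adj3 (fun i h => (S.2.1.2.1 h).1 i.castSucc) k i -
      KirchhoffConoid.lam y₀ S ^ 2 * (if k = i then 1 else 0) := by
  let e : Fin 3 → Fin 3 → Jet n → ℝ := fun i h S => (S.2.1.2.1 h).1 i.castSucc +
    KirchhoffConoid.lam y₀ S * (if i = h then 1 else 0)
  have he : ∀ a b, G.Ord m 2 (e a b) := fun a b => h.y1_add b a
  have hl : ∀ (c : ℝ) a b, G.Ord m 3 fun S => KirchhoffConoid.lam y₀ S * e a b S * c := fun c a b =>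
    ((h.lam.mul (he a b)).mul (ord_const m c)).mono (by norm_num)
  let δ : Fin 3 → Fin 3 → ℝ := fun a b => if a = b then 1 else 0
  have key := (((Ord.adj3 he k i).mono (l := 3) (by norm_num)).sub
    (((hl (δ (i + 2) (k + 2)) (i + 1) (k + 1)).add (hl (δ (i + 1) (k + 1)) (i + 2) (k + 2))).sub
      ((hl (δ (i + 2) (k + 1)) (i + 1) (k + 2)).add (hl (δ (i + 1) (k + 2)) (i + 2) (k + 1)))))
  refine key.congr fun S _ => ?_
  have d : (if k = i then (1 : ℝ) else 0) =
      δ (i + 1) (k + 1) * δ (i + 2) (k + 2) - δ (i + 1) (k + 2) * δ (i + 2) (k + 1) := by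
    fin_cases k <;> fin_cases i <;> simp [δ]
  rw [d]
  simp only [adj3, e, δ]
  ring

theorem det_add : G.Ord m 3 fun S => (K A S).det + KirchhoffConoid.lam y₀ S ^ 2 := by
  have h1 : G.Ord m 3 fun S => unitDefect S *
      (Matrix.of fun h i : Fin 3 => (S.2.1.2.1 h).1 i.castSucc).det :=
    (h.defect.mul h.detY).mono (by norm_num)
  have h2 : G.Ord m 3 fun S => unitDefect S * (KirchhoffConoid.lam y₀ S * KirchhoffConoid.lam y₀ S) :=
    (h.defect.mul (h.lam.mul h.lam)).mono (by norm_num)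
  have h3 : ∀ i k, G.Ord m 3 fun S => (KirchhoffConoid.T A S.2.1.1 i.castSucc + S.1 i) *
      (S.1 k * adj3 (fun i h => (S.2.1.2.1 h).1 i.castSucc) k i) := fun i k =>
    ((h.T_add i).mul ((h.q k).mul (h.adjY k i))).mono (by norm_num)
  have h4 : ∀ i k, G.Ord m 3 fun S => S.1 i * S.1 k *
      (adj3 (fun i h => (S.2.1.2.1 h).1 i.castSucc) k i -
        KirchhoffConoid.lam y₀ S ^ 2 * (if k = i then 1 else 0)) := fun i k =>
    (((h.q i).mul (h.q k)).mul (h.adjY_sub k i)).mono (by norm_num)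
  refine Ord.congr ((h1.add h2).add (Ord.sum (s := Finset.univ) fun i _ =>
    Ord.sum (s := Finset.univ) fun k _ => (h3 i k).sub (h4 i k))) fun S _ => ?_
  rw [det_K_eq, unitDefect]
  simp [Fin.sum_univ_three]
  ring

theorem radSq_sub : G.Ord m 3 fun S => radSq y₀ S - KirchhoffConoid.lam y₀ S ^ 2 := by
  have h1 : ∀ i : Fin 3, G.Ord m 3 fun S =>
      (S.2.1.1.1 i.castSucc - y₀ i.castSucc + KirchhoffConoid.lam y₀ S * S.1 i) *
      (S.2.1.1.1 i.castSucc - y₀ i.castSucc + KirchhoffConoid.lam y₀ S * S.1 i) := fun i =>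
    ((h.rho i).mul (h.rho i)).mono (by norm_num)
  have h2 : ∀ i : Fin 3, G.Ord m 3 fun S => 2 * (KirchhoffConoid.lam y₀ S *
      ((S.2.1.1.1 i.castSucc - y₀ i.castSucc + KirchhoffConoid.lam y₀ S * S.1 i) * S.1 i)) := fun i =>
    ((h.lam.mul ((h.rho i).mul (h.q i))).mono (by norm_num)).const_mul 2
  have h3 : G.Ord m 3 fun S => unitDefect S * (KirchhoffConoid.lam y₀ S * KirchhoffConoid.lam y₀ S) :=
    (h.defect.mul (h.lam.mul h.lam)).mono (by norm_num)
  refine Ord.congr ((Ord.sum (s := Finset.univ) fun i _ => (h1 i).sub (h2 i)).sub h3) fun S _ => ?_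
  simp only [radSq, unitDefect, Fin.sum_univ_three]
  ring

end FineOrd

section

variable (H : ConoidFlow A B Ω y₀ κ ε Z) (hG : IsAdapted A B Ω ε Z G)
include H hG

namespace ConoidFlow

theorem bd_elow (ℓ : ZVal n →L[ℝ] ℝ) : G.Bd 0 fun S => ℓ (elow A B S.2) :=
  H.bd_zero hG fun S hS _ => ℓ.continuous.continuousAt.comp
    ((H.smooth.elow (Z := S.2) hS).continuousAt.comp (f := fun S : Jet n => S.2) continuousAt_snd)

theorem bd_elow_sub (ℓ : ZVal n →L[ℝ] ℝ) :
    G.Bd 1 fun S => ℓ (elow A B S.2) - ℓ (elow A B (X0 y₀ S.1, W0 n)) :=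
  H.bd_one hG (Φ := fun z => ℓ (elow A B z)) fun z hz _ =>
    ℓ.contDiff.contDiffAt.comp z (H.smooth.elow hz)

theorem base_zero : BaseOrd A G 0 where
  q h := H.bd_zero hG fun S _ _ => by fun_prop
  y1 h α := H.bd_y1 hG h α
  T α := H.bd_zero hG fun S hS _ => (H.smooth.contDiffAt_T_jet hS α).continuousAt

omit H in
theorem bd_unitDefect (k : ℤ) : G.Bd k unitDefect :=
  ⟨0, fun x hx => by simp [unitDefect, hG.unit x hx]⟩

theorem bd_T_sub (α : Fin 4) :
    G.Bd 1 fun S => T A S.2.1.1 α - T A (y₀, S.1) α :=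
  H.bd_one hG (Φ := fun z => T A z.1.1 α) fun z hz _ =>
    ((H.smooth.contDiffAt_T hz α).of_le (by norm_num)).comp
      (f := fun z : ZVal n => z.1.1) z (by fun_prop)

theorem fine_zero : FineOrd A G y₀ 0 where
  toBaseOrd := H.base_zero hG
  lam := H.bd_y hG 3
  T_add i := (H.bd_T_sub hG i.castSucc).congr fun x _ => by
    rw [T_vertex_castSucc H.vertex, sub_neg_eq_add]
  y1_add h i := (H.bd_y1_two hG h i.castSucc).congr fun x _ => by
    simp only [Fin.castSucc_inj]
  defect := bd_unitDefect hG 1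
  rho i := H.bd_rho hG i

section Higher

variable (hD : DetBound A G)
include hD

theorem ord_one_of_contDiff {g : Ph → ℝ} (hg : ∀ v : Ph, v.1 ∈ Ω → ContDiffAt ℝ 1 g v) :
    G.Ord 1 0 fun S => g S.2.1.1 :=
  hG.ord_of_contDiff H ((H.base_zero hG).dl hG hD) ((H.base_zero hG).dq hG hD) hg

theorem ord_z1 (h j : Fin 3) :
    G.Ord 1 1 fun S => (S.2.1.2.1 h).2 j - (Pi.single h 1 : Fin 3 → ℝ) j := by
  have hb := H.base_zero hG
  have := hG.ord_entry (m := 0) (k := 1) ((pPh j).comp (v1co h)) (-(Pi.single h 1 : Fin 3 → ℝ) j)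
    (H.bd_z1 hG h j) fun i => (((hb.dl hG hD i).mul (H.bd_elow hG _)).mono (by norm_num)).add
      (Ord.sum fun k _ => ((hb.dq hG hD i k).mul (H.bd_z2 hG h k j)).mono (by norm_num))
  exact this

theorem base_one : BaseOrd A G 1 where
  q := hG.ord_q (H.base_zero hG).q ((H.base_zero hG).dq hG hD)
  y1 h α := by
    have hb := H.base_zero hG
    have := hG.ord_entry (m := 0) (k := 1) ((yPh α).comp (v1co h)) 0
      ((H.bd_y1 hG h α).congr fun x _ => (add_zero _).symm) fun i =>
      (((hb.dl hG hD i).mul (H.bd_elow hG _)).mono (by norm_num)).add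
      (Ord.sum fun k _ => ((hb.dq hG hD i k).mul (H.bd_y2 hG h k α)).mono (by norm_num))
    exact this.congr fun S _ => add_zero _
  T α := H.ord_one_of_contDiff hG hD fun v hv => (H.smooth.contDiffAt_T hv α).of_le (by norm_num)

theorem ord_y2 (h k : Fin 3) (α : Fin 4) : G.Ord 1 2 fun S => (S.2.1.2.2.1 h k).1 α := by
  have hb := H.base_zero hG
  have e : G.Bd 1 fun S => ((yPh α).comp (v2co h k)) (elow A B S.2) :=
    (H.bd_elow_sub hG ((yPh α).comp (v2co h k))).congr fun x _ => by
      rw [H.y2_vertex, sub_zero]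
  have := hG.ord_entry (m := 0) (k := 2) ((yPh α).comp (v2co h k)) 0
      ((H.bd_y2 hG h k α).congr fun x _ => (add_zero _).symm) fun i =>
      (((hb.dl hG hD i).mul e).mono (by norm_num)).add
      (Ord.sum fun l _ => ((hb.dq hG hD i l).mul (H.bd_y3 hG h k l α)).mono (by norm_num))
  exact this.congr fun S _ => add_zero _

theorem ord_y1_three (h : Fin 3) : G.Ord 1 2 fun S => (S.2.1.2.1 h).1 3 := by
  have hb := H.base_zero hG
  have e : G.Bd 1 fun S => ((yPh 3).comp (v1co h)) (elow A B S.2) :=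
    (H.bd_elow_sub hG ((yPh 3).comp (v1co h))).congr fun x _ => by
      have e1 : ((yPh 3).comp (v1co h)) (elow A B (X0 y₀ x.1.1, W0 n)) =
        -(if 3 = h.castSucc then 1 else 0) := H.dT_vertex_eq _ _ _
      have hh : (3 : Fin 4) ≠ h.castSucc := (Fin.castSucc_lt_last h).ne'
      rw [e1, if_neg hh, neg_zero, sub_zero]
  have := hG.ord_entry (m := 0) (k := 2) ((yPh 3).comp (v1co h)) 0
      ((H.bd_y1_three hG h).congr fun x _ => (add_zero _).symm) fun i =>
      (((hb.dl hG hD i).mul e).mono (by norm_num)).add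
      (Ord.sum fun l _ => ((hb.dq hG hD i l).mul (H.bd_y2 hG h l 3)).mono (by norm_num))
  exact this.congr fun S _ => add_zero _

theorem ord_w1 (h : Fin 3) (r s : Fin n) : G.Ord 1 1 fun S => S.2.2.2.1 h r s := by
  have hb := H.base_zero hG
  have := hG.ord_entry (m := 0) (k := 1) (w1co h r s) 0
      ((H.bd_w1 hG h r s).congr fun x _ => (add_zero _).symm) fun i =>
      (((hb.dl hG hD i).mul (H.bd_elow hG _)).mono (by norm_num)).add
      (Ord.sum fun l _ => ((hb.dq hG hD i l).mul (H.bd_w2 hG h l r s)).mono (by norm_num))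
  exact this.congr fun S _ => add_zero _

theorem ord_w (r s : Fin n) : G.Ord 2 1 fun S => S.2.2.1 r s - if r = s then 1 else 0 := by
  have hb := H.base_zero hG
  have hb1 := H.base_one hG hD
  have h1 : ∀ r s, G.Ord 1 0 fun S => S.2.2.1 r s := fun r s => by
    have := hG.ord_entry (m := 0) (k := 1) (wco r s) (-if r = s then 1 else 0)
      (H.bd_w hG r s) fun i =>
      (((hb.dl hG hD i).mul (H.bd_elow hG _)).mono (by norm_num)).add
      (Ord.sum fun l _ => ((hb.dq hG hD i l).mul (H.bd_w1 hG l r s)).mono (by norm_num))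
    have h2 := (this.mono (l := 0) (by norm_num)).add (ord_const 1 (if r = s then (1 : ℝ) else 0))
    exact h2.congr fun S _ => neg_add_cancel_right _ _
  have hP : ∀ r t, G.Ord 1 0 fun S => transport A B S.2.1.1 r t := fun r t =>
    H.ord_one_of_contDiff hG hD fun v hv => contDiffAt_pi.1 (contDiffAt_pi.1
      ((H.smooth.transport hv).of_le (by norm_num)) r) t
  have := hG.ord_entry (m := 1) (k := 1) (wco r s) (-if r = s then 1 else 0)
      (H.bd_w hG r s) fun i => Ord.add (φ := fun S => dl A i S * wco r s (elow A B S.2)) (by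
        refine Ord.mono (k := 0) ((hb1.dl hG hD i).mul (l := 0) ?_) (by norm_num)
        exact Ord.sum (s := Finset.univ) fun t _ => ((hP r t).mul (h1 t s)).mono (by norm_num))
      (Ord.sum fun l _ => ((hb1.dq hG hD i l).mul (H.ord_w1 hG hD l r s)).mono (by norm_num))
  exact this

theorem ord_dy (α : Fin 4) (i : Fin 3) : G.Ord 1 0 fun S =>
    dl A i S * T A S.2.1.1 α + ∑ h, dq A i h S * (S.2.1.2.1 h).1 α := by
  have hb := H.base_one hG hD
  exact (((hb.dl hG hD i).mul (hb.T α)).mono (by norm_num)).add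
    (Ord.sum fun h _ => ((hb.dq hG hD i h).mul (hb.y1 h α)).mono (by norm_num))

theorem ord_y (α : Fin 4) : G.Ord 2 1 fun S => S.2.1.1.1 α - y₀ α :=
  hG.ord_entry (m := 1) (k := 1) (yco α) (-y₀ α) (H.bd_y hG α) fun i => H.ord_dy hG hD α i

theorem ord_pd {g : Pt → ℝ} (hg : ∀ y ∈ Ω, ContDiffAt ℝ 2 g y) (μ : Fin 4) :
    G.Ord 1 0 fun S => pd μ g S.2.1.1.1 :=
  H.ord_one_of_contDiff hG hD (g := fun v : Ph => pd μ g v.1) fun v hv =>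
    (((hg _ hv).fderiv_right (m := 1) (by norm_num)).clm_apply contDiffAt_const).comp
      (f := fun v : Ph => v.1) v contDiffAt_fst

theorem ord_A (α β : Fin 4) : G.Ord 2 1 fun S => A S.2.1.1.1 α β - mink α β := by
  have hg : ∀ y ∈ Ω, ContDiffAt ℝ 2 (fun y => A y α β - mink α β) y := fun y hy =>
    ((H.smooth.smoothA y hy α β).of_le (by norm_num)).sub contDiffAt_const
  refine Ord.succ (H.bd_A hG α β) (fun S hS => differentiableAt_comp_y
    ((hg _ (hG.regular S hS).1).differentiableAt two_ne_zero))
    (φ' := fun i S => ∑ μ, pd μ (fun y => A y α β - mink α β) S.2.1.1.1 *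
      (dl A i S * T A S.2.1.1 μ + ∑ h, dq A i h S * (S.2.1.2.1 h).1 μ)) (fun i S hS => ?_) fun i => ?_
  · rw [hG.d_eq, dx_comp_y (g := fun y => A y α β - mink α β)
      ((hg _ (hG.regular S hS).1).differentiableAt two_ne_zero)]
    simp only [dx_yco]
  · exact Ord.sum fun μ _ => ((H.ord_pd hG hD hg μ).mul (H.ord_dy hG hD μ i)).mono (by norm_num)

theorem ord_p (j : Fin 3) : G.Ord 2 1 fun S => S.2.1.1.2 j - S.1 j := by
  have hb := H.base_one hG hD
  refine Ord.succ (H.bd_p hG j) (fun S _ => by fun_prop) (φ' := fun i S => dl A i S * R A S.2.1.1 j +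
    ∑ h, dq A i h S * ((S.2.1.2.1 h).2 j - (Pi.single h 1 : Fin 3 → ℝ) j)) (fun i S hS => ?_) fun i => ?_
  · rw [hG.d_eq, dx_sub (differentiableAt_p j) (by fun_prop), dx_pco, dx_q]
    simp only [mul_sub, Finset.sum_sub_distrib]
    have : ∑ h, dq A i h S * (Pi.single h 1 : Fin 3 → ℝ) j = dq A i j S := by
      simp [Pi.single_apply]
    rw [this]
    ring
  · have hR : G.Ord 1 0 fun S => R A S.2.1.1 j := H.ord_one_of_contDiff hG hD fun v hv =>
      contDiffAt_pi.1 (contDiffAt_snd.comp v ((H.smooth.bichar hv).of_le (by norm_num))) j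
    exact (((hb.dl hG hD i).mul hR).mono (by norm_num)).add
      (Ord.sum fun h _ => ((hb.dq hG hD i h).mul (H.ord_z1 hG hD h j)).mono (by norm_num))

theorem ord_q (h : Fin 3) : G.Ord 2 0 fun S => S.1 h :=
  hG.ord_q (H.base_one hG hD).q ((H.base_one hG hD).dq hG hD) h

theorem ord_cov (β : Fin 4) : G.Ord 2 0 fun S => cov S.2.1.1.2 β := by
  induction β using Fin.lastCases with
  | last => exact (ord_const 2 1).congr fun S _ => (cov_three _).symm
  | cast j =>
    refine Ord.congr (((H.ord_p hG hD j).mono (l := 0) (by norm_num)).add (H.ord_q hG hD j))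
      fun S _ => ?_
    rw [cov_castSucc]; ring

theorem ord_A_zero (α β : Fin 4) : G.Ord 2 0 fun S => A S.2.1.1.1 α β :=
  (((H.ord_A hG hD α β).mono (l := 0) (by norm_num)).add (ord_const 2 (mink α β))).congr
    fun S _ => sub_add_cancel _ _

theorem ord_T (α : Fin 4) : G.Ord 2 0 fun S => T A S.2.1.1 α :=
  Ord.sum fun β _ => ((H.ord_A_zero hG hD α β).mul (H.ord_cov hG hD β)).mono (by norm_num)

theorem ord_T_sub (α : Fin 4) :
    G.Ord 2 1 fun S => T A S.2.1.1 α - ∑ β, mink α β * cov S.2.1.1.2 β := by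
  refine Ord.congr (Ord.sum (s := Finset.univ) fun β _ => ((H.ord_A hG hD α β).mul
    (H.ord_cov hG hD β)).mono (l := 1) (by norm_num)) fun S _ => ?_
  rw [T, ← Finset.sum_sub_distrib]
  exact Finset.sum_congr rfl fun β _ => by ring

theorem ord_T_add (i : Fin 3) : G.Ord 2 1 fun S => T A S.2.1.1 i.castSucc + S.1 i := by
  refine Ord.congr ((H.ord_T_sub hG hD i.castSucc).sub (H.ord_p hG hD i)) fun S _ => ?_
  have e : ∑ β, mink i.castSucc β * cov S.2.1.1.2 β = -S.2.1.1.2 i := by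
    have hi : i.castSucc ≠ 3 := (Fin.castSucc_lt_last i).ne
    simp [mink, hi, cov_castSucc]
  rw [e]; ring

theorem ord_T_three : G.Ord 2 1 fun S => T A S.2.1.1 3 - 1 := by
  refine (H.ord_T_sub hG hD 3).congr fun S _ => ?_
  have e : ∑ β, mink 3 β * cov S.2.1.1.2 β = 1 := by
    simp [mink, cov_three]
  rw [e]

theorem ord_dT (h : Fin 3) (α : Fin 4) : G.Ord 1 1 fun S =>
    ((yPh α).comp (v1co h)) (elow A B S.2) + (if α = h.castSucc then 1 else 0) := by
  have h1 : G.Ord 1 1 fun S => ∑ β, (∑ μ, pd μ (fun y => A y α β) S.2.1.1.1 *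
      (S.2.1.2.1 h).1 μ) * cov S.2.1.1.2 β := Ord.sum fun β _ =>
    ((Ord.sum (s := Finset.univ) fun μ _ => ((H.ord_pd hG hD (fun y hy =>
      (H.smooth.smoothA y hy α β).of_le (by norm_num)) μ).mul ((H.base_one hG hD).y1 h μ)).mono
      (l := 1) (by norm_num)).mul (H.ord_cov hG hD β).of_succ).mono (by norm_num)
  have hz : ∀ j, G.Ord 1 0 fun S => (S.2.1.2.1 h).2 j := fun j =>
    (((H.ord_z1 hG hD h j).mono (l := 0) (by norm_num)).add (ord_const 1 _)).congr
      fun S _ => sub_add_cancel _ _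
  have h2 : G.Ord 1 1 fun S => ∑ j : Fin 3, ((A S.2.1.1.1 α j.castSucc - mink α j.castSucc) *
      (S.2.1.2.1 h).2 j + mink α j.castSucc * ((S.2.1.2.1 h).2 j -
        (Pi.single h 1 : Fin 3 → ℝ) j)) := Ord.sum fun j _ =>
    (((H.ord_A hG hD α _).of_succ.mul (hz j)).mono (by norm_num)).add
      ((H.ord_z1 hG hD h j).const_mul _)
  refine (h1.add h2).congr fun S hS => ?_
  have e : ((yPh α).comp (v1co h)) (elow A B S.2) = dT A S.2.1.1 (S.2.1.2.1 h) α := by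
    rw [← H.smooth.fderiv_bichar (hG.regular S hS).1]; rfl
  have e2 : ∑ j : Fin 3, mink α j.castSucc * (Pi.single h 1 : Fin 3 → ℝ) j =
      -(if α = h.castSucc then 1 else 0) := by
    have hh : h.castSucc ≠ 3 := (Fin.castSucc_lt_last h).ne
    by_cases e : α = h.castSucc
    · simp [e, mink, Pi.single_apply, hh]
    · simp [e, mink, Pi.single_apply]
  have e3 : dT A S.2.1.1 (S.2.1.2.1 h) α = ∑ β, (∑ μ, pd μ (fun y => A y α β) S.2.1.1.1 *
      (S.2.1.2.1 h).1 μ) * cov S.2.1.1.2 β +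
      ∑ j : Fin 3, A S.2.1.1.1 α j.castSucc * (S.2.1.2.1 h).2 j := by
    rw [dT, Finset.sum_add_distrib, sum_mul_dcov]
  rw [e, e3, add_assoc, ← neg_neg (ite _ _ _), ← e2, ← sub_eq_add_neg, ← Finset.sum_sub_distrib]
  congr 1
  exact Finset.sum_congr rfl fun j _ => by ring

theorem base_two : BaseOrd A G 2 where
  q := H.ord_q hG hD
  y1 h α := by
    have hb := H.base_one hG hD
    have e : G.Ord 1 0 fun S => ((yPh α).comp (v1co h)) (elow A B S.2) :=
      (((H.ord_dT hG hD h α).mono (l := 0) (by norm_num)).sub (ord_const 1 _)).congr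
        fun S _ => add_sub_cancel_right _ _
    have := hG.ord_entry (m := 1) (k := 1) ((yPh α).comp (v1co h)) 0
      ((H.bd_y1 hG h α).congr fun x _ => (add_zero _).symm) fun i =>
      (((hb.dl hG hD i).mul e).mono (by norm_num)).add
      (Ord.sum fun k _ => ((hb.dq hG hD i k).mul (H.ord_y2 hG hD h k α)).mono (by norm_num))
    exact this.congr fun S _ => add_zero _
  T := H.ord_T hG hD

theorem ord_y1_add (h i : Fin 3) : G.Ord 2 2 fun S => (S.2.1.2.1 h).1 i.castSucc +
    lam y₀ S * (if i = h then 1 else 0) := by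
  have hb := H.base_one hG hD
  have h0 := (H.fine_zero hG).y1_add h i
  generalize hδ : (if i = h then (1 : ℝ) else 0) = δ at h0 ⊢
  have e : ∀ S : Jet n, (S.2.1.2.1 h).1 i.castSucc + lam y₀ S * δ =
      ((yPh i.castSucc).comp (v1co h) + δ • yco 3 : ZVal n →L[ℝ] ℝ) S.2 + -(δ * y₀ 3) := fun S => by
    show _ = ((S.2.1.2.1 h).1 i.castSucc + δ * S.2.1.1.1 3) + _
    rw [lam]; ring
  simp only [e] at h0 ⊢
  refine hG.ord_entry (m := 1) (k := 2) _ _ h0 fun i' => ?_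
  have e1 : G.Ord 1 1 fun S => ((yPh i.castSucc).comp (v1co h) + δ • yco 3 : ZVal n →L[ℝ] ℝ) (elow A B S.2) := by
    refine Ord.congr ((H.ord_dT hG hD h i.castSucc).add
      ((H.ord_T_three hG hD).of_succ.const_mul δ)) fun S _ => ?_
    simp only [Fin.castSucc_inj, hδ]
    show _ = ((yPh i.castSucc).comp (v1co h)) (elow A B S.2) + δ * T A S.2.1.1 3
    ring
  have e2 : ∀ k, G.Ord 1 2 fun S => ((yPh i.castSucc).comp (v1co h) + δ • yco 3 : ZVal n →L[ℝ] ℝ) (nx k S.2) :=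
    fun k => (H.ord_y2 hG hD h k i.castSucc).add ((H.ord_y1_three hG hD k).const_mul δ)
  exact (((hb.dl hG hD i').mul e1).mono (by norm_num)).add
    (Ord.sum fun k _ => ((hb.dq hG hD i' k).mul (e2 k)).mono (by norm_num))

theorem ord_rho (i : Fin 3) : G.Ord 2 2 fun S => S.2.1.1.1 i.castSucc - y₀ i.castSucc +
    lam y₀ S * S.1 i := by
  have hb := H.base_one hG hD
  refine Ord.succ (H.bd_rho hG i) (fun S _ => by unfold lam; fun_prop) (φ' := fun j S =>
    dl A j S * ((T A S.2.1.1 i.castSucc + S.1 i) + (T A S.2.1.1 3 - 1) * S.1 i) +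
      ∑ h, dq A j h S * (((S.2.1.2.1 h).1 i.castSucc + lam y₀ S * (if i = h then 1 else 0)) +
        (S.2.1.2.1 h).1 3 * S.1 i)) (fun j S hS => ?_) fun j => ?_
  · have hq : DifferentiableAt ℝ (fun S : Jet n => S.1 i) S := by fun_prop
    have hl : DifferentiableAt ℝ (fun S : Jet n => lam y₀ S) S := by unfold lam; fun_prop
    have hy : ∀ α, DifferentiableAt ℝ (fun S : Jet n => S.2.1.1.1 α - y₀ α) S := fun α => by fun_prop
    have d1 : ∀ α, dx A B j (fun S : Jet n => S.2.1.1.1 α - y₀ α) S =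
        dl A j S * T A S.2.1.1 α + ∑ h, dq A j h S * (S.2.1.2.1 h).1 α := fun α => by
      rw [← dx_yco (B := B), dx, dx, fderiv_sub_const]
    rw [hG.d_eq, dx_add (hy _) (hl.fun_mul hq), dx_mul hl hq, d1, dx_q]
    have d2 : dx A B j (fun S : Jet n => lam y₀ S) S = _ := d1 3
    rw [d2]
    simp only [mul_add, Finset.sum_add_distrib]
    have d3 : ∑ h, dq A j h S * (lam y₀ S * if i = h then 1 else 0) = lam y₀ S * dq A j i S := by
      simp [mul_comm]
    have d4 : ∑ h, dq A j h S * ((S.2.1.2.1 h).1 3 * S.1 i) =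
        (∑ h, dq A j h S * (S.2.1.2.1 h).1 3) * S.1 i := by
      rw [Finset.sum_mul]; exact Finset.sum_congr rfl fun _ _ => by ring
    rw [d3, d4]
    ring
  · have e1 := ((H.ord_T_add hG hD i).of_succ.add (((H.ord_T_three hG hD).of_succ.mul
      (hb.q i)).mono (l := 1) (by norm_num)))
    have e2 : ∀ h, G.Ord 1 2 fun S => ((S.2.1.2.1 h).1 i.castSucc +
        lam y₀ S * (if i = h then 1 else 0)) + (S.2.1.2.1 h).1 3 * S.1 i := fun h =>
      (H.ord_y1_add hG hD h i).of_succ.add (((H.ord_y1_three hG hD h).mul (hb.q i)).mono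
        (by norm_num))
    exact (((hb.dl hG hD j).mul e1).mono (by norm_num)).add
      (Ord.sum fun h _ => ((hb.dq hG hD j h).mul (e2 h)).mono (by norm_num))

theorem ord_unitDefect (k : ℤ) : G.Ord 2 k unitDefect := by
  have step : ∀ {m}, (∀ i, G.Ord m 0 (dl A i)) → (∀ k, G.Ord m k unitDefect) →
      ∀ k, G.Ord (m + 1) k unitDefect := fun {m} hdl hN k => by
    have hq : ∀ h, ∀ S : Jet n, DifferentiableAt ℝ (fun S : Jet n => S.1 h) S := fun h S => by fun_prop
    refine Ord.succ (bd_unitDefect hG k) (fun S _ => by unfold unitDefect; fun_prop)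
      (φ' := fun i S => -2 * (unitDefect S * dl A i S)) (fun i S hS => ?_) fun i =>
      (((hN (k - 1)).mul (hdl i)).mono (by linarith)).const_mul _
    have e : (unitDefect : Jet n → ℝ) = fun S => 1 - ∑ h, S.1 h * S.1 h :=
      funext fun S => by simp only [unitDefect, sq]
    rw [hG.d_eq, e, dx_sub (differentiableAt_const _) (DifferentiableAt.fun_sum fun h _ =>
      (hq h S).fun_mul (hq h S)), dx_const,
      dx_sum (φ := fun h (S : Jet n) => S.1 h * S.1 h) fun h _ => (hq h S).fun_mul (hq h S)]
    simp only [dx_mul (hq _ S) (hq _ S), dx_q, dq, Fin.sum_univ_three]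
    simp only [dl, Fin.sum_univ_three]
    ring
  exact step ((H.base_one hG hD).dl hG hD) (step ((H.base_zero hG).dl hG hD)
    (bd_unitDefect hG)) k

theorem fine_two : FineOrd A G y₀ 2 where
  toBaseOrd := H.base_two hG hD
  lam := H.ord_y hG hD 3
  T_add := H.ord_T_add hG hD
  y1_add := H.ord_y1_add hG hD
  defect := H.ord_unitDefect hG hD 1
  rho := H.ord_rho hG hD

end Higher

end ConoidFlow

end

end Levels


section LBound

open Filter Topology Set Metric GradedDomain

variable {n : ℕ} {A : CoefA} {B : CoefB n} {Ω : Set Pt} {y₀ : Pt} {κ ε : ℝ}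
  {Z : ℝ → (Fin 3 → ℝ) → ZVal n} {G : GradedDomain (Jet n)}

/-- The inverse of the spatial distance from the vertex. -/
noncomputable def invRad (y₀ : Pt) (S : Jet n) : ℝ := (Real.sqrt |radSq y₀ S|)⁻¹

theorem IsAdapted.d_fun (hG : IsAdapted A B Ω ε Z G) : G.d = dx A B :=
  funext fun i => funext fun φ => funext fun S => hG.d_eq i φ S

theorem GradedDomain.d_sub_mul {φ ψ : Jet n → ℝ} {S : Jet n} (hφ : DifferentiableAt ℝ φ S)
    (hψ : DifferentiableAt ℝ ψ S) (c : ℝ) (i : Fin 3) :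
    G.d i (fun S => φ S - c * ψ S) S = G.d i φ S - c * G.d i ψ S := by
  simp only [GradedDomain.d]
  rw [fderiv_fun_sub hφ (hψ.const_mul c), fderiv_const_mul hψ]
  rfl

theorem dx_radSq {S : Jet n} (hS : IsRegular A Ω S) (j : Fin 3) :
    dx A B j (radSq y₀) S = 2 * (S.2.1.1.1 j.castSucc - y₀ j.castSucc) := by
  have hd : ∀ i : Fin 3, DifferentiableAt ℝ (fun S : Jet n => S.2.1.1.1 i.castSucc - y₀ i.castSucc) S :=
    fun i => by fun_prop
  have h1 : ∀ i : Fin 3, dx A B j (fun S : Jet n => S.2.1.1.1 i.castSucc - y₀ i.castSucc) S =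
      if i = j then 1 else 0 := fun i => by
    rw [← dx_yco_castSucc (B := B) hS.2, dx, dx, fderiv_sub_const]
  have e : (radSq y₀ : Jet n → ℝ) = fun S => ∑ i : Fin 3,
      (S.2.1.1.1 i.castSucc - y₀ i.castSucc) * (S.2.1.1.1 i.castSucc - y₀ i.castSucc) :=
    funext fun S => by simp only [radSq, sq]
  rw [e, dx_sum (φ := fun i (S : Jet n) => (S.2.1.1.1 (Fin.castSucc i) - y₀ (Fin.castSucc i)) *
    (S.2.1.1.1 (Fin.castSucc i) - y₀ (Fin.castSucc i))) fun i _ => (hd i).fun_mul (hd i)]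
  simp only [dx_mul (hd _) (hd _), h1]
  rw [Finset.sum_eq_single j (fun i _ h => by simp [h]) (by simp), if_pos rfl]
  ring

theorem hasDerivAt_radSq (S : Jet n) : DifferentiableAt ℝ (radSq y₀ : Jet n → ℝ) S := by
  unfold radSq; fun_prop

theorem dx_invRad {S : Jet n} (hS : IsRegular A Ω S) (hr : radSq y₀ S ≠ 0) (j : Fin 3) :
    dx A B j (invRad y₀) S =
      -(invRad y₀ S * ((radSq y₀ S)⁻¹ * (S.2.1.1.1 j.castSucc - y₀ j.castSucc))) := by
  have h := dx_comp (A := A) (B := B) (i := j) (hasDerivAt_invSqrt hr) (hasDerivAt_radSq S)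
  rw [dx_radSq hS] at h
  refine Eq.trans h ?_
  rw [invRad]
  ring

theorem differentiableAt_invRad {S : Jet n} (hr : radSq y₀ S ≠ 0) :
    DifferentiableAt ℝ (invRad y₀ : Jet n → ℝ) S :=
  ((hasDerivAt_invSqrt hr).comp_hasFDerivAt S (hasDerivAt_radSq S).hasFDerivAt).differentiableAt

/-- The inverse of the distance is harmonic. -/
theorem sum_dx_dx_invRad (h : SmoothCoef A B Ω) {S : Jet n} (hS : IsRegular A Ω S)
    (hr : radSq y₀ S ≠ 0) : ∑ i, dx A B i (dx A B i (invRad y₀)) S = 0 := by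
  have hU : IsOpen {S : Jet n | radSq y₀ S ≠ 0} :=
    isOpen_ne.preimage (by unfold radSq; fun_prop)
  have hy : ∀ j : Fin 3, DifferentiableAt ℝ (fun S : Jet n => S.2.1.1.1 j.castSucc - y₀ j.castSucc) S :=
    fun i => by fun_prop
  have hi : DifferentiableAt ℝ (fun S : Jet n => (radSq y₀ S)⁻¹) S := (hasDerivAt_radSq S).inv hr
  have hm : ∀ j : Fin 3, DifferentiableAt ℝ (fun S : Jet n => (radSq y₀ S)⁻¹ *
      (S.2.1.1.1 j.castSucc - y₀ j.castSucc)) S := fun j => hi.fun_mul (hy j)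
  have e : ∀ j, dx A B j (dx A B j (invRad y₀)) S = 3 * invRad y₀ S * (radSq y₀ S)⁻¹ ^ 2 *
      (S.2.1.1.1 j.castSucc - y₀ j.castSucc) ^ 2 - invRad y₀ S * (radSq y₀ S)⁻¹ := fun j => by
    have h0 : dx A B j (invRad y₀) =ᶠ[𝓝 S] fun S => -(invRad y₀ S * ((radSq y₀ S)⁻¹ *
        (S.2.1.1.1 j.castSucc - y₀ j.castSucc))) := by
      filter_upwards [h.eventually_isRegular hS, hU.mem_nhds hr] with S' h1 h2
      exact dx_invRad h1 h2 j
    have h1 : dx A B j (fun S : Jet n => S.2.1.1.1 j.castSucc - y₀ j.castSucc) S = 1 := by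
      have := dx_yco_castSucc (B := B) hS.2 j j
      rw [if_pos rfl] at this
      rw [← this, dx, dx, fderiv_sub_const]
    have h2 : dx A B j (fun S : Jet n => (radSq y₀ S)⁻¹) S = _ :=
      dx_comp (A := A) (B := B) (i := j) (hasDerivAt_inv hr) (hasDerivAt_radSq S)
    rw [dx_congr h0, dx_neg, dx_mul (differentiableAt_invRad hr) (hm j), dx_mul hi (hy j),
      dx_invRad hS hr, h1, h2, dx_radSq hS]
    field_simp
    ring
  simp only [e, Finset.sum_sub_distrib, ← Finset.mul_sum]
  have : ∑ j : Fin 3, (S.2.1.1.1 j.castSucc - y₀ j.castSucc) ^ 2 = radSq y₀ S := rfl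
  rw [this]
  simp
  field_simp
  ring

namespace ConoidFlow

variable (H : ConoidFlow A B Ω y₀ κ ε Z) (hG : IsAdapted A B Ω ε Z G) (hD : DetBound A G)
  (hneg : ∀ S ∈ G.U, (K A S).det < 0) (hpos : ∀ S ∈ G.U, 0 < radSq y₀ S)
  (hR : ∃ c > 0, ∀ x ∈ G.P, c * x.2 ^ (2 : ℤ) ≤ |radSq y₀ x.1|)
include H hG hD

theorem ord_sigma : G.Ord 2 (-1) fun S => sigma A S :=
  Ord.invSqrt (k := 1) ((H.base_two hG hD).det.mono (by norm_num))
    (fun S hS => (hG.regular S hS).2) (by simp only [mul_one]; exact hD)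

theorem ord_w_zero (r s : Fin n) : G.Ord 2 0 fun S => S.2.2.1 r s :=
  (((H.ord_w hG hD r s).mono (l := 0) (by norm_num)).add
    (ord_const 2 (if r = s then (1 : ℝ) else 0))).congr fun S _ => sub_add_cancel _ _

theorem ord_sig (r s : Fin n) : G.Ord 2 (-1) fun S => sig A r s S :=
  ((H.ord_sigma hG hD).mul (H.ord_w_zero hG hD r s)).mono (by norm_num)

theorem ord_radSq : G.Ord 2 2 (radSq y₀) :=
  Ord.congr (((H.fine_two hG hD).radSq_sub.mono (l := 2) (by norm_num)).add
    (((H.fine_two hG hD).lam.mul (H.fine_two hG hD).lam).mono (l := 2) (by norm_num)))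
      fun S _ => by ring

include hneg hpos hR

omit hneg in
theorem ord_invRad : G.Ord 2 (-1) (invRad y₀) :=
  Ord.invSqrt (k := 1) ((H.ord_radSq hG hD).mono (by norm_num))
    (fun S hS => (hpos S hS).ne') (by simp only [mul_one]; exact hR)

theorem ord_sigma_sub : G.Ord 2 0 fun S => sigma A S - invRad y₀ S := by
  have hF := H.fine_two hG hD
  have h1 := Ord.invSqrt_sub (k := 1) (l := 1) (φ := fun S => -(K A S).det) (ψ := radSq y₀)
    (hF.det.neg.mono (by norm_num)) ((H.ord_radSq hG hD).mono (by norm_num))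
    (fun S hS => neg_pos.2 (hneg S hS)) hpos (by simp only [mul_one, abs_neg]; exact hD) (by simp only [mul_one]; exact hR)
    (Ord.congr ((hF.radSq_sub.add hF.det_add).mono (by norm_num)) fun S _ => by ring)
  exact (h1.mono (by norm_num)).congr fun S _ => by rw [abs_neg]; rfl

/-- The singular part of `A^{ij} σ^r_s` is a multiple of the inverse of the distance. -/
theorem ord_A_sig (i j : Fin 3) (r s : Fin n) : G.Ord 2 0 fun S =>
    A S.2.1.1.1 i.castSucc j.castSucc * sig A r s S +
      (if i = j then 1 else 0) * (if r = s then 1 else 0) * invRad y₀ S := by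
  have h1 : G.Ord 2 0 fun S => (A S.2.1.1.1 i.castSucc j.castSucc - mink i.castSucc j.castSucc) *
      sig A r s S :=
    ((H.ord_A hG hD _ _).mul (H.ord_sig hG hD r s)).mono (by norm_num)
  have h2 : G.Ord 2 0 fun S => mink i.castSucc j.castSucc * (sigma A S *
      (S.2.2.1 r s - if r = s then 1 else 0)) :=
    (((H.ord_sigma hG hD).mul (H.ord_w hG hD r s)).mono (by norm_num)).const_mul _
  have h3 := (H.ord_sigma_sub hG hD hneg hpos hR).const_mul
    (mink i.castSucc j.castSucc * if r = s then 1 else 0)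
  refine ((h1.add h2).add h3).congr fun S _ => ?_
  have hi : i.castSucc ≠ 3 := (Fin.castSucc_lt_last i).ne
  have e : mink i.castSucc j.castSucc = -(if i = j then 1 else 0) := by
    by_cases hij : i = j
    · simp [mink, hij, hij ▸ hi]
    · simp [mink, hij]
  rw [e, sig]
  ring

theorem bd_L (r s : Fin n) : G.Bd (-2) (L A B r s) := by
  have hW := fun i j => H.ord_A_sig hG hD hneg hpos hR i j r s
  have hI := H.ord_invRad hG hD hpos hR
  have hB : ∀ i t, G.Ord 1 (-1) fun S => B t r (Fin.castSucc i) S.2.1.1.1 * sig A t s S := fun i t =>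
    ((H.ord_one_of_contDiff hG hD (g := fun v : Ph => B t r (Fin.castSucc i) v.1) fun v hv =>
      ((H.smooth.smoothB _ hv t r _).of_le (by norm_num)).comp (f := fun v : Ph => v.1) v
        contDiffAt_fst).mul (H.ord_sig hG hD t s).of_succ).mono (by norm_num)
  have h1 : G.Ord 0 (-2) fun S => ∑ i, ∑ j, G.d i (G.d j fun S =>
      A S.2.1.1.1 i.castSucc j.castSucc * sig A r s S +
      (if i = j then 1 else 0) * (if r = s then 1 else 0) * invRad y₀ S) S :=
    Ord.sum fun i _ => Ord.sum fun j _ => (((hW i j).2.2 j).2.2 i).mono (by norm_num)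
  have h2 : G.Ord 0 (-2) fun S => ∑ i, ∑ t, G.d i
      (fun S => B t r (Fin.castSucc i) S.2.1.1.1 * sig A t s S) S :=
    Ord.sum fun i _ => Ord.sum fun t _ => ((hB i t).2.2 i).mono (by norm_num)
  refine (h1.sub h2).congr fun S hS => ?_
  rw [L]
  simp only [hG.d_fun]
  congr 1
  have e1 : ∀ i j, dx A B i (dx A B j fun S' =>
      A S'.2.1.1.1 i.castSucc j.castSucc * sig A r s S') S =
      dx A B i (dx A B j fun S => A S.2.1.1.1 i.castSucc j.castSucc * sig A r s S +
        (if i = j then 1 else 0) * (if r = s then 1 else 0) * invRad y₀ S) S -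
      (if i = j then 1 else 0) * (if r = s then 1 else 0) * dx A B i (dx A B j (invRad y₀)) S :=
    fun i j => by
    simp only [← hG.d_fun]
    rw [← GradedDomain.d_sub_mul (((hW i j).2.2 j).2.1 S hS) ((hI.2.2 j).2.1 S hS)]
    refine d_congr (fun S hS => ?_) i hS
    rw [← GradedDomain.d_sub_mul ((hW i j).2.1 S hS) (hI.2.1 S hS)]
    congr 1
    funext S
    ring
  simp only [e1, Finset.sum_sub_distrib]
  have e2 : ∑ i, ∑ j, (if i = j then (1 : ℝ) else 0) * (if r = s then 1 else 0) *
      dx A B i (dx A B j (invRad y₀)) S =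
      (if r = s then 1 else 0) * ∑ i, dx A B i (dx A B i (invRad y₀)) S := by
    simp [Finset.mul_sum]
  rw [e2, sum_dx_dx_invRad H.smooth (hG.regular S hS) (hpos S hS).ne', mul_zero, sub_zero]

end ConoidFlow

end LBound


section NearVertex

open Filter Topology Set Metric GradedDomain

variable {n : ℕ} {A : CoefA} {B : CoefB n} {Ω : Set Pt} {y₀ : Pt} {κ ε : ℝ}
  {Z : ℝ → (Fin 3 → ℝ) → ZVal n} {G : GradedDomain (Jet n)}

/-- The jets of a flow up to the time `τ`. -/
noncomputable def conoidDomain (A : CoefA) (B : CoefB n) (Z : ℝ → (Fin 3 → ℝ) → ZVal n) {τ : ℝ} (hτ : τ ≤ 1)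
    {U : Set (Jet n)} (hU : IsOpen U)
    (hm : ∀ q : Fin 3 → ℝ, ∑ i, q i ^ 2 = 1 → ∀ t ∈ Ioc 0 τ, ((q, Z t q) : Jet n) ∈ U) :
    GradedDomain (Jet n) where
  D := disp A B
  U := U
  P := {x | ∑ i, x.1.1 i ^ 2 = 1 ∧ x.2 ∈ Ioc 0 τ ∧ x.1.2 = Z x.2 x.1.1}
  isOpen := hU
  mem := fun x hx => by
    have : x.1 = (x.1.1, Z x.2 x.1.1) := Prod.ext rfl hx.2.2
    rw [this]; exact hm _ hx.1 _ hx.2.1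
  pos := fun x hx => hx.2.1.1
  le_one := fun x hx => hx.2.1.2.trans hτ

theorem continuous_radSq : Continuous (radSq y₀ : Jet n → ℝ) := by
  unfold radSq; fun_prop

namespace ConoidFlow

variable (H : ConoidFlow A B Ω y₀ κ ε Z)
include H

theorem exists_domain : ∃ τ, 0 < τ ∧ τ ≤ ε ∧ ∃ G : GradedDomain (Jet n), IsAdapted A B Ω ε Z G ∧
    DetBound A G ∧ (∀ S ∈ G.U, (K A S).det < 0) ∧ (∀ S ∈ G.U, 0 < radSq y₀ S) ∧
    (∃ c > 0, ∀ x ∈ G.P, c * x.2 ^ (2 : ℤ) ≤ |radSq y₀ x.1|) ∧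
    ∀ q : Fin 3 → ℝ, ∑ i, q i ^ 2 = 1 → ∀ t ∈ Ioc 0 τ, (((q, Z t q), t) : Jet n × ℝ) ∈ G.P := by
  let G₀ : GradedDomain (Jet n) := conoidDomain A B Z (τ := min ε 1) (min_le_right _ _)
    H.smooth.isOpen_isRegular fun q hq t ht =>
      (H.isConeJet hq ⟨ht.1, ht.2.trans (min_le_left _ _)⟩).isRegular
  have hG₀ : IsAdapted A B Ω ε Z G₀ := ⟨rfl, fun S hS => hS, fun x hx => hx.1,
    fun x hx => hx.2.1.2.trans (min_le_left _ _), fun x hx => hx.2.2⟩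
  have hF := H.fine_zero hG₀
  obtain ⟨C₁, hC₁0, hC₁⟩ := hF.det_add.bd.nonneg_bound
  obtain ⟨C₂, hC₂0, hC₂⟩ := hF.radSq_sub.bd.nonneg_bound
  have hκ : 0 < κ ^ 2 := by have := H.kap_ne; positivity
  let C := C₁ + C₂ + 1
  have hC : 0 < C := by positivity
  let τ := min (min ε 1) (κ ^ 2 / (2 * C))
  have hτ0 : 0 < τ := lt_min (lt_min H.eps_pos one_pos) (by positivity)
  have hτ1 : τ ≤ min ε 1 := min_le_left _ _
  have key : ∀ q : Fin 3 → ℝ, ∑ i, q i ^ 2 = 1 → ∀ t ∈ Ioc 0 τ,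
      (K A ((q, Z t q) : Jet n)).det ≤ -(κ ^ 2 / 2 * t ^ 2) ∧
      κ ^ 2 / 2 * t ^ 2 ≤ radSq y₀ ((q, Z t q) : Jet n) := fun q hq t ht => by
    have hx : (((q, Z t q), t) : Jet n × ℝ) ∈ G₀.P := ⟨hq, ⟨ht.1, ht.2.trans hτ1⟩, rfl⟩
    have h1 := hC₁ _ hx
    have h2 := hC₂ _ hx
    have h3 := H.lam_eq hG₀ hx
    simp only at h1 h2 h3
    rw [h3, show (3 : ℤ) = ((3 : ℕ) : ℤ) from rfl, zpow_natCast] at h1 h2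
    have h4 : C * t ≤ κ ^ 2 / 2 := by
      have : t ≤ κ ^ 2 / (2 * C) := ht.2.trans (min_le_right _ _)
      rw [le_div_iff₀ (by positivity)] at this
      linarith
    have h5 : C * t ^ 3 ≤ κ ^ 2 / 2 * t ^ 2 := by
      have := mul_le_mul_of_nonneg_right h4 (sq_nonneg t)
      linarith [show C * t ^ 3 = C * t * t ^ 2 by ring]
    have ht3 : 0 ≤ t ^ 3 := pow_nonneg ht.1.le 3
    have h6 : C₁ * t ^ 3 ≤ C * t ^ 3 := mul_le_mul_of_nonneg_right (by simp only [C]; linarith) ht3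
    have h7 : C₂ * t ^ 3 ≤ C * t ^ 3 := mul_le_mul_of_nonneg_right (by simp only [C]; linarith) ht3
    have h8 := (abs_le.1 h1).2
    have h9 := (abs_le.1 h2).1
    constructor <;> nlinarith
  have hpos : ∀ t ∈ Ioc 0 τ, 0 < κ ^ 2 / 2 * t ^ 2 := fun t ht => by
    have := ht.1; positivity
  have hU : IsOpen ({S : Jet n | S.2.1.1.1 ∈ Ω ∧ (K A S).det < 0} ∩ {S | 0 < radSq y₀ S}) := by
    refine IsOpen.inter ?_ (isOpen_lt continuous_const continuous_radSq)
    exact ContinuousOn.isOpen_inter_preimage (f := fun S : Jet n => (K A S).det)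
      (fun _ hS => (H.smooth.contDiffAt_det hS).continuousAt.continuousWithinAt)
      (H.smooth.isOpen.preimage (by fun_prop : Continuous fun S : Jet n => S.2.1.1.1)) isOpen_Iio
  let G : GradedDomain (Jet n) := conoidDomain A B Z (hτ1.trans (min_le_right _ _)) hU
    fun q hq t ht => ⟨⟨H.mem q (ball_subset_closedBall (unit_mem_ball hq)) t
      ⟨ht.1.le, ht.2.trans (hτ1.trans (min_le_left _ _))⟩,
      (key q hq t ht).1.trans_lt (neg_lt_zero.2 (hpos t ht))⟩,
      (hpos t ht).trans_le (key q hq t ht).2⟩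
  have hk : ∀ x ∈ G.P, (K A x.1).det ≤ -(κ ^ 2 / 2 * x.2 ^ 2) ∧ κ ^ 2 / 2 * x.2 ^ 2 ≤ radSq y₀ x.1 :=
    fun x hx => by
    have e : x.1 = (x.1.1, Z x.2 x.1.1) := Prod.ext rfl hx.2.2
    rw [e]; exact key _ hx.1 _ hx.2.1
  refine ⟨τ, hτ0, hτ1.trans (min_le_left _ _), G, ⟨rfl, fun S hS => ⟨hS.1.1, hS.1.2.ne⟩,
    fun x hx => hx.1, fun x hx => hx.2.1.2.trans (hτ1.trans (min_le_left _ _)), fun x hx => hx.2.2⟩,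
    ⟨κ ^ 2 / 2, by positivity, fun x hx => ?_⟩, fun S hS => hS.1.2, fun S hS => hS.2,
    ⟨κ ^ 2 / 2, by positivity, fun x hx => ?_⟩, fun q hq t ht => ⟨hq, ht, rfl⟩⟩
  · rw [show (2 : ℤ) = ((2 : ℕ) : ℤ) from rfl, zpow_natCast]
    exact (le_neg.1 (hk x hx).1).trans (neg_le_abs _)
  · rw [show (2 : ℤ) = ((2 : ℕ) : ℤ) from rfl, zpow_natCast]
    exact (hk x hx).2.trans (le_abs_self _)

end ConoidFlow

section Source

variable {f u : Fin n → Pt → ℝ}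

/-- The quantity under the triple integral, without its Jacobian factor. -/
noncomputable def source (A : CoefA) (B : CoefB n) (f u : Fin n → Pt → ℝ) (s : Fin n)
    (S : Jet n) : ℝ := ∑ r, (u r S.2.1.1.1 * L A B r s S + sig A r s S * f r S.2.1.1.1)

theorem SmoothCoef.continuousAt_L (h : SmoothCoef A B Ω) {S : Jet n} (hS : IsRegular A Ω S)
    (r s : Fin n) : ContinuousAt (KirchhoffConoid.L A B r s) S := by
  have h1 : ∀ i j : Fin 3, ContinuousAt (dx A B i (dx A B j fun S' =>
      A S'.2.1.1.1 i.castSucc j.castSucc * sig A r s S')) S := fun i j =>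
    (h.contDiffAt_dx (B := B) hS (k := 1) (m := 0) (h.contDiffAt_dx (B := B) hS
      (h.contDiffAt_A_sig hS _ _ r s) (m := 1) (by norm_num) le_rfl j) (by norm_num)
      (by norm_num) i).continuousAt
  have h2 : ∀ (i : Fin 3) t, ContinuousAt (dx A B i
      (fun S' => B t r i.castSucc S'.2.1.1.1 * sig A t s S')) S := fun i t =>
    (h.contDiffAt_dx hS (h.contDiffAt_B_sig hS t r _ s) (m := 0) (by norm_num) (by norm_num)
      i).continuousAt
  unfold KirchhoffConoid.L
  exact (tendsto_finsetSum _ fun i _ => tendsto_finsetSum _ fun j _ => h1 i j).sub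
    (tendsto_finsetSum _ fun i _ => tendsto_finsetSum _ fun t _ => h2 i t)

variable (h : SmoothCoef A B Ω) (hf : ∀ s, ContinuousOn (f s) Ω) (hu : IsSolution A B f Ω u)
include h hf hu

theorem SmoothCoef.continuousAt_source {S : Jet n} (hS : IsRegular A Ω S) (s : Fin n) :
    ContinuousAt (source A B f u s) S := by
  have hy : ContinuousAt (fun S : Jet n => S.2.1.1.1) S := by fun_prop
  refine tendsto_finsetSum _ fun r _ => ContinuousAt.add (ContinuousAt.mul ?_
    (h.continuousAt_L hS r s)) (ContinuousAt.mul (h.contDiffAt_sig hS r s).continuousAt ?_)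
  · exact ContinuousAt.comp (f := fun S : Jet n => S.2.1.1.1)
      (hu.contDiffAt h.isOpen hS.1 r).continuousAt hy
  · exact ContinuousAt.comp (f := fun S : Jet n => S.2.1.1.1)
      ((hf r).continuousAt (h.isOpen.mem_nhds hS.1)) hy

end Source

namespace ConoidFlow

variable (H : ConoidFlow A B Ω y₀ κ ε Z) {f u : Fin n → Pt → ℝ}
include H

theorem bd_inv_T_three (hG : IsAdapted A B Ω ε Z G) : G.Bd 0 fun S => (T A S.2.1.1 3)⁻¹ :=
  H.bd_zero hG fun _ hS hT => (H.smooth.contDiffAt_T_jet hS 3).continuousAt.inv₀ hT.ne'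

theorem bd_comp_y (hG : IsAdapted A B Ω ε Z G) {g : Pt → ℝ} (hg : ContinuousOn g Ω) :
    G.Bd 0 fun S => g S.2.1.1.1 :=
  H.bd_zero hG fun S hS _ => ContinuousAt.comp (f := fun S : Jet n => S.2.1.1.1)
      (hg.continuousAt (H.smooth.isOpen.mem_nhds hS)) (by fun_prop)

theorem exists_bound_source (hf : ∀ s, ContinuousOn (f s) Ω) (hu : IsSolution A B f Ω u)
    (s : Fin n) : ∃ C, ∀ q : Fin 3 → ℝ, ∑ i, q i ^ 2 = 1 → ∀ t ∈ Ioc 0 ε,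
      |source A B f u s (q, Z t q) * ((K A (q, Z t q)).det * (T A (Z t q).1.1 3)⁻¹)| ≤ C := by
  obtain ⟨τ, hτ0, hτ, G, hG, hD, hneg, hpos, hR, hP⟩ := H.exists_domain
  have h1 : G.Bd 0 fun S => source A B f u s S * ((K A S).det * (T A S.2.1.1 3)⁻¹) := by
    have hs : G.Ord 0 (-2) (source A B f u s) := Ord.sum fun r _ =>
      (((H.bd_comp_y hG (hu.contDiffOn r).continuousOn).mul
        (H.bd_L hG hD hneg hpos hR r s)).mono (by norm_num)).add
      (((H.ord_sig hG hD r s).bd.mul (H.bd_comp_y hG (hf r))).mono (by norm_num))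
    exact (hs.bd.mul ((H.base_two hG hD).det.bd.mul (H.bd_inv_T_three hG))).mono (by norm_num)
  obtain ⟨C₁, hC₁⟩ := h1
  have hcomp : IsCompact (Icc τ ε ×ˢ {q : Fin 3 → ℝ | ∑ i, q i ^ 2 = 1}) := by
    refine isCompact_Icc.prod ((isCompact_closedBall (0 : Fin 3 → ℝ) 2).of_isClosed_subset
      (isClosed_eq (by fun_prop) continuous_const) fun q hq =>
        ball_subset_closedBall (unit_mem_ball hq))
  have hcont : ContinuousOn (fun x : ℝ × (Fin 3 → ℝ) => source A B f u s (x.2, Z x.1 x.2) *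
      ((K A (x.2, Z x.1 x.2)).det * (T A (Z x.1 x.2).1.1 3)⁻¹))
      (Icc τ ε ×ˢ {q : Fin 3 → ℝ | ∑ i, q i ^ 2 = 1}) := by
    rintro ⟨t, q⟩ ⟨ht, hq⟩
    have hr := (H.isConeJet hq ⟨hτ0.trans_le ht.1, ht.2⟩)
    have hc : ContinuousAt (fun S : Jet n => source A B f u s S *
        ((K A S).det * (T A S.2.1.1 3)⁻¹)) (q, Z t q) :=
      (H.smooth.continuousAt_source hf hu hr.isRegular s).mul
        ((H.smooth.contDiffAt_det hr.mem).continuousAt.mul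
          ((H.smooth.contDiffAt_T_jet hr.mem 3).continuousAt.inv₀ hr.pos.ne'))
    refine ContinuousAt.comp_continuousWithinAt (f := fun x : ℝ × (Fin 3 → ℝ) =>
      ((x.2, Z x.1 x.2) : Jet n)) (x := (t, q)) hc (continuousWithinAt_snd.prodMk ?_)
    refine (H.cont (t, q) ⟨⟨hτ0.le.trans ht.1, ht.2⟩,
      ball_subset_closedBall (unit_mem_ball hq)⟩).mono (prod_mono (Icc_subset_Icc_left hτ0.le) ?_)
    exact fun q hq => ball_subset_closedBall (unit_mem_ball hq)
  obtain ⟨C₂, hC₂⟩ := hcomp.exists_bound_of_continuousOn hcont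
  refine ⟨max C₁ C₂, fun q hq t ht => ?_⟩
  rcases le_total t τ with h | h
  · have := hC₁ _ (hP q hq t ⟨ht.1, h⟩)
    rw [zpow_zero, mul_one] at this
    exact this.trans (le_max_left _ _)
  · exact (hC₂ (t, q) ⟨⟨h, ht.2⟩, hq⟩).trans (le_max_right _ _)

end ConoidFlow

end NearVertex


section FluxLimit

open Filter Topology Set Metric GradedDomain

variable {n : ℕ} {A : CoefA} {B : CoefB n} {Ω : Set Pt} {y₀ : Pt} {κ ε : ℝ}
  {Z : ℝ → (Fin 3 → ℝ) → ZVal n} {G : GradedDomain (Jet n)} {f u : Fin n → Pt → ℝ}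

namespace ConoidFlow

variable (H : ConoidFlow A B Ω y₀ κ ε Z) (hG : IsAdapted A B Ω ε Z G) (hD : DetBound A G)
  (hneg : ∀ S ∈ G.U, (K A S).det < 0) (hpos : ∀ S ∈ G.U, 0 < radSq y₀ S)
  (hR : ∃ c > 0, ∀ x ∈ G.P, c * x.2 ^ (2 : ℤ) ≤ |radSq y₀ x.1|)
include H hG hD

theorem bd_inv_T_three_sub : G.Bd 1 fun S => (T A S.2.1.1 3)⁻¹ - 1 := by
  have h : G.Ord 0 1 fun S => (T A S.2.1.1 3)⁻¹ * (T A S.2.1.1 3 - 1) :=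
    ((H.bd_inv_T_three hG).mul (H.ord_T_three hG hD).bd).mono (by norm_num)
  refine Bd.congr (h.const_mul (-1)).bd fun x hx => ?_
  have hT : T A x.1.2.1.1 3 ≠ 0 := by
    rw [hG.fst_eq hx]; exact (H.pos _ (hG.mem_ball hx) _ (hG.mem_Icc hx)).ne'
  field_simp
  ring

theorem bd_weight : G.Bd 3 fun S => (K A S).det * (T A S.2.1.1 3)⁻¹ + lam y₀ S ^ 2 := by
  have hF := H.fine_two hG hD
  refine ((hF.det.bd.mul (H.bd_inv_T_three_sub hG hD)).add
    (Bd.mono hF.det_add.bd (by norm_num))).congr fun x hx => ?_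
  ring

omit hD in
theorem bd_sum_rho_p : G.Bd 2 fun S =>
    (∑ i : Fin 3, (S.2.1.1.1 i.castSucc - y₀ i.castSucc) * S.2.1.1.2 i) + lam y₀ S := by
  have hq : ∀ i : Fin 3, G.Ord 0 0 fun S => S.1 i := fun i => (H.base_zero hG).q i
  have hpq : ∀ i : Fin 3, G.Ord 0 1 fun S => S.2.1.1.2 i - S.1 i := fun i => H.bd_p hG i
  have hp : ∀ i : Fin 3, G.Ord 0 0 fun S => S.2.1.1.2 i := fun i =>
    (((hpq i).mono (l := 0) (by norm_num)).add (hq i)).congr fun S _ => sub_add_cancel _ _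
  have h1 : G.Ord 0 2 fun S => ∑ i : Fin 3,
      (S.2.1.1.1 i.castSucc - y₀ i.castSucc + lam y₀ S * S.1 i) * S.2.1.1.2 i :=
    Ord.sum fun i _ => (Ord.mul (m := 0) (H.bd_rho hG i) (hp i)).mono (by norm_num)
  have h2 : G.Ord 0 2 fun S => lam y₀ S * ∑ i : Fin 3, S.1 i * (S.2.1.1.2 i - S.1 i) :=
    (Ord.mul (m := 0) (k := 1) (H.bd_y hG 3) (Ord.sum (k := 1) fun i _ =>
      ((hq i).mul (hpq i)).mono (by norm_num))).mono (by norm_num)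
  refine (h1.sub h2).bd.congr fun x hx => ?_
  have hu := hG.unit x hx
  simp only [Fin.sum_univ_three] at hu ⊢
  linear_combination lam y₀ x.1 * hu

omit hD in
theorem bd_comp_sub (hu : IsSolution A B f Ω u) (s : Fin n) :
    G.Bd 1 fun S => u s S.2.1.1.1 - u s y₀ :=
  H.bd_one hG (Φ := fun z => u s z.1.1.1) fun z hz _ =>
    (hu.contDiffAt H.smooth.isOpen hz s).comp (f := fun z : ZVal n => z.1.1.1) z (by fun_prop)

include hpos hR

theorem bd_invRad_lam : G.Bd 1 fun S => invRad y₀ S * lam y₀ S - κ / |κ| := by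
  have hF := H.fine_two hG hD
  have h1 : G.Bd 1 fun S => (radSq y₀ S)⁻¹ * (radSq y₀ S - lam y₀ S ^ 2) :=
    ((Bd.inv hR).mul hF.radSq_sub.bd).mono (by norm_num)
  refine h1.of_abs_le fun x hx => ?_
  have hr := hpos _ (G.mem x hx)
  have hs : 0 < Real.sqrt (radSq y₀ x.1) := Real.sqrt_pos.2 hr
  have hss := Real.mul_self_sqrt hr.le
  have hκ : 0 < |κ| := abs_pos.2 H.kap_ne
  have hl := H.lam_eq hG hx
  have ht := G.pos x hx
  have habs : |lam y₀ x.1| = |κ| * x.2 := by rw [hl, abs_mul, abs_of_pos ht]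
  set ρ := Real.sqrt (radSq y₀ x.1) with hρ
  have e1 : invRad y₀ x.1 * lam y₀ x.1 - κ / |κ| =
      κ / |κ| * (ρ⁻¹ * (|lam y₀ x.1| - ρ)) := by
    rw [invRad, abs_of_pos hr, ← hρ, habs, hl]
    field_simp
  have e2 : |κ / (|κ|)| = 1 := by rw [abs_div, abs_abs, div_self hκ.ne']
  rw [e1, abs_mul, e2, one_mul, abs_mul, abs_mul, abs_inv, abs_inv, abs_of_pos hs, abs_of_pos hr,
    ← hss, ← sq_abs (lam y₀ x.1), ← sq, mul_comm (ρ ^ 2)⁻¹, mul_comm ρ⁻¹, ← div_eq_mul_inv,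
    ← div_eq_mul_inv, div_le_div_iff₀ hs (by positivity), sq_sub_sq, abs_mul, abs_sub_comm _ ρ]
  have e3 : ρ ≤ |ρ + (|lam y₀ x.1|)| := by
    rw [abs_of_nonneg (by positivity)]
    linarith [abs_nonneg (lam y₀ x.1)]
  have := mul_le_mul_of_nonneg_right e3 (mul_nonneg (abs_nonneg (ρ - |lam y₀ x.1|)) hs.le)
  nlinarith

include hneg

theorem bd_flux_add (hu : IsSolution A B f Ω u) (i : Fin 3) (s : Fin n) :
    G.Bd (-1) fun S => flux A B u i s S + u s S.2.1.1.1 * (invRad y₀ S * ((radSq y₀ S)⁻¹ *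
      (S.2.1.1.1 i.castSucc - y₀ i.castSucc))) := by
  have hΩ := H.smooth.isOpen
  have hu0 : ∀ r, G.Ord 0 0 fun S => u r S.2.1.1.1 := fun r =>
    H.bd_comp_y hG (hu.contDiffOn r).continuousOn
  have hpd : ∀ r μ, G.Ord 0 0 fun S => pd μ (u r) S.2.1.1.1 := fun r μ =>
    H.bd_comp_y hG (g := pd μ (u r)) fun y hy =>
      (hu.differentiableAt_pd hy r μ).continuousAt.continuousWithinAt
  have hσ : ∀ r, G.Ord 0 (-1) fun S => sig A r s S := fun r => (H.ord_sig hG hD r s).bd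
  have hp : G.Ord 0 0 fun S => S.2.1.1.2 i := H.bd_zero hG fun S _ _ => by fun_prop
  have hcon : ∀ j r, G.Ord 0 0 fun S => pdCon j (u r) S.2.1.1 := fun j r =>
    (hpd r _).sub (((H.bd_zero hG fun S _ _ => by fun_prop : G.Ord 0 0 fun S => S.2.1.1.2 j).mul
      (hpd r 3)).mono (by norm_num))
  have h1 : G.Ord 0 (-1) fun S => ∑ j : Fin 3, ∑ r,
      A S.2.1.1.1 i.castSucc j.castSucc * sig A r s S * pdCon j (u r) S.2.1.1 :=
    Ord.sum fun j _ => Ord.sum fun r _ => ((Ord.mul (m := 0) (k := 0) (l := -1)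
      (H.ord_A_zero hG hD _ _).bd (hσ r)).mul (hcon j r)).mono (by norm_num)
  have h2 : G.Ord 0 (-1) fun S => 2 * ∑ r, sig A r s S * T A S.2.1.1 i.castSucc *
      pd 3 (u r) S.2.1.1.1 :=
    (Ord.sum fun r _ => (((hσ r).mul ((H.base_zero hG).T i.castSucc)).mul (hpd r 3)).mono
      (by norm_num)).const_mul 2
  have h3 : G.Ord 0 (-1) fun S => ∑ r, ∑ t, B r t i.castSucc S.2.1.1.1 * u t S.2.1.1.1 *
      sig A r s S :=
    Ord.sum fun r _ => Ord.sum fun t _ => ((Ord.mul (m := 0) (k := 0) (l := 0)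
      (H.bd_comp_y hG fun y hy => (H.smooth.smoothB y hy r t _).continuousAt.continuousWithinAt)
      (hu0 t)).mul (hσ r)).mono (by norm_num)
  have h4 : G.Ord 0 (-1) fun S => ∑ j : Fin 3, ∑ r, u r S.2.1.1.1 * G.d j (fun S =>
      A S.2.1.1.1 i.castSucc j.castSucc * sig A r s S +
      (if i = j then 1 else 0) * (if r = s then 1 else 0) * invRad y₀ S) S :=
    Ord.sum fun j _ => Ord.sum fun r _ => ((hu0 r).mul
      (((H.ord_A_sig hG hD hneg hpos hR i j r s).2.2 j).bd)).mono (by norm_num)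
  refine Bd.congr (((h1.sub h4).add h2).add h3).bd fun x hx => ?_
  have hU := G.mem x hx
  have hreg := hG.regular _ hU
  have hI : DifferentiableAt ℝ (invRad y₀ : Jet n → ℝ) x.1 := differentiableAt_invRad (hpos _ hU).ne'
  have hd : ∀ j r, G.d j (fun S => A S.2.1.1.1 i.castSucc j.castSucc * sig A r s S +
      (if i = j then 1 else 0) * (if r = s then 1 else 0) * invRad y₀ S) x.1 =
      dx A B j (fun S => A S.2.1.1.1 i.castSucc j.castSucc * sig A r s S) x.1 +
      (if i = j then 1 else 0) * (if r = s then 1 else 0) * dx A B j (invRad y₀) x.1 := fun j r => by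
    rw [hG.d_eq, dx_add ((H.smooth.contDiffAt_A_sig hreg _ _ r s).differentiableAt (by norm_num))
      (hI.const_mul _)]
    congr 1
    rw [dx, fderiv_const_mul hI]
    rfl
  simp only [hd, dx_invRad hreg (hpos _ hU).ne', flux, mul_add, Finset.sum_add_distrib,
    Finset.sum_sub_distrib]
  have e : ∑ j : Fin 3, ∑ r, u r x.1.2.1.1.1 * ((if i = j then 1 else 0) * (if r = s then 1 else 0) *
      -(invRad y₀ x.1 * ((radSq y₀ x.1)⁻¹ * (x.1.2.1.1.1 j.castSucc - y₀ j.castSucc)))) =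
      -(u s x.1.2.1.1.1 * (invRad y₀ x.1 * ((radSq y₀ x.1)⁻¹ *
        (x.1.2.1.1.1 i.castSucc - y₀ i.castSucc)))) := by
    rw [Finset.sum_eq_single i (fun j _ hj => by simp [hj.symm]) (by simp),
      Finset.sum_eq_single s (fun r _ hr => by simp [hr]) (by simp)]
    simp
  rw [e]
  ring

/-- The behaviour near the vertex of the quantity under the double integral. -/
theorem bd_flux (hu : IsSolution A B f Ω u) (s : Fin n) : G.Bd 1 fun S =>
    (∑ i, flux A B u i s S * S.2.1.1.2 i) * ((K A S).det * (T A S.2.1.1 3)⁻¹) +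
      κ / |κ| * u s y₀ := by
  have hm : G.Ord 0 2 fun S => (K A S).det * (T A S.2.1.1 3)⁻¹ :=
    Bd.mono ((H.base_two hG hD).det.bd.mul (H.bd_inv_T_three hG)) (by norm_num)
  have hp : ∀ i : Fin 3, G.Ord 0 0 fun S => S.2.1.1.2 i := fun i =>
    H.bd_zero hG fun S _ _ => by fun_prop
  have hu0 : G.Ord 0 0 fun S => u s S.2.1.1.1 := H.bd_comp_y hG (hu.contDiffOn s).continuousOn
  have hI : G.Ord 0 (-1) fun S => invRad y₀ S := (H.ord_invRad hG hD hpos hR).bd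
  have hr : G.Ord 0 (-2) fun S => (radSq y₀ S)⁻¹ := Bd.inv hR
  have hl : G.Ord 0 1 fun S => lam y₀ S := H.bd_y hG 3
  have h1 : G.Ord 0 1 fun S => (∑ i : Fin 3, (flux A B u i s S + u s S.2.1.1.1 * (invRad y₀ S *
      ((radSq y₀ S)⁻¹ * (S.2.1.1.1 i.castSucc - y₀ i.castSucc)))) * S.2.1.1.2 i) *
      ((K A S).det * (T A S.2.1.1 3)⁻¹) :=
    ((Ord.sum fun i _ => Ord.mul (m := 0) (k := -1) (l := 0)
      (H.bd_flux_add hG hD hneg hpos hR hu i s) (hp i)).mul hm).mono (by norm_num)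
  have h2 : G.Ord 0 1 fun S => u s S.2.1.1.1 * (invRad y₀ S * ((radSq y₀ S)⁻¹ *
      (((∑ i : Fin 3, (S.2.1.1.1 i.castSucc - y₀ i.castSucc) * S.2.1.1.2 i) + lam y₀ S) *
      ((K A S).det * (T A S.2.1.1 3)⁻¹)))) :=
    (hu0.mul (hI.mul (hr.mul (Ord.mul (m := 0) (k := 2) (l := 2) (H.bd_sum_rho_p hG) hm)))).mono
      (by norm_num)
  have h3 : G.Ord 0 1 fun S => u s S.2.1.1.1 * (invRad y₀ S * ((radSq y₀ S)⁻¹ * (lam y₀ S *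
      ((K A S).det * (T A S.2.1.1 3)⁻¹ + lam y₀ S ^ 2)))) :=
    (hu0.mul (hI.mul (hr.mul (Ord.mul (m := 0) (k := 1) (l := 3) hl (H.bd_weight hG hD))))).mono
      (by norm_num)
  have h4 : G.Ord 0 1 fun S => u s S.2.1.1.1 * (invRad y₀ S * ((radSq y₀ S)⁻¹ * (lam y₀ S *
      (radSq y₀ S - lam y₀ S ^ 2)))) :=
    (hu0.mul (hI.mul (hr.mul (Ord.mul (m := 0) (k := 1) (l := 3) hl
      (H.fine_two hG hD).radSq_sub.bd)))).mono (by norm_num)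
  have h5 : G.Ord 0 1 fun S => u s S.2.1.1.1 * (invRad y₀ S * lam y₀ S - κ / |κ|) :=
    (Ord.mul (m := 0) (k := 0) (l := 1) hu0 (H.bd_invRad_lam hG hD hpos hR)).mono (by norm_num)
  have h6 : G.Ord 0 1 fun S => κ / |κ| * (u s S.2.1.1.1 - u s y₀) :=
    Ord.const_mul (m := 0) (H.bd_comp_sub hG hu s) _
  refine Bd.congr (((((h1.sub h2).add h3).add h4).sub h5).sub h6).bd fun x hx => ?_
  have hne := (hpos _ (G.mem x hx)).ne'
  generalize (K A x.1).det * (T A x.1.2.1.1 3)⁻¹ = m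
  simp only [Fin.sum_univ_three]
  field_simp
  ring

omit hG hD hpos hR hneg

/-- The limit at the vertex of the quantity under the double integral. -/
theorem exists_flux_limit (hu : IsSolution A B f Ω u) (s : Fin n) : ∃ τ, 0 < τ ∧ τ ≤ ε ∧
    ∃ C, ∀ q : Fin 3 → ℝ, ∑ i, q i ^ 2 = 1 → ∀ t ∈ Ioc 0 τ,
      |(∑ i, flux A B u i s (q, Z t q) * (Z t q).1.1.2 i) *
        ((K A (q, Z t q)).det * (T A (Z t q).1.1 3)⁻¹) + κ / |κ| * u s y₀| ≤ C * t := by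
  obtain ⟨τ, hτ0, hτ, G, hG, hD, hneg, hpos, hR, hP⟩ := H.exists_domain
  obtain ⟨C, hC⟩ := H.bd_flux hG hD hneg hpos hR hu s
  refine ⟨τ, hτ0, hτ, C, fun q hq t ht => ?_⟩
  have := hC _ (hP q hq t ht)
  rwa [zpow_one] at this

end ConoidFlow

end FluxLimit


section Divergence

open Filter Topology Set MeasureTheory

/-- The cofactors of a matrix of order three. -/
def cof (Y : Fin 3 → Fin 3 → ℝ) (a i : Fin 3) : ℝ :=
  Y (a + 1) (i + 1) * Y (a + 2) (i + 2) - Y (a + 1) (i + 2) * Y (a + 2) (i + 1)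

/-- The divergence of a vector field transported to the parameter space (Piola's identity). -/
theorem sum_fderiv_cof {Y : Fin 3 → Fin 3 → (Fin 3 → ℝ) → ℝ} {f : Fin 3 → (Fin 3 → ℝ) → ℝ}
    {x : Fin 3 → ℝ} (hY : ∀ a i, DifferentiableAt ℝ (Y a i) x)
    (hf : ∀ i, DifferentiableAt ℝ (f i) x)
    (hs : ∀ a b i, fderiv ℝ (Y a i) x (Pi.single b 1) = fderiv ℝ (Y b i) x (Pi.single a 1))
    {d : Fin 3 → Fin 3 → ℝ}
    (hd : ∀ a i, fderiv ℝ (f i) x (Pi.single a 1) = ∑ j, Y a j x * d j i) :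
    ∑ a, fderiv ℝ (fun x => ∑ i, cof (fun a i => Y a i x) a i * f i x) x (Pi.single a 1) =
      (Matrix.of fun a i => Y a i x).det * ∑ i, d i i := by
  have key : ∀ a v, fderiv ℝ (fun x => ∑ i, cof (fun a i => Y a i x) a i * f i x) x v =
      ∑ i, (((fderiv ℝ (Y (a + 1) (i + 1)) x v * Y (a + 2) (i + 2) x +
        Y (a + 1) (i + 1) x * fderiv ℝ (Y (a + 2) (i + 2)) x v) -
        (fderiv ℝ (Y (a + 1) (i + 2)) x v * Y (a + 2) (i + 1) x +
        Y (a + 1) (i + 2) x * fderiv ℝ (Y (a + 2) (i + 1)) x v)) * f i x +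
        cof (fun a i => Y a i x) a i * fderiv ℝ (f i) x v) := fun a v => by
    have h : HasFDerivAt (fun x => ∑ i, cof (fun a i => Y a i x) a i * f i x) _ x :=
      HasFDerivAt.fun_sum fun i _ => (((hY (a + 1) (i + 1)).hasFDerivAt.fun_mul
        (hY (a + 2) (i + 2)).hasFDerivAt).fun_sub ((hY (a + 1) (i + 2)).hasFDerivAt.fun_mul
        (hY (a + 2) (i + 1)).hasFDerivAt)).fun_mul (hf i).hasFDerivAt
    rw [h.fderiv]
    simp only [sum_apply, add_apply, smul_apply, sub_apply, smul_eq_mul, cof]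
    exact Finset.sum_congr rfl fun i _ => by ring
  have e1 : (1 : Fin 3) + 1 = 2 := rfl
  have e2 : (1 : Fin 3) + 2 = 0 := rfl
  have e3 : (2 : Fin 3) + 1 = 0 := rfl
  have e4 : (2 : Fin 3) + 2 = 1 := rfl
  rw [Finset.sum_congr rfl fun a _ => key a _]
  simp only [Fin.sum_univ_three, hd, cof, Matrix.det_fin_three, Matrix.of_apply, zero_add, e1,
    e2, e3, e4]
  simp only [hs 1 0, hs 2 0, hs 2 1]
  ring

/-- `(t, l, m)` as a point of the parameter space. -/
def par (t : ℝ) (w : ℝ × ℝ) : Fin 3 → ℝ := ![t, w.1, w.2]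

theorem integral_fin_two {g : (Fin 2 → ℝ) → ℝ} (a b : Fin 2 → ℝ) :
    ∫ x in Icc a b, g x = ∫ w in Icc (a 0) (b 0) ×ˢ Icc (a 1) (b 1), g ![w.1, w.2] := by
  rw [← (volume_preserving_finTwoArrow ℝ).setIntegral_preimage_emb
    (MeasurableEquiv.measurableEmbedding _)]
  have e : (MeasurableEquiv.finTwoArrow : (Fin 2 → ℝ) ≃ᵐ ℝ × ℝ) ⁻¹'
      (Icc (a 0) (b 0) ×ˢ Icc (a 1) (b 1)) = Icc a b := by
    ext x
    simp [Pi.le_def, Fin.forall_fin_two]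
  rw [e]
  refine setIntegral_congr_fun measurableSet_Icc fun x _ => congrArg g ?_
  funext i
  fin_cases i <;> rfl

theorem integral_fin_three {g : (Fin 3 → ℝ) → ℝ} (a b : Fin 3 → ℝ) :
    ∫ x in Icc a b, g x = ∫ y in Icc (a 0) (b 0) ×ˢ (Icc (a 1) (b 1) ×ˢ Icc (a 2) (b 2)),
      g (par y.1 y.2) := by
  have hm := ((MeasurePreserving.id (volume : Measure ℝ)).prod
    (volume_preserving_finTwoArrow ℝ)).comp (volume_preserving_piFinSuccAbove (fun _ : Fin 3 => ℝ) 0)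
  have he : MeasurableEmbedding (Prod.map id (MeasurableEquiv.finTwoArrow : (Fin 2 → ℝ) ≃ᵐ ℝ × ℝ) ∘
      (MeasurableEquiv.piFinSuccAbove (fun _ : Fin 3 => ℝ) 0)) :=
    (MeasurableEmbedding.id.prodMap (MeasurableEquiv.measurableEmbedding _)).comp
      (MeasurableEquiv.measurableEmbedding _)
  have h := hm.setIntegral_preimage_emb he (fun y => g (par y.1 y.2))
    (Icc (a 0) (b 0) ×ˢ (Icc (a 1) (b 1) ×ˢ Icc (a 2) (b 2)))
  refine Eq.trans ?_ h
  have e : (Prod.map id (MeasurableEquiv.finTwoArrow : (Fin 2 → ℝ) ≃ᵐ ℝ × ℝ) ∘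
      (MeasurableEquiv.piFinSuccAbove (fun _ : Fin 3 => ℝ) 0)) ⁻¹'
      (Icc (a 0) (b 0) ×ˢ (Icc (a 1) (b 1) ×ˢ Icc (a 2) (b 2))) = Icc a b := by
    ext x
    show ((a 0 ≤ x 0 ∧ x 0 ≤ b 0) ∧ (a 1 ≤ x 1 ∧ x 1 ≤ b 1) ∧ (a 2 ≤ x 2 ∧ x 2 ≤ b 2)) ↔ _
    simp only [mem_Icc, Pi.le_def, Fin.forall_fin_succ]
    simp
    tauto
  rw [e]
  refine setIntegral_congr_fun measurableSet_Icc fun x _ => congrArg g ?_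
  funext i
  fin_cases i <;> rfl

/-- The divergence theorem in a box, for a field with no flux across the lateral faces. -/
theorem integral_divergence_box {δ τ m₁ m₂ : ℝ} (hδ : δ ≤ τ) (h₁ : 0 ≤ m₁) (h₂ : 0 ≤ m₂)
    {C : Fin 3 → (Fin 3 → ℝ) → ℝ} {D : ℝ × ℝ × ℝ → ℝ}
    (hC : ∀ a x, x 0 ∈ Icc δ τ → DifferentiableAt ℝ (C a) x)
    (hD : ContinuousOn D (Icc δ τ ×ˢ (Icc 0 m₁ ×ˢ Icc 0 m₂)))
    (hdiv : ∀ x, x 0 ∈ Icc δ τ → ∑ a, fderiv ℝ (C a) x (Pi.single a 1) = D (x 0, x 1, x 2))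
    (hC₁ : ∀ t ∈ Icc δ τ, ∀ m, C 1 (par t (m₁, m)) = C 1 (par t (0, m)))
    (hC₂ : ∀ t ∈ Icc δ τ, ∀ m, C 2 (par t (m, m₂)) = C 2 (par t (m, 0))) :
    ∫ y in Icc δ τ ×ˢ (Icc 0 m₁ ×ˢ Icc 0 m₂), D y =
      (∫ w in Icc 0 m₁ ×ˢ Icc 0 m₂, C 0 (par τ w)) - ∫ w in Icc 0 m₁ ×ˢ Icc 0 m₂, C 0 (par δ w) := by
  have hab : ![δ, 0, 0] ≤ ![τ, m₁, m₂] := by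
    intro i; fin_cases i <;> assumption
  have hx0 : ∀ x ∈ Icc ![δ, 0, 0] ![τ, m₁, m₂], x 0 ∈ Icc δ τ := fun x hx => ⟨hx.1 0, hx.2 0⟩
  have hmem : ∀ x ∈ Icc ![δ, 0, 0] ![τ, m₁, m₂],
      ((x 0, x 1, x 2) : ℝ × ℝ × ℝ) ∈ Icc δ τ ×ˢ (Icc 0 m₁ ×ˢ Icc 0 m₂) := fun x hx =>
    ⟨⟨hx.1 0, hx.2 0⟩, ⟨hx.1 1, hx.2 1⟩, ⟨hx.1 2, hx.2 2⟩⟩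
  have hDc : ContinuousOn (fun x : Fin 3 → ℝ => D (x 0, x 1, x 2)) (Icc ![δ, 0, 0] ![τ, m₁, m₂]) :=
    hD.comp (by fun_prop) hmem
  have main := integral_divergence_of_hasFDerivAt_off_countable' ![δ, 0, 0] ![τ, m₁, m₂] hab C
    (fun a x => fderiv ℝ (C a) x) ∅ countable_empty
    (fun a x hx => (hC a x (hx0 x hx)).continuousAt.continuousWithinAt)
    (fun x hx a => (hC a x ⟨(hx.1 0 (mem_univ _)).1.le, (hx.1 0 (mem_univ _)).2.le⟩).hasFDerivAt)
    ((hDc.congr fun x hx => hdiv x (hx0 x hx)).integrableOn_compact isCompact_Icc)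
  rw [setIntegral_congr_fun measurableSet_Icc (fun x hx => hdiv x (hx0 x hx)), integral_fin_three,
    Fin.sum_univ_three] at main
  have f1 : (∫ x in Icc (![δ, 0, 0] ∘ (1 : Fin 3).succAbove) (![τ, m₁, m₂] ∘ (1 : Fin 3).succAbove),
      C 1 ((1 : Fin 3).insertNth (![τ, m₁, m₂] 1) x)) =
      ∫ x in Icc (![δ, 0, 0] ∘ (1 : Fin 3).succAbove) (![τ, m₁, m₂] ∘ (1 : Fin 3).succAbove),
      C 1 ((1 : Fin 3).insertNth (![δ, 0, 0] 1) x) := by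
    refine setIntegral_congr_fun measurableSet_Icc fun x hx => ?_
    have e : ∀ r : ℝ, ((1 : Fin 3).insertNth r x : Fin 3 → ℝ) = par (x 0) (r, x 1) := fun r => by
      funext i; fin_cases i <;> rfl
    rw [e, e]
    exact hC₁ _ ⟨hx.1 0, hx.2 0⟩ _
  have f2 : (∫ x in Icc (![δ, 0, 0] ∘ (2 : Fin 3).succAbove) (![τ, m₁, m₂] ∘ (2 : Fin 3).succAbove),
      C 2 ((2 : Fin 3).insertNth (![τ, m₁, m₂] 2) x)) =
      ∫ x in Icc (![δ, 0, 0] ∘ (2 : Fin 3).succAbove) (![τ, m₁, m₂] ∘ (2 : Fin 3).succAbove),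
      C 2 ((2 : Fin 3).insertNth (![δ, 0, 0] 2) x) := by
    refine setIntegral_congr_fun measurableSet_Icc fun x hx => ?_
    have e : ∀ r : ℝ, ((2 : Fin 3).insertNth r x : Fin 3 → ℝ) = par (x 0) (x 1, r) := fun r => by
      funext i; fin_cases i <;> rfl
    rw [e, e]
    exact hC₂ _ ⟨hx.1 0, hx.2 0⟩ _
  rw [f1, f2, sub_self, sub_self, add_zero, add_zero, integral_fin_two, integral_fin_two] at main
  have e : ∀ (r : ℝ) (w : ℝ × ℝ),
      ((0 : Fin 3).insertNth r (![w.1, w.2] : Fin 2 → ℝ) : Fin 3 → ℝ) = par r w := fun r w => by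
    funext i; fin_cases i <;> rfl
  simp only [e] at main
  exact main

/-- Double integrals as iterated ones. -/
theorem integral_prod_eq {m₁ m₂ : ℝ} (h₁ : 0 ≤ m₁) (h₂ : 0 ≤ m₂) {g : ℝ × ℝ → ℝ}
    (hg : ContinuousOn g (Icc 0 m₁ ×ˢ Icc 0 m₂)) :
    ∫ w in Icc 0 m₁ ×ˢ Icc 0 m₂, g w = ∫ l in (0 : ℝ)..m₁, ∫ m in (0 : ℝ)..m₂, g (l, m) := by
  rw [Measure.volume_eq_prod, setIntegral_prod _ (by
      rw [← Measure.volume_eq_prod]; exact hg.integrableOn_compact (isCompact_Icc.prod isCompact_Icc)),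
    integral_Icc_eq_integral_Ioc, intervalIntegral.integral_of_le h₁]
  refine setIntegral_congr_fun measurableSet_Ioc fun l _ => ?_
  rw [integral_Icc_eq_integral_Ioc, intervalIntegral.integral_of_le h₂]

/-- The integral over a box as the limit of the integrals over boxes that exhaust it. -/
theorem integral_eq_of_exhaustion {τ : ℝ} (hτ : 0 < τ) {Q : Set (ℝ × ℝ)} (hQ : IsCompact Q)
    {D : ℝ × ℝ × ℝ → ℝ} (hD : ContinuousOn D (Ioc 0 τ ×ˢ Q)) {C : ℝ}
    (hC : ∀ y ∈ Ioc 0 τ ×ˢ Q, |D y| ≤ C) {b : ℝ → ℝ} {L : ℝ} (hb : Tendsto b (𝓝[>] 0) (𝓝 L))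
    (h : ∀ δ ∈ Ioo 0 τ, ∫ y in Icc δ τ ×ˢ Q, D y = b δ) :
    ∫ t in (0 : ℝ)..τ, ∫ w in Q, D (t, w) = L := by
  have hQm := hQ.measurableSet
  have hI : IntegrableOn D (Ioc 0 τ ×ˢ Q) := by
    refine ⟨hD.aestronglyMeasurable (measurableSet_Ioc.prod hQm), ?_⟩
    refine HasFiniteIntegral.restrict_of_bounded C ?_ ?_
    · rw [Measure.volume_eq_prod, Measure.prod_prod]
      exact ENNReal.mul_lt_top (by simp) hQ.measure_lt_top
    · exact (ae_restrict_iff' (measurableSet_Ioc.prod hQm)).2 (Eventually.of_forall hC)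
  have hfub : ∀ δ ∈ Ico 0 τ, ∫ y in Ioc δ τ ×ˢ Q, D y = ∫ t in δ..τ, ∫ w in Q, D (t, w) :=
    fun δ hδ => by
    rw [intervalIntegral.integral_of_le hδ.2.le, Measure.volume_eq_prod]
    refine setIntegral_prod _ ?_
    rw [← Measure.volume_eq_prod]
    exact hI.mono_set (prod_mono (Ioc_subset_Ioc_left hδ.1) subset_rfl)
  have hint : IntegrableOn (fun t => ∫ w in Q, D (t, w)) (Ioc 0 τ) := by
    rw [IntegrableOn, Measure.volume_eq_prod, ← Measure.prod_restrict] at hI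
    exact hI.integral_prod_left
  have hcont : ContinuousOn (fun δ => ∫ t in δ..τ, ∫ w in Q, D (t, w)) (uIcc 0 τ) :=
    intervalIntegral.continuousOn_primitive_interval_left (by
      rw [uIcc_of_le hτ.le, integrableOn_Icc_iff_integrableOn_Ioc]; exact hint)
  have ht : Tendsto (fun δ => ∫ t in δ..τ, ∫ w in Q, D (t, w)) (𝓝[>] 0)
      (𝓝 (∫ t in (0 : ℝ)..τ, ∫ w in Q, D (t, w))) := by
    refine (hcont 0 left_mem_uIcc).mono_left ?_
    rw [uIcc_of_le hτ.le]
    exact (nhdsWithin_mono _ Ioo_subset_Icc_self).trans' (nhdsWithin_Ioo_eq_nhdsGT hτ).ge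
  refine tendsto_nhds_unique ht (hb.congr' ?_)
  filter_upwards [Ioo_mem_nhdsGT hτ] with δ hδ
  rw [← hfub δ ⟨hδ.1.le, hδ.2⟩, ← h δ hδ, Measure.volume_eq_prod]
  exact setIntegral_congr_set (Measure.set_prod_ae_eq Ioc_ae_eq_Icc.symm ae_eq_rfl)

end Divergence


section Parameters

open Filter Topology Set Metric

variable {n : ℕ} {A : CoefA} {B : CoefB n} {Ω : Set Pt} {y₀ : Pt} {κ ε : ℝ}
  {Z : ℝ → (Fin 3 → ℝ) → ZVal n}

theorem sum_p0_sq (l₂ l₃ : ℝ) : ∑ i, p0 l₂ l₃ i ^ 2 = 1 := by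
  simp only [Fin.sum_univ_three, p0]
  simp
  linear_combination Real.sin l₂ ^ 2 * Real.sin_sq_add_cos_sq l₃ + Real.sin_sq_add_cos_sq l₂

/-- The derivatives of `p⁰` with respect to the parameters `(t, λ₃, λ₂)`. -/
noncomputable def dp0 (x : Fin 3 → ℝ) : Fin 3 → Fin 3 → ℝ :=
  ![0, p0d3 (x 2) (x 1), p0d2 (x 2) (x 1)]

theorem dp0_orth (x : Fin 3 → ℝ) (a : Fin 3) : ∑ j, dp0 x a j * p0 (x 2) (x 1) j = 0 := by
  simp only [Fin.sum_univ_three, p0, dp0]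
  fin_cases a
  · simp
  · simp [p0d3]; ring
  · simp [p0d2]
    linear_combination Real.sin (x 2) * Real.cos (x 2) * Real.sin_sq_add_cos_sq (x 1)

theorem differentiable_dp0 (a k : Fin 3) : Differentiable ℝ fun x => dp0 x a k := by
  fin_cases a <;> fin_cases k <;> simp [dp0, p0d2, p0d3] <;> fun_prop

theorem hasFDerivAt_p0 (x : Fin 3 → ℝ) : HasFDerivAt (fun x : Fin 3 → ℝ => p0 (x 2) (x 1))
    (∑ a, (ContinuousLinearMap.proj a : (Fin 3 → ℝ) →L[ℝ] ℝ).smulRight (dp0 x a)) x := by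
  refine hasFDerivAt_pi'.2 fun k => ?_
  have hp : ∀ a : Fin 3, HasFDerivAt (fun x : Fin 3 → ℝ => x a)
      (ContinuousLinearMap.proj a : (Fin 3 → ℝ) →L[ℝ] ℝ) x := fun a => hasFDerivAt_apply a x
  have h2 := (hp 2).sin
  have h2' := (hp 2).cos
  have h1 := (hp 1).sin
  have h1' := (hp 1).cos
  fin_cases k
  · refine (h2.mul h1').congr_fderiv ?_
    ext v; simp [Fin.sum_univ_three, dp0, p0d2, p0d3]; ring
  · refine (h2.mul h1).congr_fderiv ?_
    ext v; simp [Fin.sum_univ_three, dp0, p0d2, p0d3]; ring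
  · refine h2'.congr_fderiv ?_
    ext v; simp [Fin.sum_univ_three, dp0, p0d2, p0d3]; ring

theorem continuous_p0 : Continuous fun w : ℝ × ℝ => p0 w.2 w.1 := by
  refine continuous_pi fun k => ?_
  fin_cases k <;> simp [p0] <;> fun_prop

/-- The Jacobian of the polar coordinates. -/
theorem Jac_eq {l₂ l₃ : ℝ} {S : Jet n} (hS : S.1 = p0 l₂ l₃) :
    Jac A l₂ l₃ S = Real.sin l₂ * (K A S).det := by
  have e : (Matrix.of ![fun i : Fin 3 => T A S.2.1.1 i.castSucc,
      fun i : Fin 3 => ∑ j, (S.2.1.2.1 j).1 i.castSucc * p0d2 l₂ l₃ j,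
      fun i : Fin 3 => ∑ j, (S.2.1.2.1 j).1 i.castSucc * p0d3 l₂ l₃ j]) =
      (Matrix.of ![p0 l₂ l₃, p0d2 l₂ l₃, p0d3 l₂ l₃]) * (K A S).transpose := by
    have h0 := sum_p0_sq l₂ l₃
    have h2 := dp0_orth ![0, l₃, l₂] 2
    have h3 := dp0_orth ![0, l₃, l₂] 1
    simp only [dp0, Fin.sum_univ_three] at h0 h2 h3
    simp at h2 h3
    ext a i
    fin_cases a
    · simp [Matrix.mul_apply, Fin.sum_univ_three, K, hS]
      linear_combination (-T A S.2.1.1 i.castSucc + (S.2.1.2.1 0).1 i.castSucc * p0 l₂ l₃ 0 +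
        (S.2.1.2.1 1).1 i.castSucc * p0 l₂ l₃ 1 + (S.2.1.2.1 2).1 i.castSucc * p0 l₂ l₃ 2) * h0
    · simp [Matrix.mul_apply, Fin.sum_univ_three, K, hS]
      linear_combination (-T A S.2.1.1 i.castSucc + (S.2.1.2.1 0).1 i.castSucc * p0 l₂ l₃ 0 +
        (S.2.1.2.1 1).1 i.castSucc * p0 l₂ l₃ 1 + (S.2.1.2.1 2).1 i.castSucc * p0 l₂ l₃ 2) * h2
    · simp [Matrix.mul_apply, Fin.sum_univ_three, K, hS]
      linear_combination (-T A S.2.1.1 i.castSucc + (S.2.1.2.1 0).1 i.castSucc * p0 l₂ l₃ 0 +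
        (S.2.1.2.1 1).1 i.castSucc * p0 l₂ l₃ 1 + (S.2.1.2.1 2).1 i.castSucc * p0 l₂ l₃ 2) * h3
  rw [Jac, e, Matrix.det_mul, Matrix.det_transpose]
  congr 1
  simp [Matrix.det_fin_three, p0, p0d2, p0d3]
  linear_combination Real.sin l₂ * (Real.sin l₂ ^ 2 + Real.cos l₂ ^ 2) * Real.sin_sq_add_cos_sq l₃ +
    Real.sin l₂ * Real.sin_sq_add_cos_sq l₂

/-- The jets of a flow, as functions of the parameters `(t, λ₃, λ₂)`. -/
noncomputable def coneJet (Z : ℝ → (Fin 3 → ℝ) → ZVal n) (x : Fin 3 → ℝ) : Jet n :=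
  (p0 (x 2) (x 1), Z (x 0) (p0 (x 2) (x 1)))

/-- The derivatives of the spatial coordinates with respect to the parameters. -/
noncomputable def tang (A : CoefA) (κ : ℝ) (x : Fin 3 → ℝ) (S : Jet n) (a i : Fin 3) : ℝ :=
  ((![κ, 0, 0] : Fin 3 → ℝ) a - ∑ k, dp0 x a k * (S.2.1.2.1 k).1 3) / T A S.2.1.1 3 *
    T A S.2.1.1 i.castSucc + ∑ k, dp0 x a k * (S.2.1.2.1 k).1 i.castSucc

theorem det_tang (x : Fin 3 → ℝ) {S : Jet n} (hT : T A S.2.1.1 3 ≠ 0) :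
    (Matrix.of fun a i => tang A κ x S a i).det = -(κ * Jac A (x 2) (x 1) S / T A S.2.1.1 3) := by
  simp only [Jac, tang, dp0, Matrix.det_fin_three, Matrix.of_apply, Fin.sum_univ_three]
  simp
  field_simp
  ring

theorem sum_tang_smul_disp {x : Fin 3 → ℝ} {S : Jet n} (hS : IsConeJet A Ω S)
    (hx : S.1 = p0 (x 2) (x 1)) (a : Fin 3) : ∑ i, tang A κ x S a i • disp A B i S =
      (dp0 x a, ((![κ, 0, 0] : Fin 3 → ℝ) a / T A S.2.1.1 3) • elow A B S.2 +
        ∑ k, dp0 x a k • dirDeriv A B k S.2) := by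
  simp only [tang, add_smul, mul_smul, Finset.sum_add_distrib, ← Finset.smul_sum]
  rw [sum_T_smul_disp hS.unit hS.det_ne, sum_smul_disp_of_orth hS.det_ne (by
    rw [hx]; exact dp0_orth x a)]
  refine Prod.ext (by simp) ?_
  simp only [Prod.smul_snd, Prod.snd_add, Prod.snd_sub, dirDeriv, smul_sub, smul_smul, Finset.sum_sub_distrib,
    ← Finset.sum_smul, sub_div, sub_smul, Finset.sum_div, mul_div_assoc]
  abel

/-- The covector `p` is conormal to the sections of the conoid by constant times. -/
theorem sum_tang_mul_p {x : Fin 3 → ℝ} {S : Jet n} (hS : IsConeJet A Ω S)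
    (hx : S.1 = p0 (x 2) (x 1)) {a : Fin 3} (ha : a ≠ 0) :
    ∑ i, tang A κ x S a i * S.2.1.1.2 i = 0 := by
  have h1 := hS.orth (dp0 x a) (by rw [hx]; exact dp0_orth x a)
  have h2 := hS.char
  have e : (![κ, 0, 0] : Fin 3 → ℝ) a = 0 := by fin_cases a <;> simp_all
  have hT := hS.pos.ne'
  simp only [Fin.sum_univ_castSucc (n := 3), cov_castSucc, show Fin.last 3 = 3 from rfl,
    cov_three] at h1 h2
  simp only [tang, e, Fin.sum_univ_three] at h1 h2 ⊢
  field_simp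
  linear_combination (-(dp0 x a 0 * (S.2.1.2.1 0).1 3 + dp0 x a 1 * (S.2.1.2.1 1).1 3 +
    dp0 x a 2 * (S.2.1.2.1 2).1 3)) * h2 + T A S.2.1.1 3 * h1

theorem sum_cof_tang {x : Fin 3 → ℝ} {S : Jet n} (hS : IsConeJet A Ω S)
    (hx : S.1 = p0 (x 2) (x 1)) (f : Fin 3 → ℝ) : ∑ i, cof (tang A κ x S) 0 i * f i =
      (∑ i, f i * S.2.1.1.2 i) * Jac A (x 2) (x 1) S / T A S.2.1.1 3 := by
  have h1 := sum_tang_mul_p (κ := 1) hS hx (a := 1) (by decide)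
  have h2 := sum_tang_mul_p (κ := 1) hS hx (a := 2) (by decide)
  have hc := hS.char
  have hT := hS.pos.ne'
  have hdet := det_tang (κ := 1) x hT
  have e1 : (1 : Fin 3) + 1 = 2 := rfl
  have e2 : (1 : Fin 3) + 2 = 0 := rfl
  have e3 : ∀ i, tang A 1 x S 0 i = 1 / T A S.2.1.1 3 * T A S.2.1.1 i.castSucc := fun i => by
    simp [tang, dp0]
  have e4 : ∀ i, tang A κ x S 1 i = tang A 1 x S 1 i := fun i => by simp [tang]
  have e5 : ∀ i, tang A κ x S 2 i = tang A 1 x S 2 i := fun i => by simp [tang]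
  simp only [Fin.sum_univ_castSucc (n := 3), cov_castSucc, show Fin.last 3 = 3 from rfl,
    cov_three] at hc
  rw [mul_div_assoc, show Jac A (x 2) (x 1) S / T A S.2.1.1 3 = -(-(1 * Jac A (x 2) (x 1) S / T A S.2.1.1 3))
    by ring, ← hdet]
  simp only [cof, Matrix.det_fin_three, Matrix.of_apply, Fin.sum_univ_three, e3, e4, e5,
    zero_add, e1, show (2 : Fin 3) + 1 = 0 from rfl, show (2 : Fin 3) + 2 = 1 from rfl, e2] at h1 h2 hc ⊢
  generalize tang A 1 x S 1 = Y at *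
  generalize tang A 1 x S 2 = W at *
  have d01 : (Y 1 * W 2 - Y 2 * W 1) * S.2.1.1.2 1 - (Y 2 * W 0 - Y 0 * W 2) * S.2.1.1.2 0 = 0 := by
    linear_combination W 2 * h1 - Y 2 * h2
  have d12 : (Y 2 * W 0 - Y 0 * W 2) * S.2.1.1.2 2 - (Y 0 * W 1 - Y 1 * W 0) * S.2.1.1.2 1 = 0 := by
    linear_combination W 0 * h1 - Y 0 * h2
  have d20 : (Y 0 * W 1 - Y 1 * W 0) * S.2.1.1.2 0 - (Y 1 * W 2 - Y 2 * W 1) * S.2.1.1.2 2 = 0 := by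
    linear_combination W 1 * h1 - Y 1 * h2
  field_simp
  linear_combination ((Y 1 * W 2 - Y 2 * W 1) * f 0 + (Y 2 * W 0 - Y 0 * W 2) * f 1 +
      (Y 0 * W 1 - Y 1 * W 0) * f 2) * hc +
    (f 1 * T A S.2.1.1 (Fin.castSucc 0) - f 0 * T A S.2.1.1 (Fin.castSucc 1)) * d01 +
    (f 2 * T A S.2.1.1 (Fin.castSucc 1) - f 1 * T A S.2.1.1 (Fin.castSucc 2)) * d12 +
    (f 0 * T A S.2.1.1 (Fin.castSucc 2) - f 2 * T A S.2.1.1 (Fin.castSucc 0)) * d20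

end Parameters


section AlongConoid

open Filter Topology Set Metric

variable {n : ℕ} {A : CoefA} {B : CoefB n} {Ω : Set Pt} {y₀ : Pt} {κ ε : ℝ}
  {Z : ℝ → (Fin 3 → ℝ) → ZVal n} {f u : Fin n → Pt → ℝ}

/-- The truncation of jets. -/
def trJet : Jet n →L[ℝ] Jet n := (ContinuousLinearMap.id ℝ (Fin 3 → ℝ)).prodMap tr

/-- The truncation of jets that keeps `y`, `p`, `y_j`, `z_j` and `ω` only. -/
def baseJet : Jet n →L[ℝ] Jet n where
  toFun S := (S.1, (S.2.1.1, S.2.1.2.1, 0, 0), (S.2.2.1, 0, 0))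
  map_add' _ _ := by simp
  map_smul' _ _ := by simp
  cont := by fun_prop

theorem fderiv_of_comp_eq {V : Type*} [NormedAddCommGroup V] [NormedSpace ℝ V] {φ : V → ℝ}
    {π : V →L[ℝ] V} {S : V} (h : ∀ᶠ S' in 𝓝 S, φ (π S') = φ S') (hd : DifferentiableAt ℝ φ (π S))
    (v : V) : fderiv ℝ φ S v = fderiv ℝ φ (π S) (π v) := by
  rw [((hd.hasFDerivAt.comp S π.hasFDerivAt).congr_of_eventuallyEq
    (h.mono fun _ e => e.symm)).fderiv]
  rfl

theorem isRegular_trJet {S : Jet n} (hS : IsRegular A Ω S) : IsRegular A Ω (trJet S) := hS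

theorem isRegular_baseJet {S : Jet n} (hS : IsRegular A Ω S) : IsRegular A Ω (baseJet S) := hS

theorem baseJet_disp (A : CoefA) (B : CoefB n) (i : Fin 3) (S : Jet n) :
    baseJet (disp A B i (trJet S)) = baseJet (disp A B i S) := rfl

theorem trJet_disp (A : CoefA) (B : CoefB n) (i : Fin 3) (S : Jet n) :
    trJet (disp A B i S) = disp A B i S := rfl

theorem SmoothCoef.dx_A_sig_trJet (h : SmoothCoef A B Ω) {S : Jet n} (hS : IsRegular A Ω S)
    (i j k : Fin 3) (r s : Fin n) :
    dx A B k (fun S => A S.2.1.1.1 i.castSucc j.castSucc * sig A r s S) (trJet S) =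
      dx A B k (fun S => A S.2.1.1.1 i.castSucc j.castSucc * sig A r s S) S := by
  have hd := (h.contDiffAt_A_sig (isRegular_baseJet hS) i.castSucc j.castSucc r s).differentiableAt
    three_ne_zero
  rw [dx, dx, fderiv_of_comp_eq (π := baseJet) (S := S) (Eventually.of_forall fun _ => rfl) hd,
    fderiv_of_comp_eq (π := baseJet) (S := trJet S) (Eventually.of_forall fun _ => rfl) hd,
    baseJet_disp]
  rfl

theorem SmoothCoef.flux_trJet (h : SmoothCoef A B Ω) {S : Jet n} (hS : IsRegular A Ω S)
    (i : Fin 3) (s : Fin n) : flux A B u i s (trJet S) = flux A B u i s S := by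
  simp only [flux, h.dx_A_sig_trJet hS]
  rfl

namespace ConoidFlow

variable (H : ConoidFlow A B Ω y₀ κ ε Z)
include H

theorem isConeJet_coneJet {x : Fin 3 → ℝ} (hx : x 0 ∈ Ioo 0 ε) : IsConeJet A Ω (coneJet Z x) :=
  H.isConeJet (sum_p0_sq _ _) (Ioo_subset_Ioc_self hx)

theorem continuousAt_coneJet {x : Fin 3 → ℝ} (hx : x 0 ∈ Ioo 0 ε) :
    ContinuousAt (coneJet Z) x := by
  have hp : ContinuousAt (fun x : Fin 3 → ℝ => p0 (x 2) (x 1)) x :=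
    (hasFDerivAt_p0 x).continuousAt
  refine hp.prodMk ?_
  exact ContinuousAt.comp (f := fun x : Fin 3 → ℝ => (x 0, p0 (x 2) (x 1))) (x := x)
    (H.continuousAt_joint (unit_mem_ball (sum_p0_sq _ _)) hx) ((continuousAt_apply 0 x).prodMk hp)

theorem exists_hasFDerivAt_coneJet {x : Fin 3 → ℝ} (hx : x 0 ∈ Ioo 0 ε) :
    ∃ M : (Fin 3 → ℝ) →L[ℝ] Jet n, HasFDerivAt (fun x => trJet (coneJet Z x)) M x ∧
      ∀ a, M (Pi.single a 1) = ∑ i, tang A κ x (coneJet Z x) a i • disp A B i (coneJet Z x) := by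
  have hp := hasFDerivAt_p0 x
  have h0 : HasFDerivAt (fun x : Fin 3 → ℝ => x 0)
      (ContinuousLinearMap.proj 0 : (Fin 3 → ℝ) →L[ℝ] ℝ) x := hasFDerivAt_apply 0 x
  have h1 := HasFDerivAt.comp (f := fun x : Fin 3 → ℝ => (x 0, p0 (x 2) (x 1))) x
    (H.hasFDerivAt_joint (unit_mem_ball (sum_p0_sq (x 2) (x 1))) hx) (h0.prodMk hp)
  refine ⟨_, hp.prodMk h1, fun a => ?_⟩
  rw [sum_tang_smul_disp (H.isConeJet_coneJet hx) rfl]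
  have e : (∑ b, (ContinuousLinearMap.proj b : (Fin 3 → ℝ) →L[ℝ] ℝ).smulRight (dp0 x b))
      (Pi.single a 1) = dp0 x a := by
    rw [sum_apply, Finset.sum_eq_single a (fun b _ hb => by simp [hb]) (by simp)]
    simp
  refine Prod.ext e ?_
  show (ContinuousLinearMap.toSpanSingleton ℝ (timeField A B κ (coneJet Z x).2))
    ((Pi.single a 1 : Fin 3 → ℝ) 0) + dirDiff A B (coneJet Z x).2 ((∑ b, (ContinuousLinearMap.proj b :
      (Fin 3 → ℝ) →L[ℝ] ℝ).smulRight (dp0 x b)) (Pi.single a 1)) = _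
  rw [e, dirDiff_apply, ContinuousLinearMap.toSpanSingleton_apply, timeField, smul_smul]
  congr 2
  fin_cases a <;> simp

theorem hasFDerivAt_comp_coneJet {φ : Jet n → ℝ}
    (hφ : ∀ S, IsRegular A Ω S → DifferentiableAt ℝ φ S ∧ φ (trJet S) = φ S) {x : Fin 3 → ℝ}
    (hx : x 0 ∈ Ioo 0 ε) : HasFDerivAt (fun x => φ (coneJet Z x))
      (∑ a, (∑ i, tang A κ x (coneJet Z x) a i * dx A B i φ (coneJet Z x)) •
        (ContinuousLinearMap.proj a : (Fin 3 → ℝ) →L[ℝ] ℝ)) x := by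
  obtain ⟨M, hM, hM'⟩ := H.exists_hasFDerivAt_coneJet hx
  have hreg := (H.isConeJet_coneJet hx).isRegular
  have hev : ∀ᶠ x in 𝓝 x, φ (trJet (coneJet Z x)) = φ (coneJet Z x) :=
    (H.continuousAt_coneJet hx).eventually
      ((H.smooth.eventually_isRegular hreg).mono fun S hS => (hφ S hS).2)
  have h1 := (((hφ _ (isRegular_trJet hreg)).1.hasFDerivAt.comp x hM).congr_of_eventuallyEq
    (hev.mono fun _ e => e.symm))
  refine h1.congr_fderiv ?_
  have e : ∀ a, fderiv ℝ φ (trJet (coneJet Z x)) (M (Pi.single a 1)) =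
      ∑ i, tang A κ x (coneJet Z x) a i * dx A B i φ (coneJet Z x) := fun a => by
    rw [hM', map_sum]
    refine Finset.sum_congr rfl fun i _ => ?_
    rw [map_smul, smul_eq_mul, dx, fderiv_of_comp_eq (π := trJet)
      ((H.smooth.eventually_isRegular hreg).mono fun S hS => (hφ S hS).2)
      (hφ _ (isRegular_trJet hreg)).1, trJet_disp]
  ext v
  rw [ContinuousLinearMap.comp_apply]
  conv_lhs => rw [pi_eq_sum_univ' v]
  simp only [map_sum, map_smul, e, sum_apply, smul_apply, smul_eq_mul, ContinuousLinearMap.proj_apply]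
  exact Finset.sum_congr rfl fun a _ => mul_comm _ _

theorem differentiableAt_tang {x : Fin 3 → ℝ} (hx : x 0 ∈ Ioo 0 ε) (a i : Fin 3) :
    DifferentiableAt ℝ (fun x => tang A κ x (coneJet Z x) a i) x := by
  have hT : ∀ α, DifferentiableAt ℝ (fun x => T A (coneJet Z x).2.1.1 α) x := fun α =>
    (H.hasFDerivAt_comp_coneJet (φ := fun S => T A S.2.1.1 α) (fun S hS =>
      ⟨(H.smooth.contDiffAt_T_jet hS.1 α).differentiableAt three_ne_zero, rfl⟩) hx).differentiableAt
  have hy : ∀ k α, DifferentiableAt ℝ (fun x => ((coneJet Z x).2.1.2.1 k).1 α) x := fun k α =>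
    (H.hasFDerivAt_comp_coneJet (φ := fun S => (S.2.1.2.1 k).1 α) (fun S hS =>
      ⟨by fun_prop, rfl⟩) hx).differentiableAt
  have hs : ∀ α, DifferentiableAt ℝ (fun x => ∑ k, dp0 x a k * ((coneJet Z x).2.1.2.1 k).1 α) x :=
    fun α => DifferentiableAt.fun_sum fun k _ => (differentiable_dp0 a k x).mul (hy k α)
  have hc : DifferentiableAt ℝ (fun x => ((![κ, 0, 0] : Fin 3 → ℝ) a -
      ∑ k, dp0 x a k * ((coneJet Z x).2.1.2.1 k).1 3) / T A (coneJet Z x).2.1.1 3) x := by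
    simp only [div_eq_mul_inv]
    exact ((differentiableAt_const _).fun_sub (hs 3)).mul
      ((hT 3).fun_inv (H.isConeJet_coneJet hx).pos.ne')
  exact (hc.mul (hT i.castSucc)).add (hs i.castSucc)

theorem fderiv_tang_symm {x : Fin 3 → ℝ} (hx : x 0 ∈ Ioo 0 ε) (a b i : Fin 3) :
    fderiv ℝ (fun x => tang A κ x (coneJet Z x) a i) x (Pi.single b 1) =
      fderiv ℝ (fun x => tang A κ x (coneJet Z x) b i) x (Pi.single a 1) := by
  have hev : ∀ᶠ x in 𝓝 x, HasFDerivAt (fun x => (coneJet Z x).2.1.1.1 i.castSucc)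
      (∑ a, tang A κ x (coneJet Z x) a i • (ContinuousLinearMap.proj a : (Fin 3 → ℝ) →L[ℝ] ℝ)) x := by
    filter_upwards [(continuous_apply 0).continuousAt.eventually (isOpen_Ioo.mem_nhds hx)] with x hx
    refine (H.hasFDerivAt_comp_coneJet (φ := fun S => S.2.1.1.1 i.castSucc) (fun S hS =>
      ⟨by fun_prop, rfl⟩) hx).congr_fderiv ?_
    simp only [dx_yco_castSucc (H.isConeJet_coneJet hx).det_ne]
    simp
  have hd : HasFDerivAt (fun x => ∑ a, tang A κ x (coneJet Z x) a i •
      (ContinuousLinearMap.proj a : (Fin 3 → ℝ) →L[ℝ] ℝ)) _ x := HasFDerivAt.fun_sum fun a _ =>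
    (H.differentiableAt_tang hx a i).hasFDerivAt.smul_const
      (ContinuousLinearMap.proj a : (Fin 3 → ℝ) →L[ℝ] ℝ)
  have := second_derivative_symmetric_of_eventually hev hd (Pi.single b 1) (Pi.single a 1)
  simpa [Pi.single_apply] using this

/-- The Piola transform of the flux. -/
theorem sum_fderiv_flux (hu : IsSolution A B f Ω u) (s : Fin n) {x : Fin 3 → ℝ} (hx : x 0 ∈ Ioo 0 ε) :
    (∀ a, DifferentiableAt ℝ (fun x => ∑ i, cof (tang A κ x (coneJet Z x)) a i *
      flux A B u i s (coneJet Z x)) x) ∧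
    ∑ a, fderiv ℝ (fun x => ∑ i, cof (tang A κ x (coneJet Z x)) a i *
      flux A B u i s (coneJet Z x)) x (Pi.single a 1) =
      KirchhoffConoid.H A B f u κ s (x 2) (x 1) (coneJet Z x) := by
  have hS := H.isConeJet_coneJet hx
  have hY := H.differentiableAt_tang hx
  have hf := fun i => H.hasFDerivAt_comp_coneJet (φ := flux A B u i s) (fun S hS =>
    ⟨H.smooth.differentiableAt_flux hu hS i s, H.smooth.flux_trJet hS i s⟩) hx
  refine ⟨fun a => DifferentiableAt.fun_sum fun i _ => ((((hY _ _).mul (hY _ _)).sub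
    ((hY _ _).mul (hY _ _)))).mul (hf i).differentiableAt, ?_⟩
  have h := sum_fderiv_cof (Y := fun a i x => tang A κ x (coneJet Z x) a i)
    (f := fun i x => flux A B u i s (coneJet Z x)) hY (fun i => (hf i).differentiableAt)
    (H.fderiv_tang_symm hx) (d := fun j i => dx A B j (flux A B u i s) (coneJet Z x))
    (fun a i => by rw [(hf i).fderiv]; simp [Pi.single_apply])
  refine h.trans ?_
  rw [det_tang x hS.pos.ne', H.smooth.sum_dx_flux hu hS s, KirchhoffConoid.H]
  ring

end ConoidFlow

end AlongConoid


section Representation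

open Filter Topology Set Metric MeasureTheory

variable {n : ℕ} {A : CoefA} {B : CoefB n} {Ω : Set Pt} {y₀ : Pt} {κ ε : ℝ}
  {Z : ℝ → (Fin 3 → ℝ) → ZVal n} {f u : Fin n → Pt → ℝ}

theorem H_eq {l₂ l₃ : ℝ} {S : Jet n} (hS : S.1 = p0 l₂ l₃) (s : Fin n) :
    H A B f u κ s l₂ l₃ S =
      κ * Real.sin l₂ * (source A B f u s S * ((K A S).det * (T A S.2.1.1 3)⁻¹)) := by
  rw [H, Jac_eq hS, source]
  ring

theorem I_eq {l₂ l₃ : ℝ} {S : Jet n} (hS : S.1 = p0 l₂ l₃) (s : Fin n) :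
    I A B u s l₂ l₃ S = Real.sin l₂ * ((∑ i, flux A B u i s S * S.2.1.1.2 i) *
      ((K A S).det * (T A S.2.1.1 3)⁻¹)) := by
  rw [I, Jac_eq hS]
  ring

/-- The jets of a flow as functions of the time and of the angles. -/
noncomputable def timeJet (Z : ℝ → (Fin 3 → ℝ) → ZVal n) (y : ℝ × ℝ × ℝ) : Jet n :=
  (p0 y.2.2 y.2.1, Z y.1 (p0 y.2.2 y.2.1))

namespace ConoidFlow

variable (H : ConoidFlow A B Ω y₀ κ ε Z)
include H

theorem continuousOn_timeJet : ContinuousOn (timeJet Z) (Icc 0 ε ×ˢ univ) := by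
  have hp : Continuous fun y : ℝ × ℝ × ℝ => p0 y.2.2 y.2.1 := continuous_p0.comp continuous_snd
  refine hp.continuousOn.prodMk (H.cont.comp (continuous_fst.prodMk hp).continuousOn fun y hy =>
    ⟨hy.1, ball_subset_closedBall (unit_mem_ball (sum_p0_sq _ _))⟩)

theorem isConeJet_timeJet {y : ℝ × ℝ × ℝ} (hy : y.1 ∈ Ioc 0 ε) : IsConeJet A Ω (timeJet Z y) :=
  H.isConeJet (sum_p0_sq _ _) hy

theorem continuousOn_comp_timeJet {φ : Jet n → ℝ} (hφ : ∀ S, IsConeJet A Ω S → ContinuousAt φ S) :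
    ContinuousOn (fun y => φ (timeJet Z y)) (Ioc 0 ε ×ˢ univ) := fun y hy =>
  (hφ _ (H.isConeJet_timeJet hy.1)).comp_continuousWithinAt
    ((H.continuousOn_timeJet y ⟨Ioc_subset_Icc_self hy.1, trivial⟩).mono
      (prod_mono Ioc_subset_Icc_self subset_rfl))

theorem continuousAt_weight {S : Jet n} (hS : IsConeJet A Ω S) :
    ContinuousAt (fun S : Jet n => (K A S).det * (T A S.2.1.1 3)⁻¹) S :=
  (H.smooth.contDiffAt_det hS.mem).continuousAt.mul
    ((H.smooth.contDiffAt_T_jet hS.mem 3).continuousAt.inv₀ hS.pos.ne')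

theorem continuousOn_H (hf : ∀ s, ContinuousOn (f s) Ω) (hu : IsSolution A B f Ω u) (s : Fin n) :
    ContinuousOn (fun y : ℝ × ℝ × ℝ => KirchhoffConoid.H A B f u κ s y.2.2 y.2.1 (timeJet Z y))
      (Ioc 0 ε ×ˢ univ) := by
  refine ContinuousOn.congr (ContinuousOn.mul (by fun_prop) (H.continuousOn_comp_timeJet
    (φ := fun S => source A B f u s S * ((K A S).det * (T A S.2.1.1 3)⁻¹)) fun S hS =>
      (H.smooth.continuousAt_source hf hu hS.isRegular s).mul (H.continuousAt_weight hS)))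
    fun y _ => H_eq rfl s

theorem exists_bound_H (hf : ∀ s, ContinuousOn (f s) Ω) (hu : IsSolution A B f Ω u) (s : Fin n) :
    ∃ C, ∀ y : ℝ × ℝ × ℝ, y.1 ∈ Ioc 0 ε →
      |KirchhoffConoid.H A B f u κ s y.2.2 y.2.1 (timeJet Z y)| ≤ C := by
  obtain ⟨C, hC⟩ := H.exists_bound_source hf hu s
  refine ⟨|κ| * C, fun y hy => ?_⟩
  have h := hC _ (sum_p0_sq y.2.2 y.2.1) _ hy
  rw [H_eq rfl, abs_mul, abs_mul]
  refine mul_le_mul ?_ h (abs_nonneg _) (abs_nonneg _)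
  exact mul_le_of_le_one_right (abs_nonneg _) (Real.abs_sin_le_one _)

theorem continuousOn_I (hu : IsSolution A B f Ω u) (s : Fin n) :
    ContinuousOn (fun y : ℝ × ℝ × ℝ => I A B u s y.2.2 y.2.1 (timeJet Z y)) (Ioc 0 ε ×ˢ univ) := by
  refine ContinuousOn.congr (ContinuousOn.mul (by fun_prop) (H.continuousOn_comp_timeJet
    (φ := fun S => (∑ i, flux A B u i s S * S.2.1.1.2 i) * ((K A S).det * (T A S.2.1.1 3)⁻¹))
      fun S hS => ContinuousAt.mul (tendsto_finsetSum _ fun i _ => ContinuousAt.mul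
        (H.smooth.differentiableAt_flux hu hS.isRegular i s).continuousAt (by fun_prop))
        (H.continuousAt_weight hS)))
    fun y _ => I_eq rfl s

theorem continuous_I (hu : IsSolution A B f Ω u) (s : Fin n) {t : ℝ} (ht : t ∈ Ioc 0 ε) :
    Continuous fun w : ℝ × ℝ => I A B u s w.2 w.1 (timeJet Z (t, w)) := by
  rw [← continuousOn_univ]
  exact (H.continuousOn_I hu s).comp (by fun_prop : Continuous fun w : ℝ × ℝ => (t, w)).continuousOn
    fun w _ => ⟨ht, trivial⟩

/-- The limit at the vertex of the double integrals. -/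
theorem tendsto_integral_I (hu : IsSolution A B f Ω u) (s : Fin n) :
    Tendsto (fun t => ∫ w in Icc 0 (2 * Real.pi) ×ˢ Icc 0 Real.pi,
      I A B u s w.2 w.1 (timeJet Z (t, w))) (𝓝[>] 0)
      (𝓝 (-(κ / |κ| * (4 * Real.pi * u s y₀)))) := by
  obtain ⟨τ, hτ0, hτ, C, hC⟩ := H.exists_flux_limit hu s
  set Q : Set (ℝ × ℝ) := Icc 0 (2 * Real.pi) ×ˢ Icc 0 Real.pi
  have hQ : IsCompact Q := isCompact_Icc.prod isCompact_Icc
  have hpi := Real.pi_pos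
  have hsin : ∫ w in Q, -(κ / |κ| * u s y₀) * Real.sin w.2 = -(κ / |κ| * (4 * Real.pi * u s y₀)) := by
    rw [integral_prod_eq (by positivity) hpi.le (by fun_prop)]
    simp
    ring
  rw [← hsin, tendsto_iff_norm_sub_tendsto_zero]
  refine squeeze_zero' (Eventually.of_forall fun _ => norm_nonneg _)
    (g := fun t => C * t * volume.real Q) ?_ ?_
  · filter_upwards [Ioo_mem_nhdsGT hτ0] with t ht
    rw [← integral_sub]
    · refine norm_setIntegral_le_of_norm_le_const hQ.measure_lt_top fun w _ => ?_
      rw [I_eq rfl]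
      have h := hC _ (sum_p0_sq w.2 w.1) t ⟨ht.1, ht.2.le⟩
      rw [Real.norm_eq_abs, show ∀ a b c : ℝ, a * b - -c * a = a * (b + c) from fun a b c => by ring,
        abs_mul]
      exact (mul_le_of_le_one_left (abs_nonneg _) (Real.abs_sin_le_one _)).trans h
    · exact (H.continuous_I hu s ⟨ht.1, (ht.2.trans_le hτ).le⟩).continuousOn.integrableOn_compact hQ
    · exact ContinuousOn.integrableOn_compact hQ (by fun_prop)
  · have : Tendsto (fun t : ℝ => C * t * volume.real Q) (𝓝 0) (𝓝 (C * 0 * volume.real Q)) :=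
      Continuous.tendsto (by fun_prop) 0
    rw [mul_zero, zero_mul] at this
    exact this.mono_left nhdsWithin_le_nhds

theorem representation (hf : ∀ s, ContinuousOn (f s) Ω) (hu : IsSolution A B f Ω u) (s : Fin n)
    {τ : ℝ} (hτ0 : 0 < τ) (hτ : τ < ε) :
    ∫ t in (0 : ℝ)..τ, ∫ w in Icc 0 (2 * Real.pi) ×ˢ Icc 0 Real.pi,
        KirchhoffConoid.H A B f u κ s w.2 w.1 (timeJet Z (t, w)) =
      (∫ w in Icc 0 (2 * Real.pi) ×ˢ Icc 0 Real.pi, I A B u s w.2 w.1 (timeJet Z (τ, w))) +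
        κ / |κ| * (4 * Real.pi * u s y₀) := by
  obtain ⟨C, hC⟩ := H.exists_bound_H hf hu s
  have hpi := Real.pi_pos
  have hsub : ∀ {δ}, 0 < δ → Icc δ τ ⊆ Ioo 0 ε := fun hδ t ht => ⟨hδ.trans_le ht.1, ht.2.trans_lt hτ⟩
  refine integral_eq_of_exhaustion hτ0 (isCompact_Icc.prod isCompact_Icc)
    (D := fun y => KirchhoffConoid.H A B f u κ s y.2.2 y.2.1 (timeJet Z y))
    ((H.continuousOn_H hf hu s).mono (prod_mono (Ioc_subset_Ioc_right hτ.le) (subset_univ _)))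
    (fun y hy => hC y ⟨hy.1.1, hy.1.2.trans hτ.le⟩)
    (b := fun δ => (∫ w in Icc 0 (2 * Real.pi) ×ˢ Icc 0 Real.pi,
      I A B u s w.2 w.1 (timeJet Z (τ, w))) - ∫ w in Icc 0 (2 * Real.pi) ×ˢ Icc 0 Real.pi,
      I A B u s w.2 w.1 (timeJet Z (δ, w))) ?_ fun δ hδ => ?_
  · have := (H.tendsto_integral_I hu s).const_sub (∫ w in Icc 0 (2 * Real.pi) ×ˢ Icc 0 Real.pi,
      I A B u s w.2 w.1 (timeJet Z (τ, w)))
    rwa [sub_neg_eq_add] at this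
  · have hcof : ∀ t ∈ Icc δ τ, ∀ w : ℝ × ℝ, ∑ i, cof (tang A κ (par t w) (coneJet Z (par t w))) 0 i *
        flux A B u i s (coneJet Z (par t w)) = I A B u s w.2 w.1 (timeJet Z (t, w)) := fun t ht w =>
      sum_cof_tang (H.isConeJet_coneJet (x := par t w) (hsub hδ.1 ht)) rfl _
    rw [integral_divergence_box (C := fun a x => ∑ i, cof (tang A κ x (coneJet Z x)) a i *
      flux A B u i s (coneJet Z x)) hδ.2.le (by positivity) hpi.le
      (fun a x hx => (H.sum_fderiv_flux hu s (hsub hδ.1 hx)).1 a)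
      ((H.continuousOn_H hf hu s).mono (prod_mono ((hsub hδ.1).trans Ioo_subset_Ioc_self)
        (subset_univ _)))
      (fun x hx => (H.sum_fderiv_flux hu s (hsub hδ.1 hx)).2)]
    · congr 1
      · exact integral_congr_ae (Eventually.of_forall (hcof τ ⟨hδ.2.le, le_rfl⟩))
      · exact integral_congr_ae (Eventually.of_forall (hcof δ ⟨le_rfl, hδ.2.le⟩))
    · intro t _ m
      have h1 : coneJet Z (par t (2 * Real.pi, m)) = coneJet Z (par t (0, m)) := by
        simp [coneJet, par, p0]
      have h2 : tang A κ (par t (2 * Real.pi, m)) (coneJet Z (par t (0, m))) =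
          tang A κ (par t (0, m)) (coneJet Z (par t (0, m))) := by
        have : dp0 (par t (2 * Real.pi, m)) = dp0 (par t (0, m)) := by
          simp [dp0, par, p0d2, p0d3]
        funext a i
        simp only [tang, this]
      simp only [h1, h2]
    · have h0 : ∀ x : Fin 3 → ℝ, Real.sin (x 2) = 0 → ∑ i, cof (tang A κ x (coneJet Z x)) 2 i *
          flux A B u i s (coneJet Z x) = 0 := fun x hx => by
        have : ∀ i, tang A κ x (coneJet Z x) 1 i = 0 := fun i => by
          simp [tang, dp0, p0d3, hx, Fin.sum_univ_three]
        refine Finset.sum_eq_zero fun i _ => ?_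
        simp only [cof, show (2 : Fin 3) + 1 = 0 from rfl, show (2 : Fin 3) + 2 = 1 from rfl, this]
        ring
      intro t _ m
      exact (h0 (par t (m, Real.pi)) Real.sin_pi).trans (h0 (par t (m, 0)) Real.sin_zero).symm

end ConoidFlow

end Representation


section Transfer

open Filter Topology Set

variable {n : ℕ} {A : CoefA} {B : CoefB n} {Ω : Set Pt} {f u : Fin n → Pt → ℝ}
  {a : Matrix (Fin 4) (Fin 4) ℝ}

/-- The change of coordinates as a continuous linear map. -/
def toXL (a : Matrix (Fin 4) (Fin 4) ℝ) : Pt →L[ℝ] Pt where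
  toFun := toX a
  map_add' y z := by funext β; simp [toX, mul_add, Finset.sum_add_distrib]
  map_smul' r y := by
    funext β
    simp only [toX, Pi.smul_apply, smul_eq_mul, RingHom.id_apply, Finset.mul_sum]
    exact Finset.sum_congr rfl fun α _ => by ring
  cont := (contDiff_toX (m := 0) a).continuous

theorem toXL_single (α : Fin 4) : toXL a (Pi.single α 1) = a α := by
  funext β
  show toX a (Pi.single α 1) β = a α β
  rw [toX, Finset.sum_eq_single α (fun γ _ hγ => by simp [hγ]) (by simp)]
  simp

theorem pd_comp_toX {g : Pt → ℝ} {y : Pt} (hg : DifferentiableAt ℝ g (toX a y)) (α : Fin 4) :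
    pd α (fun y => g (toX a y)) y = ∑ β, a α β * pd β g (toX a y) := by
  have h : HasFDerivAt (fun y => g (toX a y)) ((fderiv ℝ g (toX a y)).comp (toXL a)) y :=
    HasFDerivAt.comp (g := g) (f := toXL a) y hg.hasFDerivAt (toXL a).hasFDerivAt
  rw [pd, h.fderiv, ContinuousLinearMap.comp_apply, toXL_single]
  conv_lhs => rw [pi_eq_sum_univ' (a α)]
  simp only [map_sum, map_smul, smul_eq_mul, pd]

theorem sum_inv_mul_sum (ha : a.det ≠ 0) (l : Fin 4) (v : Fin 4 → ℝ) :
    ∑ α, inv a α l * ∑ β, a α β * v β = v l := by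
  simp only [Finset.mul_sum]
  rw [Finset.sum_comm]
  have e : ∀ β, ∑ α, inv a α l * (a α β * v β) = (if β = l then 1 else 0) * v β := fun β => by
    rw [← sum_frame_inv' ha β l, Finset.sum_mul]
    exact Finset.sum_congr rfl fun α _ => by ring
  simp [e]

theorem sum_AStar_mul (ha : a.det ≠ 0) (y : Pt) (D : Fin 4 → Fin 4 → ℝ) :
    ∑ α, ∑ μ, AStar a A y α μ * ∑ β, a α β * ∑ γ, a μ γ * D β γ =
      ∑ l, ∑ m, A (toX a y) l m * D l m := by
  have h0 : ∀ α (G : Fin 4 → ℝ), ∑ μ, AStar a A y α μ * G μ =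
      ∑ l, ∑ m, A (toX a y) l m * inv a α l * ∑ μ, inv a μ m * G μ := fun α G => by
    simp only [AStar, Finset.sum_mul, Finset.mul_sum]
    rw [Finset.sum_comm]
    refine Finset.sum_congr rfl fun l _ => ?_
    rw [Finset.sum_comm]
    exact Finset.sum_congr rfl fun m _ => Finset.sum_congr rfl fun μ _ => by ring
  have h1 : ∀ α m, ∑ μ, inv a μ m * ∑ β, a α β * ∑ γ, a μ γ * D β γ = ∑ β, a α β * D β m :=
    fun α m => by
    simp only [← sum_inv_mul_sum ha m (D _), Finset.mul_sum (s := Finset.univ)]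
    rw [Finset.sum_comm]
    exact Finset.sum_congr rfl fun β _ => Finset.sum_congr rfl fun μ _ =>
      Finset.sum_congr rfl fun γ _ => by ring
  calc ∑ α, ∑ μ, AStar a A y α μ * ∑ β, a α β * ∑ γ, a μ γ * D β γ
      = ∑ α, ∑ l, ∑ m, A (toX a y) l m * inv a α l * ∑ μ, inv a μ m *
          ∑ β, a α β * ∑ γ, a μ γ * D β γ := by
        exact Finset.sum_congr rfl fun α _ => h0 α _
    _ = ∑ l, ∑ m, A (toX a y) l m * ∑ α, inv a α l * ∑ β, a α β * D β m := by
        simp only [h1]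
        rw [Finset.sum_comm]
        refine Finset.sum_congr rfl fun l _ => ?_
        rw [Finset.sum_comm]
        refine Finset.sum_congr rfl fun m _ => ?_
        rw [Finset.mul_sum]
        exact Finset.sum_congr rfl fun α _ => by ring
    _ = ∑ l, ∑ m, A (toX a y) l m * D l m := by
        simp only [sum_inv_mul_sum ha _ fun β => D β _]

/-- The system in the adapted coordinates. -/
theorem IsSolution.comp_toX (hu : IsSolution A B f Ω u) (hΩ : IsOpen Ω) (ha : a.det ≠ 0) :
    IsSolution (AStar a A) (BStar a B) (fStar a f) (toX a ⁻¹' Ω) (fStar a u) where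
  contDiffOn s := (hu.contDiffOn s).comp (contDiff_toX a).contDiffOn fun _ hy => hy
  twice s y hy := by
    have hev : (fun y => (fderiv ℝ (u s) (toX a y)).comp (toXL a)) =ᶠ[𝓝 y]
        fderiv ℝ (fStar a u s) := by
      filter_upwards [(hΩ.preimage (contDiff_toX (m := 0) a).continuous).mem_nhds hy] with z hz
      exact (HasFDerivAt.comp (g := u s) (f := toXL a) z (hu.differentiableAt hΩ hz s).hasFDerivAt
        (toXL a).hasFDerivAt).fderiv.symm
    refine DifferentiableAt.congr_of_eventuallyEq ?_ hev.symm
    exact DifferentiableAt.clm_comp (DifferentiableAt.comp (f := toXL a) y (hu.twice s _ hy)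
      (toXL a).differentiableAt) (differentiableAt_const _)
  eqn r y hy := by
    have h1 : ∀ s μ, pd μ (fStar a u s) y = ∑ β, a μ β * pd β (u s) (toX a y) := fun s μ =>
      pd_comp_toX (hu.differentiableAt hΩ hy s) μ
    have h2 : ∀ α μ, pd α (pd μ (fStar a u r)) y =
        ∑ β, a α β * ∑ γ, a μ γ * pd β (pd γ (u r)) (toX a y) := fun α μ => by
      have hev : pd μ (fStar a u r) =ᶠ[𝓝 y] fun y => ∑ γ, a μ γ * pd γ (u r) (toX a y) := by
        filter_upwards [(hΩ.preimage (contDiff_toX (m := 0) a).continuous).mem_nhds hy] with z hz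
        exact pd_comp_toX (hu.differentiableAt hΩ hz r) μ
      have hd := fun γ => hu.differentiableAt_pd hy r γ
      rw [pd, hev.fderiv_eq, ← pd, pd_comp_toX (g := fun x => ∑ γ, a μ γ * pd γ (u r) x)
        (DifferentiableAt.fun_sum fun γ _ => (hd γ).const_mul _)]
      refine Finset.sum_congr rfl fun β _ => ?_
      rw [pd, fderiv_fun_sum fun γ _ => (hd γ).const_mul _, sum_apply]
      congr 1
      refine Finset.sum_congr rfl fun γ _ => ?_
      rw [fderiv_const_mul (hd γ)]
      rfl
    have e1 : ∑ α, ∑ μ, AStar a A y α μ * pd α (pd μ (fStar a u r)) y =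
        ∑ l, ∑ m, A (toX a y) l m * pd l (pd m (u r)) (toX a y) := by
      simp only [h2]
      exact sum_AStar_mul ha y fun β γ => pd β (pd γ (u r)) (toX a y)
    have e2 : ∑ s, ∑ μ, BStar a B r s μ y * pd μ (fStar a u s) y =
        ∑ s, ∑ m, B r s m (toX a y) * pd m (u s) (toX a y) := by
      refine Finset.sum_congr rfl fun s _ => ?_
      have e : ∀ G : Fin 4 → ℝ, ∑ μ, BStar a B r s μ y * G μ =
          ∑ m, B r s m (toX a y) * ∑ μ, inv a μ m * G μ := fun G => by
        simp only [BStar, Finset.sum_mul, Finset.mul_sum]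
        rw [Finset.sum_comm]
        exact Finset.sum_congr rfl fun m _ => Finset.sum_congr rfl fun μ _ => by ring
      simp only [h1, e, sum_inv_mul_sum ha _ fun β => pd β (u s) (toX a y)]
    rw [e1, e2]
    exact hu.eqn r _ hy

end Transfer

section Reparametrization

open Filter Topology Set Metric MeasureTheory

section

variable {V W : Type*} [NormedAddCommGroup V] [NormedSpace ℝ V] [CompleteSpace V]
  [NormedAddCommGroup W] [NormedSpace ℝ W] [CompleteSpace W] {ς : ℝ}

theorem intervalIntegral_prod_mk {g : ℝ → V × W} {t : ℝ} (ht : 0 ≤ t)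
    (hg : ContinuousOn g (Icc 0 t)) :
    ∫ τ in (0 : ℝ)..t, g τ = (∫ τ in (0 : ℝ)..t, (g τ).1, ∫ τ in (0 : ℝ)..t, (g τ).2) := by
  have hi : IntegrableOn g (Ioc 0 t) :=
    (hg.integrableOn_compact isCompact_Icc).mono_set Ioc_subset_Icc_self
  simp only [intervalIntegral.integral_of_le ht]
  exact Prod.ext (fst_integral hi) (snd_integral hi)

theorem eq_integral_of_reparam (hς : ς * ς = 1) {z g : ℝ → V × W} {z₀ : V × W} {ε : ℝ}
    (hg : ContinuousOn g (Icc 0 ε))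
    (hz : ∀ t ∈ Icc 0 ε, z t = z₀ + ∫ τ in (0 : ℝ)..t, ς • g τ) {t₀ t : ℝ}
    (ht : ς * t - ς * t₀ ∈ Icc 0 ε) :
    (z (ς * t - ς * t₀)).1 = z₀.1 + ∫ τ in t₀..t, (g (ς * τ - ς * t₀)).1 ∧
    (z (ς * t - ς * t₀)).2 = z₀.2 + ∫ τ in t₀..t, (g (ς * τ - ς * t₀)).2 := by
  have h0 : ς ≠ 0 := left_ne_zero_of_mul_eq_one hς
  have hi : ς⁻¹ = ς := inv_eq_of_mul_eq_one_right hς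
  have h := hz _ ht
  rw [intervalIntegral.integral_smul, intervalIntegral_prod_mk ht.1
    (hg.mono (Icc_subset_Icc_right ht.2))] at h
  rw [intervalIntegral.integral_comp_mul_sub (fun τ => (g τ).1) h0,
    intervalIntegral.integral_comp_mul_sub (fun τ => (g τ).2) h0, hi, sub_self, h]
  exact ⟨rfl, rfl⟩

theorem prod_eq_integral_of_reparam (hς : ς * ς = 1) {x g₁ : ℝ → V} {w g₂ : ℝ → W} {x₀ : V} {w₀ : W}
    {t₀ t : ℝ} (ht : 0 ≤ t) (hx : x (t₀ + ς * t) = x₀ + ∫ τ in t₀..t₀ + ς * t, g₁ τ)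
    (hw : w (t₀ + ς * t) = w₀ + ∫ τ in t₀..t₀ + ς * t, g₂ τ)
    (hc : ContinuousOn (fun τ => ς • (g₁ (t₀ + ς * τ), g₂ (t₀ + ς * τ))) (Icc 0 t)) :
    (x (t₀ + ς * t), w (t₀ + ς * t)) =
      (x₀, w₀) + ∫ τ in (0 : ℝ)..t, ς • (g₁ (t₀ + ς * τ), g₂ (t₀ + ς * τ)) := by
  have h0 : ς ≠ 0 := left_ne_zero_of_mul_eq_one hς
  rw [intervalIntegral_prod_mk ht hc, hx, hw]
  simp only [Prod.smul_mk, intervalIntegral.integral_smul]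
  rw [intervalIntegral.integral_comp_add_mul g₁ h0, intervalIntegral.integral_comp_add_mul g₂ h0,
    smul_inv_smul₀ h0, smul_inv_smul₀ h0, mul_zero, add_zero]
  rfl

end

variable {n : ℕ} {A : CoefA} {B : CoefB n} {Ω : Set Pt} {y₀ : Pt} {κ ς ε : ℝ}
  {Z : ℝ → (Fin 3 → ℝ) → ZVal n} {f u : Fin n → Pt → ℝ} {q : Fin 3 → ℝ}

namespace ConoidFlow

variable (H : ConoidFlow A B Ω y₀ (ς * κ) ε Z) (hς : ς * ς = 1)
include H hς

theorem isAuxiliary (hq : q ∈ closedBall (0 : Fin 3 → ℝ) 2) {t₀ t₁ : ℝ}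
    (ht : ∀ t ∈ uIcc t₀ t₁, ς * t - ς * t₀ ∈ Icc 0 ε) :
    IsAuxiliary A B κ y₀ q t₀ t₁ (fun t => (Z (ς * t - ς * t₀) q).1)
      (fun t => (Z (ς * t - ς * t₀) q).2) := by
  have hc : ContinuousOn (fun t => Z (ς * t - ς * t₀) q) (uIcc t₀ t₁) :=
    (H.continuousOn_time hq).comp (by fun_prop) ht
  have hg : ContinuousOn (fun τ => (κ / T A (Z τ q).1.1 3) • efull A B (Z τ q)) (Icc 0 ε) :=
    (continuousOn_const.div (H.continuousOn_T hq 3) fun t ht => (H.pos q hq t ht).ne').smul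
      fun τ hτ => (H.smooth.efull (H.mem q hq τ hτ)).comp_continuousWithinAt
        (f := fun τ => Z τ q) (H.continuousOn_time hq τ hτ)
  have h := fun t (h : t ∈ uIcc t₀ t₁) => eq_integral_of_reparam (z := fun t => Z t q)
    (z₀ := (X0 y₀ q, W0 n)) hς hg
    (fun t ht => by
      rw [H.integral_eq hq ht]
      simp only [smul_smul, mul_div_assoc]) (ht t h)
  exact ⟨continuous_fst.comp_continuousOn hc, continuous_snd.comp_continuousOn hc,
    fun t ht => (h t ht).1, fun t ht => (h t ht).2⟩

theorem eq_of_isAuxiliary (hq : q ∈ closedBall (0 : Fin 3 → ℝ) 2) {t₀ t₁ τ : ℝ} (hτ : τ ≤ ε)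
    (ht : ∀ t ∈ Icc 0 τ, t₀ + ς * t ∈ uIcc t₀ t₁) {X : ℝ → XVal} {W : ℝ → WVal n}
    (h : IsAuxiliary A B κ y₀ q t₀ t₁ X W) {t : ℝ} (ht' : t ∈ Icc 0 τ) :
    Z t q = (X (t₀ + ς * t), W (t₀ + ς * t)) := by
  refine H.unique hq hτ (y := fun t => (X (t₀ + ς * t), W (t₀ + ς * t))) ?_ (fun t ht₂ hc => ?_) ht'
  · exact (h.contX.comp (by fun_prop) ht).prodMk (h.contW.comp (by fun_prop) ht)
  · have e : ∀ (x : XVal) (w : WVal n), (ς * κ / T A x.1 3) • efull A B (x, w) =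
        ς • ((κ / T A x.1 3) • E A x, (κ / T A x.1 3) • EW A B x w) := fun x w => by
      rw [mul_div_assoc, mul_smul]; rfl
    simp only [e] at hc ⊢
    exact prod_eq_integral_of_reparam (g₁ := fun τ => (κ / T A (X τ).1 3) • E A (X τ))
      (g₂ := fun τ => (κ / T A (X τ).1 3) • EW A B (X τ) (W τ)) hς ht₂.1 (h.eqX _ (ht t ht₂)) (h.eqW _ (ht t ht₂)) hc

theorem kirchhoff_formula (hκ : 0 < κ) {t₀ : ℝ} (h0 : 0 < -(ς * t₀)) (h1 : -(ς * t₀) < ε)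
    (hf : ∀ s, ContinuousOn (f s) Ω) (hu : IsSolution A B f Ω u) (s : Fin n) :
    4 * Real.pi * u s y₀ = -ς * ((∫ l₃ in (0 : ℝ)..(2 * Real.pi), ∫ l₂ in (0 : ℝ)..Real.pi,
      I A B u s l₂ l₃ (timeJet Z (-(ς * t₀), l₃, l₂))) -
      ∫ t in t₀..0, ∫ l₃ in (0 : ℝ)..(2 * Real.pi), ∫ l₂ in (0 : ℝ)..Real.pi,
        KirchhoffConoid.H A B f u κ s l₂ l₃ (timeJet Z (ς * t - ς * t₀, l₃, l₂))) := by
  have hpi := Real.pi_pos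
  have hς0 : ς ≠ 0 := left_ne_zero_of_mul_eq_one hς
  have hi : ς⁻¹ = ς := inv_eq_of_mul_eq_one_right hς
  have habs : ς * κ / |ς * κ| = ς := by
    have : |ς| = 1 := by
      have := abs_mul_abs_self ς
      rw [hς] at this
      nlinarith [abs_nonneg ς]
    rw [abs_mul, this, one_mul, abs_of_pos hκ]
    field_simp
  have hlin : ∀ l₂ l₃ S, KirchhoffConoid.H A B f u (ς * κ) s l₂ l₃ S =
      ς * KirchhoffConoid.H A B f u κ s l₂ l₃ S := fun l₂ l₃ S => by
    simp only [KirchhoffConoid.H]; ring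
  have main := H.representation hf hu s h0 h1
  rw [habs, integral_prod_eq (by positivity) hpi.le (H.continuous_I hu s ⟨h0, h1.le⟩).continuousOn]
    at main
  have e1 : (∫ t in (0 : ℝ)..(-(ς * t₀)), ∫ w in Icc 0 (2 * Real.pi) ×ˢ Icc 0 Real.pi,
      KirchhoffConoid.H A B f u (ς * κ) s w.2 w.1 (timeJet Z (t, w))) =
      ς * ∫ t in (0 : ℝ)..(-(ς * t₀)), ∫ l₃ in (0 : ℝ)..(2 * Real.pi), ∫ l₂ in (0 : ℝ)..Real.pi,
        KirchhoffConoid.H A B f u κ s l₂ l₃ (timeJet Z (t, l₃, l₂)) := by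
    rw [← intervalIntegral.integral_const_mul, intervalIntegral.integral_of_le h0.le,
      intervalIntegral.integral_of_le h0.le]
    refine setIntegral_congr_fun measurableSet_Ioc fun t ht => ?_
    rw [integral_prod_eq (m₁ := 2 * Real.pi) (m₂ := Real.pi) (g := fun w : ℝ × ℝ =>
      KirchhoffConoid.H A B f u (ς * κ) s w.2 w.1 (timeJet Z (t, w))) (by positivity) hpi.le
      ((H.continuousOn_H hf hu s).comp (by fun_prop : Continuous fun w : ℝ × ℝ => (t, w)).continuousOn
        fun w _ => ⟨⟨ht.1, ht.2.trans h1.le⟩, trivial⟩)]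
    simp only [hlin, intervalIntegral.integral_const_mul]
  rw [e1] at main
  rw [intervalIntegral.integral_comp_mul_sub (fun t => ∫ l₃ in (0 : ℝ)..(2 * Real.pi),
    ∫ l₂ in (0 : ℝ)..Real.pi, KirchhoffConoid.H A B f u κ s l₂ l₃ (timeJet Z (t, l₃, l₂))) hς0,
    sub_self, mul_zero, zero_sub, hi, smul_eq_mul, main]
  linear_combination (-(4 * Real.pi * u s y₀)) * hς

end ConoidFlow

end Reparametrization

end KirchhoffConoid

theorem mainTheorem4 (n : ℕ) (c : Fin 3 → ℝ) (d e : ℝ) (hd : 0 < d) (he : 0 < e)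
    (A : KirchhoffConoid.CoefA) (B : KirchhoffConoid.CoefB n)
    (hAB : KirchhoffConoid.GoodCoef A B (KirchhoffConoid.box c d e))
    (d₀ : ℝ) (hd₀ : 0 < d₀) (hd₀d : d₀ < d) :
    ∃ ε₀ : ℝ, 0 < ε₀ ∧ ε₀ < e ∧
      ∀ x₀ : Fin 4 → ℝ, (∀ i : Fin 3, |x₀ i.castSucc - c i| ≤ d₀) → |x₀ 3| ≤ ε₀ → x₀ 3 ≠ 0 →
        (∃ a, KirchhoffConoid.IsFrame (A x₀) a) ∧
        ∀ a : Matrix (Fin 4) (Fin 4) ℝ, KirchhoffConoid.IsFrame (A x₀) a →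
          let As := KirchhoffConoid.AStar a A
          let Bs := KirchhoffConoid.BStar a B
          let y₀ := KirchhoffConoid.toY a x₀
          let κ := KirchhoffConoid.inv a 3 3
          let dom : Set (ℝ × ℝ × ℝ) :=
            Set.uIcc (x₀ 3) 0 ×ˢ Set.Icc 0 Real.pi ×ˢ Set.Icc 0 (2 * Real.pi)
          ∃ (X : ℝ × ℝ × ℝ → KirchhoffConoid.XVal) (W : ℝ × ℝ × ℝ → KirchhoffConoid.WVal n),
            ContinuousOn X dom ∧ ContinuousOn W dom ∧
            (∀ l₂ ∈ Set.Icc 0 Real.pi, ∀ l₃ ∈ Set.Icc 0 (2 * Real.pi),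
              KirchhoffConoid.IsAuxiliary As Bs κ y₀ (KirchhoffConoid.p0 l₂ l₃) (x₀ 3) 0
                (fun t => X (t, l₂, l₃)) (fun t => W (t, l₂, l₃)) ∧
              ∀ (X' : ℝ → KirchhoffConoid.XVal) (W' : ℝ → KirchhoffConoid.WVal n),
                KirchhoffConoid.IsAuxiliary As Bs κ y₀ (KirchhoffConoid.p0 l₂ l₃) (x₀ 3) 0 X' W' →
                ∀ t ∈ Set.uIcc (x₀ 3) 0, X' t = X (t, l₂, l₃) ∧ W' t = W (t, l₂, l₃)) ∧
            (∀ z ∈ dom,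
              KirchhoffConoid.toX a (X z).1.1 ∈ KirchhoffConoid.box c d e ∧
              KirchhoffConoid.toX a (X z).1.1 3 = z.1 ∧
              KirchhoffConoid.F As (X z).1.2 (X z).1.1 = 0 ∧
              0 < KirchhoffConoid.T As (X z).1 3 ∧
              (z.1 ≠ x₀ 3 →
                (KirchhoffConoid.K As (KirchhoffConoid.p0 z.2.1 z.2.2, X z, W z)).det ≠ 0)) ∧
            ∀ f u : Fin n → (Fin 4 → ℝ) → ℝ,
              (∀ s, ContinuousOn (f s) (KirchhoffConoid.box c d e)) →
              KirchhoffConoid.IsSolution A B f (KirchhoffConoid.box c d e) u →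
              ∀ s : Fin n,
                let H : ℝ × ℝ × ℝ → ℝ := fun z =>
                  KirchhoffConoid.H As Bs (KirchhoffConoid.fStar a f) (KirchhoffConoid.fStar a u)
                    κ s z.2.1 z.2.2 (KirchhoffConoid.p0 z.2.1 z.2.2, X z, W z)
                let I : ℝ × ℝ → ℝ := fun w =>
                  KirchhoffConoid.I As Bs (KirchhoffConoid.fStar a u) s w.1 w.2
                    (KirchhoffConoid.p0 w.1 w.2, X (0, w.1, w.2), W (0, w.1, w.2))
                ContinuousOn H {z | z ∈ dom ∧ z.1 ≠ x₀ 3} ∧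
                (∃ C : ℝ, ∀ z ∈ dom, z.1 ≠ x₀ 3 → |H z| ≤ C) ∧
                ContinuousOn I (Set.Icc 0 Real.pi ×ˢ Set.Icc 0 (2 * Real.pi)) ∧
                4 * Real.pi * u s x₀ =
                  Real.sign (x₀ 3) *
                    ((∫ l₃ in (0 : ℝ)..(2 * Real.pi), ∫ l₂ in (0 : ℝ)..Real.pi, I (l₂, l₃)) -
                      ∫ t in (x₀ 3)..0, ∫ l₃ in (0 : ℝ)..(2 * Real.pi),
                        ∫ l₂ in (0 : ℝ)..Real.pi, H (t, l₂, l₃)) := by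
  obtain ⟨ε₁, hε₁, h₁⟩ := hAB.exists_conoidFlow he hd₀d (one_ne_zero (α := ℝ))
  obtain ⟨ε₂, hε₂, h₂⟩ := hAB.exists_conoidFlow he hd₀d (neg_ne_zero.2 (one_ne_zero (α := ℝ)))
  have hm₁ : min ε₁ ε₂ / 2 < ε₁ := by
    have := min_le_left ε₁ ε₂
    have := lt_min hε₁ hε₂
    linarith
  have hm₂ : min ε₁ ε₂ / 2 < ε₂ := by
    have := min_le_right ε₁ ε₂
    have := lt_min hε₁ hε₂
    linarith
  refine ⟨min (e / 2) (min ε₁ ε₂ / 2), lt_min (half_pos he) (half_pos (lt_min hε₁ hε₂)),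
    (min_le_left _ _).trans_lt (half_lt_self he), fun x₀ hx hx3 hx0 => ?_⟩
  have hxe : |x₀ 3| ≤ e / 2 := hx3.trans (min_le_left _ _)
  have hxε := hx3.trans (min_le_right _ _)
  have hbox : x₀ ∈ KirchhoffConoid.box c d e := ⟨fun i => (hx i).trans_lt hd₀d, hxe.trans_lt
      (half_lt_self he)⟩
  have hyp := hAB.hyperbolic hbox
  refine ⟨KirchhoffConoid.exists_isFrame hyp, fun a ha => ?_⟩
  have hdet := ha.det_ne_zero hyp
  have hκ : a 3 3 * KirchhoffConoid.inv a 3 3 = 1 := ha.mul_inv hdet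
  have hκ0 : 0 < KirchhoffConoid.inv a 3 3 := (mul_pos_iff_of_pos_left ha.pos).1 (hκ ▸ one_pos)
  obtain ⟨ς, hς, hsgn, h0, ε, hε, Z, H⟩ : ∃ ς : ℝ, ς * ς = 1 ∧ Real.sign (x₀ 3) = -ς ∧
      0 < -(ς * x₀ 3) ∧ ∃ ε, -(ς * x₀ 3) < ε ∧ ∃ Z, KirchhoffConoid.ConoidFlow
          (KirchhoffConoid.AStar a A) (KirchhoffConoid.BStar a B)
        (KirchhoffConoid.toX a ⁻¹' KirchhoffConoid.box c d e) (KirchhoffConoid.toY a x₀) (ς *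
            KirchhoffConoid.inv a 3 3) ε Z := by
    rcases lt_or_gt_of_ne hx0 with h | h
    · refine ⟨1, by norm_num, by rw [Real.sign_of_neg h], by linarith, ε₁, ?_, h₁ x₀ hx hxe a ha⟩
      rw [abs_of_neg h] at hxε
      linarith
    · refine ⟨-1, by norm_num, by rw [Real.sign_of_pos h, neg_neg], by linarith, ε₂, ?_,
        h₂ x₀ hx hxe a ha⟩
      rw [abs_of_pos h] at hxε
      linarith
  have hm : ∀ t ∈ Set.uIcc (x₀ 3) 0, ς * t - ς * x₀ 3 ∈ Set.Icc 0 (-(ς * x₀ 3)) := fun t ht => by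
    rcases mul_self_eq_one_iff.1 hς with rfl | rfl
    · rw [Set.uIcc_of_le (by linarith)] at ht
      exact ⟨by linarith [ht.1], by linarith [ht.2]⟩
    · rw [Set.uIcc_of_ge (by linarith)] at ht
      exact ⟨by linarith [ht.2], by linarith [ht.1]⟩
  have hm' : ∀ t ∈ Set.Icc 0 (-(ς * x₀ 3)), x₀ 3 + ς * t ∈ Set.uIcc (x₀ 3) 0 := fun t ht => by
    rcases mul_self_eq_one_iff.1 hς with rfl | rfl
    · rw [Set.uIcc_of_le (by linarith)]
      exact ⟨by linarith [ht.1], by linarith [ht.2]⟩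
    · rw [Set.uIcc_of_ge (by linarith)]
      exact ⟨by linarith [ht.2], by linarith [ht.1]⟩
  have hmε : ∀ t ∈ Set.uIcc (x₀ 3) 0, ς * t - ς * x₀ 3 ∈ Set.Icc 0 ε := fun t ht =>
    Set.Icc_subset_Icc_right hε.le (hm t ht)
  have hmpos : ∀ t ∈ Set.uIcc (x₀ 3) 0, t ≠ x₀ 3 → ς * t - ς * x₀ 3 ∈ Set.Ioc 0 ε := fun t ht hne =>
    ⟨(hmε t ht).1.lt_of_ne fun h => hne (mul_left_cancel₀ (left_ne_zero_of_mul_eq_one hς)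
      (sub_eq_zero.1 h.symm)), (hmε t ht).2⟩
  have hball : ∀ l₂ l₃, KirchhoffConoid.p0 l₂ l₃ ∈ Metric.closedBall (0 : Fin 3 → ℝ) 2 := fun l₂ l₃
      =>
    Metric.ball_subset_closedBall (KirchhoffConoid.unit_mem_ball (KirchhoffConoid.sum_p0_sq l₂ l₃))
  have hmap : Continuous fun z : ℝ × ℝ × ℝ => (ς * z.1 - ς * x₀ 3, z.2.2, z.2.1) := by fun_prop
  have hZ : ContinuousOn (fun z : ℝ × ℝ × ℝ => KirchhoffConoid.timeJet Z (ς * z.1 - ς * x₀ 3,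
      z.2.2, z.2.1))
      (Set.uIcc (x₀ 3) 0 ×ˢ Set.Icc 0 Real.pi ×ˢ Set.Icc 0 (2 * Real.pi)) :=
    H.continuousOn_timeJet.comp hmap.continuousOn fun z hz => ⟨hmε _ hz.1, trivial⟩
  refine ⟨fun z => (Z (ς * z.1 - ς * x₀ 3) (KirchhoffConoid.p0 z.2.1 z.2.2)).1,
    fun z => (Z (ς * z.1 - ς * x₀ 3) (KirchhoffConoid.p0 z.2.1 z.2.2)).2,
    continuous_fst.comp_continuousOn (continuous_snd.comp_continuousOn hZ),
    continuous_snd.comp_continuousOn (continuous_snd.comp_continuousOn hZ), ?_, ?_, ?_⟩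
  · refine fun l₂ _ l₃ _ => ⟨H.isAuxiliary hς (hball l₂ l₃) hmε, fun X' W' h t ht => ?_⟩
    have e := H.eq_of_isAuxiliary hς (hball l₂ l₃) hε.le hm' h (hm t ht)
    rw [show x₀ 3 + ς * (ς * t - ς * x₀ 3) = t by linear_combination (t - x₀ 3) * hς] at e
    exact ⟨congrArg Prod.fst e.symm, congrArg Prod.snd e.symm⟩
  · intro z hz
    have ht := hmε z.1 hz.1
    have hq := hball z.2.1 z.2.2
    refine ⟨H.mem _ hq _ ht, ?_, H.F_eq_zero (KirchhoffConoid.sum_p0_sq _ _) ht, H.pos _ hq _ ht,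
        fun hne =>
      H.det_ne _ (KirchhoffConoid.sum_p0_sq _ _) _ (hmpos z.1 hz.1 hne)⟩
    have e := ha.toX_three (KirchhoffConoid.toY a x₀)
    rw [KirchhoffConoid.toX_toY hdet] at e
    rw [ha.toX_three, H.y_three hq ht]
    linear_combination -e + ς * (ς * z.1 - ς * x₀ 3) * hκ + (z.1 - x₀ 3) * hς
  · intro f u hf hu s
    have hus := hu.comp_toX (KirchhoffConoid.isOpen_box c d e) hdet
    have hfs : ∀ s, ContinuousOn (KirchhoffConoid.fStar a f s) (KirchhoffConoid.toX a ⁻¹'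
        KirchhoffConoid.box c d e) := fun s =>
      (hf s).comp (KirchhoffConoid.contDiff_toX (m := 0) a).continuous.continuousOn fun _ hy => hy
    have hlin : ∀ l₂ l₃ (S : KirchhoffConoid.Jet n), KirchhoffConoid.H (KirchhoffConoid.AStar a A)
        (KirchhoffConoid.BStar a B) (KirchhoffConoid.fStar a f)
        (KirchhoffConoid.fStar a u) (KirchhoffConoid.inv a 3 3) s l₂ l₃ S = ς * KirchhoffConoid.H
            (KirchhoffConoid.AStar a A) (KirchhoffConoid.BStar a B)
          (KirchhoffConoid.fStar a f) (KirchhoffConoid.fStar a u) (ς * KirchhoffConoid.inv a 3 3) s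
              l₂ l₃ S := fun l₂ l₃ S => by
      simp only [KirchhoffConoid.H]
      linear_combination (-((∑ r, (KirchhoffConoid.fStar a u r S.2.1.1.1 * KirchhoffConoid.L
          (KirchhoffConoid.AStar a A) (KirchhoffConoid.BStar a B) r s S +
        KirchhoffConoid.sig (KirchhoffConoid.AStar a A) r s S * KirchhoffConoid.fStar a f r
            S.2.1.1.1)) *
        (KirchhoffConoid.inv a 3 3 * KirchhoffConoid.Jac (KirchhoffConoid.AStar a A) l₂ l₃ S /
            KirchhoffConoid.T (KirchhoffConoid.AStar a A) S.2.1.1 3))) * hς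
    refine ⟨?_, ?_, ?_, ?_⟩
    · have h : ContinuousOn (fun z : ℝ × ℝ × ℝ => ς * KirchhoffConoid.H (KirchhoffConoid.AStar a A)
        (KirchhoffConoid.BStar a B)
          (KirchhoffConoid.fStar a f) (KirchhoffConoid.fStar a u) (ς * KirchhoffConoid.inv a 3 3) s
              z.2.1 z.2.2
            (KirchhoffConoid.timeJet Z (ς * z.1 - ς * x₀ 3, z.2.2, z.2.1)))
          {z | z ∈ Set.uIcc (x₀ 3) 0 ×ˢ Set.Icc 0 Real.pi ×ˢ Set.Icc 0 (2 * Real.pi) ∧ z.1 ≠ x₀ 3}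
              :=
        continuousOn_const.mul ((H.continuousOn_H hfs hus s).comp hmap.continuousOn
          fun z hz => ⟨hmpos z.1 hz.1.1 hz.2, trivial⟩)
      exact h.congr fun z _ => hlin _ _ _
    · obtain ⟨C, hC⟩ := H.exists_bound_H hfs hus s
      refine ⟨|ς| * C, fun z hz hne => ?_⟩
      refine (congrArg abs (hlin _ _ _)).trans_le ?_
      rw [abs_mul]
      exact mul_le_mul_of_nonneg_left (hC (ς * z.1 - ς * x₀ 3, z.2.2, z.2.1) (hmpos z.1 hz.1 hne))
        (abs_nonneg _)
    · have h0m := hmpos 0 Set.right_mem_uIcc hx0.symm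
      exact ((H.continuous_I hus s h0m).comp continuous_swap).continuousOn
    · have h := H.kirchhoff_formula hς hκ0 h0 hε hfs hus s
      rw [← hsgn, KirchhoffConoid.fStar, KirchhoffConoid.toX_toY hdet] at h
      have e : -(ς * x₀ 3) = ς * 0 - ς * x₀ 3 := by ring
      rw [e] at h
      exact h
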